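/- A weighted tree is a finite tree $T$ with a non-negative real length on each edge; the distance $d(v,w)$ of two vertices is the sum of the edge lengths on the simple path from $v$ to $w$. Consider two minimization problems on weighted trees. (a) $r$-gather clustering. Given a weighted tree $T$, $n$ users located at vertices of $T$ (several users may share a vertex), and an integer $r\ge 1$, partition the users into clusters, each with at least $r$ users, so as to minimize the maximum over the clusters $C$ of $\operatorname{diam}(C)=\max_{u,u'\in C}d(u,u')$. (b) $r$-gathering. Given in addition $m$ facilities located at vertices of $T$, find an assignment $\pi$ of the users to the facilities such that every facility $f$ satisfies $|\pi^{-1}(f)|=0$ or $|\pi^{-1}(f)|\ge r$, so as to minimize $\max_u d(u,\pi(u))$. (The objective is $0$ if there are no users.) **Theorem.** Both problems admit a polynomial-time approximation scheme. That is, for each of the two problems there is a single algorithm that receives an instance $\mathcal I$ and a real number $\varepsilon>0$, and for every $\varepsilon>0$ there is a polynomial $p_\varepsilon$, such that on every instance $\mathcal I$ the algorithm halts after at most $p_\varepsilon(N)$ steps, where $N=|V(T)|+n$ for (a) and $N=|V(T)|+n+m$ for (b); if $\mathcal I$ has a feasible solution, it outputs a feasible solution of cost at most $(1+\varepsilon)\,\mathrm{OPT}(\mathcal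 I)$, and otherwise it reports that there is none. Here an algorithm is a program (assignments, sequencing, conditionals, while loops) for a random access machine with scalar variables and arrays holding natural numbers or real numbers, in which every operation has unit cost; the operations are constants, array access at a computed natural-number address, addition, subtraction (truncated at $0$ for natural numbers) and comparison. There is no multiplication, division, rounding or conversion between the two sorts. The tree is given by its adjacency matrix and its matrix of edge lengths, the users and facilities by the lists of their vertices. -/

import Mathlib

open scoped NNReal

/-! ### The machine model

Structured programs for a random access machine with two sorts of memory, natural numbers and real
numbers.  A program owns finitely many scalar variables and finitely many arrays of either sort,
each array being addressed by (computed) natural numbers.  The only arithmetic is addition and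
subtraction; real numbers can be added, subtracted and compared, but neither multiplied, divided,
rounded nor turned into natural numbers.  Every operation and every test has unit cost. -/

namespace RAM

/-- The memory: scalar variables `nv i`, `rv i` and arrays `na a`, `ra a`. -/
@[ext] structure State where
  nv : ℕ → ℕ
  rv : ℕ → ℝ
  na : ℕ → ℕ → ℕ
  ra : ℕ → ℕ → ℝ

/-- Expressions with natural number values; `arr a e` is the array access `a[e]`. -/
inductive NExp where
  | const (c : ℕ)
  | var (i : ℕ)
  | arr (a : ℕ) (e : NExp)
  | add (e f : NExp)
  | sub (e f : NExp)

/-- Expressions with real values. -/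
inductive RExp where
  | zero
  | one
  | var (i : ℕ)
  | arr (a : ℕ) (e : NExp)
  | add (e f : RExp)
  | sub (e f : RExp)

/-- Tests. -/
inductive Test where
  | nlt (e f : NExp)
  | neq (e f : NExp)
  | rlt (e f : RExp)
  | not (b : Test)
  | and (b c : Test)

def NExp.eval (σ : State) : NExp → ℕ
  | .const c => c
  | .var i => σ.nv i
  | .arr a e => σ.na a (e.eval σ)
  | .add e f => e.eval σ + f.eval σ
  | .sub e f => e.eval σ - f.eval σ

/-- The number of operations needed to evaluate an expression. -/
def NExp.cost : NExp → ℕ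
  | .const _ => 1
  | .var _ => 1
  | .arr _ e => e.cost + 1
  | .add e f => e.cost + f.cost + 1
  | .sub e f => e.cost + f.cost + 1

noncomputable def RExp.eval (σ : State) : RExp → ℝ
  | .zero => 0
  | .one => 1
  | .var i => σ.rv i
  | .arr a e => σ.ra a (e.eval σ)
  | .add e f => e.eval σ + f.eval σ
  | .sub e f => e.eval σ - f.eval σ

/-- The number of operations needed to evaluate an expression. -/
def RExp.cost : RExp → ℕ
  | .zero => 1
  | .one => 1
  | .var _ => 1
  | .arr _ e => e.cost + 1
  | .add e f => e.cost + f.cost + 1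
  | .sub e f => e.cost + f.cost + 1

def Test.Holds (σ : State) : Test → Prop
  | .nlt e f => e.eval σ < f.eval σ
  | .neq e f => e.eval σ = f.eval σ
  | .rlt e f => e.eval σ < f.eval σ
  | .not b => ¬ b.Holds σ
  | .and b c => b.Holds σ ∧ c.Holds σ

/-- The number of operations needed to evaluate a test. -/
def Test.cost : Test → ℕ
  | .nlt e f => e.cost + f.cost + 1
  | .neq e f => e.cost + f.cost + 1
  | .rlt e f => e.cost + f.cost + 1
  | .not b => b.cost + 1
  | .and b c => b.cost + c.cost + 1

/-- Programs.  The four kinds of assignment write to a scalar variable or to an array cell. -/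
inductive Prog where
  | skip
  | nset (i : ℕ) (e : NExp)
  | rset (i : ℕ) (e : RExp)
  | nstore (a : ℕ) (idx : NExp) (e : NExp)
  | rstore (a : ℕ) (idx : NExp) (e : RExp)
  | seq (p q : Prog)
  | ite (b : Test) (p q : Prog)
  | while (b : Test) (p : Prog)

def State.setN (σ : State) (i v : ℕ) : State :=
  { σ with nv := Function.update σ.nv i v }

noncomputable def State.setR (σ : State) (i : ℕ) (v : ℝ) : State :=
  { σ with rv := Function.update σ.rv i v }

def State.storeN (σ : State) (a k v : ℕ) : State :=
  { σ with na := Function.update σ.na a (Function.update (σ.na a) k v) }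

noncomputable def State.storeR (σ : State) (a k : ℕ) (v : ℝ) : State :=
  { σ with ra := Function.update σ.ra a (Function.update (σ.ra a) k v) }

/-- `Exec p σ t σ'`: started in the memory `σ`, the program `p` halts after `t` steps with the
memory `σ'`. -/
inductive Exec : Prog → State → ℕ → State → Prop
  | skip (σ : State) : Exec .skip σ 1 σ
  | nset (σ : State) (i : ℕ) (e : NExp) :
      Exec (.nset i e) σ (e.cost + 1) (σ.setN i (e.eval σ))
  | rset (σ : State) (i : ℕ) (e : RExp) :
      Exec (.rset i e) σ (e.cost + 1) (σ.setR i (e.eval σ))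
  | nstore (σ : State) (a : ℕ) (k e : NExp) :
      Exec (.nstore a k e) σ (k.cost + e.cost + 1) (σ.storeN a (k.eval σ) (e.eval σ))
  | rstore (σ : State) (a : ℕ) (k : NExp) (e : RExp) :
      Exec (.rstore a k e) σ (k.cost + e.cost + 1) (σ.storeR a (k.eval σ) (e.eval σ))
  | seq {p q : Prog} {σ σ₁ σ₂ : State} {s t : ℕ} :
      Exec p σ s σ₁ → Exec q σ₁ t σ₂ → Exec (.seq p q) σ (s + t) σ₂
  | ite_true {b : Test} {p q : Prog} {σ σ₁ : State} {t : ℕ} :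
      b.Holds σ → Exec p σ t σ₁ → Exec (.ite b p q) σ (b.cost + t) σ₁
  | ite_false {b : Test} {p q : Prog} {σ σ₁ : State} {t : ℕ} :
      ¬ b.Holds σ → Exec q σ t σ₁ → Exec (.ite b p q) σ (b.cost + t) σ₁
  | while_false {b : Test} {p : Prog} {σ : State} :
      ¬ b.Holds σ → Exec (.while b p) σ b.cost σ
  | while_true {b : Test} {p : Prog} {σ σ₁ σ₂ : State} {s t : ℕ} :
      b.Holds σ → Exec p σ s σ₁ → Exec (.while b p) σ₁ t σ₂ →
      Exec (.while b p) σ (b.cost + s + t) σ₂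

end RAM

/-! ### Minimization problems and polynomial-time approximation schemes -/

/-- A minimization problem, with the representation of its instances and solutions in the memory
of the machine. -/
structure MinProblem where
  Inst : Type
  Sol : Inst → Type
  Feasible : (I : Inst) → Sol I → Prop
  cost : (I : Inst) → Sol I → ℝ≥0
  /-- the size of an instance, in which running times are measured -/
  size : Inst → ℕ
  /-- the memory that holds a given instance -/
  input : Inst → RAM.State
  /-- the given memory represents the given solution -/
  Output : (I : Inst) → RAM.State → Sol I → Prop

namespace MinProblem

/-- The optimal value, meaningful if there is a feasible solution. -/
noncomputable def opt (P : MinProblem) (I : P.Inst) : ℝ≥0 :=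
  sInf {c | ∃ s : P.Sol I, P.Feasible I s ∧ P.cost I s = c}

/-- A polynomial-time approximation scheme: a single program that receives an instance and `ε > 0`
(in the real variable `0`), and whose running time is, for each fixed `ε`, bounded by a polynomial
in the size of the instance.  If there is a feasible solution, then the program
sets the natural variable `4` to `1` and outputs a feasible solution of cost at most
`(1 + ε) * opt`; otherwise it sets that variable to `0`. -/
def HasPTAS (P : MinProblem) : Prop :=
  ∃ A : RAM.Prog, ∀ ε : ℝ, 0 < ε → ∃ p : Polynomial ℕ, ∀ I : P.Inst,
    ∃ (t : ℕ) (σ : RAM.State),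
      RAM.Exec A ((P.input I).setR 0 ε) t σ ∧ t ≤ p.eval (P.size I) ∧
      ((∃ s, P.Feasible I s) → σ.nv 4 = 1 ∧
        ∃ s, P.Output I σ s ∧ P.Feasible I s ∧ (P.cost I s : ℝ) ≤ (1 + ε) * (P.opt I : ℝ)) ∧
      ((¬ ∃ s, P.Feasible I s) → σ.nv 4 = 0)

end MinProblem

/-! ### Weighted trees -/

/-- A weighted tree on the vertex set `{0, …, N - 1}` with non-negative edge lengths. -/
structure WeightedTree where
  N : ℕ
  graph : SimpleGraph (Fin N)
  isTree : graph.IsTree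
  len : graph.edgeSet → ℝ≥0

namespace WeightedTree

variable (T : WeightedTree)

open Classical in
/-- The length of an edge (and zero for pairs of vertices that are not edges). -/
noncomputable def edgeLen (e : Sym2 (Fin T.N)) : ℝ≥0 :=
  if h : e ∈ T.graph.edgeSet then T.len ⟨e, h⟩ else 0

/-- The simple path from `v` to `w`. -/
noncomputable def path (v w : Fin T.N) : T.graph.Walk v w :=
  (T.isTree.existsUnique_path v w).choose

theorem path_isPath (v w : Fin T.N) : (T.path v w).IsPath :=
  (T.isTree.existsUnique_path v w).choose_spec.1

theorem path_eq {v w : Fin T.N} (q : T.graph.Walk v w) (hq : q.IsPath) : q = T.path v w :=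
  (T.isTree.existsUnique_path v w).choose_spec.2 q hq

/-- The tree metric: the sum of the edge lengths on the simple path from `v` to `w`. -/
noncomputable def dist (v w : Fin T.N) : ℝ≥0 :=
  ((T.path v w).edges.map T.edgeLen).sum

open Classical in
/-- The adjacency matrix, stored row by row: the entry `(i, j)` is at the address `i * N + j`. -/
noncomputable def adjArray (k : ℕ) : ℕ :=
  if h : k < T.N * T.N then
    if T.graph.Adj (finProdFinEquiv.symm ⟨k, h⟩).1 (finProdFinEquiv.symm ⟨k, h⟩).2 then 1 else 0
  else 0

/-- The matrix of the edge lengths, stored row by row. -/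
noncomputable def lenArray (k : ℕ) : ℝ :=
  if h : k < T.N * T.N then
    (T.edgeLen s((finProdFinEquiv.symm ⟨k, h⟩).1, (finProdFinEquiv.symm ⟨k, h⟩).2) : ℝ)
  else 0

end WeightedTree

/-! ### The two problems -/

/-- An instance of `r`-gather clustering on a weighted tree; user `i` is at the vertex `user i`. -/
structure ClusteringInstance where
  tree : WeightedTree
  n : ℕ
  user : Fin n → Fin tree.N
  r : ℕ
  r_pos : 0 < r

/-- An instance of `r`-gathering on a weighted tree; facility `f` is at the vertex `fac f`. -/
structure GatheringInstance extends ClusteringInstance where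
  m : ℕ
  fac : Fin m → Fin tree.N

/-- The list of the vertices `g 0, …, g (k - 1)` as an array, continued by zeros. -/
def vertexArray {N k : ℕ} (g : Fin k → Fin N) (i : ℕ) : ℕ :=
  if h : i < k then (g ⟨i, h⟩ : ℕ) else 0

namespace ClusteringInstance

variable (I : ClusteringInstance)

/-- The diameter of a set of users. -/
noncomputable def diam (C : Finset (Fin I.n)) : ℝ≥0 :=
  C.sup fun i => C.sup fun j => I.tree.dist (I.user i) (I.user j)

/-- Variables `0`, `1`, `3` hold the numbers of vertices and users and `r`, natural arrays `0`, `1`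
the adjacency matrix and the users, real array `0` the edge lengths. -/
noncomputable def input : RAM.State where
  nv i := match i with
    | 0 => I.tree.N
    | 1 => I.n
    | 3 => I.r
    | _ => 0
  rv _ := 0
  na a := match a with
    | 0 => I.tree.adjArray
    | 1 => vertexArray I.user
    | _ => fun _ => 0
  ra a := match a with
    | 0 => I.tree.lenArray
    | _ => fun _ => 0

end ClusteringInstance

namespace GatheringInstance

variable (I : GatheringInstance)

/-- As for clustering; in addition, variable `2` holds the number of facilities and natural
array `2` the facilities. -/
noncomputable def input : RAM.State where
  nv i := match i with
    | 0 => I.tree.N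
    | 1 => I.n
    | 2 => I.m
    | 3 => I.r
    | _ => 0
  rv _ := 0
  na a := match a with
    | 0 => I.tree.adjArray
    | 1 => vertexArray I.user
    | 2 => vertexArray I.fac
    | _ => fun _ => 0
  ra a := match a with
    | 0 => I.tree.lenArray
    | _ => fun _ => 0

end GatheringInstance

/-- The min-max `r`-gather clustering problem on weighted trees: partition the users into clusters
of at least `r` users and minimize the largest diameter.  A partition is output in the natural
array `3` as a labelling of the users: two users are in the same cluster if and only if they have
the same label. -/
noncomputable def rGatherClustering : MinProblem where
  Inst := ClusteringInstance
  Sol I := Finpartition (Finset.univ : Finset (Fin I.n))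
  Feasible I P := ∀ C ∈ P.parts, I.r ≤ C.card
  cost I P := P.parts.sup I.diam
  size I := I.tree.N + I.n
  input I := I.input
  Output I σ P := ∀ i j : Fin I.n, σ.na 3 i = σ.na 3 j ↔ ∃ C ∈ P.parts, i ∈ C ∧ j ∈ C

/-- The min-max `r`-gathering problem on weighted trees: assign each user to a facility such that
each facility has no users or at least `r` users, and minimize the largest distance from a user to
its facility.  The facility of user `i` is output in cell `i` of the natural array `3`. -/
noncomputable def rGathering : MinProblem where
  Inst := GatheringInstance
  Sol I := Fin I.n → Fin I.m
  Feasible I π := ∀ f : Fin I.m,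
    (Finset.univ.filter fun u => π u = f).card = 0 ∨
      I.r ≤ (Finset.univ.filter fun u => π u = f).card
  cost I π := Finset.univ.sup fun u => I.tree.dist (I.user u) (I.fac (π u))
  size I := I.tree.N + I.n + I.m
  input I := I.input
  Output I σ π := ∀ u : Fin I.n, σ.na 3 u = (π u : ℕ)

/-! Rounding. Root the tree at the vertex `0`, fix a length scale `B` and a number `M` with `4 ≤ M *
ε`, and measure lengths in units of `B / M`. The edges are rounded from the root downwards, and each
edge takes over the error left by the edge above it. The errors therefore telescope: on a path
through a common ancestor only the errors at the two ends and at the ancestor survive, each at most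
one unit. A distance at most `B` becomes at most `M + 2` units (`unitNear_of_dist_le`), and `M + 2`
units come from a distance at most `(1 + 4 / M) * B` (`UnitNear.dist_le`). Hence a solution of cost
`B` survives the rounding at scale `B`, and any solution of the rounded problem costs at most `(1 +
ε) * B`. The optimum is `0` or a distance of two vertices, hence of the form `depth v + depth w - 2
* depth x`. All such values are tried, and the least scale at which the rounded problem is solvable
is at most the optimum.

The rounded problem. Edges are subdivided into edges of length `0` or `1`. An edge is cut off at `M
+ 3` units, which is too long to be crossed anyway, so for fixed `ε` the tree stays of linear size.
Facilities become additional leaves. In a tree with such edges a set of diameter at most `2 * h`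
lies within distance `h` of some node (`ParentTree.exists_center`), so clustering is gathering with
half the radius and a facility at every node.

Deciding the rounded problem. For a node `k` and the part of its subtree treated so far, a vector
records how many users at each distance `i ≤ R` from `k` are still open, and how many users are
still demanded by nodes at each distance. There are only `(n + 1) ^ (2 * (R + 1))` vectors. Four
rules generate the attainable ones: start at a single node, pass over a number that is not a child,
merge the subtree of a child, and match an open user at distance `i` with a demand at distance `j`
if `i + j ≤ R`. Counts suffice, since a user and a demand matched at `k` are near through `k`
whoever they are. The rules are sound (`Sem.init`, `Sem.lift`, `Sem.union`, `Sem.cancel`), and they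
are complete because a solution can be replayed from the leaves to the root, cancelling each user at
a chosen common ancestor of the user and its node (`Solvable.complete`). The instance is solvable if
and only if the zero vector is derived at the root. An assignment is then found by self-reduction:
fix one user at a time and ask again.

The machine. All loops but those of a short prelude run up to one number, `limVar`, which the
prelude computes and which is polynomial in the size for fixed `ε`. Terms with bounded sums and
programs with bounded loops are compiled so that the running time is a polynomial in `limVar`
(`Tm.comp_spec`, `Stmt.comp_spec`); after that, only the values computed by these programs have to
be examined. Products, quotients and digits come from tables built by addition and counting. -/

namespace RAM

/-! ### Terms with bounded sums and their compilation -/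

/-- The variable that bounds the ranges of all loops. -/
abbrev limVar : ℕ := 5

/-- Two memories agree except possibly for the natural variables from `100` on. -/
structure Agree (σ τ : State) : Prop where
  nv : ∀ i < 100, τ.nv i = σ.nv i
  rv : τ.rv = σ.rv
  na : τ.na = σ.na
  ra : τ.ra = σ.ra

theorem Agree.refl (σ : State) : Agree σ σ := ⟨fun _ _ => rfl, rfl, rfl, rfl⟩

theorem Agree.trans {σ τ υ : State} (h : Agree σ τ) (h' : Agree τ υ) : Agree σ υ :=
  ⟨fun i hi => (h'.nv i hi).trans (h.nv i hi), h'.rv.trans h.rv, h'.na.trans h.na,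
    h'.ra.trans h.ra⟩

theorem Agree.setN_right {σ τ : State} (h : Agree σ τ) {i : ℕ} (hi : 100 ≤ i) (v : ℕ) :
    Agree σ (τ.setN i v) :=
  ⟨fun j hj => by
    have : j ≠ i := by omega
    simp [State.setN, this, h.nv j hj], h.rv, h.na, h.ra⟩

theorem Agree.setN {σ τ : State} (h : Agree σ τ) (i v : ℕ) :
    Agree (σ.setN i v) (τ.setN i v) :=
  ⟨fun j hj => by
    by_cases hji : j = i
    · subst hji; simp [State.setN]
    · simp [State.setN, hji, h.nv j hj], h.rv, h.na, h.ra⟩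

theorem Agree.setR {σ τ : State} (h : Agree σ τ) (i : ℕ) (v : ℝ) :
    Agree (σ.setR i v) (τ.setR i v) :=
  ⟨h.nv, by simp [State.setR, h.rv], h.na, h.ra⟩

theorem Agree.storeN {σ τ : State} (h : Agree σ τ) (a k v : ℕ) :
    Agree (σ.storeN a k v) (τ.storeN a k v) :=
  ⟨h.nv, h.rv, by simp [State.storeN, h.na], h.ra⟩

theorem Agree.storeR {σ τ : State} (h : Agree σ τ) (a k : ℕ) (v : ℝ) :
    Agree (σ.storeR a k v) (τ.storeR a k v) :=
  ⟨h.nv, h.rv, h.na, by simp [State.storeR, h.ra]⟩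

/-- The natural variables of the expression are below `100`. -/
def NExp.low : NExp → Bool
  | .const _ => true
  | .var i => decide (i < 100)
  | .arr _ e => e.low
  | .add e f => e.low && f.low
  | .sub e f => e.low && f.low

/-- The natural variables of the expression are below `100`. -/
def RExp.low : RExp → Bool
  | .zero => true
  | .one => true
  | .var _ => true
  | .arr _ e => e.low
  | .add e f => e.low && f.low
  | .sub e f => e.low && f.low

theorem NExp.eval_agree {σ τ : State} (h : Agree σ τ) :
    ∀ e : NExp, e.low = true → e.eval τ = e.eval σ
  | .const _, _ => rfl
  | .var i, hi => h.nv i (by simpa [NExp.low] using hi)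
  | .arr a e, he => by
    simp only [NExp.eval, h.na]; rw [NExp.eval_agree h e he]
  | .add e f, he => by
    simp only [NExp.low, Bool.and_eq_true] at he
    simp only [NExp.eval]; rw [NExp.eval_agree h e he.1, NExp.eval_agree h f he.2]
  | .sub e f, he => by
    simp only [NExp.low, Bool.and_eq_true] at he
    simp only [NExp.eval]; rw [NExp.eval_agree h e he.1, NExp.eval_agree h f he.2]

theorem RExp.eval_agree {σ τ : State} (h : Agree σ τ) :
    ∀ e : RExp, e.low = true → e.eval τ = e.eval σ
  | .zero, _ => rfl
  | .one, _ => rfl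
  | .var i, hi => by simp only [RExp.eval, h.rv]
  | .arr a e, he => by
    simp only [RExp.eval, h.ra]; rw [NExp.eval_agree h e he]
  | .add e f, he => by
    simp only [RExp.low, Bool.and_eq_true] at he
    simp only [RExp.eval]; rw [RExp.eval_agree h e he.1, RExp.eval_agree h f he.2]
  | .sub e f, he => by
    simp only [RExp.low, Bool.and_eq_true] at he
    simp only [RExp.eval]; rw [RExp.eval_agree h e he.1, RExp.eval_agree h f he.2]

/-- Terms with natural number values, with bounded sums; truth values are `0` and `1`. -/
inductive Tm where
  | const (c : ℕ)
  | var (i : ℕ)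
  | arr (a : ℕ) (t : Tm)
  | add (s t : Tm)
  | sub (s t : Tm)
  | lt (s t : Tm)
  | eq (s t : Tm)
  | rlt (e f : RExp)
  | ite (c s t : Tm)
  | scale (t : Tm)
  | sum (x : ℕ) (t : Tm)

open Classical in
/-- The value of a term; sums extend over the numbers below the variable `limVar`. -/
noncomputable def Tm.eval : Tm → State → ℕ
  | .const c, _ => c
  | .var i, σ => σ.nv i
  | .arr a t, σ => σ.na a (t.eval σ)
  | .add s t, σ => s.eval σ + t.eval σ
  | .sub s t, σ => s.eval σ - t.eval σ
  | .lt s t, σ => if s.eval σ < t.eval σ then 1 else 0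
  | .eq s t, σ => if s.eval σ = t.eval σ then 1 else 0
  | .rlt e f, σ => if e.eval σ < f.eval σ then 1 else 0
  | .ite c s t, σ => if c.eval σ = 0 then t.eval σ else s.eval σ
  | .scale t, σ => t.eval σ * σ.nv limVar
  | .sum x t, σ => ∑ v ∈ Finset.range (σ.nv limVar), t.eval (σ.setN x v)

/-- The variables of the term are below `100`, and `limVar` is not bound. -/
def Tm.low : Tm → Bool
  | .const _ => true
  | .var i => decide (i < 100)
  | .arr _ t => t.low
  | .add s t => s.low && t.low
  | .sub s t => s.low && t.low
  | .lt s t => s.low && t.low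
  | .eq s t => s.low && t.low
  | .rlt e f => e.low && f.low
  | .ite c s t => c.low && (s.low && t.low)
  | .scale t => t.low
  | .sum x t => decide (x < 100) && (decide (x ≠ limVar) && t.low)

/-- Compiled code uses the variables from `100` on as scratch registers; a low term cannot see them.
-/
theorem Tm.eval_agree : ∀ (t : Tm) {σ τ : State}, Agree σ τ → t.low = true →
    t.eval τ = t.eval σ
  | .const _, _, _, _, _ => rfl
  | .var i, _, _, h, hi => h.nv i (by simpa [Tm.low] using hi)
  | .arr a t, _, _, h, ht => by
    simp only [Tm.eval, h.na]; rw [Tm.eval_agree t h ht]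
  | .add s t, _, _, h, ht => by
    simp only [Tm.low, Bool.and_eq_true] at ht
    simp only [Tm.eval]; rw [Tm.eval_agree s h ht.1, Tm.eval_agree t h ht.2]
  | .sub s t, _, _, h, ht => by
    simp only [Tm.low, Bool.and_eq_true] at ht
    simp only [Tm.eval]; rw [Tm.eval_agree s h ht.1, Tm.eval_agree t h ht.2]
  | .lt s t, _, _, h, ht => by
    simp only [Tm.low, Bool.and_eq_true] at ht
    simp only [Tm.eval]; rw [Tm.eval_agree s h ht.1, Tm.eval_agree t h ht.2]
  | .eq s t, _, _, h, ht => by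
    simp only [Tm.low, Bool.and_eq_true] at ht
    simp only [Tm.eval]; rw [Tm.eval_agree s h ht.1, Tm.eval_agree t h ht.2]
  | .rlt s t, _, _, h, ht => by
    simp only [Tm.low, Bool.and_eq_true] at ht
    simp only [Tm.eval]; rw [RExp.eval_agree h s ht.1, RExp.eval_agree h t ht.2]
  | .ite c s t, _, _, h, ht => by
    simp only [Tm.low, Bool.and_eq_true] at ht
    simp only [Tm.eval]
    rw [Tm.eval_agree c h ht.1, Tm.eval_agree s h ht.2.1, Tm.eval_agree t h ht.2.2]
  | .scale t, _, _, h, ht => by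
    simp only [Tm.eval]; rw [Tm.eval_agree t h ht, h.nv limVar (by decide)]
  | .sum x t, _, _, h, ht => by
    simp only [Tm.low, Bool.and_eq_true] at ht
    simp only [Tm.eval]
    rw [h.nv limVar (by decide)]
    exact Finset.sum_congr rfl fun v _ => Tm.eval_agree t (h.setN x v) ht.2.2

/-! Counting loops. -/

/-- A loop whose counter `c` runs to the value of the variable `c + 1`. -/
def Prog.count (c : ℕ) (body : Prog) : Prog :=
  .while (.nlt (.var c) (.var (c + 1))) (.seq body (.nset c (.add (.var c) (.const 1))))

/-- A pass costs `B` for the body, 3 for the test and 4 for the increment; the failing test at the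
end costs 3. -/
theorem exec_count {c n B : ℕ} {body : Prog} (I : ℕ → State → Prop)
    (hI : ∀ v σ, I v σ → σ.nv c = v ∧ σ.nv (c + 1) = n)
    (hbody : ∀ v < n, ∀ σ, I v σ → ∃ T σ', Exec body σ T σ' ∧ T ≤ B ∧ σ'.nv c = v ∧
      I (v + 1) (σ'.setN c (v + 1)))
    {σ : State} (hσ : I 0 σ) :
    ∃ T σ', Exec (Prog.count c body) σ T σ' ∧ T ≤ n * (B + 7) + 3 ∧ I n σ' := by
  have key : ∀ k v σ, v + k = n → I v σ →
      ∃ T σ', Exec (Prog.count c body) σ T σ' ∧ T ≤ k * (B + 7) + 3 ∧ I n σ' := by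
    intro k
    induction k with
    | zero =>
      intro v σ hv hσ
      obtain rfl : v = n := by omega
      refine ⟨3, σ, ?_, by omega, hσ⟩
      have := Exec.while_false (b := .nlt (.var c) (.var (c + 1)))
        (p := .seq body (.nset c (.add (.var c) (.const 1)))) (σ := σ)
        (by simp [Test.Holds, NExp.eval, hI _ _ hσ])
      simpa [Test.cost, NExp.cost, Prog.count] using this
    | succ k ih =>
      intro v σ hv hσ
      obtain ⟨T, σ', hex, hT, hc, hI'⟩ := hbody v (by omega) σ hσ
      obtain ⟨T', σ'', hex', hT', hI''⟩ := ih (v + 1) _ (by omega) hI'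
      have h1 := Exec.nset σ' c (.add (.var c) (.const 1))
      simp only [NExp.eval, hc, NExp.cost] at h1
      have h2 := Exec.while_true (b := .nlt (.var c) (.var (c + 1)))
        (by simp only [Test.Holds, NExp.eval, hI _ _ hσ]; omega) (Exec.seq hex h1) hex'
      refine ⟨_, σ'', h2, ?_, hI''⟩
      simp only [Test.cost, NExp.cost]
      rw [Nat.succ_mul]; omega
  exact key n 0 σ (by omega) hσ

/-- The program that computes a term into the variable `k`, using the variables from `k` on. -/
def Tm.comp : Tm → ℕ → Prog
  | .const c, k => .nset k (.const c)
  | .var i, k => .nset k (.var i)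
  | .arr a t, k => .seq (t.comp k) (.nset k (.arr a (.var k)))
  | .add s t, k =>
    .seq (s.comp k) (.seq (t.comp (k + 1)) (.nset k (.add (.var k) (.var (k + 1)))))
  | .sub s t, k =>
    .seq (s.comp k) (.seq (t.comp (k + 1)) (.nset k (.sub (.var k) (.var (k + 1)))))
  | .lt s t, k =>
    .seq (s.comp k) (.seq (t.comp (k + 1))
      (.ite (.nlt (.var k) (.var (k + 1))) (.nset k (.const 1)) (.nset k (.const 0))))
  | .eq s t, k =>
    .seq (s.comp k) (.seq (t.comp (k + 1))
      (.ite (.neq (.var k) (.var (k + 1))) (.nset k (.const 1)) (.nset k (.const 0))))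
  | .rlt e f, k => .ite (.rlt e f) (.nset k (.const 1)) (.nset k (.const 0))
  | .ite c s t, k =>
    .seq (c.comp k) (.ite (.neq (.var k) (.const 0)) (t.comp k) (s.comp k))
  -- The machine cannot multiply: the value is added `limVar` times.
  | .scale t, k =>
    .seq (t.comp (k + 1)) (.seq (.nset k (.const 0)) (.seq (.nset (k + 2) (.const 0))
      (.seq (.nset (k + 3) (.var limVar))
        (Prog.count (k + 2) (.nset k (.add (.var k) (.var (k + 1))))))))
  -- Register `k` accumulates, `k + 1` saves the old value of `x`, `k + 2` and `k + 3` are the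
  -- counter and its bound; the summand works from `k + 4` on.
  | .sum x t, k =>
    .seq (.nset (k + 1) (.var x)) (.seq (.nset k (.const 0)) (.seq (.nset (k + 2) (.const 0))
      (.seq (.nset (k + 3) (.var limVar))
        (.seq (Prog.count (k + 2) (.seq (.nset x (.var (k + 2))) (.seq (t.comp (k + 4))
          (.nset k (.add (.var k) (.var (k + 4)))))))
            (.nset x (.var (k + 1)))))))

@[simp] theorem setN_nv (σ : State) (i v : ℕ) (j : ℕ) :
    (σ.setN i v).nv j = if j = i then v else σ.nv j := by
  simp [State.setN, Function.update_apply]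
@[simp] theorem setN_rv (σ : State) (i v : ℕ) : (σ.setN i v).rv = σ.rv := rfl
@[simp] theorem setN_na (σ : State) (i v : ℕ) : (σ.setN i v).na = σ.na := rfl
@[simp] theorem setN_ra (σ : State) (i v : ℕ) : (σ.setN i v).ra = σ.ra := rfl
@[simp] theorem setR_nv (σ : State) (i : ℕ) (v : ℝ) : (σ.setR i v).nv = σ.nv := rfl
@[simp] theorem setR_rv (σ : State) (i : ℕ) (v : ℝ) (j : ℕ) :
    (σ.setR i v).rv j = if j = i then v else σ.rv j := by
  simp [State.setR, Function.update_apply]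
@[simp] theorem setR_na (σ : State) (i : ℕ) (v : ℝ) : (σ.setR i v).na = σ.na := rfl
@[simp] theorem setR_ra (σ : State) (i : ℕ) (v : ℝ) : (σ.setR i v).ra = σ.ra := rfl
@[simp] theorem storeN_nv (σ : State) (a k v : ℕ) : (σ.storeN a k v).nv = σ.nv := rfl
@[simp] theorem storeN_rv (σ : State) (a k v : ℕ) : (σ.storeN a k v).rv = σ.rv := rfl
@[simp] theorem storeN_na (σ : State) (a k v : ℕ) (b j : ℕ) :
    (σ.storeN a k v).na b j = if b = a ∧ j = k then v else σ.na b j := by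
  by_cases h : b = a
  · subst h; simp [State.storeN, Function.update_apply]
  · simp [State.storeN, h]
@[simp] theorem storeN_ra (σ : State) (a k v : ℕ) : (σ.storeN a k v).ra = σ.ra := rfl
@[simp] theorem storeR_nv (σ : State) (a k : ℕ) (v : ℝ) : (σ.storeR a k v).nv = σ.nv := rfl
@[simp] theorem storeR_rv (σ : State) (a k : ℕ) (v : ℝ) : (σ.storeR a k v).rv = σ.rv := rfl
@[simp] theorem storeR_na (σ : State) (a k : ℕ) (v : ℝ) : (σ.storeR a k v).na = σ.na := rfl
@[simp] theorem storeR_ra (σ : State) (a k : ℕ) (v : ℝ) (b j : ℕ) :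
    (σ.storeR a k v).ra b j = if b = a ∧ j = k then v else σ.ra b j := by
  by_cases h : b = a
  · subst h; simp [State.storeR, Function.update_apply]
  · simp [State.storeR, h]

/-- `p` computes the number `v` into the variable `k` within `B` steps. -/
def Yields (p : Prog) (k : ℕ) (σ : State) (v B : ℕ) : Prop :=
  ∃ T σ', Exec p σ T σ' ∧ Agree σ σ' ∧ (∀ i, 100 ≤ i → i < k → σ'.nv i = σ.nv i) ∧
    σ'.nv k = v ∧ T ≤ B

/-- The first operand waits in register `k` while the second is computed from `k + 1` on. It
survives because `Yields` protects the registers from `100` to the one that receives the result. -/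
theorem Tm.comp_binary {s t : Tm} {p q : Polynomial ℕ} {last : ℕ → Prog} {F : ℕ → ℕ → ℕ} {D : ℕ}
    (ht : t.low = true)
    (hp : ∀ k σ, 100 ≤ k → Yields (s.comp k) k σ (s.eval σ) (p.eval (σ.nv limVar)))
    (hq : ∀ k σ, 100 ≤ k → Yields (t.comp k) k σ (t.eval σ) (q.eval (σ.nv limVar)))
    (hlast : ∀ k σ, ∃ T, T ≤ D ∧
      Exec (last k) σ T (σ.setN k (F (σ.nv k) (σ.nv (k + 1)))))
    (k : ℕ) (σ : State) (hk : 100 ≤ k) :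
    Yields (.seq (s.comp k) (.seq (t.comp (k + 1)) (last k))) k σ (F (s.eval σ) (t.eval σ))
      ((p + q + Polynomial.C D).eval (σ.nv limVar)) := by
  obtain ⟨T₁, σ₁, h₁, a₁, f₁, v₁, b₁⟩ := hp k σ hk
  obtain ⟨T₂, σ₂, h₂, a₂, f₂, v₂, b₂⟩ := hq (k + 1) σ₁ (by omega)
  obtain ⟨T₃, b₃, h₃⟩ := hlast k σ₂
  refine ⟨_, _, .seq h₁ (.seq h₂ h₃), (a₁.trans a₂).setN_right hk _, ?_, ?_, ?_⟩
  · intro i hi hik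
    rw [setN_nv, if_neg (by omega), f₂ i hi (by omega), f₁ i hi hik]
  · rw [setN_nv, if_pos rfl, v₂, f₂ k hk (by omega), v₁, Tm.eval_agree t a₁ ht]
  · rw [a₁.nv limVar (by decide)] at b₂
    simp only [Polynomial.eval_add, Polynomial.eval_C]; omega

/-- The polynomial depends on the term alone. Costs of subterms add up, and `scale` and `sum`
contribute a factor `X` for their `limVar` passes. -/
theorem Tm.comp_spec : ∀ t : Tm, t.low = true → ∃ p : Polynomial ℕ, ∀ k σ, 100 ≤ k →
    Yields (t.comp k) k σ (t.eval σ) (p.eval (σ.nv limVar))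
  | .const c, _ => ⟨Polynomial.C 2, fun k σ hk => ⟨_, _, Exec.nset σ k _,
      (Agree.refl σ).setN_right hk _, fun i _ hik => by rw [setN_nv, if_neg (by omega)],
      by simp [NExp.eval, Tm.eval], by simp [NExp.cost]⟩⟩
  | .var i, _ => ⟨Polynomial.C 2, fun k σ hk => ⟨_, _, Exec.nset σ k _,
      (Agree.refl σ).setN_right hk _, fun i _ hik => by rw [setN_nv, if_neg (by omega)],
      by simp [NExp.eval, Tm.eval], by simp [NExp.cost]⟩⟩
  | .arr a t, ht => by
    obtain ⟨p, hp⟩ := Tm.comp_spec t ht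
    refine ⟨p + Polynomial.C 3, fun k σ hk => ?_⟩
    obtain ⟨T₁, σ₁, h₁, a₁, f₁, v₁, b₁⟩ := hp k σ hk
    refine ⟨_, _, .seq h₁ (Exec.nset _ _ _), a₁.setN_right hk _, ?_, ?_, ?_⟩
    · intro i hi hik
      rw [setN_nv, if_neg (by omega), f₁ i hi hik]
    · simp [NExp.eval, Tm.eval, v₁, a₁.na]
    · simp only [Polynomial.eval_add, Polynomial.eval_C, NExp.cost]; omega
  | .add s t, h => by
    simp only [Tm.low, Bool.and_eq_true] at h
    obtain ⟨p, hp⟩ := Tm.comp_spec s h.1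
    obtain ⟨q, hq⟩ := Tm.comp_spec t h.2
    exact ⟨_, Tm.comp_binary (D := 4) (F := fun a b => a + b)
      (last := fun k => .nset k (.add (.var k) (.var (k + 1)))) h.2 hp hq
      fun k σ => ⟨_, by simp [NExp.cost], Exec.nset σ k _⟩⟩
  | .sub s t, h => by
    simp only [Tm.low, Bool.and_eq_true] at h
    obtain ⟨p, hp⟩ := Tm.comp_spec s h.1
    obtain ⟨q, hq⟩ := Tm.comp_spec t h.2
    exact ⟨_, Tm.comp_binary (D := 4) (F := fun a b => a - b)
      (last := fun k => .nset k (.sub (.var k) (.var (k + 1)))) h.2 hp hq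
      fun k σ => ⟨_, by simp [NExp.cost], Exec.nset σ k _⟩⟩
  | .lt s t, h => by
    simp only [Tm.low, Bool.and_eq_true] at h
    obtain ⟨p, hp⟩ := Tm.comp_spec s h.1
    obtain ⟨q, hq⟩ := Tm.comp_spec t h.2
    refine ⟨_, Tm.comp_binary (D := 5) (F := fun a b => if a < b then 1 else 0)
      (last := fun k => .ite (.nlt (.var k) (.var (k + 1))) (.nset k (.const 1))
        (.nset k (.const 0))) h.2 hp hq fun k σ => ?_⟩
    by_cases hlt : σ.nv k < σ.nv (k + 1)
    · simp only [if_pos hlt]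
      exact ⟨5, le_rfl, Exec.ite_true (by simpa [Test.Holds, NExp.eval] using hlt)
        (Exec.nset σ k (.const 1))⟩
    · simp only [if_neg hlt]
      exact ⟨5, le_rfl, Exec.ite_false (by simpa [Test.Holds, NExp.eval] using hlt)
        (Exec.nset σ k (.const 0))⟩
  | .eq s t, h => by
    simp only [Tm.low, Bool.and_eq_true] at h
    obtain ⟨p, hp⟩ := Tm.comp_spec s h.1
    obtain ⟨q, hq⟩ := Tm.comp_spec t h.2
    refine ⟨_, Tm.comp_binary (D := 5) (F := fun a b => if a = b then 1 else 0)
      (last := fun k => .ite (.neq (.var k) (.var (k + 1))) (.nset k (.const 1))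
        (.nset k (.const 0))) h.2 hp hq fun k σ => ?_⟩
    by_cases hlt : σ.nv k = σ.nv (k + 1)
    · simp only [if_pos hlt]
      exact ⟨5, le_rfl, Exec.ite_true (by simpa [Test.Holds, NExp.eval] using hlt)
        (Exec.nset σ k (.const 1))⟩
    · simp only [if_neg hlt]
      exact ⟨5, le_rfl, Exec.ite_false (by simpa [Test.Holds, NExp.eval] using hlt)
        (Exec.nset σ k (.const 0))⟩
  | .rlt e f, _ => by
    refine ⟨Polynomial.C (e.cost + f.cost + 3), fun k σ hk => ?_⟩
    have hA : ∀ v, Agree σ (σ.setN k v) := fun v => (Agree.refl σ).setN_right hk _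
    by_cases hlt : e.eval σ < f.eval σ
    · exact ⟨_, _, Exec.ite_true hlt (Exec.nset σ k (.const 1)), hA _,
        fun i _ hik => by rw [setN_nv, if_neg (by omega)], by simp [NExp.eval, Tm.eval, hlt],
        by simp [Test.cost, NExp.cost]⟩
    · exact ⟨_, _, Exec.ite_false hlt (Exec.nset σ k (.const 0)), hA _,
        fun i _ hik => by rw [setN_nv, if_neg (by omega)],
        by simpa [NExp.eval, Tm.eval] using hlt,
        by simp [Test.cost, NExp.cost]⟩
  | .ite c s t, h => by
    simp only [Tm.low, Bool.and_eq_true] at h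
    obtain ⟨p, hp⟩ := Tm.comp_spec c h.1
    obtain ⟨q, hq⟩ := Tm.comp_spec s h.2.1
    obtain ⟨r, hr⟩ := Tm.comp_spec t h.2.2
    refine ⟨p + q + r + Polynomial.C 3, fun k σ hk => ?_⟩
    obtain ⟨T₁, σ₁, h₁, a₁, f₁, v₁, b₁⟩ := hp k σ hk
    by_cases h0 : c.eval σ = 0
    · obtain ⟨T₂, σ₂, h₂, a₂, f₂, v₂, b₂⟩ := hr k σ₁ hk
      refine ⟨_, _, .seq h₁ (.ite_true ?_ h₂), a₁.trans a₂, ?_, ?_, ?_⟩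
      · simp [Test.Holds, NExp.eval, v₁, h0]
      · intro i hi hik
        rw [f₂ i hi hik, f₁ i hi hik]
      · simp [Tm.eval, v₂, h0, Tm.eval_agree t a₁ h.2.2]
      · rw [a₁.nv limVar (by decide)] at b₂
        simp only [Polynomial.eval_add, Polynomial.eval_C, NExp.cost, Test.cost]; omega
    · obtain ⟨T₂, σ₂, h₂, a₂, f₂, v₂, b₂⟩ := hq k σ₁ hk
      refine ⟨_, _, .seq h₁ (.ite_false ?_ h₂), a₁.trans a₂, ?_, ?_, ?_⟩
      · simp [Test.Holds, NExp.eval, v₁, h0]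
      · intro i hi hik
        rw [f₂ i hi hik, f₁ i hi hik]
      · simp [Tm.eval, v₂, h0, Tm.eval_agree s a₁ h.2.1]
      · rw [a₁.nv limVar (by decide)] at b₂
        simp only [Polynomial.eval_add, Polynomial.eval_C, NExp.cost, Test.cost]; omega
  | .scale t, ht => by
    obtain ⟨p, hp⟩ := Tm.comp_spec t ht
    refine ⟨p + Polynomial.X * Polynomial.C 11 + Polynomial.C 9, fun k σ hk => ?_⟩
    obtain ⟨T₁, σ₁, h₁, a₁, f₁, v₁, b₁⟩ := hp (k + 1) σ (by omega)
    have hL := a₁.nv limVar (by decide)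
    obtain ⟨T₂, σ₂, h₂, b₂, i₂⟩ := exec_count (c := k + 2) (n := σ.nv limVar) (B := 4)
      (body := .nset k (.add (.var k) (.var (k + 1))))
      (fun v τ => τ.nv (k + 2) = v ∧ τ.nv (k + 3) = σ.nv limVar ∧ Agree σ τ ∧
        (∀ i, 100 ≤ i → i < k → τ.nv i = σ.nv i) ∧ τ.nv k = t.eval σ * v ∧
        τ.nv (k + 1) = t.eval σ) (fun v τ h => ⟨h.1, h.2.1⟩)
      (fun v _ τ h => by
        obtain ⟨h1, h2, h3, h4, h5, h6⟩ := h
        refine ⟨_, _, Exec.nset _ _ _, by simp [NExp.cost], by simp [h1], by simp, by simp [h2],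
          (h3.setN_right hk _).setN_right (by omega) _, fun i hi hik => ?_, ?_, by simp [h6]⟩
        · simp [show i ≠ k + 2 by omega, show i ≠ k by omega, h4 i hi hik]
        · simp [NExp.eval, h5, h6, Nat.mul_succ])
      (σ := ((σ₁.setN k 0).setN (k + 2) 0).setN (k + 3) (σ.nv limVar))
      ⟨by simp, by simp, ((a₁.setN_right hk _).setN_right (by omega) _).setN_right (by omega) _,
        fun i hi hik => by
          simp [show i ≠ k + 3 by omega, show i ≠ k + 2 by omega, show i ≠ k by omega,
            f₁ i hi (by omega)], by simp, by simp [v₁]⟩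
    have hs₁ := Exec.nset σ₁ k (.const 0)
    have hs₂ := Exec.nset (σ₁.setN k 0) (k + 2) (.const 0)
    have hs₃ := Exec.nset ((σ₁.setN k 0).setN (k + 2) 0) (k + 3) (.var limVar)
    have hLk : limVar ≠ k := by unfold limVar; omega
    have hL2 : limVar ≠ k + 2 := by unfold limVar; omega
    simp only [NExp.eval, NExp.cost, setN_nv, if_neg hLk, if_neg hL2, hL] at hs₁ hs₂ hs₃
    refine ⟨_, σ₂, .seq h₁ (.seq hs₁ (.seq hs₂ (.seq hs₃ h₂))), i₂.2.2.1, i₂.2.2.2.1,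
      i₂.2.2.2.2.1, ?_⟩
    simp only [Polynomial.eval_add, Polynomial.eval_C, Polynomial.eval_mul, Polynomial.eval_X]
    omega
  | .sum x t, ht => by
    simp only [Tm.low, Bool.and_eq_true, decide_eq_true_eq] at ht
    obtain ⟨p, hp⟩ := Tm.comp_spec t ht.2.2
    obtain ⟨hx, hx5, ht⟩ := ht
    refine ⟨Polynomial.X * (p + Polynomial.C 13) + Polynomial.C 13, fun k σ hk => ?_⟩
    have hLk : limVar ≠ k := by unfold limVar; omega
    have hL1 : limVar ≠ k + 1 := by unfold limVar; omega
    have hL2 : limVar ≠ k + 2 := by unfold limVar; omega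
    obtain ⟨T₂, σ₂, h₂, b₂, i₂⟩ := exec_count (c := k + 2) (n := σ.nv limVar)
      (B := p.eval (σ.nv limVar) + 6)
      (body := .seq (.nset x (.var (k + 2))) (.seq (t.comp (k + 4))
          (.nset k (.add (.var k) (.var (k + 4))))))
      (fun v τ => τ.nv (k + 2) = v ∧ τ.nv (k + 3) = σ.nv limVar ∧
        -- The loop overwrites `x`, so agreement holds only once the old value is put back.
        Agree σ (τ.setN x (σ.nv x)) ∧
        (∀ i, 100 ≤ i → i < k → τ.nv i = σ.nv i) ∧
        τ.nv k = ∑ v ∈ Finset.range v, t.eval (σ.setN x v) ∧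
        τ.nv (k + 1) = σ.nv x) (fun v τ h => ⟨h.1, h.2.1⟩)
      (fun v _ τ h => by
        obtain ⟨h1, h2, h3, h4, h5, h6⟩ := h
        have h3' : Agree (σ.setN x v) (τ.setN x v) := by
          have := h3.setN x v
          have e : (τ.setN x (σ.nv x)).setN x v = τ.setN x v := by
            simp [State.setN]
          rwa [e] at this
        obtain ⟨T₁, σ₁, q₁, a₁, f₁, v₁, b₁⟩ := hp (k + 4) (τ.setN x v) (by omega)
        have hL : (τ.setN x v).nv limVar = σ.nv limVar := by
          rw [h3'.nv limVar (by decide), setN_nv, if_neg (Ne.symm hx5)]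
        rw [hL] at b₁
        have e₁ := Exec.nset τ x (.var (k + 2))
        have e₂ := Exec.nset σ₁ k (.add (.var k) (.var (k + 4)))
        simp only [NExp.eval, NExp.cost, h1] at e₁ e₂
        have g : ∀ i, 100 ≤ i → i < k + 4 → σ₁.nv i = τ.nv i := fun i hi hik => by
          rw [f₁ i hi hik, setN_nv, if_neg (by omega)]
        refine ⟨_, _, .seq e₁ (.seq q₁ e₂), by omega, ?_, ?_, ?_, ?_, ?_, ?_, ?_⟩
        · rw [setN_nv, if_neg (by omega), g _ (by omega) (by omega), h1]
        · simp
        · simp [g (k + 3) (by omega) (by omega), h2]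
        · have a := (h3'.trans a₁).setN x (σ.nv x)
          have e : (σ.setN x v).setN x (σ.nv x) = σ := by
            ext <;> simp
            split_ifs <;> simp_all
          rw [e] at a
          have a' := (a.setN_right hk (σ₁.nv k + σ₁.nv (k + 4))).setN_right
            (show 100 ≤ k + 2 by omega) (v + 1)
          refine ⟨fun i hi => ?_, a'.rv, a'.na, a'.ra⟩
          rw [← a'.nv i hi]
          have : i ≠ k := by omega
          have : i ≠ k + 2 := by omega
          simp [*]
        · intro i hi hik
          simp [show i ≠ k + 2 by omega, show i ≠ k by omega, g i hi (by omega), h4 i hi hik]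
        · simp [g k hk (by omega), h5, Finset.sum_range_succ, v₁, Tm.eval_agree t h3' ht]
        · simp [g (k + 1) (by omega) (by omega), h6])
      (σ := (((σ.setN (k + 1) (σ.nv x)).setN k 0).setN (k + 2) 0).setN (k + 3) (σ.nv limVar))
      ⟨by simp, by simp, by
          have a : Agree σ ((((σ.setN (k + 1) (σ.nv x)).setN k 0).setN (k + 2) 0).setN (k + 3)
              (σ.nv limVar)) :=
            ((((Agree.refl σ).setN_right (by omega) _).setN_right hk _).setN_right
              (by omega) _).setN_right (by omega) _
          refine ⟨fun i hi => ?_, a.rv, a.na, a.ra⟩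
          rw [setN_nv]
          split_ifs with h
          · rw [h]
          · exact a.nv i hi, fun i hi hik => by
          simp [show i ≠ k + 3 by omega, show i ≠ k + 2 by omega, show i ≠ k by omega,
            show i ≠ k + 1 by omega], by simp, by simp⟩
    have hs₀ := Exec.nset σ (k + 1) (.var x)
    have hs₁ := Exec.nset (σ.setN (k + 1) (σ.nv x)) k (.const 0)
    have hs₂ := Exec.nset ((σ.setN (k + 1) (σ.nv x)).setN k 0) (k + 2) (.const 0)
    have hs₃ := Exec.nset (((σ.setN (k + 1) (σ.nv x)).setN k 0).setN (k + 2) 0) (k + 3)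
      (.var limVar)
    have hs₄ := Exec.nset σ₂ x (.var (k + 1))
    simp only [NExp.eval, NExp.cost, setN_nv, if_neg hLk, if_neg hL1, if_neg hL2,
      i₂.2.2.2.2.2] at hs₀ hs₁ hs₂ hs₃ hs₄
    refine ⟨_, _, .seq hs₀ (.seq hs₁ (.seq hs₂ (.seq hs₃ (.seq h₂ hs₄)))), i₂.2.2.1, ?_, ?_, ?_⟩
    · intro i hi hik
      rw [setN_nv, if_neg (by omega), i₂.2.2.2.1 i hi hik]
    · rw [setN_nv, if_neg (by omega), i₂.2.2.2.2.1]; rfl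
    · simp only [Polynomial.eval_add, Polynomial.eval_C, Polynomial.eval_mul, Polynomial.eval_X]
      have : Polynomial.eval (σ.nv limVar) p + 6 + 7 = Polynomial.eval (σ.nv limVar) p + 13 := rfl
      rw [this] at b₂; omega

end RAM

/-! ### Programs with bounded loops and their compilation -/

namespace RAM

/-- Terminating programs; a loop lets its variable run through the numbers below `limVar`. -/
inductive Stmt where
  | nset (i : ℕ) (t : Tm)
  | rset (i : ℕ) (e : RExp)
  | nstore (a : ℕ) (k t : Tm)
  | rstore (a : ℕ) (k : Tm) (e : RExp)
  | seq (p q : Stmt)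
  | ite (c : Tm) (p q : Stmt)
  | loop (x : ℕ) (p : Stmt)

/-- `f` applied for `0`, …, `n - 1` in succession. -/
def iter (f : ℕ → State → State) : ℕ → State → State
  | 0, σ => σ
  | n + 1, σ => f n (iter f n σ)

noncomputable def Stmt.run : Stmt → State → State
  | .nset i t, σ => σ.setN i (t.eval σ)
  | .rset i e, σ => σ.setR i (e.eval σ)
  | .nstore a k t, σ => σ.storeN a (k.eval σ) (t.eval σ)
  | .rstore a k e, σ => σ.storeR a (k.eval σ) (e.eval σ)
  | .seq p q, σ => q.run (p.run σ)
  | .ite c p q, σ => if c.eval σ = 0 then q.run σ else p.run σ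
  | .loop x p, σ => iter (fun v τ => p.run (τ.setN x v)) (σ.nv limVar) σ

/-- All variables are below `100`, and `limVar` is not changed. -/
def Stmt.low : Stmt → Bool
  | .nset i t => decide (i < 100) && (decide (i ≠ limVar) && t.low)
  | .rset _ e => e.low
  | .nstore _ k t => k.low && t.low
  | .rstore _ k e => k.low && e.low
  | .seq p q => p.low && q.low
  | .ite c p q => c.low && (p.low && q.low)
  | .loop x p => decide (x < 100) && (decide (x ≠ limVar) && p.low)

def Stmt.comp : Stmt → ℕ → Prog
  | .nset i t, k => .seq (t.comp k) (.nset i (.var k))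
  | .rset i e, _ => .rset i e
  | .nstore a s t, k => .seq (s.comp k) (.seq (t.comp (k + 1)) (.nstore a (.var k) (.var (k + 1))))
  | .rstore a s e, k => .seq (s.comp k) (.rstore a (.var k) e)
  | .seq p q, k => .seq (p.comp k) (q.comp k)
  | .ite c p q, k => .seq (c.comp k) (.ite (.neq (.var k) (.const 0)) (q.comp k) (p.comp k))
  | .loop x p, k =>
    .seq (.nset k (.const 0)) (.seq (.nset (k + 1) (.var limVar))
      (Prog.count k (.seq (.nset x (.var k)) (p.comp (k + 2)))))

theorem iter_limVar {f : ℕ → State → State} (hf : ∀ v σ, (f v σ).nv limVar = σ.nv limVar)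
    (n : ℕ) (σ : State) : (iter f n σ).nv limVar = σ.nv limVar := by
  induction n with
  | zero => rfl
  | succ n ih => rw [iter, hf, ih]

/-- The time bounds of consecutive statements are polynomials in `limVar`; they can be added because
all of them refer to the same value. -/
theorem Stmt.run_limVar : ∀ (s : Stmt), s.low = true → ∀ σ, (s.run σ).nv limVar = σ.nv limVar
  | .nset i t, h, σ => by
    simp only [Stmt.low, Bool.and_eq_true, decide_eq_true_eq] at h
    simp [Stmt.run, Ne.symm h.2.1]
  | .rset i e, _, σ => rfl
  | .nstore a k t, _, σ => rfl
  | .rstore a k e, _, σ => rfl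
  | .seq p q, h, σ => by
    simp only [Stmt.low, Bool.and_eq_true] at h
    rw [Stmt.run, Stmt.run_limVar q h.2, Stmt.run_limVar p h.1]
  | .ite c p q, h, σ => by
    simp only [Stmt.low, Bool.and_eq_true] at h
    rw [Stmt.run]
    split_ifs
    · exact Stmt.run_limVar q h.2.2 σ
    · exact Stmt.run_limVar p h.2.1 σ
  | .loop x p, h, σ => by
    simp only [Stmt.low, Bool.and_eq_true, decide_eq_true_eq] at h
    exact iter_limVar (fun v τ => by
      rw [Stmt.run_limVar p h.2.2, setN_nv, if_neg (Ne.symm h.2.1)]) _ _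

/-- `p` turns `τ` into a memory that agrees with `σ'`, within `B` steps and without changing the
variables from `100` to `k`. -/
def Achieves (p : Prog) (k : ℕ) (τ σ' : State) (B : ℕ) : Prop :=
  ∃ T τ', Exec p τ T τ' ∧ Agree σ' τ' ∧ (∀ i, 100 ≤ i → i < k → τ'.nv i = τ.nv i) ∧ T ≤ B

/-- The compiled program starts in any memory `τ` that agrees with `σ` below `100`, since earlier
pieces leave garbage in the scratch registers. Induction on the statement: a sequence adds
polynomials, a loop multiplies by `X`. -/
theorem Stmt.comp_spec : ∀ s : Stmt, s.low = true → ∃ p : Polynomial ℕ, ∀ k σ τ, 100 ≤ k →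
    Agree σ τ → Achieves (s.comp k) k τ (s.run σ) (p.eval (σ.nv limVar))
  | .nset i t, h => by
    simp only [Stmt.low, Bool.and_eq_true, decide_eq_true_eq] at h
    obtain ⟨p, hp⟩ := Tm.comp_spec t h.2.2
    refine ⟨p + Polynomial.C 2, fun k σ τ hk hA => ?_⟩
    obtain ⟨T₁, τ₁, h₁, a₁, f₁, v₁, b₁⟩ := hp k τ hk
    have e := Exec.nset τ₁ i (.var k)
    simp only [NExp.eval, NExp.cost, v₁, Tm.eval_agree t hA h.2.2] at e
    refine ⟨_, _, .seq h₁ e, (hA.trans a₁).setN _ _, fun j hj hjk => ?_, ?_⟩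
    · rw [setN_nv, if_neg (by omega), f₁ j hj hjk]
    · rw [hA.nv limVar (by decide)] at b₁
      simp only [Polynomial.eval_add, Polynomial.eval_C]; omega
  | .rset i e, h => by
    refine ⟨Polynomial.C (e.cost + 1), fun k σ τ hk hA => ?_⟩
    have e₁ := Exec.rset τ i e
    rw [RExp.eval_agree hA e h] at e₁
    exact ⟨_, _, e₁, hA.setR _ _, fun _ _ _ => rfl, by simp⟩
  | .nstore a s t, h => by
    simp only [Stmt.low, Bool.and_eq_true] at h
    obtain ⟨p, hp⟩ := Tm.comp_spec s h.1
    obtain ⟨q, hq⟩ := Tm.comp_spec t h.2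
    refine ⟨p + q + Polynomial.C 3, fun k σ τ hk hA => ?_⟩
    obtain ⟨T₁, τ₁, h₁, a₁, f₁, v₁, b₁⟩ := hp k τ hk
    obtain ⟨T₂, τ₂, h₂, a₂, f₂, v₂, b₂⟩ := hq (k + 1) τ₁ (by omega)
    have e := Exec.nstore τ₂ a (.var k) (.var (k + 1))
    simp only [NExp.eval, NExp.cost, v₂, f₂ k hk (by omega), v₁, Tm.eval_agree s hA h.1,
      Tm.eval_agree t (hA.trans a₁) h.2] at e
    refine ⟨_, _, .seq h₁ (.seq h₂ e), ((hA.trans a₁).trans a₂).storeN _ _ _,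
      fun j hj hjk => ?_, ?_⟩
    · rw [storeN_nv, f₂ j hj (by omega), f₁ j hj hjk]
    · rw [hA.nv limVar (by decide)] at b₁
      rw [(hA.trans a₁).nv limVar (by decide)] at b₂
      simp only [Polynomial.eval_add, Polynomial.eval_C]; omega
  | .rstore a s e, h => by
    simp only [Stmt.low, Bool.and_eq_true] at h
    obtain ⟨p, hp⟩ := Tm.comp_spec s h.1
    refine ⟨p + Polynomial.C (e.cost + 2), fun k σ τ hk hA => ?_⟩
    obtain ⟨T₁, τ₁, h₁, a₁, f₁, v₁, b₁⟩ := hp k τ hk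
    have e₁ := Exec.rstore τ₁ a (.var k) e
    simp only [NExp.eval, NExp.cost, v₁, Tm.eval_agree s hA h.1,
      RExp.eval_agree (hA.trans a₁) e h.2] at e₁
    refine ⟨_, _, .seq h₁ e₁, (hA.trans a₁).storeR _ _ _, fun j hj hjk => ?_, ?_⟩
    · rw [storeR_nv, f₁ j hj hjk]
    · rw [hA.nv limVar (by decide)] at b₁
      simp only [Polynomial.eval_add, Polynomial.eval_C]; omega
  | .seq s t, h => by
    simp only [Stmt.low, Bool.and_eq_true] at h
    obtain ⟨p, hp⟩ := Stmt.comp_spec s h.1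
    obtain ⟨q, hq⟩ := Stmt.comp_spec t h.2
    refine ⟨p + q, fun k σ τ hk hA => ?_⟩
    obtain ⟨T₁, τ₁, h₁, a₁, f₁, b₁⟩ := hp k σ τ hk hA
    obtain ⟨T₂, τ₂, h₂, a₂, f₂, b₂⟩ := hq k _ τ₁ hk a₁
    refine ⟨_, _, .seq h₁ h₂, a₂, fun j hj hjk => by rw [f₂ j hj hjk, f₁ j hj hjk], ?_⟩
    rw [Stmt.run_limVar s h.1] at b₂
    simp only [Polynomial.eval_add]; omega
  | .ite c s t, h => by
    simp only [Stmt.low, Bool.and_eq_true] at h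
    obtain ⟨r, hr⟩ := Tm.comp_spec c h.1
    obtain ⟨p, hp⟩ := Stmt.comp_spec s h.2.1
    obtain ⟨q, hq⟩ := Stmt.comp_spec t h.2.2
    refine ⟨r + p + q + Polynomial.C 3, fun k σ τ hk hA => ?_⟩
    obtain ⟨T₁, τ₁, h₁, a₁, f₁, v₁, b₁⟩ := hr k τ hk
    rw [hA.nv limVar (by decide)] at b₁
    rw [Tm.eval_agree c hA h.1] at v₁
    by_cases h0 : c.eval σ = 0
    · obtain ⟨T₂, τ₂, h₂, a₂, f₂, b₂⟩ := hq k σ τ₁ hk (hA.trans a₁)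
      refine ⟨_, _, .seq h₁ (.ite_true (by simp [Test.Holds, NExp.eval, v₁, h0]) h₂), ?_,
        fun j hj hjk => by rw [f₂ j hj hjk, f₁ j hj hjk], ?_⟩
      · simpa [Stmt.run, h0] using a₂
      · simp only [Polynomial.eval_add, Polynomial.eval_C, Test.cost, NExp.cost]; omega
    · obtain ⟨T₂, τ₂, h₂, a₂, f₂, b₂⟩ := hp k σ τ₁ hk (hA.trans a₁)
      refine ⟨_, _, .seq h₁ (.ite_false (by simp [Test.Holds, NExp.eval, v₁, h0]) h₂), ?_,
        fun j hj hjk => by rw [f₂ j hj hjk, f₁ j hj hjk], ?_⟩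
      · simpa [Stmt.run, h0] using a₂
      · simp only [Polynomial.eval_add, Polynomial.eval_C, Test.cost, NExp.cost]; omega
  | .loop x s, h => by
    simp only [Stmt.low, Bool.and_eq_true, decide_eq_true_eq] at h
    obtain ⟨hx, hx5, hs⟩ := h
    obtain ⟨p, hp⟩ := Stmt.comp_spec s hs
    refine ⟨Polynomial.X * (p + Polynomial.C 9) + Polynomial.C 7, fun k σ τ hk hA => ?_⟩
    have hL := hA.nv limVar (by decide)
    have hf : ∀ (v : ℕ) (ρ : State), (s.run (ρ.setN x v)).nv limVar = ρ.nv limVar :=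
      fun v ρ => by rw [Stmt.run_limVar s hs, setN_nv, if_neg (Ne.symm hx5)]
    obtain ⟨T₂, τ₂, h₂, b₂, i₂⟩ := exec_count (c := k) (n := σ.nv limVar)
      (B := p.eval (σ.nv limVar) + 2)
      (body := .seq (.nset x (.var k)) (s.comp (k + 2)))
      (fun v ρ => ρ.nv k = v ∧ ρ.nv (k + 1) = σ.nv limVar ∧
        Agree (iter (fun v τ => s.run (τ.setN x v)) v σ) ρ ∧
        (∀ i, 100 ≤ i → i < k → ρ.nv i = τ.nv i)) (fun v ρ h => ⟨h.1, h.2.1⟩)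
      (fun v _ ρ h => by
        obtain ⟨h1, h2, h3, h4⟩ := h
        obtain ⟨T₁, τ₁, q₁, a₁, f₁, b₁⟩ := hp (k + 2) _ (ρ.setN x v) (by omega) (h3.setN x v)
        have hL' : ((iter (fun v τ => s.run (τ.setN x v)) v σ).setN x v).nv limVar =
            σ.nv limVar := by
          rw [setN_nv, if_neg (Ne.symm hx5), iter_limVar hf]
        rw [hL'] at b₁
        have e₁ := Exec.nset ρ x (.var k)
        simp only [NExp.eval, NExp.cost, h1] at e₁
        have g : ∀ i, 100 ≤ i → i < k + 2 → τ₁.nv i = ρ.nv i := fun i hi hik => by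
          rw [f₁ i hi hik, setN_nv, if_neg (by omega)]
        refine ⟨_, _, .seq e₁ q₁, by omega, by rw [g k hk (by omega), h1], by simp, ?_,
          a₁.setN_right hk _, fun i hi hik => ?_⟩
        · simp [g (k + 1) (by omega) (by omega), h2]
        · rw [setN_nv, if_neg (by omega), g i hi (by omega), h4 i hi hik])
      (σ := (τ.setN k 0).setN (k + 1) (σ.nv limVar))
      ⟨by simp, by simp, (hA.setN_right hk _).setN_right (by omega) _, fun i hi hik => by
        simp [show i ≠ k + 1 by omega, show i ≠ k by omega]⟩
    have hLk : limVar ≠ k := by unfold limVar; omega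
    have hs₁ := Exec.nset τ k (.const 0)
    have hs₂ := Exec.nset (τ.setN k 0) (k + 1) (.var limVar)
    simp only [NExp.eval, NExp.cost, setN_nv, if_neg hLk, hL] at hs₁ hs₂
    refine ⟨_, _, .seq hs₁ (.seq hs₂ h₂), i₂.2.2.1, i₂.2.2.2, ?_⟩
    simp only [Polynomial.eval_add, Polynomial.eval_C, Polynomial.eval_mul, Polynomial.eval_X]
    have : Polynomial.eval (σ.nv limVar) p + 2 + 7 = Polynomial.eval (σ.nv limVar) p + 9 := rfl
    rw [this] at b₂; omega

end RAM

namespace RAM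

/-! ### Reasoning about programs -/

namespace Stmt

/-- The natural variables that are assigned. -/
def wn : Stmt → List ℕ
  | nset i _ => [i]
  | rset _ _ => []
  | nstore _ _ _ => []
  | rstore _ _ _ => []
  | seq p q => p.wn ++ q.wn
  | ite _ p q => p.wn ++ q.wn
  | loop x p => x :: p.wn

/-- The real variables that are assigned. -/
def wr : Stmt → List ℕ
  | nset _ _ => []
  | rset i _ => [i]
  | nstore _ _ _ => []
  | rstore _ _ _ => []
  | seq p q => p.wr ++ q.wr
  | ite _ p q => p.wr ++ q.wr
  | loop _ p => p.wr

/-- The natural arrays that are written to. -/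
def wna : Stmt → List ℕ
  | nset _ _ => []
  | rset _ _ => []
  | nstore a _ _ => [a]
  | rstore _ _ _ => []
  | seq p q => p.wna ++ q.wna
  | ite _ p q => p.wna ++ q.wna
  | loop _ p => p.wna

/-- The real arrays that are written to. -/
def wra : Stmt → List ℕ
  | nset _ _ => []
  | rset _ _ => []
  | nstore _ _ _ => []
  | rstore a _ _ => [a]
  | seq p q => p.wra ++ q.wra
  | ite _ p q => p.wra ++ q.wra
  | loop _ p => p.wra

end Stmt

/-- `τ` differs from `σ` only in what the program `s` writes to. -/
structure Off (s : Stmt) (σ τ : State) : Prop where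
  nv : ∀ i, i ∉ s.wn → τ.nv i = σ.nv i
  rv : ∀ i, i ∉ s.wr → τ.rv i = σ.rv i
  na : ∀ i, i ∉ s.wna → τ.na i = σ.na i
  ra : ∀ i, i ∉ s.wra → τ.ra i = σ.ra i

theorem Off.refl (s : Stmt) (σ : State) : Off s σ σ :=
  ⟨fun _ _ => rfl, fun _ _ => rfl, fun _ _ => rfl, fun _ _ => rfl⟩

theorem Off.trans {s : Stmt} {σ τ υ : State} (h : Off s σ τ) (h' : Off s τ υ) : Off s σ υ :=
  ⟨fun i hi => (h'.nv i hi).trans (h.nv i hi), fun i hi => (h'.rv i hi).trans (h.rv i hi),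
    fun i hi => (h'.na i hi).trans (h.na i hi), fun i hi => (h'.ra i hi).trans (h.ra i hi)⟩

theorem Off.mono {s s' : Stmt} {σ τ : State} (h : Off s σ τ) (hn : s.wn ⊆ s'.wn)
    (hr : s.wr ⊆ s'.wr) (hna : s.wna ⊆ s'.wna) (hra : s.wra ⊆ s'.wra) : Off s' σ τ :=
  ⟨fun i hi => h.nv i fun hh => hi (hn hh), fun i hi => h.rv i fun hh => hi (hr hh),
    fun i hi => h.na i fun hh => hi (hna hh), fun i hi => h.ra i fun hh => hi (hra hh)⟩

theorem iter_induction {f : ℕ → State → State} {I : ℕ → State → Prop} {n : ℕ} {σ : State}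
    (h0 : I 0 σ) (hs : ∀ v < n, ∀ τ, I v τ → I (v + 1) (f v τ)) : I n (iter f n σ) := by
  have : ∀ v ≤ n, I v (iter f v σ) := by
    intro v
    induction v with
    | zero => exact fun _ => h0
    | succ v ih => exact fun hv => hs v hv _ (ih (by omega))
  exact this n le_rfl

theorem Off.run : ∀ (s : Stmt) (σ : State), Off s σ (s.run σ)
  | .nset i t, σ => ⟨fun j hj => by
      simp only [Stmt.wn, List.mem_singleton] at hj
      simp [Stmt.run, hj], fun _ _ => rfl, fun _ _ => rfl, fun _ _ => rfl⟩
  | .rset i e, σ => ⟨fun _ _ => rfl, fun j hj => by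
      simp only [Stmt.wr, List.mem_singleton] at hj
      simp [Stmt.run, hj], fun _ _ => rfl, fun _ _ => rfl⟩
  | .nstore a k t, σ => ⟨fun _ _ => rfl, fun _ _ => rfl, fun j hj => by
      simp only [Stmt.wna, List.mem_singleton] at hj
      funext i
      simp [Stmt.run, hj], fun _ _ => rfl⟩
  | .rstore a k e, σ => ⟨fun _ _ => rfl, fun _ _ => rfl, fun _ _ => rfl, fun j hj => by
      simp only [Stmt.wra, List.mem_singleton] at hj
      funext i
      simp [Stmt.run, hj]⟩
  | .seq p q, σ =>
    ((Off.run p σ).mono (by simp [Stmt.wn]) (by simp [Stmt.wr]) (by simp [Stmt.wna])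
      (by simp [Stmt.wra])).trans ((Off.run q (p.run σ)).mono (by simp [Stmt.wn])
        (by simp [Stmt.wr]) (by simp [Stmt.wna]) (by simp [Stmt.wra]))
  | .ite c p q, σ => by
    simp only [Stmt.run]
    split_ifs
    · exact (Off.run q σ).mono (by simp [Stmt.wn]) (by simp [Stmt.wr]) (by simp [Stmt.wna])
        (by simp [Stmt.wra])
    · exact (Off.run p σ).mono (by simp [Stmt.wn]) (by simp [Stmt.wr]) (by simp [Stmt.wna])
        (by simp [Stmt.wra])
  | .loop x p, σ => by
    simp only [Stmt.run]
    refine iter_induction (I := fun _ τ => Off (.loop x p) σ τ) (Off.refl _ _) fun v _ τ h => ?_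
    refine h.trans (.trans ?_ ((Off.run p (τ.setN x v)).mono (by simp [Stmt.wn])
      (by simp [Stmt.wr]) (by simp [Stmt.wna]) (by simp [Stmt.wra])))
    refine ⟨fun j hj => ?_, fun _ _ => rfl, fun _ _ => rfl, fun _ _ => rfl⟩
    simp only [Stmt.wn, List.mem_cons, not_or] at hj
    simp [hj.1]

/-- The frame condition `Off` is supplied at every pass, so an invariant need only mention what the
loop changes. -/
theorem run_loop {x : ℕ} {p : Stmt} {σ : State} (I : ℕ → State → Prop) (h0 : I 0 σ)
    (hs : ∀ v < σ.nv limVar, ∀ τ, Off (.loop x p) σ τ → I v τ →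
      I (v + 1) (p.run (τ.setN x v))) :
    I (σ.nv limVar) ((Stmt.loop x p).run σ) := by
  have := iter_induction (f := fun v τ => p.run (τ.setN x v)) (n := σ.nv limVar) (σ := σ)
    (I := fun v τ => Off (.loop x p) σ τ ∧ I v τ) ⟨Off.refl _ _, h0⟩ fun v hv τ h => by
      refine ⟨h.1.trans (.trans ?_ ((Off.run p (τ.setN x v)).mono (by simp [Stmt.wn])
        (by simp [Stmt.wr]) (by simp [Stmt.wna]) (by simp [Stmt.wra]))), hs v hv τ h.1 h.2⟩
      refine ⟨fun j hj => ?_, fun _ _ => rfl, fun _ _ => rfl, fun _ _ => rfl⟩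
      simp only [Stmt.wn, List.mem_cons, not_or] at hj
      simp [hj.1]
  exact this.2

/-- A loop that fills the array `a`. -/
theorem run_tab {x a : ℕ} {t : Tm} {σ : State} (f : ℕ → ℕ)
    (h : ∀ v < σ.nv limVar, ∀ τ, Off (.loop x (.nstore a (.var x) t)) σ τ →
      (∀ i < v, τ.na a i = f i) → t.eval (τ.setN x v) = f v) :
    ∀ i < σ.nv limVar, ((Stmt.loop x (.nstore a (.var x) t)).run σ).na a i = f i := by
  refine run_loop (fun v τ => ∀ i < v, τ.na a i = f i) (by simp) fun v hv τ hτ hI i hi => ?_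
  simp only [Stmt.run, Tm.eval, storeN_na, setN_nv, true_and, if_true, setN_na]
  split_ifs with hiv
  · rw [h v hv τ hτ hI, hiv]
  · exact hI i (by omega)

namespace Tm

/-- The truth of a term. -/
def tt (t : Tm) (σ : State) : Prop := t.eval σ ≠ 0

def not (t : Tm) : Tm := .ite t (.const 0) (.const 1)
def and (s t : Tm) : Tm := .ite s t (.const 0)
def or (s t : Tm) : Tm := .ite s (.const 1) t
def ex (x : ℕ) (t : Tm) : Tm := .lt (.const 0) (.sum x t)
def all (x : ℕ) (t : Tm) : Tm := (ex x t.not).not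
def pair (s t : Tm) : Tm := .add (.scale s) t

@[simp] theorem tt_not (t : Tm) (σ : State) : t.not.tt σ ↔ ¬ t.tt σ := by
  simp only [tt, not, eval]; split_ifs <;> simp_all
@[simp] theorem tt_and (s t : Tm) (σ : State) : (s.and t).tt σ ↔ s.tt σ ∧ t.tt σ := by
  simp only [tt, and, eval]; split_ifs <;> simp_all
@[simp] theorem tt_or (s t : Tm) (σ : State) : (s.or t).tt σ ↔ s.tt σ ∨ t.tt σ := by
  simp only [tt, or, eval]; split_ifs <;> simp_all
@[simp] theorem tt_lt (s t : Tm) (σ : State) : (lt s t).tt σ ↔ s.eval σ < t.eval σ := by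
  simp [tt, eval]
@[simp] theorem tt_eq (s t : Tm) (σ : State) : (eq s t).tt σ ↔ s.eval σ = t.eval σ := by
  simp [tt, eval]
@[simp] theorem tt_rlt (e f : RExp) (σ : State) : (rlt e f).tt σ ↔ e.eval σ < f.eval σ := by
  simp [tt, eval]
@[simp] theorem tt_arr (a : ℕ) (t : Tm) (σ : State) :
    (arr a t).tt σ ↔ σ.na a (t.eval σ) ≠ 0 := Iff.rfl
@[simp] theorem tt_ex (x : ℕ) (t : Tm) (σ : State) :
    (ex x t).tt σ ↔ ∃ v < σ.nv limVar, t.tt (σ.setN x v) := by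
  simp [tt, ex, eval, Nat.pos_iff_ne_zero, Finset.sum_eq_zero_iff]
@[simp] theorem tt_all (x : ℕ) (t : Tm) (σ : State) :
    (all x t).tt σ ↔ ∀ v < σ.nv limVar, t.tt (σ.setN x v) := by
  simp [all]
theorem tt_ite (c s t : Tm) (σ : State) :
    (ite c s t).tt σ ↔ (c.tt σ → s.tt σ) ∧ (¬ c.tt σ → t.tt σ) := by
  simp only [tt, eval]; split_ifs <;> simp_all
@[simp] theorem eval_const (c : ℕ) (σ : State) : (const c).eval σ = c := rfl
@[simp] theorem eval_var (i : ℕ) (σ : State) : (var i).eval σ = σ.nv i := rfl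
@[simp] theorem eval_arr (a : ℕ) (t : Tm) (σ : State) :
    (arr a t).eval σ = σ.na a (t.eval σ) := rfl
@[simp] theorem eval_add (s t : Tm) (σ : State) : (add s t).eval σ = s.eval σ + t.eval σ := rfl
@[simp] theorem eval_sub (s t : Tm) (σ : State) : (sub s t).eval σ = s.eval σ - t.eval σ := rfl
@[simp] theorem eval_sum (x : ℕ) (t : Tm) (σ : State) :
    (sum x t).eval σ = ∑ v ∈ Finset.range (σ.nv limVar), t.eval (σ.setN x v) := rfl
@[simp] theorem eval_pair (s t : Tm) (σ : State) :
    (pair s t).eval σ = s.eval σ * σ.nv limVar + t.eval σ := rfl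
open Classical in
theorem eval_ite (c s t : Tm) (σ : State) :
    (ite c s t).eval σ = if c.tt σ then s.eval σ else t.eval σ := by
  by_cases h : c.eval σ = 0 <;> simp [tt, eval, h]
open Classical in
/-- Conditions evaluate to `0` or `1`. -/
theorem eval_cond (c : Tm) (σ : State) :
    (ite c (const 1) (const 0)).eval σ = if c.tt σ then 1 else 0 := eval_ite _ _ _ _

end Tm

open Classical in
theorem Stmt.run_ite (c : Tm) (p q : Stmt) (σ : State) :
    (Stmt.ite c p q).run σ = if c.tt σ then p.run σ else q.run σ := by
  by_cases h : c.eval σ = 0 <;> simp [Tm.tt, Stmt.run, h]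

attribute [simp] NExp.eval RExp.eval

theorem pair_lt {L a b : ℕ} (ha : a < L) (hb : b < L) : a * L + b < L * L := by
  nlinarith

theorem pair_inj {L a b a' b' : ℕ} (hb : b < L) (hb' : b' < L) :
    a * L + b = a' * L + b' ↔ a = a' ∧ b = b' := by
  constructor
  · intro h
    have h1 : (a * L + b) / L = a := by
      rw [Nat.add_comm, Nat.add_mul_div_right _ _ (by omega), Nat.div_eq_of_lt hb, zero_add]
    have h2 : (a' * L + b') / L = a' := by
      rw [Nat.add_comm, Nat.add_mul_div_right _ _ (by omega), Nat.div_eq_of_lt hb', zero_add]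
    have : a = a' := by rw [← h1, ← h2, h]
    subst this
    exact ⟨rfl, by omega⟩
  · rintro ⟨rfl, rfl⟩; rfl

end RAM

/-! ### Gathering in rooted trees with natural edge lengths -/

/-- A rooted tree on the nodes below `S`, given by the parents `par`, with the length `w k` of the
edge from `k` to its parent; `rk` and `dep` are the unweighted and the weighted depth. -/
structure ParentTree where
  S : ℕ
  root : ℕ
  par : ℕ → ℕ
  w : ℕ → ℕ
  rk : ℕ → ℕ
  dep : ℕ → ℕ
  root_lt : root < S
  par_root : S ≤ par root
  par_lt : ∀ k < S, k ≠ root → par k < S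
  rk_par : ∀ k < S, k ≠ root → rk k = rk (par k) + 1
  dep_par : ∀ k < S, k ≠ root → dep k = dep (par k) + w k

namespace ParentTree

variable (F : ParentTree)

/-- `F.Up k x`: the node `x` is an ancestor of `k`. -/
def Up (k x : ℕ) : Prop :=
  Relation.ReflTransGen (fun a b => a < F.S ∧ a ≠ F.root ∧ F.par a = b) k x

variable {F}

theorem Up.refl (k : ℕ) : F.Up k k := Relation.ReflTransGen.refl

theorem Up.trans {a b c : ℕ} (h : F.Up a b) (h' : F.Up b c) : F.Up a c :=
  Relation.ReflTransGen.trans h h'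

theorem up_par {k : ℕ} (hk : k < F.S) (hr : k ≠ F.root) : F.Up k (F.par k) :=
  Relation.ReflTransGen.single ⟨hk, hr, rfl⟩

theorem Up.rk_le {k x : ℕ} (h : F.Up k x) : F.rk x ≤ F.rk k := by
  induction h with
  | refl => exact le_rfl
  | tail _ h ih => have := F.rk_par _ h.1 h.2.1; rw [h.2.2] at this; omega

theorem Up.dep_le {k x : ℕ} (h : F.Up k x) : F.dep x ≤ F.dep k := by
  induction h with
  | refl => exact le_rfl
  | tail _ h ih => have := F.dep_par _ h.1 h.2.1; rw [h.2.2] at this; omega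

theorem Up.eq_or {k x : ℕ} (h : F.Up k x) : x = k ∨ (k < F.S ∧ k ≠ F.root ∧ F.Up (F.par k) x) := by
  rcases Relation.ReflTransGen.cases_head h with h | ⟨y, h, h'⟩
  · exact Or.inl h.symm
  · exact Or.inr ⟨h.1, h.2.1, h.2.2 ▸ h'⟩

theorem Up.eq_of_rk {k x : ℕ} (h : F.Up k x) (hr : F.rk x = F.rk k) : x = k := by
  rcases h.eq_or with h | ⟨h1, h2, h3⟩
  · exact h
  · have := h3.rk_le; have := F.rk_par k h1 h2; omega

/-- Parents are unique, so the ancestors of a node form a chain. -/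
theorem Up.total {k x y : ℕ} (h : F.Up k x) (h' : F.Up k y) : F.Up x y ∨ F.Up y x :=
  Relation.ReflTransGen.total_of_right_unique
    (fun _ _ _ h h' => h.2.2.symm.trans h'.2.2) h h'

theorem up_root {k : ℕ} (hk : k < F.S) : F.Up k F.root := by
  induction h : F.rk k using Nat.strong_induction_on generalizing k with
  | _ r ih =>
    by_cases hr : k = F.root
    · rw [hr]; exact .refl _
    · have := F.rk_par k hk hr
      exact (up_par hk hr).trans (ih (F.rk (F.par k)) (by omega) (F.par_lt k hk hr) rfl)

variable (F)

/-- Two nodes are at distance at most `R`, measured through some common ancestor. -/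
def Near (R a b : ℕ) : Prop :=
  ∃ x, F.Up a x ∧ F.Up b x ∧ (F.dep a - F.dep x) + (F.dep b - F.dep x) ≤ R

/-- The users in `U`, placed by `nd`, can be assigned to nodes at distance at most `R` so that
the number of users of each node `k` satisfies `al k`. -/
def Solvable (R : ℕ) (nd : ℕ → ℕ) (U : Finset ℕ) (al : ℕ → ℕ → Prop) : Prop :=
  ∃ g : ℕ → ℕ, (∀ u ∈ U, g u < F.S ∧ F.Near R (nd u) (g u)) ∧
    ∀ k < F.S, al k (U.filter fun u => g u = k).card

open Classical in
/-- The node `k` together with the subtrees at those of its children that are below `c`. -/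
noncomputable def sub (k c : ℕ) : Finset ℕ :=
  (Finset.range F.S).filter fun x => x = k ∨ ∃ c' < c, F.par c' = k ∧ F.Up x c'

variable {F}

theorem mem_sub {k c x : ℕ} :
    x ∈ F.sub k c ↔ x < F.S ∧ (x = k ∨ ∃ c' < c, F.par c' = k ∧ F.Up x c') := by
  simp [sub]

theorem ne_root_of_par {k c : ℕ} (hk : k < F.S) (h : F.par c = k) : c ≠ F.root := by
  rintro rfl
  have := F.par_root
  omega

theorem sub_zero {k : ℕ} (hk : k < F.S) : F.sub k 0 = {k} := by
  ext x; simp only [mem_sub, Finset.mem_singleton]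
  constructor
  · rintro ⟨-, h | ⟨c', h, -⟩⟩
    · exact h
    · omega
  · rintro rfl; exact ⟨hk, Or.inl rfl⟩

theorem sub_full {k x : ℕ} (hk : k < F.S) : x ∈ F.sub k F.S ↔ x < F.S ∧ F.Up x k := by
  rw [mem_sub]
  refine and_congr_right fun hx => ⟨?_, fun h => ?_⟩
  · rintro (rfl | ⟨c, hc, rfl, h⟩)
    · exact .refl _
    · exact h.trans (up_par hc (ne_root_of_par hk rfl))
  · rcases Relation.ReflTransGen.cases_tail h with h | ⟨c, h, hc⟩
    · exact Or.inl h.symm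
    · exact Or.inr ⟨c, hc.1, hc.2.2, h⟩

theorem up_of_mem_sub {k c x : ℕ} (hk : k < F.S) (hc : c ≤ F.S) (h : x ∈ F.sub k c) :
    F.Up x k := by
  refine ((sub_full hk).1 ?_).2
  rw [mem_sub] at h ⊢
  exact ⟨h.1, h.2.imp_right fun ⟨c', h1, h2⟩ => ⟨c', by omega, h2⟩⟩

theorem sub_skip {k c : ℕ} (h : F.par c ≠ k) : F.sub k (c + 1) = F.sub k c := by
  ext x; simp only [mem_sub]
  refine and_congr_right fun _ => or_congr_right ⟨?_, ?_⟩
  · rintro ⟨c', h1, h2, h3⟩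
    refine ⟨c', ?_, h2, h3⟩
    have : c' ≠ c := by rintro rfl; exact h h2
    omega
  · rintro ⟨c', h1, h2⟩; exact ⟨c', by omega, h2⟩

theorem sub_succ {k c : ℕ} (hc : c < F.S) (h : F.par c = k) :
    F.sub k (c + 1) = F.sub k c ∪ F.sub c F.S := by
  ext x; rw [Finset.mem_union, sub_full hc]; simp only [mem_sub]
  constructor
  · rintro ⟨h0, h1 | ⟨c', h1, h2, h3⟩⟩
    · exact Or.inl ⟨h0, Or.inl h1⟩
    · by_cases hcc : c' = c
      · subst hcc; exact Or.inr ⟨h0, h3⟩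
      · exact Or.inl ⟨h0, Or.inr ⟨c', by omega, h2, h3⟩⟩
  · rintro (⟨h0, h1 | ⟨c', h1, h2⟩⟩ | ⟨h0, h1⟩)
    · exact ⟨h0, Or.inl h1⟩
    · exact ⟨h0, Or.inr ⟨c', by omega, h2⟩⟩
    · exact ⟨h0, Or.inr ⟨c, by omega, h, h1⟩⟩

/-- Children of the same node have equal rank. Two of them with a common descendant are comparable,
hence equal. -/
theorem sub_disjoint {k c : ℕ} (hk : k < F.S) (hc : c < F.S) (h : F.par c = k) :
    Disjoint (F.sub k c) (F.sub c F.S) := by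
  rw [Finset.disjoint_left]
  intro x hx hx'
  rw [sub_full hc] at hx'
  rw [mem_sub] at hx
  have hcr := F.rk_par c hc (ne_root_of_par hk h)
  rw [h] at hcr
  rcases hx.2 with rfl | ⟨c', h1, h2, h3⟩
  · have := hx'.2.rk_le; omega
  · have hcr' := F.rk_par c' (by omega) (ne_root_of_par hk h2)
    rw [h2] at hcr'
    rcases h3.total hx'.2 with h4 | h4
    · have := h4.eq_of_rk (by omega); omega
    · have := h4.eq_of_rk (by omega); omega

/-! ### Soundness of the derivation rules -/

section sem

variable (F)
variable (R : ℕ) (nd : ℕ → ℕ) (U : Finset ℕ) (al : ℕ → ℕ → Prop)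

/-- The users at the nodes of `X` can be assigned in such a way to the nodes of `X`, that exactly
`b i` users at distance `i` from `k` remain, and that `a i` more users are needed
by nodes at distance `i` from `k`. -/
def Sem (k : ℕ) (X : Finset ℕ) (b a : ℕ → ℕ) : Prop :=
  ∃ (P : Finset ℕ) (g y : ℕ → ℕ), P ⊆ U ∧
    (∀ u ∈ P, nd u ∈ X ∧ F.dep (nd u) - F.dep k ≤ R) ∧
    (∀ u ∈ U, nd u ∈ X → u ∉ P → g u ∈ X ∧ F.Near R (nd u) (g u)) ∧
    (∀ f ∈ X, al f (y f + (U.filter fun u => nd u ∈ X ∧ u ∉ P ∧ g u = f).card)) ∧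
    (∀ f ∈ X, y f ≠ 0 → F.dep f - F.dep k ≤ R) ∧
    (∀ i ≤ R, b i = (P.filter fun u => F.dep (nd u) - F.dep k = i).card) ∧
    (∀ i ≤ R, a i = ∑ f ∈ X with F.dep f - F.dep k = i, y f)

variable {F R nd U al}

/-- Nobody is assigned yet: all users at `k` stay open, and the whole permitted number `a 0` is
demanded. -/
theorem Sem.init {k : ℕ} {b a : ℕ → ℕ} (hb : b 0 = (U.filter fun u => nd u = k).card)
    (ha : al k (a 0)) (h : ∀ i ≤ R, i ≠ 0 → b i = 0 ∧ a i = 0) : F.Sem R nd U al k {k} b a := by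
  refine ⟨U.filter fun u => nd u = k, fun _ => 0, fun _ => a 0, Finset.filter_subset _ _, ?_, ?_,
    ?_, ?_, ?_, ?_⟩
  · intro u hu
    simp only [Finset.mem_filter] at hu
    simp [hu.2]
  · intro u hu h1 h2
    simp only [Finset.mem_singleton] at h1
    exact absurd (Finset.mem_filter.2 ⟨hu, h1⟩) h2
  · intro f hf
    obtain rfl := Finset.mem_singleton.1 hf
    convert ha
    simp only [Nat.add_eq_left, Finset.card_eq_zero, Finset.filter_eq_empty_iff]
    rintro u hu ⟨h1, h2, -⟩
    exact h2 (Finset.mem_filter.2 ⟨hu, Finset.mem_singleton.1 h1⟩)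
  · intro f hf _
    obtain rfl := Finset.mem_singleton.1 hf
    simp
  · intro i hi
    rw [Finset.filter_filter]
    by_cases h0 : i = 0
    · subst h0
      rw [hb]
      congr 1
      ext u; simp only [Finset.mem_filter]
      constructor
      · rintro ⟨h1, h2⟩; exact ⟨h1, h2, by simp [h2]⟩
      · rintro ⟨h1, h2, -⟩; exact ⟨h1, h2⟩
    · rw [(h i hi h0).1, eq_comm, Finset.card_eq_zero, Finset.filter_eq_empty_iff]
      rintro u hu ⟨h1, h2⟩
      rw [h1] at h2; omega
  · intro i hi
    by_cases h0 : i = 0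
    · subst h0; simp [Finset.filter_singleton]
    · rw [(h i hi h0).2]
      simp [Finset.filter_singleton, Ne.symm h0]

/-- The same partial assignment serves; only the distances, now measured from the parent, grow by
`F.w c`. By `hb` and `ha` no open user or demand is pushed beyond `R`. -/
theorem Sem.lift {k c : ℕ} {X : Finset ℕ} {b a b' a' : ℕ → ℕ} (h : F.Sem R nd U al c X b a)
    (hX : ∀ x ∈ X, F.dep c ≤ F.dep x) (hk : F.dep c = F.dep k + F.w c)
    (hb : ∀ i ≤ R, b i ≠ 0 → i + F.w c ≤ R) (ha : ∀ i ≤ R, a i ≠ 0 → i + F.w c ≤ R)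
    (hb' : ∀ i ≤ R, b' i = if F.w c ≤ i then b (i - F.w c) else 0)
    (ha' : ∀ i ≤ R, a' i = if F.w c ≤ i then a (i - F.w c) else 0) :
    F.Sem R nd U al k X b' a' := by
  obtain ⟨P, g, y, h1, h2, h3, h4, h5, h6, h7⟩ := h
  refine ⟨P, g, y, h1, fun u hu => ⟨(h2 u hu).1, ?_⟩, h3, h4, fun f hf hy => ?_, fun i hi => ?_,
    fun i hi => ?_⟩
  · have := hX _ (h2 u hu).1
    have h8 := hb _ (h2 u hu).2 (by
      rw [h6 _ (h2 u hu).2]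
      exact Finset.card_ne_zero.2 ⟨u, Finset.mem_filter.2 ⟨hu, rfl⟩⟩)
    omega
  · have := hX _ hf
    have h8 := ha _ (h5 f hf hy) (by
      rw [h7 _ (h5 f hf hy)]
      intro h0
      rw [Finset.sum_eq_zero_iff] at h0
      exact hy (h0 f (Finset.mem_filter.2 ⟨hf, rfl⟩)))
    omega
  · rw [hb' i hi]
    split_ifs with hw
    · rw [h6 _ (by omega)]
      congr 1
      refine Finset.filter_congr fun u hu => ?_
      have := hX _ (h2 u hu).1
      omega
    · rw [eq_comm, Finset.card_eq_zero, Finset.filter_eq_empty_iff]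
      intro u hu
      have := hX _ (h2 u hu).1
      omega
  · rw [ha' i hi]
    split_ifs with hw
    · rw [h7 _ (by omega)]
      congr 1
      refine Finset.filter_congr fun u hu => ?_
      have := hX _ hu
      omega
    · rw [eq_comm]
      refine Finset.sum_eq_zero fun u hu => ?_
      rw [Finset.mem_filter] at hu
      have := hX _ hu.1
      omega

/-- Users assigned so far stay within their own part, so over disjoint parts the two partial
assignments can be glued. -/
theorem Sem.union {k : ℕ} {X X' : Finset ℕ} {b a b' a' b'' a'' : ℕ → ℕ}
    (h : F.Sem R nd U al k X b a) (h' : F.Sem R nd U al k X' b' a') (hX : Disjoint X X')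
    (hb : ∀ i ≤ R, b'' i = b i + b' i) (ha : ∀ i ≤ R, a'' i = a i + a' i) :
    F.Sem R nd U al k (X ∪ X') b'' a'' := by
  classical
  obtain ⟨P, g, y, h1, h2, h3, h4, h5, h6, h7⟩ := h
  obtain ⟨P', g', y', h1', h2', h3', h4', h5', h6', h7'⟩ := h'
  have hd : ∀ {x}, x ∈ X → x ∉ X' := fun hx hx' => Finset.disjoint_left.1 hX hx hx'
  have hPP : Disjoint P P' := Finset.disjoint_left.2 fun u hu hu' =>
    hd (h2 u hu).1 (h2' u hu').1
  refine ⟨P ∪ P', fun u => if nd u ∈ X then g u else g' u, fun f => if f ∈ X then y f else y' f,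
    Finset.union_subset h1 h1', ?_, ?_, ?_, ?_, ?_, ?_⟩
  · intro u hu
    rcases Finset.mem_union.1 hu with hu | hu
    · exact ⟨Finset.mem_union_left _ (h2 u hu).1, (h2 u hu).2⟩
    · exact ⟨Finset.mem_union_right _ (h2' u hu).1, (h2' u hu).2⟩
  · intro u hu hux huP
    rw [Finset.mem_union, not_or] at huP
    by_cases hx : nd u ∈ X
    · simp only [hx, if_true]
      exact ⟨Finset.mem_union_left _ (h3 u hu hx huP.1).1, (h3 u hu hx huP.1).2⟩
    · have hx' : nd u ∈ X' := (Finset.mem_union.1 hux).resolve_left hx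
      simp only [hx, if_false]
      exact ⟨Finset.mem_union_right _ (h3' u hu hx' huP.2).1, (h3' u hu hx' huP.2).2⟩
  · intro f hf
    by_cases hx : f ∈ X
    · simp only [hx, if_true]
      convert h4 f hx using 4 with u hu
      constructor
      · rintro ⟨h8, h9, h10⟩
        rw [Finset.mem_union, not_or] at h9
        by_cases hux : nd u ∈ X
        · rw [if_pos hux] at h10; exact ⟨hux, h9.1, h10⟩
        · rw [if_neg hux] at h10
          have := (h3' u hu ((Finset.mem_union.1 h8).resolve_left hux) h9.2).1
          rw [h10] at this
          exact absurd this (hd hx)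
      · rintro ⟨h8, h9, h10⟩
        rw [if_pos h8]
        refine ⟨Finset.mem_union_left _ h8, ?_, h10⟩
        rw [Finset.mem_union, not_or]
        exact ⟨h9, fun hu' => hd h8 (h2' u hu').1⟩
    · have hx' : f ∈ X' := (Finset.mem_union.1 hf).resolve_left hx
      simp only [hx, if_false]
      convert h4' f hx' using 4 with u hu
      constructor
      · rintro ⟨h8, h9, h10⟩
        rw [Finset.mem_union, not_or] at h9
        by_cases hux : nd u ∈ X
        · rw [if_pos hux] at h10
          have := (h3 u hu hux h9.1).1
          rw [h10] at this
          exact absurd this hx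
        · rw [if_neg hux] at h10
          exact ⟨(Finset.mem_union.1 h8).resolve_left hux, h9.2, h10⟩
      · rintro ⟨h8, h9, h10⟩
        rw [if_neg fun h => hd h h8]
        refine ⟨Finset.mem_union_right _ h8, ?_, h10⟩
        rw [Finset.mem_union, not_or]
        exact ⟨fun hu' => hd (h2 u hu').1 h8, h9⟩
  · intro f hf hy
    by_cases hx : f ∈ X
    · exact h5 f hx (by simpa [hx] using hy)
    · exact h5' f ((Finset.mem_union.1 hf).resolve_left hx) (by simpa [hx] using hy)
  · intro i hi
    rw [hb i hi, h6 i hi, h6' i hi, Finset.filter_union, Finset.card_union_of_disjoint]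
    exact Finset.disjoint_filter_filter hPP
  · intro i hi
    rw [ha i hi, h7 i hi, h7' i hi, Finset.filter_union, Finset.sum_union
      (Finset.disjoint_filter_filter hX)]
    congr 1
    · refine Finset.sum_congr rfl fun f hf => ?_
      rw [if_pos (Finset.mem_filter.1 hf).1]
    · refine Finset.sum_congr rfl fun f hf => ?_
      rw [if_neg fun h => hd h (Finset.mem_filter.1 hf).1]

/-- Any open user at distance `i` may serve any demand at distance `j`, because both lie below `k`
and `i + j ≤ R`. At the chosen node the demand drops by one and the number of assigned users rises
by one, so the total remains permitted. -/
theorem Sem.cancel {k i j : ℕ} {X : Finset ℕ} {b a b' a' : ℕ → ℕ}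
    (h : F.Sem R nd U al k X b' a') (hX : ∀ x ∈ X, F.Up x k) (hij : i + j ≤ R)
    (hb : ∀ t ≤ R, b' t = b t + if t = i then 1 else 0)
    (ha : ∀ t ≤ R, a' t = a t + if t = j then 1 else 0) : F.Sem R nd U al k X b a := by
  classical
  obtain ⟨P, g, y, h1, h2, h3, h4, h5, h6, h7⟩ := h
  obtain ⟨v, hv⟩ : (P.filter fun u => F.dep (nd u) - F.dep k = i).Nonempty := by
    rw [← Finset.card_ne_zero, ← h6 i (by omega), hb i (by omega)]; simp
  obtain ⟨p, hp, hyp⟩ : ∃ p ∈ X.filter (fun f => F.dep f - F.dep k = j), y p ≠ 0 := by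
    by_contra hcon
    push Not at hcon
    have := h7 j (by omega)
    rw [Finset.sum_eq_zero hcon, ha j (by omega)] at this
    simp at this
  rw [Finset.mem_filter] at hv hp
  have hvX := (h2 v hv.1).1
  have hnear : F.Near R (nd v) p :=
    ⟨k, hX _ hvX, hX _ hp.1, by omega⟩
  refine ⟨P.erase v, Function.update g v p, Function.update y p (y p - 1),
    (Finset.erase_subset _ _).trans h1, fun u hu => h2 u (Finset.mem_of_mem_erase hu), ?_, ?_, ?_,
    ?_, ?_⟩
  · intro u hu hux huP
    by_cases huv : u = v
    · subst huv; simp only [Function.update_self]; exact ⟨hp.1, hnear⟩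
    · rw [Function.update_of_ne huv]
      exact h3 u hu hux fun h => huP (Finset.mem_erase.2 ⟨huv, h⟩)
  · intro f hf
    have key : (U.filter fun u => nd u ∈ X ∧ u ∉ P.erase v ∧ Function.update g v p u = f) =
        if f = p then insert v (U.filter fun u => nd u ∈ X ∧ u ∉ P ∧ g u = f)
        else U.filter fun u => nd u ∈ X ∧ u ∉ P ∧ g u = f := by
      ext u
      by_cases huv : u = v
      · subst huv
        by_cases hfp : f = p
        · simp [hfp, hvX, h1 hv.1]
        · simp [hfp, hv.1, Ne.symm hfp]
      · by_cases hfp : f = p <;> simp [hfp, huv]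
    rw [key]
    by_cases hfp : f = p
    · subst hfp
      rw [if_pos rfl, Function.update_self, Finset.card_insert_of_notMem]
      · convert h4 f hf using 1; omega
      · simp [hv.1]
    · rw [if_neg hfp, Function.update_of_ne hfp]; exact h4 f hf
  · intro f hf hy
    by_cases hfp : f = p
    · subst hfp; exact h5 f hf hyp
    · rw [Function.update_of_ne hfp] at hy; exact h5 f hf hy
  · intro t ht
    rw [Finset.filter_erase]
    by_cases hti : t = i
    · subst hti
      rw [Finset.card_erase_of_mem (Finset.mem_filter.2 hv), ← h6 t ht, hb t ht]; simp
    · rw [Finset.erase_eq_of_notMem, ← h6 t ht, hb t ht, if_neg hti, add_zero]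
      rw [Finset.mem_filter]
      rintro ⟨-, h⟩
      exact hti (by omega)
  · intro t ht
    have h8 := h7 t ht
    rw [ha t ht] at h8
    by_cases htj : t = j
    · subst htj
      rw [if_pos rfl, ← Finset.add_sum_erase _ _ (Finset.mem_filter.2 hp)] at h8
      rw [← Finset.add_sum_erase _ _ (Finset.mem_filter.2 hp), Function.update_self,
        Finset.sum_congr rfl fun f hf => Function.update_of_ne (Finset.ne_of_mem_erase hf) _ _]
      omega
    · rw [if_neg htj, add_zero] at h8
      rw [h8]
      refine Finset.sum_congr rfl fun f hf => ?_
      rw [Function.update_of_ne]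
      rintro rfl
      exact htj (by rw [← hp.2, (Finset.mem_filter.1 hf).2])

/-- Zero vectors at the root mean that `P` is empty and `y` vanishes, so the partial assignment is a
full one. -/
theorem Sem.solvable {b a : ℕ → ℕ} (h : F.Sem R nd U al F.root (F.sub F.root F.S) b a)
    (hb : ∀ i ≤ R, b i = 0) (ha : ∀ i ≤ R, a i = 0) (hnd : ∀ u ∈ U, nd u < F.S) :
    F.Solvable R nd U al := by
  obtain ⟨P, g, y, h1, h2, h3, h4, h5, h6, h7⟩ := h
  have hX : ∀ x, x ∈ F.sub F.root F.S ↔ x < F.S := fun x => by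
    rw [sub_full F.root_lt]; exact and_iff_left_of_imp fun hx => up_root hx
  have hP : P = ∅ := by
    by_contra hP
    obtain ⟨u, hu⟩ := Finset.nonempty_iff_ne_empty.2 hP
    have := h6 _ (h2 u hu).2
    rw [hb _ (h2 u hu).2, eq_comm, Finset.card_eq_zero, Finset.filter_eq_empty_iff] at this
    exact this hu rfl
  have hy : ∀ f < F.S, y f = 0 := by
    intro f hf
    by_contra hy
    have h8 := h5 f ((hX f).2 hf) hy
    have h9 := h7 _ h8
    rw [ha _ h8, eq_comm, Finset.sum_eq_zero_iff] at h9
    exact hy (h9 f (Finset.mem_filter.2 ⟨(hX f).2 hf, rfl⟩))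
  subst hP
  refine ⟨g, fun u hu => ?_, fun k hk => ?_⟩
  · have := h3 u hu ((hX _).2 (hnd u hu)) (by simp)
    exact ⟨(hX _).1 this.1, this.2⟩
  · have := h4 k ((hX k).2 hk)
    rw [hy k hk, zero_add] at this
    convert this using 2
    refine Finset.filter_congr fun u hu => ?_
    simp [hX, hnd u hu]

end sem

end ParentTree

/-! ### Completeness of the derivation rules -/

namespace ParentTree

variable {F : ParentTree}

/-- The number of elements `u` of `U` for which `p u` belongs to `X`, at distance `i` from `k`. -/
noncomputable def cnt (F : ParentTree) (U : Finset ℕ) (p : ℕ → ℕ) (X : Finset ℕ) (k : ℕ)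
    (i : ℕ) : ℕ :=
  (U.filter fun u => p u ∈ X ∧ F.dep (p u) - F.dep k = i).card

theorem cnt_le (U : Finset ℕ) (p : ℕ → ℕ) (X : Finset ℕ) (k i : ℕ) :
    F.cnt U p X k i ≤ U.card := Finset.card_filter_le _ _

/-- Distances from `k` to nodes below the child `c` exceed those from `c` by `F.w c`. The sets `U`
and `U'` need to agree only on what lies below `c`, since the sets of open users are described
differently at `c` and at `k`. -/
theorem cnt_merge {U U' : Finset ℕ} {p : ℕ → ℕ} {X : Finset ℕ} {k c : ℕ} (hk : k < F.S)
    (hc : c < F.S) (h : F.par c = k)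
    (hU : ∀ u, p u ∈ F.sub c F.S → (u ∈ U ↔ u ∈ U')) (hX : X = F.sub k c) (i : ℕ) :
    F.cnt U p (F.sub k (c + 1)) k i = F.cnt U p X k i +
      if F.w c ≤ i then F.cnt U' p (F.sub c F.S) c (i - F.w c) else 0 := by
  classical
  have hd := F.dep_par c hc (ne_root_of_par hk h)
  rw [h] at hd
  have hdisj := sub_disjoint hk hc h
  subst hX
  have : (U.filter fun u => p u ∈ F.sub k (c + 1) ∧ F.dep (p u) - F.dep k = i) =
      (U.filter fun u => p u ∈ F.sub k c ∧ F.dep (p u) - F.dep k = i) ∪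
      (U.filter fun u => p u ∈ F.sub c F.S ∧ F.dep (p u) - F.dep k = i) := by
    rw [sub_succ hc h, ← Finset.filter_or]
    refine Finset.filter_congr fun u _ => ?_
    rw [Finset.mem_union]; tauto
  unfold cnt
  rw [this, Finset.card_union_of_disjoint]
  · congr 1
    split_ifs with hw
    · congr 1
      ext u
      simp only [Finset.mem_filter]
      constructor
      · rintro ⟨h1, h2, h3⟩
        have := ((sub_full hc).1 h2).2.dep_le
        exact ⟨(hU u h2).1 h1, h2, by omega⟩
      · rintro ⟨h1, h2, h3⟩
        have := ((sub_full hc).1 h2).2.dep_le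
        exact ⟨(hU u h2).2 h1, h2, by omega⟩
    · rw [Finset.card_eq_zero, Finset.filter_eq_empty_iff]
      rintro u hu ⟨h2, h3⟩
      have := ((sub_full hc).1 h2).2.dep_le
      omega
  · rw [Finset.disjoint_left]
    intro u hu hu'
    rw [Finset.mem_filter] at hu hu'
    exact Finset.disjoint_left.1 hdisj hu.2.1 hu'.2.1

theorem cnt_erase {U : Finset ℕ} {p : ℕ → ℕ} {X : Finset ℕ} {k u : ℕ} (hu : u ∈ U)
    (hX : p u ∈ X) (t : ℕ) :
    F.cnt U p X k t =
      F.cnt (U.erase u) p X k t + if t = F.dep (p u) - F.dep k then 1 else 0 := by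
  unfold cnt
  rw [Finset.filter_erase]
  split_ifs with ht
  · rw [Finset.card_erase_add_one]
    exact Finset.mem_filter.2 ⟨hu, hX, ht.symm⟩
  · rw [Finset.erase_eq_of_notMem, add_zero]
    rw [Finset.mem_filter]
    rintro ⟨-, -, h⟩
    exact ht h.symm

/-- A relation that contains the vectors of the open demands at the single nodes and is closed
under merging subtrees and matching users with demands contains the zero vector of the whole
tree, if the instance is solvable. -/
theorem Solvable.complete {R n : ℕ} {nd : ℕ → ℕ} {U : Finset ℕ} {al : ℕ → ℕ → Prop}
    (hs : F.Solvable R nd U al) (hn : U.card ≤ n)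
    {P : ℕ → ℕ → (ℕ → ℕ) → (ℕ → ℕ) → Prop}
    (hinit : ∀ k < F.S, ∀ b a : ℕ → ℕ, (∀ i, b i ≤ n) → (∀ i, a i ≤ n) →
      b 0 = (U.filter fun u => nd u = k).card → al k (a 0) →
      (∀ i ≤ R, i ≠ 0 → b i = 0 ∧ a i = 0) → P k 0 b a)
    (hskip : ∀ k < F.S, ∀ c < F.S, ∀ b a : ℕ → ℕ, (∀ i, b i ≤ n) → (∀ i, a i ≤ n) →
      F.par c ≠ k → P k c b a → P k (c + 1) b a)
    (hmerge : ∀ k < F.S, ∀ c < F.S, ∀ b a b₁ a₁ b₂ a₂ : ℕ → ℕ, (∀ i, b i ≤ n) →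
      (∀ i, a i ≤ n) → (∀ i, b₁ i ≤ n) → (∀ i, a₁ i ≤ n) → (∀ i, b₂ i ≤ n) → (∀ i, a₂ i ≤ n) →
      F.par c = k → P k c b₁ a₁ → P c F.S b₂ a₂ →
      (∀ i ≤ R, b₂ i ≠ 0 → i + F.w c ≤ R) → (∀ i ≤ R, a₂ i ≠ 0 → i + F.w c ≤ R) →
      (∀ i ≤ R, b i = b₁ i + if F.w c ≤ i then b₂ (i - F.w c) else 0) →
      (∀ i ≤ R, a i = a₁ i + if F.w c ≤ i then a₂ (i - F.w c) else 0) → P k (c + 1) b a)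
    (hcancel : ∀ k < F.S, ∀ b a b₁ a₁ : ℕ → ℕ, ∀ i j, (∀ i, b i ≤ n) → (∀ i, a i ≤ n) →
      (∀ i, b₁ i ≤ n) → (∀ i, a₁ i ≤ n) → P k F.S b₁ a₁ → i + j ≤ R →
      (∀ t ≤ R, b₁ t = b t + if t = i then 1 else 0) →
      (∀ t ≤ R, a₁ t = a t + if t = j then 1 else 0) → P k F.S b a) :
    P F.root F.S (fun _ => 0) (fun _ => 0) := by
  classical
  obtain ⟨g, hg, hal⟩ := hs
  -- The node `mt u` is where the user `u` and its demand will be cancelled.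
  choose! mt hmt using fun u (hu : u ∈ U) => (hg u hu).2
  have hbd : ∀ (V : Finset ℕ) (p : ℕ → ℕ) (X : Finset ℕ) (k : ℕ), V ⊆ U → ∀ i,
      F.cnt V p X k i ≤ n :=
    fun V p X k hV i => (cnt_le _ _ _ _ _).trans ((Finset.card_le_card hV).trans hn)
  obtain ⟨B, hB⟩ : ∃ B, ∀ k < F.S, F.rk k ≤ B :=
    ⟨(Finset.range F.S).sup F.rk, fun k hk => Finset.le_sup (Finset.mem_range.2 hk)⟩
  -- At a finished node exactly those users and demands of its subtree are open whose meeting node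
  -- lies strictly above it. The induction is on `B - F.rk k`, so children come before parents.
  have key : ∀ k < F.S, P k F.S
      (F.cnt (U.filter fun u => F.Up k (mt u) ∧ mt u ≠ k) nd (F.sub k F.S) k)
      (F.cnt (U.filter fun u => F.Up k (mt u) ∧ mt u ≠ k) g (F.sub k F.S) k) := by
    intro k hk
    induction h : B - F.rk k using Nat.strong_induction_on generalizing k with
    | _ d ih =>
    -- Before the cancellations at `k`, those meeting at `k` itself are open as well.
    have hch : ∀ c ≤ F.S, P k c (F.cnt (U.filter fun u => F.Up k (mt u)) nd (F.sub k c) k)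
        (F.cnt (U.filter fun u => F.Up k (mt u)) g (F.sub k c) k) := by
      intro c
      induction c with
      | zero =>
        intro _
        have hz : ∀ p : ℕ → ℕ, (∀ u ∈ U, F.Up (p u) (mt u)) →
            F.cnt (U.filter fun u => F.Up k (mt u)) p (F.sub k 0) k 0 =
              (U.filter fun u => p u = k).card := fun p hp => by
          unfold cnt
          rw [Finset.filter_filter, sub_zero hk]
          congr 1
          refine Finset.filter_congr fun u hu => ?_
          simp only [Finset.mem_singleton]
          constructor
          · exact fun h => h.2.1
          · intro h; exact ⟨h ▸ hp u hu, h, by simp [h]⟩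
        refine hinit k hk _ _ (hbd _ _ _ _ (Finset.filter_subset _ _))
          (hbd _ _ _ _ (Finset.filter_subset _ _)) (hz nd fun u hu => (hmt u hu).1) ?_ ?_
        · rw [hz g fun u hu => (hmt u hu).2.1]; exact hal k hk
        · intro i _ hi
          have : ∀ p : ℕ → ℕ, F.cnt (U.filter fun u => F.Up k (mt u)) p (F.sub k 0) k i = 0 := by
            intro p
            unfold cnt
            rw [Finset.card_eq_zero, Finset.filter_eq_empty_iff, sub_zero hk]
            rintro u _ ⟨h1, h2⟩
            rw [Finset.mem_singleton.1 h1] at h2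
            omega
          exact ⟨this _, this _⟩
      | succ c ihc =>
        intro hc
        have ihc := ihc (by omega)
        by_cases hp : F.par c = k
        · have hrk := F.rk_par c hc (ne_root_of_par hk hp)
          have hdp := F.dep_par c hc (ne_root_of_par hk hp)
          rw [hp] at hrk hdp
          have hBc := hB c hc
          have hck : F.Up c k := hp ▸ up_par hc (ne_root_of_par hk hp)
          have ih' := ih (B - F.rk c) (by omega) c hc rfl
          -- For users or demands below `c`, meeting at or above `k` is the same as meeting strictly
          -- above `c`, because `k` is the parent of `c`.
          have hU : ∀ p : ℕ → ℕ, (∀ u ∈ U, F.Up (p u) (mt u)) → ∀ u, p u ∈ F.sub c F.S →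
              (u ∈ (U.filter fun u => F.Up k (mt u)) ↔
                u ∈ (U.filter fun u => F.Up c (mt u) ∧ mt u ≠ c)) := by
            intro p hp' u hu
            simp only [Finset.mem_filter]
            refine and_congr_right fun huU => ⟨fun h => ⟨hck.trans h, ?_⟩, fun h => ?_⟩
            · intro h'
              rw [h'] at h
              have := h.rk_le
              omega
            · rcases h.1.eq_or with h' | ⟨-, -, h'⟩
              · exact absurd h' h.2
              · rwa [hp] at h'
          -- What has to pass the edge above `c` reaches its meeting node within `R`, so it is still
          -- within `R` when measured from `k`.
          have hran : ∀ p : ℕ → ℕ, (∀ u ∈ U, F.Up (p u) (mt u) ∧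
              F.dep (p u) - F.dep (mt u) ≤ R) → ∀ i ≤ R,
              F.cnt (U.filter fun u => F.Up c (mt u) ∧ mt u ≠ c) p (F.sub c F.S) c i ≠ 0 →
                i + F.w c ≤ R := by
            intro p hp' i _ hne
            unfold cnt at hne
            obtain ⟨u, hu⟩ := Finset.card_ne_zero.1 hne
            simp only [Finset.mem_filter] at hu
            obtain ⟨⟨hu, h1, h2⟩, h3, h4⟩ := hu
            have h5 := ((hU p (fun u hu => (hp' u hu).1) u h3).2
              (Finset.mem_filter.2 ⟨hu, h1, h2⟩))
            have h6 := (Finset.mem_filter.1 h5).2.dep_le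
            have h7 := (hp' u hu).2
            have h8 := ((sub_full hc).1 h3).2.dep_le
            omega
          exact hmerge k hk c hc _ _ _ _ _ _ (hbd _ _ _ _ (Finset.filter_subset _ _))
            (hbd _ _ _ _ (Finset.filter_subset _ _)) (hbd _ _ _ _ (Finset.filter_subset _ _))
            (hbd _ _ _ _ (Finset.filter_subset _ _)) (hbd _ _ _ _ (Finset.filter_subset _ _))
            (hbd _ _ _ _ (Finset.filter_subset _ _)) hp ihc ih'
            (hran nd fun u hu => ⟨(hmt u hu).1, by have := (hmt u hu).2.2; omega⟩)
            (hran g fun u hu => ⟨(hmt u hu).2.1, by have := (hmt u hu).2.2; omega⟩)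
            (fun i _ => cnt_merge hk hc hp (hU nd fun u hu => (hmt u hu).1) rfl i)
            (fun i _ => cnt_merge hk hc hp (hU g fun u hu => (hmt u hu).2.1) rfl i)
        · rw [sub_skip hp]
          exact hskip k hk c hc _ _ (hbd _ _ _ _ (Finset.filter_subset _ _))
            (hbd _ _ _ _ (Finset.filter_subset _ _)) hp ihc
    -- The users meeting at `k` are cancelled one by one; `Z` collects those already done.
    have hcan : ∀ Z ⊆ U.filter (fun u => mt u = k),
        P k F.S (F.cnt ((U.filter fun u => F.Up k (mt u)) \ Z) nd (F.sub k F.S) k)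
          (F.cnt ((U.filter fun u => F.Up k (mt u)) \ Z) g (F.sub k F.S) k) := by
      intro Z
      induction Z using Finset.induction_on with
      | empty => intro _; rw [Finset.sdiff_empty]; exact hch F.S le_rfl
      | insert v Z hv ihZ =>
        intro hZ
        have ihZ := ihZ fun x hx => hZ (Finset.mem_insert_of_mem hx)
        obtain ⟨hvU, hvk⟩ := Finset.mem_filter.1 (hZ (Finset.mem_insert_self v Z))
        obtain ⟨m1, m2, m3⟩ := hmt v hvU
        rw [hvk] at m1 m2 m3
        have hgv := (hg v hvU).1
        have hndv : nd v < F.S := by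
          rcases m1.eq_or with h | h
          · exact h ▸ hk
          · exact h.1
        have hmem : v ∈ (U.filter fun u => F.Up k (mt u)) \ Z := by
          rw [Finset.mem_sdiff, Finset.mem_filter]
          exact ⟨⟨hvU, hvk ▸ .refl _⟩, hv⟩
        rw [Finset.sdiff_insert]
        have hsub : ∀ W, (U.filter fun u => F.Up k (mt u)) \ W ⊆ U := fun W =>
          Finset.sdiff_subset.trans (Finset.filter_subset _ _)
        have hsub' := (Finset.erase_subset v _).trans (hsub Z)
        exact hcancel k hk _ _ _ _ _ _ (hbd _ _ _ _ hsub') (hbd _ _ _ _ hsub')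
          (hbd _ _ _ _ (hsub Z)) (hbd _ _ _ _ (hsub Z)) ihZ m3
          (fun t _ => cnt_erase hmem ((sub_full hk).2 ⟨hndv, m1⟩) t)
          (fun t _ => cnt_erase hmem ((sub_full hk).2 ⟨hgv, m2⟩) t)
    have := hcan _ (Finset.Subset.refl _)
    have e : (U.filter fun u => F.Up k (mt u)) \ U.filter (fun u => mt u = k) =
        U.filter fun u => F.Up k (mt u) ∧ mt u ≠ k := by
      ext u; simp only [Finset.mem_sdiff, Finset.mem_filter]; tauto
    rwa [e] at this
  have := key F.root F.root_lt
  have e : (U.filter fun u => F.Up F.root (mt u) ∧ mt u ≠ F.root) = ∅ := by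
    rw [Finset.filter_eq_empty_iff]
    rintro u _ ⟨h1, h2⟩
    rcases h1.eq_or with h | h
    · exact h2 h
    · exact h.2.1 rfl
  have hz : ∀ p, F.cnt ∅ p (F.sub F.root F.S) F.root = fun _ => 0 := fun p => by
    funext i; simp [cnt]
  rwa [e, hz, hz] at this

/-! ### Distances through common ancestors -/

theorem Near.symm {R a b : ℕ} (h : F.Near R a b) : F.Near R b a := by
  obtain ⟨x, h1, h2, h3⟩ := h
  exact ⟨x, h2, h1, by omega⟩

/-- The two meeting nodes are ancestors of `b`, hence comparable; the upper one serves for `a` and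
`c`. -/
theorem Near.trans {R R' a b c : ℕ} (h : F.Near R a b) (h' : F.Near R' b c) :
    F.Near (R + R') a c := by
  obtain ⟨x, h1, h2, h3⟩ := h
  obtain ⟨y, h4, h5, h6⟩ := h'
  have := h1.dep_le
  have := h2.dep_le
  have := h4.dep_le
  have := h5.dep_le
  rcases h2.total h4 with h | h
  · have := h.dep_le
    exact ⟨y, h1.trans h, h5, by omega⟩
  · have := h.dep_le
    exact ⟨x, h1, h5.trans h, by omega⟩

/-- Some ancestor is at the given distance, unless the root is nearer. -/
theorem exists_ancestor (hw : ∀ k < F.S, F.w k ≤ 1) (h : ℕ) {k : ℕ} (hk : k < F.S) :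
    ∃ c, F.Up k c ∧ (F.dep k - F.dep c = h ∨ F.dep k - F.dep c ≤ h ∧ c = F.root) := by
  induction hr : F.rk k using Nat.strong_induction_on generalizing k h with
  | _ r ih =>
    by_cases hkr : k = F.root
    · exact ⟨k, .refl _, Or.inr ⟨by simp, hkr⟩⟩
    · cases h with
      | zero => exact ⟨k, .refl _, Or.inl (by simp)⟩
      | succ h =>
        have h1 := F.rk_par k hk hkr
        have h2 := F.dep_par k hk hkr
        have h3 := hw k hk
        obtain ⟨c, hc, hc'⟩ := ih (F.rk (F.par k)) (by omega) (h + 1 - F.w k)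
          (F.par_lt k hk hkr) rfl
        have := hc.dep_le
        refine ⟨c, (up_par hk hkr).trans hc, ?_⟩
        rcases hc' with hc' | ⟨hc', hc''⟩
        · left; omega
        · right; exact ⟨by omega, hc''⟩

/-- Nodes at mutual distance at most `2 * h` are at distance at most `h` from some center. -/
theorem exists_center (hw : ∀ k < F.S, F.w k ≤ 1) {h : ℕ} {A : Finset ℕ} (hA : A.Nonempty)
    (hS : ∀ a ∈ A, a < F.S) (hnear : ∀ a ∈ A, ∀ b ∈ A, F.Near (2 * h) a b) :
    ∃ c, (∃ a ∈ A, F.Up a c) ∧ ∀ a ∈ A, F.Near h a c := by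
  -- The center is found by climbing `h` from a deepest node `u`. If the path from `u` to `a` passes
  -- through the center `c`, at most `2 * h - h` of it remains. If it turns around below `c`, then
  -- `a`, being no deeper than `u`, is no farther from `c` than `u` is. If the root is reached
  -- early, everything is within `h` of it.
  obtain ⟨u, hu, hmax⟩ := Finset.exists_max_image A F.dep hA
  obtain ⟨c, hc, hc'⟩ := exists_ancestor hw h (hS u hu)
  refine ⟨c, ⟨u, hu, hc⟩, fun a ha => ?_⟩
  obtain ⟨x, h1, h2, h3⟩ := hnear u hu a ha
  have := hmax a ha
  have := hc.dep_le
  have := h1.dep_le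
  have := h2.dep_le
  rcases h1.total hc with h4 | h4
  · have := h4.dep_le
    exact ⟨c, h2.trans h4, .refl _, by omega⟩
  · have := h4.dep_le
    refine ⟨x, h2, h4, ?_⟩
    rcases hc' with hc' | ⟨hc', rfl⟩
    · omega
    · rcases h4.eq_or with rfl | h5
      · omega
      · exact absurd rfl h5.2.1

end ParentTree

/-! ### Weighted trees, rooted at the vertex `0` -/

namespace WeightedTree

variable (T : WeightedTree)

theorem N_pos : 0 < T.N := by
  have := T.isTree.connected.nonempty
  obtain ⟨v⟩ := this
  exact v.pos

def root : Fin T.N := ⟨0, T.N_pos⟩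

/-- The number of edges between a vertex and the root. -/
noncomputable def hop (v : Fin T.N) : ℕ := T.graph.dist T.root v

theorem hop_root : T.hop T.root = 0 := by simp [hop]

theorem hop_eq_zero {v : Fin T.N} : T.hop v = 0 ↔ v = T.root := by
  rw [hop, (T.isTree.connected T.root v).dist_eq_zero_iff, eq_comm]

/-- A walk as long as the graph distance is a path, and paths in a tree are unique. -/
theorem path_concat {u v : Fin T.N} (h : T.graph.Adj u v) (hd : T.hop u + 1 = T.hop v) :
    T.path T.root v = (T.path T.root u).concat h := by
  obtain ⟨q, hq⟩ := T.isTree.connected.exists_walk_length_eq_dist T.root u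
  have hqp : q = T.path T.root u := T.path_eq q (q.isPath_of_length_eq_dist hq)
  rw [← hqp]
  refine (T.path_eq _ (SimpleGraph.Walk.isPath_of_length_eq_dist _ ?_)).symm
  rw [SimpleGraph.Walk.length_concat, hq]; exact hd

theorem exists_parent {v : Fin T.N} (hv : v ≠ T.root) :
    ∃ u, T.graph.Adj u v ∧ T.hop u + 1 = T.hop v := by
  obtain ⟨q, hq⟩ := T.isTree.connected.exists_walk_length_eq_dist v T.root
  cases q with
  | nil => exact absurd rfl hv
  | @cons _ u _ h q =>
    refine ⟨u, h.symm, ?_⟩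
    rw [SimpleGraph.Walk.length_cons] at hq
    have h1 : T.hop u ≤ q.length := by
      rw [hop, SimpleGraph.dist_comm]; exact SimpleGraph.dist_le q
    have h2 : T.hop v ≤ T.hop u + 1 := by
      have := T.isTree.connected.dist_triangle (u := T.root) (v := u) (w := v)
      rwa [SimpleGraph.dist_eq_one_iff_adj.2 h.symm] at this
    have h3 : T.hop v = T.graph.dist v T.root := SimpleGraph.dist_comm
    omega

open Classical in
/-- The neighbour of a vertex in the direction of the root. -/
noncomputable def par (v : Fin T.N) : Fin T.N :=
  if hv : v = T.root then T.root else (T.exists_parent hv).choose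

variable {T}

theorem par_root : T.par T.root = T.root := by simp [par]

theorem par_adj {v : Fin T.N} (hv : v ≠ T.root) : T.graph.Adj (T.par v) v := by
  rw [par, dif_neg hv]; exact (T.exists_parent hv).choose_spec.1

theorem par_hop {v : Fin T.N} (hv : v ≠ T.root) : T.hop (T.par v) + 1 = T.hop v := by
  rw [par, dif_neg hv]; exact (T.exists_parent hv).choose_spec.2

/-- Both vertices are penultimate on the unique path from the root to `v`. -/
theorem eq_par {u v : Fin T.N} (h : T.graph.Adj u v) (hd : T.hop u + 1 = T.hop v) :
    u = T.par v := by
  have hv : v ≠ T.root := by rintro rfl; rw [hop_root] at hd; omega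
  have h1 := T.path_concat h hd
  have h2 := T.path_concat (par_adj hv) (par_hop hv)
  have := congrArg SimpleGraph.Walk.penultimate (h1.symm.trans h2)
  simpa using this

variable (T) in
/-- The distance from the root. -/
noncomputable def depth (v : Fin T.N) : ℝ := T.dist T.root v

variable (T) in
/-- The length of the edge from a vertex to its parent. -/
noncomputable def parLen (v : Fin T.N) : ℝ := T.edgeLen s(T.par v, v)

theorem parLen_nonneg (v : Fin T.N) : 0 ≤ T.parLen v := NNReal.coe_nonneg _

/-- `par` fixes the root, and a loop is not an edge, so the default length `0` applies; thus
`depth_par` needs no exception at the root. -/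
theorem parLen_root : T.parLen T.root = 0 := by
  simp [parLen, par_root, edgeLen]

theorem dist_self (v : Fin T.N) : T.dist v v = 0 := by
  have := T.path_eq (SimpleGraph.Walk.nil : T.graph.Walk v v) SimpleGraph.Walk.IsPath.nil
  simp [dist, ← this]

theorem depth_root : T.depth T.root = 0 := by simp [depth, dist_self]

theorem depth_par (v : Fin T.N) : T.depth v = T.depth (T.par v) + T.parLen v := by
  by_cases hv : v = T.root
  · subst hv; rw [par_root, parLen_root, add_zero]
  · have := T.path_concat (par_adj hv) (par_hop hv)
    simp only [depth, dist, parLen, this, SimpleGraph.Walk.edges_concat, List.map_append,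
      List.concat_eq_append, List.sum_append]
    simp

variable (T) in
/-- The second vertex is an ancestor of the first. -/
def Anc (a x : Fin T.N) : Prop :=
  Relation.ReflTransGen (fun a b => a ≠ T.root ∧ T.par a = b) a x

theorem Anc.refl (a : Fin T.N) : T.Anc a a := Relation.ReflTransGen.refl

theorem Anc.eq_or {a x : Fin T.N} (h : T.Anc a x) :
    x = a ∨ (a ≠ T.root ∧ T.Anc (T.par a) x) := by
  rcases Relation.ReflTransGen.cases_head h with h | ⟨y, h, h'⟩
  · exact Or.inl h.symm
  · exact Or.inr ⟨h.1, h.2 ▸ h'⟩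

theorem Anc.of_par {a x : Fin T.N} (ha : a ≠ T.root) (h : T.Anc (T.par a) x) : T.Anc a x :=
  Relation.ReflTransGen.head ⟨ha, rfl⟩ h

theorem Anc.hop_le {a x : Fin T.N} (h : T.Anc a x) : T.hop x ≤ T.hop a := by
  induction h with
  | refl => exact le_rfl
  | tail _ h ih => have := par_hop h.1; rw [h.2] at this; omega

theorem Anc.eq_of_hop {a x : Fin T.N} (h : T.Anc a x) (hh : T.hop a ≤ T.hop x) : x = a := by
  rcases h.eq_or with h | ⟨h1, h2⟩
  · exact h
  · have := h2.hop_le; have := par_hop h1; omega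

theorem Anc.depth_le {a x : Fin T.N} (h : T.Anc a x) : T.depth x ≤ T.depth a := by
  induction h with
  | refl => exact le_rfl
  | @tail b c _ h ih =>
    have := depth_par b; rw [h.2] at this
    have := parLen_nonneg b
    linarith

/-- The simple path leads through the lowest common ancestor. -/
theorem exists_lca (a b : Fin T.N) : ∃ x, ∃ p : T.graph.Walk a b, p.IsPath ∧
    T.Anc a x ∧ T.Anc b x ∧ (∀ y, T.Anc a y → T.Anc b y → T.Anc x y) ∧
    (∀ y ∈ p.support, T.Anc a y ∨ T.Anc b y) ∧
    ((p.edges.map T.edgeLen).sum : ℝ) + 2 * T.depth x = T.depth a + T.depth b := by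
  have hrev : ∀ a b : Fin T.N, (∃ x, ∃ p : T.graph.Walk a b, p.IsPath ∧
      T.Anc a x ∧ T.Anc b x ∧ (∀ y, T.Anc a y → T.Anc b y → T.Anc x y) ∧
      (∀ y ∈ p.support, T.Anc a y ∨ T.Anc b y) ∧
      ((p.edges.map T.edgeLen).sum : ℝ) + 2 * T.depth x = T.depth a + T.depth b) →
      ∃ x, ∃ p : T.graph.Walk b a, p.IsPath ∧
      T.Anc b x ∧ T.Anc a x ∧ (∀ y, T.Anc b y → T.Anc a y → T.Anc x y) ∧
      (∀ y ∈ p.support, T.Anc b y ∨ T.Anc a y) ∧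
      ((p.edges.map T.edgeLen).sum : ℝ) + 2 * T.depth x = T.depth b + T.depth a := by
    rintro a b ⟨x, p, h1, h2, h3, h4, h5, h6⟩
    refine ⟨x, p.reverse, h1.reverse, h3, h2, fun y hy hy' => h4 y hy' hy, fun y hy => ?_, ?_⟩
    · rw [SimpleGraph.Walk.support_reverse, List.mem_reverse] at hy
      exact (h5 y hy).symm
    · rw [SimpleGraph.Walk.edges_reverse, List.map_reverse, List.sum_reverse, h6, add_comm]
  induction hn : T.hop a + T.hop b using Nat.strong_induction_on generalizing a b with
  | _ n ih =>
    by_cases hab : a = b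
    · subst hab
      refine ⟨a, .nil, .nil, .refl a, .refl a, fun y h _ => h, fun y hy => ?_, ?_⟩
      · simp at hy; subst hy; exact Or.inl (.refl _)
      · simp; ring
    -- By symmetry let `a` be at least as many edges away from the root as `b`. Then `a` is not an
    -- ancestor of `b`, and the path starts with the edge from `a` to its parent.
    · have main : ∀ a b : Fin T.N, T.hop a + T.hop b = n → a ≠ b → T.hop b ≤ T.hop a →
          ∃ x, ∃ p : T.graph.Walk a b, p.IsPath ∧
          T.Anc a x ∧ T.Anc b x ∧ (∀ y, T.Anc a y → T.Anc b y → T.Anc x y) ∧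
          (∀ y ∈ p.support, T.Anc a y ∨ T.Anc b y) ∧
          ((p.edges.map T.edgeLen).sum : ℝ) + 2 * T.depth x = T.depth a + T.depth b := by
        intro a b hn hab hle
        have ha : a ≠ T.root := by
          rintro rfl
          rw [hop_root, Nat.le_zero, hop_eq_zero] at hle
          exact hab hle.symm
        have hp := par_hop ha
        obtain ⟨x, p, h1, h2, h3, h4, h5, h6⟩ := ih _ (by omega) (T.par a) b rfl
        have hba : ¬ T.Anc b a := fun h => hab (h.eq_of_hop hle)
        refine ⟨x, .cons (par_adj ha).symm p, ?_, h2.of_par ha, h3, fun y hy hy' => ?_,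
          fun y hy => ?_, ?_⟩
        -- The path from the parent avoids `a`: its vertices are ancestors of the parent or of `b`,
        -- and `a` is neither. This is why the support is part of the induction.
        · rw [SimpleGraph.Walk.cons_isPath_iff]
          refine ⟨h1, fun h => ?_⟩
          rcases h5 a h with h | h
          · have := h.hop_le; omega
          · exact hba h
        · rcases hy.eq_or with rfl | ⟨-, hy⟩
          · exact absurd hy' hba
          · exact h4 y hy hy'
        · rw [SimpleGraph.Walk.support_cons, List.mem_cons] at hy
          rcases hy with rfl | hy
          · exact Or.inl (.refl _)
          · exact (h5 y hy).imp_left fun h => h.of_par ha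
        · have h7 : T.parLen a = (T.edgeLen s(a, T.par a) : ℝ) := by rw [parLen, Sym2.eq_swap]
          have h8 := depth_par a
          rw [SimpleGraph.Walk.edges_cons, List.map_cons, List.sum_cons]
          push_cast
          push_cast at h6
          linarith
      rcases le_total (T.hop b) (T.hop a) with h | h
      · exact main a b hn hab h
      · exact hrev _ _ (main b a (by omega) (Ne.symm hab) h)

theorem exists_dist_eq (a b : Fin T.N) : ∃ x, T.Anc a x ∧ T.Anc b x ∧
    (T.dist a b : ℝ) = (T.depth a - T.depth x) + (T.depth b - T.depth x) := by
  obtain ⟨x, p, h1, h2, h3, -, -, h6⟩ := exists_lca a b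
  refine ⟨x, h2, h3, ?_⟩
  rw [dist, ← T.path_eq p h1]
  linarith

theorem dist_le_of_anc {a b x : Fin T.N} (ha : T.Anc a x) (hb : T.Anc b x) :
    (T.dist a b : ℝ) ≤ (T.depth a - T.depth x) + (T.depth b - T.depth x) := by
  obtain ⟨y, p, h1, -, -, h4, -, h6⟩ := exists_lca a b
  have := (h4 x ha hb).depth_le
  rw [dist, ← T.path_eq p h1]
  linarith

/-! Functions defined from the root to the leaves. -/

variable (T) in
/-- `treeRec x f` after `t` steps. -/
noncomputable def recAux {α : Type*} (x : α) (f : Fin T.N → α → α) : ℕ → Fin T.N → α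
  | 0, _ => x
  | t + 1, v => f v (recAux x f t (T.par v))

variable (T) in
/-- The function with the value `x` at the root, and `f v` applied to the value of its parent at
any other vertex `v`. -/
noncomputable def treeRec {α : Type*} (x : α) (f : Fin T.N → α → α) (v : Fin T.N) : α :=
  T.recAux x f (T.hop v) v

theorem treeRec_root {α : Type*} (x : α) (f : Fin T.N → α → α) :
    T.treeRec x f T.root = x := by simp [treeRec, hop_root, recAux]

theorem treeRec_par {α : Type*} (x : α) (f : Fin T.N → α → α) {v : Fin T.N}
    (hv : v ≠ T.root) : T.treeRec x f v = f v (T.treeRec x f (T.par v)) := by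
  rw [treeRec, treeRec, ← par_hop hv, recAux]

theorem par_induction {P : Fin T.N → Prop} (h0 : P T.root)
    (hs : ∀ v, v ≠ T.root → P (T.par v) → P v) (v : Fin T.N) : P v := by
  induction h : T.hop v using Nat.strong_induction_on generalizing v with
  | _ n ih =>
    by_cases hv : v = T.root
    · exact hv ▸ h0
    · have := par_hop hv
      exact hs v hv (ih _ (by omega) _ rfl)

end WeightedTree

namespace WeightedTree

variable {T : WeightedTree}

/-! ### Rounding the edge lengths

For a length scale `B` and a natural number `M`, the edge lengths are rounded to multiples of
`B / M` so that the rounding errors do not accumulate along a path from the root.  The vertex `v`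
carries the error `slack v`; its edge to the parent gets `units v` units, but at most `K + 1`. -/

variable (T) in
open Classical in
/-- The number of units of the edge from `v` to its parent if the parent has the error `s`. -/
noncomputable def unitsOf (M K : ℕ) (B : ℝ) (v : Fin T.N) (s : ℝ) : ℕ :=
  ((Finset.range (K + 1)).filter fun i : ℕ => s + i * B < M * T.parLen v).card

-- Everything is scaled by `M`, which avoids division: `M * parLen` is compared with multiples of
-- `B`, and errors lie between `0` and `B`. The maximum with `0` takes effect only when the count of
-- units is cut off at `K + 1`.
variable (T) in
noncomputable def slack (M K : ℕ) (B : ℝ) : Fin T.N → ℝ :=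
  T.treeRec 0 fun v s => max 0 (s + T.unitsOf M K B v s * B - M * T.parLen v)

variable (T) in
noncomputable def units (M K : ℕ) (B : ℝ) (v : Fin T.N) : ℕ :=
  T.unitsOf M K B v (T.slack M K B (T.par v))

variable (T) in
noncomputable def unitDepth (M K : ℕ) (B : ℝ) : Fin T.N → ℕ :=
  T.treeRec 0 fun v d => d + T.units M K B v

variable {M K : ℕ} {B : ℝ}

theorem unitsOf_le (v : Fin T.N) (s : ℝ) : T.unitsOf M K B v s ≤ K + 1 := by
  simpa [unitsOf] using Finset.card_filter_le (Finset.range (K + 1)) _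

/-- The counted numbers form an initial segment. -/
theorem lt_unitsOf (hB : 0 ≤ B) {v : Fin T.N} {s : ℝ} {i : ℕ} :
    i < T.unitsOf M K B v s ↔ i ≤ K ∧ s + i * B < M * T.parLen v := by
  classical
  obtain ⟨c, hc, hle⟩ : ∃ c, ((Finset.range (K + 1)).filter fun i : ℕ =>
      s + i * B < M * T.parLen v) = Finset.range c ∧ c ≤ K + 1 := by
    have hmono : ∀ i j : ℕ, i ≤ j → s + i * B ≤ s + j * B := fun i j hij => by
      have : (i : ℝ) ≤ j := by exact_mod_cast hij
      nlinarith
    by_cases h : ∃ c ≤ K + 1, ¬ (c ≤ K ∧ s + c * B < M * T.parLen v)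
    · have hs : ∃ c, ¬ (c ≤ K ∧ s + c * B < M * T.parLen v) := ⟨_, h.choose_spec.2⟩
      refine ⟨Nat.find hs, ?_, (Nat.find_min' hs h.choose_spec.2).trans h.choose_spec.1⟩
      ext i
      simp only [Finset.mem_filter, Finset.mem_range, Nat.lt_find_iff, not_not]
      constructor
      · rintro ⟨h1, h2⟩ m hm
        exact ⟨by omega, (hmono m i hm).trans_lt h2⟩
      · intro h1
        have := h1 i le_rfl
        exact ⟨by omega, this.2⟩
    · exact absurd ⟨K + 1, le_rfl, fun h => by omega⟩ h
  have h1 : T.unitsOf M K B v s = c := by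
    unfold unitsOf; rw [hc, Finset.card_range]
  rw [h1, ← Finset.mem_range, ← hc, Finset.mem_filter, Finset.mem_range]
  exact and_congr_left fun _ => by omega

theorem slack_root : T.slack M K B T.root = 0 := treeRec_root _ _

theorem slack_par {v : Fin T.N} (hv : v ≠ T.root) : T.slack M K B v =
    max 0 (T.slack M K B (T.par v) + T.units M K B v * B - M * T.parLen v) :=
  treeRec_par _ _ hv

theorem slack_nonneg (v : Fin T.N) : 0 ≤ T.slack M K B v := by
  by_cases hv : v = T.root
  · rw [hv, slack_root]
  · rw [slack_par hv]; exact le_max_left _ _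

theorem units_root (hB : 0 ≤ B) : T.units M K B T.root = 0 := by
  by_contra h
  have := ((lt_unitsOf hB).1 (Nat.pos_of_ne_zero h)).2
  rw [par_root, slack_root, parLen_root] at this
  simp at this

/-- The last counted unit was still needed, since without it the rounded length falls short; so the
overshoot is at most one unit. If no unit is counted, the error does not grow. -/
theorem slack_le (hB : 0 ≤ B) (v : Fin T.N) : T.slack M K B v ≤ B := by
  refine par_induction (P := fun v => T.slack M K B v ≤ B) (by rw [slack_root]; exact hB)
    (fun v hv ih => ?_) v
  rw [slack_par hv]
  refine max_le hB ?_
  by_cases h : T.units M K B v = 0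
  · rw [h]
    have := parLen_nonneg v
    have : 0 ≤ (M : ℝ) * T.parLen v := by positivity
    push_cast; linarith
  · have h1 := ((lt_unitsOf (M := M) (K := K) hB (v := v)
      (s := T.slack M K B (T.par v)) (i := T.units M K B v - 1)).1 (by
        change _ < T.units M K B v; omega)).2
    have h2 : ((T.units M K B v - 1 : ℕ) : ℝ) = T.units M K B v - 1 := by
      rw [Nat.cast_sub (by omega)]; simp
    rw [h2] at h1
    linarith

/-- Below the cap the counting stops because the length is covered, so the maximum in `slack` is
inactive. In this form the identity telescopes along paths. -/
theorem units_mul (hB : 0 ≤ B) (v : Fin T.N) (h : T.units M K B v ≤ K) :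
    T.units M K B v * B =
      M * T.parLen v + T.slack M K B v - T.slack M K B (T.par v) := by
  by_cases hv : v = T.root
  · subst hv
    rw [units_root hB, par_root, parLen_root]; simp
  · have h1 := mt (lt_unitsOf (M := M) (K := K) hB (v := v)
      (s := T.slack M K B (T.par v)) (i := T.units M K B v)).2 (lt_irrefl _)
    rw [not_and, not_lt] at h1
    have h1 := h1 h
    rw [slack_par hv, max_eq_right (by linarith)]
    ring

/-- `M` units of size `B` already cover `M * parLen v`, so for `M ≤ K` such an edge is not cut off.
-/
theorem units_le (hB : 0 ≤ B) {v : Fin T.N} (h : T.parLen v ≤ B) : T.units M K B v ≤ M := by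
  by_contra hM
  have h1 := ((lt_unitsOf (M := M) (K := K) hB (v := v)
      (s := T.slack M K B (T.par v)) (i := M)).1 (by
        change _ < T.units M K B v; omega)).2
  have := slack_nonneg (M := M) (K := K) (B := B) (T.par v)
  have : (M : ℝ) * T.parLen v ≤ M * B := by gcongr
  linarith

/-- The scale `0` occurs when the optimum is `0`. There one cannot divide by `B`; this and
`Anc.unitDepth_eq` replace the estimates. -/
theorem units_eq_zero {v : Fin T.N} (h : T.parLen v = 0) : T.units M K 0 v = 0 := by
  by_contra hM
  have h1 := ((lt_unitsOf (M := M) (K := K) le_rfl (v := v)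
      (s := T.slack M K 0 (T.par v)) (i := 0)).1 (by
        change _ < T.units M K 0 v; omega)).2
  have := slack_nonneg (M := M) (K := K) (B := 0) (T.par v)
  rw [h] at h1
  simp at h1; linarith

theorem unitDepth_par (hB : 0 ≤ B) (v : Fin T.N) :
    T.unitDepth M K B v = T.unitDepth M K B (T.par v) + T.units M K B v := by
  by_cases hv : v = T.root
  · subst hv; rw [par_root, units_root hB]; rfl
  · exact treeRec_par _ _ hv

theorem Anc.unitDepth_le (hB : 0 ≤ B) {a x : Fin T.N} (h : T.Anc a x) :
    T.unitDepth M K B x ≤ T.unitDepth M K B a := by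
  induction h with
  | refl => exact le_rfl
  | @tail b c _ h ih =>
    have := unitDepth_par (M := M) (K := K) hB b; rw [h.2] at this
    omega

/-- The sum of `units_mul` over the edges of the path; a total of at most `K` units leaves no room
for an edge that was cut off. -/
theorem Anc.unitDepth_mul (hB : 0 ≤ B) {a x : Fin T.N} (h : T.Anc a x)
    (hK : T.unitDepth M K B a ≤ T.unitDepth M K B x + K) :
    (T.unitDepth M K B a - T.unitDepth M K B x : ℝ) * B =
      M * (T.depth a - T.depth x) + T.slack M K B a - T.slack M K B x := by
  induction h with
  | refl => ring
  | @tail b c hab h ih =>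
    have h1 := unitDepth_par (M := M) (K := K) hB b; rw [h.2] at h1
    have h2 := Anc.unitDepth_le (M := M) (K := K) hB hab
    have h3 := depth_par b; rw [h.2] at h3
    have h4 := units_mul (M := M) (K := K) hB b (by omega); rw [h.2] at h4
    have ih := ih (by omega)
    have h5 : (T.unitDepth M K B b : ℝ) = T.unitDepth M K B c + T.units M K B b := by
      exact_mod_cast h1
    rw [h5] at ih
    rw [h3] at ih
    linear_combination ih + h4

/-- The same telescoping sum; here no edge is cut off because none is longer than `B`. -/
theorem Anc.unitDepth_mul_of_le (hB : 0 ≤ B) (hMK : M ≤ K) {a x : Fin T.N} (h : T.Anc a x)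
    (hd : T.depth a - T.depth x ≤ B) :
    (T.unitDepth M K B a - T.unitDepth M K B x : ℝ) * B =
      M * (T.depth a - T.depth x) + T.slack M K B a - T.slack M K B x := by
  induction h with
  | refl => ring
  | @tail b c hab h ih =>
    have h1 := unitDepth_par (M := M) (K := K) hB b; rw [h.2] at h1
    have h2 := Anc.depth_le hab
    have h3 := depth_par b; rw [h.2] at h3
    have h6 := parLen_nonneg b
    have h4 := units_mul (M := M) (K := K) hB b
      ((units_le hB (by linarith)).trans hMK); rw [h.2] at h4
    have ih := ih (by linarith)
    have h5 : (T.unitDepth M K B b : ℝ) = T.unitDepth M K B c + T.units M K B b := by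
      exact_mod_cast h1
    rw [h5] at ih
    rw [h3] at ih
    linear_combination ih + h4

theorem Anc.unitDepth_eq {a x : Fin T.N} (h : T.Anc a x) (hd : T.depth a - T.depth x ≤ 0) :
    T.unitDepth M K 0 a = T.unitDepth M K 0 x := by
  induction h with
  | refl => rfl
  | @tail b c hab h ih =>
    have h1 := unitDepth_par (M := M) (K := K) le_rfl b; rw [h.2] at h1
    have h2 := Anc.depth_le hab
    have h3 := depth_par b; rw [h.2] at h3
    have h6 := parLen_nonneg b
    rw [ih (by linarith), h1, units_eq_zero (by linarith), add_zero]

variable (T) in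
/-- The rounded distance of two vertices, measured through some common ancestor, is at most `R`. -/
def UnitNear (M K : ℕ) (B : ℝ) (R : ℕ) (a b : Fin T.N) : Prop :=
  ∃ x, T.Anc a x ∧ T.Anc b x ∧
    (T.unitDepth M K B a - T.unitDepth M K B x) + (T.unitDepth M K B b - T.unitDepth M K B x) ≤ R

/-- Of all errors only those of `a`, `b` and, twice, of the common ancestor remain. The first two
help, and the last costs at most `2 * B`. -/
theorem UnitNear.dist_le (hB : 0 ≤ B) {a b : Fin T.N} (h : T.UnitNear M K B K a b) :
    M * (T.dist a b : ℝ) ≤ (K + 2) * B := by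
  obtain ⟨x, h1, h2, h3⟩ := h
  have := Anc.unitDepth_le (M := M) (K := K) hB h1
  have := Anc.unitDepth_le (M := M) (K := K) hB h2
  have e1 := h1.unitDepth_mul (M := M) (K := K) hB (by omega)
  have e2 := h2.unitDepth_mul (M := M) (K := K) hB (by omega)
  have h4 := dist_le_of_anc h1 h2
  have h5 : (M : ℝ) * T.dist a b ≤ M * ((T.depth a - T.depth x) + (T.depth b - T.depth x)) := by
    gcongr
  have h6 : ((T.unitDepth M K B a : ℝ) - T.unitDepth M K B x) +
      (T.unitDepth M K B b - T.unitDepth M K B x) ≤ K := by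
    have : T.unitDepth M K B a + T.unitDepth M K B b ≤ K + 2 * T.unitDepth M K B x := by omega
    have : (T.unitDepth M K B a : ℝ) + T.unitDepth M K B b ≤ K + 2 * T.unitDepth M K B x := by
      exact_mod_cast this
    linarith
  have h7 := mul_le_mul_of_nonneg_right h6 hB
  have := slack_nonneg (M := M) (K := K) (B := B) a
  have := slack_nonneg (M := M) (K := K) (B := B) b
  have := slack_le (M := M) (K := K) hB x
  linarith

/-- With the lowest common ancestor the errors at `a` and `b` add at most `2 * B`, that is, two
units; division by `B` requires the separate case `B = 0`. -/
theorem unitNear_of_dist_le (hB : 0 ≤ B) (hMK : M ≤ K) {a b : Fin T.N}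
    (h : (T.dist a b : ℝ) ≤ B) : T.UnitNear M K B (M + 2) a b := by
  obtain ⟨x, h1, h2, h3⟩ := exists_dist_eq a b
  have h4 := h1.depth_le
  have h5 := h2.depth_le
  refine ⟨x, h1, h2, ?_⟩
  rcases hB.eq_or_lt with rfl | hB'
  · rw [h1.unitDepth_eq (by linarith), h2.unitDepth_eq (by linarith)]; simp
  · have e1 := h1.unitDepth_mul_of_le (M := M) (K := K) hB hMK (by linarith)
    have e2 := h2.unitDepth_mul_of_le (M := M) (K := K) hB hMK (by linarith)
    have := slack_le (M := M) (K := K) hB a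
    have := slack_le (M := M) (K := K) hB b
    have := slack_nonneg (M := M) (K := K) (B := B) x
    have h6 : (M : ℝ) * ((T.depth a - T.depth x) + (T.depth b - T.depth x)) ≤ M * B := by
      gcongr; linarith
    have h7 : (((T.unitDepth M K B a : ℝ) - T.unitDepth M K B x) +
        (T.unitDepth M K B b - T.unitDepth M K B x)) * B ≤ (M + 2) * B := by linarith
    have h8 := le_of_mul_le_mul_right h7 hB'
    have h9 : (T.unitDepth M K B a : ℝ) + T.unitDepth M K B b ≤
        M + 2 + 2 * T.unitDepth M K B x := by linarith
    have h9 : T.unitDepth M K B a + T.unitDepth M K B b ≤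
        M + 2 + 2 * T.unitDepth M K B x := by exact_mod_cast h9
    have := Anc.unitDepth_le (M := M) (K := K) hB h1
    have := Anc.unitDepth_le (M := M) (K := K) hB h2
    omega

end WeightedTree

namespace WeightedTree

variable (T : WeightedTree)

/-- The vertex with the given number, and the root if there is none. -/
def vert (v : ℕ) : Fin T.N := if h : v < T.N then ⟨v, h⟩ else T.root

variable {T}

@[simp] theorem vert_val (v : Fin T.N) : T.vert v = v := by simp [vert]

theorem val_vert {v : ℕ} (h : v < T.N) : (T.vert v : ℕ) = v := by simp [vert, h]

variable (T)

/-! ### The subdivided tree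

The edge from the vertex `v` to its parent is subdivided into `K + 1` edges of length at most `1`
and an edge of length `0`; the `i`-th node on it is `v * (K + 2) + i`.  In addition, there are
`Fc` leaves, attached to the nodes `fpar f`. -/

section chain

variable (M K : ℕ) (B : ℝ) (Fc : ℕ) (fpar : ℕ → ℕ)

/-- The vertex `v` itself is node `0` of its chain, and the index grows towards the root. The root
of the subdivided tree is the last node `K + 1` in the chain of the vertex `0`; its parent is the
number of nodes, which is not a node. -/
noncomputable def chainPar (k : ℕ) : ℕ :=
  if k < T.N * (K + 2) then
    if k % (K + 2) < K + 1 then k + 1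
    else if k / (K + 2) = 0 then T.N * (K + 2) + Fc
    else T.par (T.vert (k / (K + 2))) * (K + 2)
  else fpar (k - T.N * (K + 2))

/-- The edges of length `1` come first. As there are at most `K + 1` of them, the last edge of a
chain has length `0`. -/
noncomputable def chainW (k : ℕ) : ℕ :=
  if k < T.N * (K + 2) then
    if k % (K + 2) < T.units M K B (T.vert (k / (K + 2))) then 1 else 0
  else 0

noncomputable def chainRk₀ (k : ℕ) : ℕ :=
  T.hop (T.vert (k / (K + 2))) * (K + 2) + (K + 1 - k % (K + 2))

/-- The depth of the upper end of the chain plus the units between it and the node; truncation gives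
all nodes beyond the last unit the depth of the upper end. -/
noncomputable def chainDep₀ (k : ℕ) : ℕ :=
  (T.unitDepth M K B (T.vert (k / (K + 2))) - T.units M K B (T.vert (k / (K + 2)))) +
    (T.units M K B (T.vert (k / (K + 2))) - k % (K + 2))

variable {T M K B Fc fpar}

theorem chain_div {v i : ℕ} (hi : i < K + 2) : (v * (K + 2) + i) / (K + 2) = v := by
  rw [Nat.add_comm, Nat.add_mul_div_right _ _ (by omega), Nat.div_eq_of_lt hi, zero_add]

theorem chain_mod {v i : ℕ} (hi : i < K + 2) : (v * (K + 2) + i) % (K + 2) = i := by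
  rw [Nat.add_comm, Nat.add_mul_mod_self_right, Nat.mod_eq_of_lt hi]

theorem chain_lt {v : ℕ} (hv : v < T.N) {i : ℕ} (hi : i < K + 2) :
    v * (K + 2) + i < T.N * (K + 2) := by
  calc v * (K + 2) + i < (v + 1) * (K + 2) := by rw [Nat.succ_mul]; omega
    _ ≤ T.N * (K + 2) := Nat.mul_le_mul_right _ hv

theorem exists_chain {k : ℕ} (hk : k < T.N * (K + 2)) :
    ∃ (v : Fin T.N) (i : ℕ), i < K + 2 ∧ k = v * (K + 2) + i :=
  ⟨⟨k / (K + 2), Nat.div_lt_of_lt_mul (by rwa [Nat.mul_comm] at hk)⟩, k % (K + 2),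
    Nat.mod_lt _ (by omega), by
      rw [Nat.mul_comm]; exact (Nat.div_add_mod k (K + 2)).symm⟩

theorem root_val : (T.root : ℕ) = 0 := rfl

theorem eq_root_iff {v : Fin T.N} : (v : ℕ) = 0 ↔ v = T.root := by
  rw [Fin.ext_iff, root_val]

theorem chainPar_step (v : Fin T.N) {i : ℕ} (hi : i < K + 1) :
    T.chainPar K Fc fpar (v * (K + 2) + i) = v * (K + 2) + (i + 1) := by
  rw [chainPar, if_pos (chain_lt v.2 (by omega)), chain_mod (by omega), if_pos hi, add_assoc]

theorem chainPar_last {v : Fin T.N} (hv : v ≠ T.root) :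
    T.chainPar K Fc fpar (v * (K + 2) + (K + 1)) = T.par v * (K + 2) + 0 := by
  rw [chainPar, if_pos (chain_lt v.2 (by omega)), chain_mod (by omega), if_neg (lt_irrefl _),
    chain_div (by omega), if_neg (mt eq_root_iff.1 hv), vert_val, add_zero]

theorem chainPar_root : T.chainPar K Fc fpar (K + 1) = T.N * (K + 2) + Fc := by
  have h := chain_lt (K := K) T.N_pos (show K + 1 < K + 2 by omega)
  rw [zero_mul, zero_add] at h
  have h1 : (K + 1) % (K + 2) = K + 1 := Nat.mod_eq_of_lt (by omega)
  have h2 : (K + 1) / (K + 2) = 0 := Nat.div_eq_of_lt (by omega)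
  simp [chainPar, h, h1, h2]

theorem chainPar_leaf (f : ℕ) : T.chainPar K Fc fpar (T.N * (K + 2) + f) = fpar f := by
  rw [chainPar, if_neg (by omega), Nat.add_sub_cancel_left]

theorem chainW_node (v : Fin T.N) {i : ℕ} (hi : i < K + 2) :
    T.chainW M K B (v * (K + 2) + i) = if i < T.units M K B v then 1 else 0 := by
  rw [chainW, if_pos (chain_lt v.2 hi), chain_mod hi, chain_div hi, vert_val]

theorem chainW_leaf (f : ℕ) : T.chainW M K B (T.N * (K + 2) + f) = 0 := by
  rw [chainW, if_neg (by omega)]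

theorem chainRk₀_node (v : Fin T.N) {i : ℕ} (hi : i < K + 2) :
    T.chainRk₀ K (v * (K + 2) + i) = T.hop v * (K + 2) + (K + 1 - i) := by
  rw [chainRk₀, chain_mod hi, chain_div hi, vert_val]

theorem chainDep₀_node (v : Fin T.N) {i : ℕ} (hi : i < K + 2) :
    T.chainDep₀ M K B (v * (K + 2) + i) =
      (T.unitDepth M K B v - T.units M K B v) + (T.units M K B v - i) := by
  rw [chainDep₀, chain_mod hi, chain_div hi, vert_val]

theorem chain_cases {k : ℕ} (hk : k < T.N * (K + 2) + Fc) (hr : k ≠ K + 1) :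
    (∃ (v : Fin T.N) (i : ℕ), i < K + 1 ∧ k = v * (K + 2) + i) ∨
    (∃ v : Fin T.N, v ≠ T.root ∧ k = v * (K + 2) + (K + 1)) ∨
    ∃ f < Fc, k = T.N * (K + 2) + f := by
  by_cases hkN : k < T.N * (K + 2)
  · obtain ⟨v, i, hi, rfl⟩ := exists_chain hkN
    by_cases h : i < K + 1
    · exact Or.inl ⟨v, i, h, rfl⟩
    · obtain rfl : i = K + 1 := by omega
      refine Or.inr (Or.inl ⟨v, ?_, rfl⟩)
      rintro rfl
      rw [root_val, zero_mul, zero_add] at hr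
      exact hr rfl
  · exact Or.inr (Or.inr ⟨k - T.N * (K + 2), by omega, by omega⟩)

theorem units_le_unitDepth (hB : 0 ≤ B) (v : Fin T.N) :
    T.units M K B v ≤ T.unitDepth M K B v := by
  rw [unitDepth_par hB v]; omega

variable (T M K B Fc fpar)

/-- The subdivided tree. -/
noncomputable def chainTree (hB : 0 ≤ B) (hf : ∀ f < Fc, fpar f < T.N * (K + 2)) :
    ParentTree where
  S := T.N * (K + 2) + Fc
  root := K + 1
  par := T.chainPar K Fc fpar
  w := T.chainW M K B
  rk k := if k < T.N * (K + 2) then T.chainRk₀ K k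
    else T.chainRk₀ K (fpar (k - T.N * (K + 2))) + 1
  dep k := if k < T.N * (K + 2) then T.chainDep₀ M K B k
    else T.chainDep₀ M K B (fpar (k - T.N * (K + 2)))
  root_lt := by
    have := chain_lt (K := K) T.N_pos (show K + 1 < K + 2 by omega)
    omega
  par_root := chainPar_root.ge
  par_lt k hk hr := by
    rcases chain_cases hk hr with ⟨v, i, hi, rfl⟩ | ⟨v, hv, rfl⟩ | ⟨f, hf', rfl⟩
    · rw [chainPar_step v hi]
      have := chain_lt (K := K) v.2 (show i + 1 < K + 2 by omega)
      omega
    · rw [chainPar_last hv]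
      have := chain_lt (K := K) (T.par v).2 (show 0 < K + 2 by omega)
      omega
    · rw [chainPar_leaf]
      have := hf f hf'
      omega
  rk_par k hk hr := by
    rcases chain_cases hk hr with ⟨v, i, hi, rfl⟩ | ⟨v, hv, rfl⟩ | ⟨f, hf', rfl⟩
    · rw [chainPar_step v hi, if_pos (chain_lt v.2 (by omega)),
        if_pos (chain_lt v.2 (by omega)), chainRk₀_node v (by omega), chainRk₀_node v (by omega)]
      omega
    · rw [chainPar_last hv, if_pos (chain_lt v.2 (by omega)),
        if_pos (chain_lt (T.par v).2 (by omega)), chainRk₀_node v (by omega),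
        chainRk₀_node (T.par v) (by omega), ← par_hop hv, Nat.succ_mul]
      omega
    · rw [chainPar_leaf, if_neg (by omega), if_pos (hf f hf'), Nat.add_sub_cancel_left]
  dep_par k hk hr := by
    rcases chain_cases hk hr with ⟨v, i, hi, rfl⟩ | ⟨v, hv, rfl⟩ | ⟨f, hf', rfl⟩
    · rw [chainPar_step v hi, if_pos (chain_lt v.2 (by omega)),
        if_pos (chain_lt v.2 (by omega)), chainDep₀_node v (by omega),
        chainDep₀_node v (by omega), chainW_node v (by omega)]
      split_ifs <;> omega
    · rw [chainPar_last hv, if_pos (chain_lt v.2 (by omega)),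
        if_pos (chain_lt (T.par v).2 (by omega)), chainDep₀_node v (by omega),
        chainDep₀_node (T.par v) (by omega), chainW_node v (by omega)]
      have h1 : T.units M K B v ≤ K + 1 := unitsOf_le _ _
      have h2 := unitDepth_par (M := M) (K := K) hB v
      have h3 := units_le_unitDepth (M := M) (K := K) hB (T.par v)
      rw [if_neg (by omega)]
      omega
    · rw [chainPar_leaf, if_neg (by omega), if_pos (hf f hf'), Nat.add_sub_cancel_left,
        chainW_leaf, add_zero]

variable {T M K B Fc fpar} {hB : 0 ≤ B} {hf : ∀ f < Fc, fpar f < T.N * (K + 2)}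

theorem chainTree_w_le (k : ℕ) : (T.chainTree M K B Fc fpar hB hf).w k ≤ 1 := by
  change T.chainW M K B k ≤ 1
  unfold chainW; split_ifs <;> omega

theorem chainTree_dep_node (v : Fin T.N) {i : ℕ} (hi : i < K + 2) :
    (T.chainTree M K B Fc fpar hB hf).dep (v * (K + 2) + i) =
      (T.unitDepth M K B v - T.units M K B v) + (T.units M K B v - i) := by
  change (if _ then _ else _) = _
  rw [if_pos (chain_lt v.2 hi), chainDep₀_node v hi]

theorem chainTree_dep_vert (v : Fin T.N) :
    (T.chainTree M K B Fc fpar hB hf).dep (v * (K + 2)) = T.unitDepth M K B v := by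
  have := chainTree_dep_node (M := M) (B := B) (hB := hB) (hf := hf) v (show 0 < K + 2 by omega)
  rw [add_zero] at this
  rw [this]
  have := units_le_unitDepth (M := M) (K := K) hB v
  omega

theorem chainTree_dep_leaf {f : ℕ} (hf' : f < Fc) :
    (T.chainTree M K B Fc fpar hB hf).dep (T.N * (K + 2) + f) =
      (T.chainTree M K B Fc fpar hB hf).dep (fpar f) := by
  change (if _ then _ else _) = (if _ then _ else _)
  rw [if_neg (by omega), if_pos (hf f hf'), Nat.add_sub_cancel_left]

theorem chainTree_up_chain (v : Fin T.N) {i : ℕ} (hi : i < K + 2) :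
    (T.chainTree M K B Fc fpar hB hf).Up (v * (K + 2)) (v * (K + 2) + i) := by
  induction i with
  | zero => exact .refl _
  | succ i ih =>
    refine (ih (by omega)).trans (Relation.ReflTransGen.single ⟨?_, ?_, ?_⟩)
    · have := chain_lt (K := K) v.2 (show i < K + 2 by omega)
      exact this.trans_le (Nat.le_add_right _ _)
    · intro h
      have := congrArg (· % (K + 2)) h
      change (v * (K + 2) + i) % (K + 2) = (K + 1) % (K + 2) at this
      rw [chain_mod (by omega), Nat.mod_eq_of_lt (by omega)] at this
      omega
    · exact chainPar_step v (by omega)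

theorem chainTree_up_of_anc {a x : Fin T.N} (h : T.Anc a x) :
    (T.chainTree M K B Fc fpar hB hf).Up (a * (K + 2)) (x * (K + 2)) := by
  induction h with
  | refl => exact .refl _
  | @tail b c _ h ih =>
    refine (ih.trans (chainTree_up_chain b (show K + 1 < K + 2 by omega))).trans
      (Relation.ReflTransGen.single ⟨?_, ?_, ?_⟩)
    · exact (chain_lt b.2 (by omega)).trans_le (Nat.le_add_right _ _)
    · intro hh
      have := congrArg (· / (K + 2)) hh
      change (b * (K + 2) + (K + 1)) / (K + 2) = (K + 1) / (K + 2) at this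
      rw [chain_div (by omega), Nat.div_eq_of_lt (by omega)] at this
      exact h.1 (eq_root_iff.1 this)
    · rw [← h.2]; exact chainPar_last h.1

theorem anc_of_chainTree_up {a : Fin T.N} {y : ℕ}
    (h : (T.chainTree M K B Fc fpar hB hf).Up (a * (K + 2)) y) :
    ∃ (x : Fin T.N) (i : ℕ), i < K + 2 ∧ y = x * (K + 2) + i ∧ T.Anc a x := by
  induction h with
  | refl => exact ⟨a, 0, by omega, rfl, .refl _⟩
  | @tail b c _ h ih =>
    obtain ⟨x, i, hi, rfl, hx⟩ := ih
    rw [← h.2.2]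
    by_cases hi' : i < K + 1
    · exact ⟨x, i + 1, by omega, chainPar_step x hi', hx⟩
    · obtain rfl : i = K + 1 := by omega
      have hxr : x ≠ T.root := by
        rintro rfl
        apply h.2.1
        rw [root_val, zero_mul, zero_add]; rfl
      exact ⟨T.par x, 0, by omega, chainPar_last hxr,
        hx.trans (Relation.ReflTransGen.single ⟨hxr, rfl⟩)⟩

/-- A common ancestor inside a chain can be replaced by the vertex at its lower end, which is also a
common ancestor and no farther away. -/
theorem chainTree_near_iff {R : ℕ} {a b : Fin T.N} :
    (T.chainTree M K B Fc fpar hB hf).Near R (a * (K + 2)) (b * (K + 2)) ↔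
      T.UnitNear M K B R a b := by
  constructor
  · rintro ⟨y, h1, h2, h3⟩
    obtain ⟨x, i, hi, rfl, hx⟩ := anc_of_chainTree_up h1
    obtain ⟨x', i', hi', e, hx'⟩ := anc_of_chainTree_up h2
    have hxx : x' = x := by
      have := congrArg (· / (K + 2)) e
      simp only [chain_div hi, chain_div hi'] at this
      exact Fin.ext this.symm
    subst hxx
    refine ⟨x', hx, hx', ?_⟩
    rw [chainTree_dep_vert, chainTree_dep_vert, chainTree_dep_node x' hi] at h3
    have := units_le_unitDepth (M := M) (K := K) hB x'
    omega
  · rintro ⟨x, h1, h2, h3⟩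
    refine ⟨x * (K + 2), chainTree_up_of_anc h1, chainTree_up_of_anc h2, ?_⟩
    rw [chainTree_dep_vert, chainTree_dep_vert, chainTree_dep_vert]
    exact h3

/-- The leaf hangs on an edge of length `0` and is not an ancestor of any vertex. -/
theorem chainTree_near_leaf {R : ℕ} {a : Fin T.N} {f : ℕ} (hf' : f < Fc) :
    (T.chainTree M K B Fc fpar hB hf).Near R (a * (K + 2)) (T.N * (K + 2) + f) ↔
      (T.chainTree M K B Fc fpar hB hf).Near R (a * (K + 2)) (fpar f) := by
  have hroot : T.N * (K + 2) + f ≠ (T.chainTree M K B Fc fpar hB hf).root := by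
    have := chain_lt (K := K) T.N_pos (show K + 1 < K + 2 by omega)
    change _ ≠ K + 1
    omega
  have hS : T.N * (K + 2) + f < (T.chainTree M K B Fc fpar hB hf).S := by
    change _ < _ + _; omega
  have hp : (T.chainTree M K B Fc fpar hB hf).par (T.N * (K + 2) + f) = fpar f :=
    chainPar_leaf f
  constructor
  · rintro ⟨y, h1, h2, h3⟩
    rcases h2.eq_or with rfl | ⟨-, -, h2⟩
    · obtain ⟨x, i, hi, e, -⟩ := anc_of_chainTree_up h1
      have := chain_lt (K := K) x.2 hi
      omega
    · rw [hp] at h2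
      rw [chainTree_dep_leaf hf'] at h3
      exact ⟨y, h1, h2, h3⟩
  · rintro ⟨y, h1, h2, h3⟩
    refine ⟨y, h1, ?_, ?_⟩
    · have := ParentTree.up_par hS hroot
      rw [hp] at this
      exact this.trans h2
    · rw [chainTree_dep_leaf hf']; exact h3

end chain

end WeightedTree

namespace RAM

/-! ### Nested loops -/

theorem Off.setN {s : Stmt} {σ τ : State} (h : Off s σ τ) {i : ℕ} (hi : i ∈ s.wn) (v : ℕ) :
    Off s σ (τ.setN i v) :=
  ⟨fun j hj => by
    have : j ≠ i := by rintro rfl; exact hj hi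
    simp [this, h.nv j hj], h.rv, h.na, h.ra⟩

/-- Passes of the inner body are numbered lexicographically by `a * limVar + b`. The invariant must
not depend on the loop variables, which are also reset between passes. -/
theorem run_loop2 {x y : ℕ} {p : Stmt} {σ : State} (hxy : x ∉ y :: p.wn)
    (hL : limVar ∉ (Stmt.loop x (.loop y p)).wn) (I : ℕ → State → Prop)
    (hI : ∀ j τ v, I j τ → I j (τ.setN x v) ∧ I j (τ.setN y v)) (h0 : I 0 σ)
    (hs : ∀ a < σ.nv limVar, ∀ b < σ.nv limVar, ∀ τ, Off (.loop x (.loop y p)) σ τ →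
      τ.nv x = a → τ.nv y = b → I (a * σ.nv limVar + b) τ →
      I (a * σ.nv limVar + b + 1) (p.run τ)) :
    I (σ.nv limVar * σ.nv limVar) ((Stmt.loop x (.loop y p)).run σ) := by
  refine run_loop (fun a τ => I (a * σ.nv limVar) τ) (by simpa using h0) fun a ha τ hτ hIτ => ?_
  have hτ' : Off (.loop x (.loop y p)) σ (τ.setN x a) := hτ.setN (by simp [Stmt.wn]) _
  have e : (τ.setN x a).nv limVar = σ.nv limVar := hτ'.nv _ hL
  have := run_loop (x := y) (p := p) (σ := τ.setN x a)
    (fun b τ => I (a * σ.nv limVar + b) τ) (by simpa using (hI _ _ _ hIτ).1)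
    fun b hb υ hυ hIυ => ?_
  · rw [e] at this; rw [Nat.succ_mul]; exact this
  · rw [e] at hb
    have hsub : Off (.loop x (.loop y p)) (τ.setN x a) υ :=
      hυ.mono (by simp [Stmt.wn]) (by simp [Stmt.wr]) (by simp [Stmt.wna]) (by simp [Stmt.wra])
    have hx : υ.nv x = a := by
      rw [hυ.nv x hxy]; simp
    refine hs a ha b hb (υ.setN y b) ((hτ'.trans hsub).setN (by simp [Stmt.wn]) _) ?_ (by simp)
      (hI _ _ _ hIυ).2
    have : x ≠ y := fun h => hxy (by simp [h])
    simp [this, hx]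

theorem run_loop3 {x y z : ℕ} {p : Stmt} {σ : State} (hxy : x ∉ y :: z :: p.wn)
    (hyz : y ∉ z :: p.wn)
    (hL : limVar ∉ (Stmt.loop x (.loop y (.loop z p))).wn) (I : ℕ → State → Prop)
    (hI : ∀ j τ v, I j τ → I j (τ.setN x v) ∧ I j (τ.setN y v) ∧ I j (τ.setN z v)) (h0 : I 0 σ)
    (hs : ∀ a < σ.nv limVar, ∀ b < σ.nv limVar, ∀ c < σ.nv limVar, ∀ τ,
      Off (.loop x (.loop y (.loop z p))) σ τ → τ.nv x = a → τ.nv y = b → τ.nv z = c →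
      I ((a * σ.nv limVar + b) * σ.nv limVar + c) τ →
      I ((a * σ.nv limVar + b) * σ.nv limVar + c + 1) (p.run τ)) :
    I (σ.nv limVar * σ.nv limVar * σ.nv limVar) ((Stmt.loop x (.loop y (.loop z p))).run σ) := by
  refine run_loop2 hxy hL (fun a τ => I (a * σ.nv limVar) τ)
    (fun j τ v h => ⟨(hI _ _ _ h).1, (hI _ _ _ h).2.1⟩) (by simpa using h0)
    fun a ha b hb τ hτ hx hy hIτ => ?_
  have e : τ.nv limVar = σ.nv limVar := hτ.nv _ hL
  have := run_loop (x := z) (p := p) (σ := τ)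
    (fun c τ => I ((a * σ.nv limVar + b) * σ.nv limVar + c) τ) (by simpa using hIτ)
    fun c hc υ hυ hIυ => ?_
  · rw [e] at this; rw [Nat.succ_mul]; exact this
  · rw [e] at hc
    have hsub : Off (.loop x (.loop y (.loop z p))) τ υ :=
      hυ.mono (by simp [Stmt.wn]) (by simp [Stmt.wr]) (by simp [Stmt.wna]) (by simp [Stmt.wra])
    refine hs a ha b hb c hc (υ.setN z c) ((hτ.trans hsub).setN (by simp [Stmt.wn]) _) ?_ ?_
      (by simp) (hI _ _ _ hIυ).2.2
    · have : x ≠ z := fun h => hxy (by simp [h])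
      have hx' : υ.nv x = τ.nv x := hυ.nv x fun h => hxy (List.mem_cons_of_mem _ h)
      simp [this, hx', hx]
    · have : y ≠ z := fun h => hyz (by simp [h])
      have hy' : υ.nv y = τ.nv y := hυ.nv y hyz
      simp [this, hy', hy]

/-! ### Least fixed points -/

/-- A monotone operator on the subsets of an initial segment of length `n` reaches its least
fixed point within `n` steps. -/
theorem iterate_fixed {f : Set ℕ → Set ℕ} (hf : Monotone f) {n : ℕ}
    (hn : ∀ Z, f Z ⊆ Set.Iio n) : f (f^[n] ∅) = f^[n] ∅ := by
  have hsucc : ∀ j, f^[j] ∅ ⊆ f^[j + 1] ∅ := by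
    intro j
    induction j with
    | zero => exact Set.empty_subset _
    | succ j ih =>
      rw [Function.iterate_succ_apply' f j, Function.iterate_succ_apply' f (j + 1)]
      exact hf ih
  have hsub : ∀ j, f^[j] ∅ ⊆ Set.Iio n := by
    intro j
    cases j with
    | zero => exact Set.empty_subset _
    | succ j => rw [Function.iterate_succ_apply']; exact hn _
  by_contra hne
  -- If the `n`-th stage is not fixed, no earlier one is, so `n + 1` stages would each add an
  -- element to a set of at most `n` elements.
  have hstrict : ∀ j ≤ n, j + 1 ≤ (f^[j + 1] ∅).ncard := by
    intro j
    induction j with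
    | zero =>
      intro _
      rw [Nat.succ_le_iff, Set.ncard_pos ((Set.finite_Iio n).subset (hsub _))]
      by_contra h
      rw [Set.not_nonempty_iff_eq_empty] at h
      have h : f ∅ = ∅ := h
      exact hne (by rw [Function.iterate_fixed h, h])
    | succ j ih =>
      intro hj
      have ih := ih (by omega)
      refine Nat.lt_of_le_of_lt ih (Set.ncard_lt_ncard ?_ ((Set.finite_Iio n).subset (hsub _)))
      refine (hsucc _).ssubset_of_ne fun h => hne ?_
      obtain ⟨d, rfl⟩ : ∃ d, n = d + (j + 1) := ⟨n - (j + 1), by omega⟩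
      have hfix : f (f^[j + 1] ∅) = f^[j + 1] ∅ := by
        rw [← Function.iterate_succ_apply' f]; exact h.symm
      rw [Function.iterate_add_apply, Function.iterate_fixed hfix, hfix]
  have h1 := hstrict n le_rfl
  have h2 := Set.ncard_le_ncard (hsub (n + 1)) (Set.finite_Iio n)
  rw [Set.ncard_Iio_nat] at h2
  omega

/-! ### Closure programs -/

/-- The cell of the table with the position given by the loop variables `20`, `21` and `22`. -/
def cellIdx : Tm := .pair (.pair (.var 20) (.var 21)) (.var 22)

/-- One round of adding to the table, the array `12`, the positions at which `t` holds. -/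
def roundStmt (t : Tm) : Stmt :=
  .loop 20 (.loop 21 (.loop 22
    (.nstore 12 cellIdx (.ite (.or (.arr 12 cellIdx) t) (.const 1) (.const 0)))))

def clearStmt : Stmt := .loop 20 (.loop 21 (.loop 22 (.nstore 12 cellIdx (.const 0))))

/-- Starting from the empty table, add positions at which `t` holds, until nothing changes. -/
def closureStmt (t : Tm) : Stmt :=
  -- The three outer loops yield as many rounds as there are cells, which is enough by
  -- `iterate_fixed`.
  .seq clearStmt (.loop 28 (.loop 29 (.loop 30 (roundStmt t))))

/-- The positions in the table. -/
def table (n : ℕ) (σ : State) : Set ℕ := {i | i < n ∧ σ.na 12 i ≠ 0}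

theorem idx_lt {L a b c : ℕ} (ha : a < L) (hb : b < L) (hc : c < L) :
    (a * L + b) * L + c < L * L * L := by
  have := pair_lt ha hb
  nlinarith

/-- Additions take effect within the same round, so the result is not exactly one application of
`f`. It is caught between `f Z` and every closed set that contains the old table, and this
determines the limit. -/
theorem run_round {t : Tm} {σ : State} {f : Set ℕ → Set ℕ} (hf : Monotone f)
    (ht : ∀ a < σ.nv limVar, ∀ b < σ.nv limVar, ∀ c < σ.nv limVar, ∀ τ, Off (roundStmt t) σ τ →
      τ.nv 20 = a → τ.nv 21 = b → τ.nv 22 = c →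
      (t.tt τ ↔ (a * σ.nv limVar + b) * σ.nv limVar + c ∈
        f (table (σ.nv limVar * σ.nv limVar * σ.nv limVar) τ)))
    (hn : ∀ Z, f Z ⊆ Set.Iio (σ.nv limVar * σ.nv limVar * σ.nv limVar))
    {Z : Set ℕ} (hZ : Z ⊆ table (σ.nv limVar * σ.nv limVar * σ.nv limVar) σ) :
    f Z ⊆ table (σ.nv limVar * σ.nv limVar * σ.nv limVar) ((roundStmt t).run σ) ∧
    ∀ G, f G ⊆ G → table (σ.nv limVar * σ.nv limVar * σ.nv limVar) σ ⊆ G →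
      table (σ.nv limVar * σ.nv limVar * σ.nv limVar) ((roundStmt t).run σ) ⊆ G := by
  set L := σ.nv limVar with hLdef
  have main := run_loop3 (x := 20) (y := 21) (z := 22) (σ := σ)
    (p := .nstore 12 cellIdx (.ite (.or (.arr 12 cellIdx) t) (.const 1) (.const 0)))
    (by simp [Stmt.wn]) (by simp [Stmt.wn]) (by simp [Stmt.wn])
    (fun j τ => Z ⊆ table (L * L * L) τ ∧ (∀ i < j, i ∈ f Z → τ.na 12 i ≠ 0) ∧
      ∀ G, f G ⊆ G → table (L * L * L) σ ⊆ G → table (L * L * L) τ ⊆ G)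
    (fun j τ v h => ⟨h, h, h⟩) ⟨hZ, by simp, fun _ _ h => h⟩
    (fun a ha b hb c hc τ hτ h20 h21 h22 hI => by
      obtain ⟨h1, h2, h3⟩ := hI
      have hlim : τ.nv limVar = L := hτ.nv _ (by simp [Stmt.wn])
      have hidx : cellIdx.eval τ = (a * L + b) * L + c := by
        simp [cellIdx, h20, h21, h22, hlim]
      have ht' := ht a ha b hb c hc τ hτ h20 h21 h22
      rw [← hLdef] at h2 ⊢
      set m := (a * L + b) * L + c with hm
      have hcond : (Tm.or (.arr 12 cellIdx) t).tt τ ↔ τ.na 12 m ≠ 0 ∨ m ∈ f (table (L * L * L) τ) := by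
        rw [Tm.tt_or, Tm.tt_arr, hidx, ht']
      have hna : ∀ i, ((Stmt.nstore 12 cellIdx (.ite (.or (.arr 12 cellIdx) t) (.const 1)
          (.const 0))).run τ).na 12 i ≠ 0 ↔
          τ.na 12 i ≠ 0 ∨ (i = m ∧ m ∈ f (table (L * L * L) τ)) := by
        intro i
        simp only [Stmt.run, storeN_na, hidx, true_and, Tm.eval_cond]
        by_cases him : i = m
        · subst him
          simp only [if_true, true_and]
          rw [← hcond]
          split_ifs with h <;> simp [h]
        · simp [him]
      have hsub : table (L * L * L) τ ⊆ table (L * L * L) ((Stmt.nstore 12 cellIdx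
          (.ite (.or (.arr 12 cellIdx) t) (.const 1) (.const 0))).run τ) :=
        fun i hi => ⟨hi.1, (hna i).2 (Or.inl hi.2)⟩
      refine ⟨h1.trans hsub, fun i hi hif => ?_, fun G hG hσ i hi => ?_⟩
      · rw [hna]
        rcases Nat.lt_succ_iff_lt_or_eq.1 hi with h | h
        · exact Or.inl (h2 i h hif)
        · exact Or.inr ⟨h, h ▸ hf h1 hif⟩
      · rcases (hna i).1 hi.2 with h | ⟨h, h'⟩
        · exact h3 G hG hσ ⟨hi.1, h⟩
        · rw [h]; exact hG (hf (h3 G hG hσ) h'))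
  exact ⟨fun i hi => ⟨hn _ hi, main.2.1 i (hn _ hi) hi⟩, main.2.2⟩

theorem run_clear (σ : State) (n : ℕ) (hn : n = σ.nv limVar * σ.nv limVar * σ.nv limVar) :
    table n (clearStmt.run σ) = ∅ := by
  have main := run_loop3 (x := 20) (y := 21) (z := 22) (σ := σ) (p := .nstore 12 cellIdx (.const 0))
    (by simp [Stmt.wn]) (by simp [Stmt.wn]) (by simp [Stmt.wn])
    (fun j τ => ∀ i < j, τ.na 12 i = 0)
    (fun j τ v h => ⟨h, h, h⟩) (by simp)
    (fun a ha b hb c hc τ hτ h20 h21 h22 hI i hi => by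
      have hlim : τ.nv limVar = σ.nv limVar := hτ.nv _ (by simp [Stmt.wn])
      have hidx : cellIdx.eval τ = (a * σ.nv limVar + b) * σ.nv limVar + c := by
        simp [cellIdx, h20, h21, h22, hlim]
      simp only [Stmt.run, storeN_na, true_and, hidx, Tm.eval_const]
      split_ifs with h
      · rfl
      · exact hI i (by omega))
  ext i
  simp only [table, Set.mem_ofPred_eq, Set.mem_empty_iff_false, iff_false, not_and, not_not]
  intro hi
  exact main i (hn ▸ hi)

/-- The closure program computes the least fixed point. -/
theorem run_closure {t : Tm} {σ : State} {f : Set ℕ → Set ℕ} (hf : Monotone f) {n : ℕ}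
    (hn' : n = σ.nv limVar * σ.nv limVar * σ.nv limVar)
    (ht : ∀ a < σ.nv limVar, ∀ b < σ.nv limVar, ∀ c < σ.nv limVar, ∀ τ,
      Off (closureStmt t) σ τ → τ.nv 20 = a → τ.nv 21 = b → τ.nv 22 = c →
      (t.tt τ ↔ (a * σ.nv limVar + b) * σ.nv limVar + c ∈ f (table n τ)))
    (hn : ∀ Z, f Z ⊆ Set.Iio n) :
    f (table n ((closureStmt t).run σ)) = table n ((closureStmt t).run σ) ∧
    ∀ G, f G ⊆ G → table n ((closureStmt t).run σ) ⊆ G := by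
  have hclear : Off (closureStmt t) σ (clearStmt.run σ) :=
    (Off.run clearStmt σ).mono (by simp [closureStmt, Stmt.wn]) (by simp [closureStmt, Stmt.wr])
      (by simp [closureStmt, Stmt.wna]) (by simp [closureStmt, Stmt.wra])
  have hlim : (clearStmt.run σ).nv limVar = σ.nv limVar :=
    (Off.run clearStmt σ).nv _ (by simp [clearStmt, Stmt.wn])
  have main := run_loop3 (x := 28) (y := 29) (z := 30) (σ := clearStmt.run σ) (p := roundStmt t)
    (by simp [Stmt.wn, roundStmt]) (by simp [Stmt.wn, roundStmt]) (by simp [Stmt.wn, roundStmt])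
    (fun j τ => f^[j] ∅ ⊆ table n τ ∧ ∀ G, f G ⊆ G → table n τ ⊆ G)
    (fun j τ v h => ⟨h, h, h⟩)
    ⟨Set.empty_subset _, fun G _ => by rw [run_clear σ n hn']; exact Set.empty_subset _⟩
    (fun a ha b hb c hc τ hτ _ _ _ hI => by
      have hlim' : τ.nv limVar = σ.nv limVar := by
        rw [← hlim]; exact hτ.nv _ (by simp [Stmt.wn, roundStmt])
      have hτ' : Off (closureStmt t) σ τ := hclear.trans
        (hτ.mono (by simp [closureStmt, Stmt.wn]) (by simp [closureStmt, Stmt.wr])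
          (by simp [closureStmt, Stmt.wna]) (by simp [closureStmt, Stmt.wra]))
      have := run_round (t := t) (σ := τ) hf (by
        rw [hlim', ← hn']
        intro a ha b hb c hc υ hυ
        refine ht a ha b hb c hc υ (hτ'.trans (hυ.mono ?_ ?_ ?_ ?_))
        · simp [roundStmt, closureStmt, clearStmt, Stmt.wn]
        · simp [roundStmt, closureStmt, clearStmt, Stmt.wr]
        · simp [roundStmt, closureStmt, clearStmt, Stmt.wna]
        · simp [roundStmt, closureStmt, clearStmt, Stmt.wra]) (by rw [hlim', ← hn']; exact hn)
        (Z := f^[(a * (clearStmt.run σ).nv limVar + b) * (clearStmt.run σ).nv limVar + c] ∅)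
        (by rw [hlim', ← hn']; exact hI.1)
      rw [hlim', ← hn'] at this
      rw [Function.iterate_succ_apply']
      exact ⟨this.1, fun G hG => this.2 G hG (hI.2 G hG)⟩)
  rw [hlim, ← hn'] at main
  have hfix := iterate_fixed hf hn
  have heq : table n ((closureStmt t).run σ) = f^[n] ∅ :=
    Set.Subset.antisymm (main.2 _ hfix.le) main.1
  rw [heq]
  exact ⟨hfix, fun G hG => heq ▸ main.2 G hG⟩

end RAM

namespace RAM

/-! ### The program that decides solvability

Natural variables: `13` the number of nodes, `14` the radius plus `1`, `16` the root; natural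
arrays: `10` the parents, `11` the edge lengths, `13` the numbers of users of the nodes, `14` the
permitted numbers of users of the nodes, `15` the digits of the codes of vectors.
A position `(k, c, s)` in the table stands for the node `k`, together with its subtrees at
children below `c`, and the vector with code `s`. -/

/-- The derivation rules, for positions in the table `X`. -/
def GRule (L R S : ℕ) (par w ub al V : ℕ → ℕ) (X : ℕ → ℕ → ℕ → Prop) (k c s : ℕ) : Prop :=
  -- Here `R` is the radius plus one: the digits below `R` count open users by distance, the next
  -- `R` digits the demands. The four rules are: a single node, passing over a number that is not a
  -- child, merging a child, matching a user with a demand.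
  (c = 0 ∧ V (s * L) = ub k ∧ al (k * L + V (s * L + R)) ≠ 0 ∧
    ∀ t < L, 0 < t → t < R → V (s * L + t) = 0 ∧ V (s * L + (R + t)) = 0) ∨
  (0 < c ∧ par (c - 1) ≠ k ∧ X k (c - 1) s) ∨
  (0 < c ∧ par (c - 1) = k ∧ ∃ s₁ < L, X k (c - 1) s₁ ∧ ∃ s₂ < L, X (c - 1) S s₂ ∧
    ∀ t < L, t < R →
      (V (s₂ * L + t) ≠ 0 → t + w (c - 1) < R) ∧ (V (s₂ * L + (R + t)) ≠ 0 → t + w (c - 1) < R) ∧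
      V (s * L + t) = V (s₁ * L + t) +
        (if w (c - 1) < t + 1 then V (s₂ * L + (t - w (c - 1))) else 0) ∧
      V (s * L + (R + t)) = V (s₁ * L + (R + t)) +
        (if w (c - 1) < t + 1 then V (s₂ * L + (R + (t - w (c - 1)))) else 0)) ∨
  ∃ s₁ < L, X k c s₁ ∧ ∃ i < L, ∃ j < L, i + j < R ∧ ∀ t < L, t < R →
    V (s₁ * L + t) = V (s * L + t) + (if t = i then 1 else 0) ∧
    V (s₁ * L + (R + t)) = V (s * L + (R + t)) + (if t = j then 1 else 0)

theorem GRule.mono {L R S : ℕ} {par w ub al V : ℕ → ℕ} {X Y : ℕ → ℕ → ℕ → Prop} {k c s : ℕ}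
    (hS : S < L) (hk : k < L) (hc : c < L) (hs : s < L)
    (h : ∀ k < L, ∀ c < L, ∀ s < L, X k c s → Y k c s) :
    GRule L R S par w ub al V X k c s → GRule L R S par w ub al V Y k c s := by
  rintro (h1 | ⟨h1, h2, h3⟩ | ⟨h1, h2, s₁, h3, h4, s₂, h5, h6, h7⟩ | ⟨s₁, h3, h4, h5⟩)
  · exact Or.inl h1
  · exact Or.inr (Or.inl ⟨h1, h2, h _ hk _ (by omega) _ hs h3⟩)
  · exact Or.inr (Or.inr (Or.inl ⟨h1, h2, s₁, h3, h _ hk _ (by omega) _ h3 h4, s₂, h5,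
      h _ (by omega) _ hS _ h5 h6, h7⟩))
  · exact Or.inr (Or.inr (Or.inr ⟨s₁, h3, h _ hk _ hc _ h3 h4, h5⟩))

def cellTm (k c s : Tm) : Tm := .arr 12 (.pair (.pair k c) s)
def digTm (s t : Tm) : Tm := .arr 15 (.pair s t)
def impTm (a b : Tm) : Tm := .or a.not b

@[simp] theorem tt_impTm (a b : Tm) (σ : State) : (impTm a b).tt σ ↔ (a.tt σ → b.tt σ) := by
  simp only [impTm, Tm.tt_or, Tm.tt_not]; tauto

def initRule : Tm :=
  .and (.eq (.var 21) (.const 0))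
    (.and (.eq (digTm (.var 22) (.const 0)) (.arr 13 (.var 20)))
      (.and (.arr 14 (.pair (.var 20) (digTm (.var 22) (.var 14))))
        (.all 25 (impTm (.lt (.const 0) (.var 25)) (impTm (.lt (.var 25) (.var 14))
          (.and (.eq (digTm (.var 22) (.var 25)) (.const 0))
            (.eq (digTm (.var 22) (.add (.var 14) (.var 25))) (.const 0))))))))

def skipRule : Tm :=
  .and (.lt (.const 0) (.var 21))
    (.and (.not (.eq (.arr 10 (.sub (.var 21) (.const 1))) (.var 20)))
      (cellTm (.var 20) (.sub (.var 21) (.const 1)) (.var 22)))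

/-- The length of the edge from the last child to its parent. -/
def childW : Tm := .arr 11 (.sub (.var 21) (.const 1))

def mergeRule : Tm :=
  .and (.lt (.const 0) (.var 21))
    (.and (.eq (.arr 10 (.sub (.var 21) (.const 1))) (.var 20))
      (.ex 23 (.and (cellTm (.var 20) (.sub (.var 21) (.const 1)) (.var 23))
        (.ex 24 (.and (cellTm (.sub (.var 21) (.const 1)) (.var 13) (.var 24))
          (.all 25 (impTm (.lt (.var 25) (.var 14))
            (.and (impTm (digTm (.var 24) (.var 25)) (.lt (.add (.var 25) childW) (.var 14)))
            (.and (impTm (digTm (.var 24) (.add (.var 14) (.var 25)))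
              (.lt (.add (.var 25) childW) (.var 14)))
            (.and (.eq (digTm (.var 22) (.var 25)) (.add (digTm (.var 23) (.var 25))
              (.ite (.lt childW (.add (.var 25) (.const 1)))
                (digTm (.var 24) (.sub (.var 25) childW)) (.const 0))))
            (.eq (digTm (.var 22) (.add (.var 14) (.var 25)))
              (.add (digTm (.var 23) (.add (.var 14) (.var 25)))
              (.ite (.lt childW (.add (.var 25) (.const 1)))
                (digTm (.var 24) (.add (.var 14) (.sub (.var 25) childW)))
                (.const 0))))))))))))))

def cancelRule : Tm :=
  .ex 23 (.and (cellTm (.var 20) (.var 21) (.var 23))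
    (.ex 26 (.ex 27 (.and (.lt (.add (.var 26) (.var 27)) (.var 14))
      (.all 25 (impTm (.lt (.var 25) (.var 14))
        (.and (.eq (digTm (.var 23) (.var 25)) (.add (digTm (.var 22) (.var 25))
          (.ite (.eq (.var 25) (.var 26)) (.const 1) (.const 0))))
        (.eq (digTm (.var 23) (.add (.var 14) (.var 25)))
          (.add (digTm (.var 22) (.add (.var 14) (.var 25)))
          (.ite (.eq (.var 25) (.var 27)) (.const 1) (.const 0)))))))))))

def ruleTm : Tm := .or initRule (.or skipRule (.or mergeRule cancelRule))

theorem tt_ruleTm (τ : State) : ruleTm.tt τ ↔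
    GRule (τ.nv limVar) (τ.nv 14) (τ.nv 13) (τ.na 10) (τ.na 11) (τ.na 13) (τ.na 14) (τ.na 15)
      (fun k c s => τ.na 12 ((k * τ.nv limVar + c) * τ.nv limVar + s) ≠ 0)
      (τ.nv 20) (τ.nv 21) (τ.nv 22) := by
  simp only [ruleTm, GRule, initRule, skipRule, mergeRule, cancelRule, cellTm, digTm, childW,
    Tm.tt_or, Tm.tt_and, Tm.tt_eq, Tm.tt_lt, Tm.tt_not, Tm.tt_arr, Tm.tt_ex, Tm.tt_all, tt_impTm,
    Tm.eval_var, Tm.eval_const, Tm.eval_arr, Tm.eval_add, Tm.eval_sub, Tm.eval_pair, Tm.eval_ite,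
    setN_nv, setN_na, limVar, Nat.reduceEqDiff, if_true, if_false, add_zero]

/-- The program that decides solvability; the answer is left in the variable `31`. -/
def oracleStmt : Stmt :=
  .seq (closureStmt ruleTm)
    (.nset 31 (.ite (cellTm (.var 16) (.var 13) (.const 0)) (.const 1) (.const 0)))

/-- The digit of `s` at position `t` in base `W`. -/
def digit (W s t : ℕ) : ℕ := s / W ^ t % W

theorem exists_digits {W D : ℕ} {v : ℕ → ℕ} (hv : ∀ t, v t < W) :
    ∃ s < W ^ D, ∀ t < D, digit W s t = v t := by
  refine ⟨finFunctionFinEquiv (fun t : Fin D => (⟨v t, hv t⟩ : Fin W)), Fin.is_lt _,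
    fun t ht => ?_⟩
  exact congrArg (fun f => (f ⟨t, ht⟩ : Fin W).val)
    (finFunctionFinEquiv.symm_apply_apply (fun t : Fin D => (⟨v t, hv t⟩ : Fin W)))

theorem digit_lt {W : ℕ} (hW : 0 < W) (s t : ℕ) : digit W s t < W := Nat.mod_lt _ hW

/-- What the program for solvability expects in the memory. -/
structure OracleEnv (F : ParentTree) (R W : ℕ) (nd : ℕ → ℕ) (U : Finset ℕ) (al : ℕ → ℕ → Prop)
    (σ : State) : Prop where
  S_lt : F.S < σ.nv limVar
  R_le : 2 * (R + 1) ≤ σ.nv limVar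
  W_pow : W ^ (2 * (R + 1)) ≤ σ.nv limVar
  v13 : σ.nv 13 = F.S
  v14 : σ.nv 14 = R + 1
  v16 : σ.nv 16 = F.root
  a10 : ∀ k < F.S, σ.na 10 k = F.par k
  a11 : ∀ k < F.S, σ.na 11 k = F.w k
  a15 : ∀ s < σ.nv limVar, ∀ t < 2 * (R + 1), σ.na 15 (s * σ.nv limVar + t) = digit W s t
  card_lt : U.card < W
  nd_lt : ∀ u ∈ U, nd u < F.S
  a13 : ∀ k < F.S, σ.na 13 k = (U.filter fun u => nd u = k).card
  a14 : ∀ k < F.S, ∀ x < W, σ.na 14 (k * σ.nv limVar + x) ≠ 0 ↔ al k x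

/-- The table is the least set closed under the rules. For soundness, the positions whose vectors
are realizable in the sense of `Sem` are closed; for completeness, `Solvable.complete` is applied to
membership in the table. -/
theorem oracle_spec {F : ParentTree} {R W : ℕ} {nd : ℕ → ℕ} {U : Finset ℕ} {al : ℕ → ℕ → Prop}
    {σ : State} (h : OracleEnv F R W nd U al σ) :
    (oracleStmt.run σ).nv 31 ≠ 0 ↔ F.Solvable R nd U al := by
  classical
  set L := σ.nv limVar with hL
  let Q := GRule L (R + 1) F.S (σ.na 10) (σ.na 11) (σ.na 13) (σ.na 14) (σ.na 15)
  let f : Set ℕ → Set ℕ := fun Z => {i | ∃ a < L, ∃ b < L, ∃ c < L, i = (a * L + b) * L + c ∧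
    Q (fun k c s => (k * L + c) * L + s ∈ Z) a b c}
  have hmem : ∀ Z, ∀ a < L, ∀ b < L, ∀ c < L, (a * L + b) * L + c ∈ f Z ↔
      Q (fun k c s => (k * L + c) * L + s ∈ Z) a b c := by
    intro Z a ha b hb c hc
    constructor
    · rintro ⟨a', ha', b', hb', c', hc', he, hQ⟩
      rw [pair_inj hc hc', pair_inj hb hb'] at he
      obtain ⟨⟨rfl, rfl⟩, rfl⟩ := he
      exact hQ
    · intro hQ; exact ⟨a, ha, b, hb, c, hc, rfl, hQ⟩
  have hf : Monotone f := by
    rintro Z Z' hZ i ⟨a, ha, b, hb, c, hc, he, hQ⟩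
    exact ⟨a, ha, b, hb, c, hc, he,
      GRule.mono h.S_lt ha hb hc (fun _ _ _ _ _ _ h => hZ h) hQ⟩
  have main := run_closure (t := ruleTm) (σ := σ) hf rfl (fun a ha b hb c hc τ hτ h20 h21 h22 => by
      have hlim : τ.nv limVar = L := hτ.nv _ (by simp [Stmt.wn, closureStmt, clearStmt, roundStmt])
      rw [tt_ruleTm, hmem _ a ha b hb c hc, hlim, h20, h21, h22,
        hτ.nv 14 (by simp [Stmt.wn, closureStmt, clearStmt, roundStmt]), h.v14,
        hτ.nv 13 (by simp [Stmt.wn, closureStmt, clearStmt, roundStmt]), h.v13,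
        hτ.na 10 (by simp [Stmt.wna, closureStmt, clearStmt, roundStmt]),
        hτ.na 11 (by simp [Stmt.wna, closureStmt, clearStmt, roundStmt]),
        hτ.na 13 (by simp [Stmt.wna, closureStmt, clearStmt, roundStmt]),
        hτ.na 14 (by simp [Stmt.wna, closureStmt, clearStmt, roundStmt]),
        hτ.na 15 (by simp [Stmt.wna, closureStmt, clearStmt, roundStmt])]
      constructor
      · exact GRule.mono h.S_lt ha hb hc fun k hk c hc s hs hX => ⟨idx_lt hk hc hs, hX⟩
      · exact GRule.mono h.S_lt ha hb hc fun k hk c hc s hs hX => hX.2)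
    (by
      rintro Z i ⟨a, ha, b, hb, c, hc, rfl, -⟩
      exact idx_lt ha hb hc)
  set υ := (closureStmt ruleTm).run σ with hυ
  have hoff : Off (closureStmt ruleTm) σ υ := Off.run _ _
  have hlim : υ.nv limVar = L := hoff.nv _ (by simp [Stmt.wn, closureStmt, clearStmt, roundStmt])
  have h13 : υ.nv 13 = F.S :=
    (hoff.nv _ (by simp [Stmt.wn, closureStmt, clearStmt, roundStmt])).trans h.v13
  have h16 : υ.nv 16 = F.root :=
    (hoff.nv _ (by simp [Stmt.wn, closureStmt, clearStmt, roundStmt])).trans h.v16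
  have hL0 : 0 < L := by have := h.S_lt; omega
  have hrt : F.root < L := F.root_lt.trans h.S_lt
  set Z := table (L * L * L) υ with hZ
  have hres : (oracleStmt.run σ).nv 31 ≠ 0 ↔ (F.root * L + F.S) * L + 0 ∈ Z := by
    have : (F.root * L + F.S) * L + 0 ∈ Z ↔ υ.na 12 ((F.root * L + F.S) * L + 0) ≠ 0 :=
      ⟨fun h => h.2, fun h' => ⟨idx_lt hrt h.S_lt hL0, h'⟩⟩
    rw [this]
    change ((Stmt.nset 31 _).run υ).nv 31 ≠ 0 ↔ _
    simp only [Stmt.run, setN_nv, if_true, Tm.eval_cond, cellTm, Tm.tt_arr, Tm.eval_pair,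
      Tm.eval_var, Tm.eval_const, hlim, h13, h16]
    split_ifs with hc <;> simp_all
  have hV : ∀ s < L, ∀ t < 2 * (R + 1), σ.na 15 (s * L + t) = digit W s t := h.a15
  rw [hres]
  constructor
  · -- soundness
    intro hmemZ
    -- Numbers that do not encode a position of the tree belong to `G` vacuously.
    let G : Set ℕ := {i | ∀ k < F.S, ∀ c ≤ F.S, ∀ s < L, i = (k * L + c) * L + s →
      F.Sem R nd U al k (F.sub k c) (fun t => digit W s t) (fun t => digit W s (R + 1 + t))}
    have hG : f G ⊆ G := by
      rintro i ⟨a, ha, b, hb, s, hs, rfl, hQ⟩ k hk c hc s' hs' he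
      have hSL := h.S_lt
      rw [pair_inj hs hs', pair_inj hb (by omega)] at he
      obtain ⟨⟨rfl, rfl⟩, rfl⟩ := he
      have hRL := h.R_le
      rcases hQ with ⟨rfl, h2, h3, h4⟩ | ⟨h1, h2, h3⟩ | ⟨h1, h2, s₁, h3, h4, s₂, h5, h6, h7⟩ |
        ⟨s₁, h3, h4, i, hi, j, hj, hij, h5⟩
      · rw [ParentTree.sub_zero hk]
        have e := hV s hs 0 (by omega)
        rw [add_zero] at e
        refine ParentTree.Sem.init ?_ ?_ ?_
        · rw [← e, h2, h.a13 a hk]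
        · rw [hV s hs _ (by omega)] at h3
          exact (h.a14 a hk _ (digit_lt (by have := h.card_lt; omega) _ _)).1 h3
        · intro i hi hi0
          have := h4 i (by omega) (by omega) (by omega)
          rwa [hV s hs _ (by omega), hV s hs _ (by omega)] at this
      · obtain ⟨d, rfl⟩ : ∃ d, b = d + 1 := ⟨b - 1, by omega⟩
        rw [Nat.add_sub_cancel] at h2 h3
        rw [h.a10 d (by omega)] at h2
        rw [ParentTree.sub_skip h2]
        exact h3 a hk d (by omega) s hs rfl
      · obtain ⟨d, rfl⟩ : ∃ d, b = d + 1 := ⟨b - 1, by omega⟩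
        rw [Nat.add_sub_cancel] at h2 h4 h6 h7
        have hd : d < F.S := by omega
        rw [h.a10 d hd] at h2
        rw [h.a11 d hd] at h7
        rw [ParentTree.sub_succ hd h2]
        have s1 := h4 a hk d (by omega) s₁ h3 rfl
        have s2 := h6 d hd F.S le_rfl s₂ h5 rfl
        have hdep := F.dep_par d hd (ParentTree.ne_root_of_par hk h2)
        rw [h2] at hdep
        have h7 : ∀ t ≤ R, (digit W s₂ t ≠ 0 → t + F.w d < R + 1) ∧
            (digit W s₂ (R + 1 + t) ≠ 0 → t + F.w d < R + 1) ∧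
            digit W s t = digit W s₁ t + (if F.w d ≤ t then digit W s₂ (t - F.w d) else 0) ∧
            digit W s (R + 1 + t) = digit W s₁ (R + 1 + t) +
              (if F.w d ≤ t then digit W s₂ (R + 1 + (t - F.w d)) else 0) := by
          intro t ht
          have := h7 t (by omega) (by omega)
          rw [hV s hs _ (by omega), hV s hs _ (by omega), hV s₁ h3 _ (by omega),
            hV s₁ h3 _ (by omega), hV s₂ h5 _ (by omega), hV s₂ h5 _ (by omega),
            hV s₂ h5 _ (by omega), hV s₂ h5 _ (by omega)] at this
          simpa only [Nat.lt_succ_iff] using this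
        refine (ParentTree.Sem.union s1 (s2.lift (b' := fun t =>
          if F.w d ≤ t then digit W s₂ (t - F.w d) else 0) (a' := fun t =>
          if F.w d ≤ t then digit W s₂ (R + 1 + (t - F.w d)) else 0) ?_ hdep ?_ ?_
          (fun _ _ => rfl) (fun _ _ => rfl)) (ParentTree.sub_disjoint hk hd h2) ?_ ?_)
        · exact fun x hx => ((ParentTree.sub_full hd).1 hx).2.dep_le
        · intro t ht hne; have := (h7 t ht).1 hne; omega
        · intro t ht hne; have := (h7 t ht).2.1 hne; omega
        · exact fun t ht => (h7 t ht).2.2.1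
        · exact fun t ht => (h7 t ht).2.2.2
      · have s1 := h4 a hk b hc s₁ h3 rfl
        refine s1.cancel (i := i) (j := j) (fun x hx => ParentTree.up_of_mem_sub hk hc hx)
          (by omega) ?_ ?_
        · intro t ht
          have := (h5 t (by omega) (by omega)).1
          rwa [hV s hs _ (by omega), hV s₁ h3 _ (by omega)] at this
        · intro t ht
          have := (h5 t (by omega) (by omega)).2
          rwa [hV s hs _ (by omega), hV s₁ h3 _ (by omega)] at this
    have := main.2 G hG hmemZ F.root F.root_lt F.S le_rfl 0 hL0 rfl
    exact this.solvable (by simp [digit]) (by simp [digit]) h.nd_lt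
  · -- completeness
    intro hsol
    have hclosed : ∀ a < L, ∀ b < L, ∀ c < L, Q (fun k c s => (k * L + c) * L + s ∈ Z) a b c →
        (a * L + b) * L + c ∈ Z := by
      intro a ha b hb c hc hQ
      have := (hmem Z a ha b hb c hc).2 hQ
      rwa [main.1] at this
    have hrep : ∀ b a : ℕ → ℕ, (∀ i, b i ≤ U.card) → (∀ i, a i ≤ U.card) → ∃ s < L,
        ∀ t ≤ R, digit W s t = b t ∧ digit W s (R + 1 + t) = a t := by
      intro b a hb ha
      have hc := h.card_lt
      obtain ⟨s, hs, hst⟩ := exists_digits (W := W) (D := 2 * (R + 1))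
        (v := fun t => if t < R + 1 then b t else a (t - (R + 1))) (by
          intro t
          split_ifs
          · have := hb t; omega
          · have := ha (t - (R + 1)); omega)
      refine ⟨s, hs.trans_le h.W_pow, fun t ht => ⟨?_, ?_⟩⟩
      · rw [hst t (by omega), if_pos (by omega)]
      · rw [hst _ (by omega), if_neg (by omega), Nat.add_sub_cancel_left]
    have hSL := h.S_lt
    have hRL := h.R_le
    -- There may be more code numbers than vectors, so a vector can have several codes; the
    -- predicate asks for all of them.
    have := hsol.complete (n := U.card) le_rfl (P := fun k c b a => ∀ s < L,
      (∀ t ≤ R, digit W s t = b t ∧ digit W s (R + 1 + t) = a t) → (k * L + c) * L + s ∈ Z)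
      ?_ ?_ ?_ ?_
    · exact this 0 hL0 (by simp [digit])
    · intro k hk b a _ ha hbk hak h0 s hs hst
      refine hclosed k (by omega) 0 (by omega) s hs (Or.inl ⟨rfl, ?_, ?_, ?_⟩)
      · have := hV s hs 0 (by omega)
        rw [add_zero] at this
        rw [this, (hst 0 (by omega)).1, hbk, h.a13 k hk]
      · rw [hV s hs _ (by omega), h.a14 k hk _ (digit_lt (by have := h.card_lt; omega) _ _)]
        have := (hst 0 (by omega)).2
        rw [add_zero] at this
        rwa [this]
      · intro t _ ht0 ht
        rw [hV s hs _ (by omega), hV s hs _ (by omega), (hst t (by omega)).1,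
          (hst t (by omega)).2]
        exact h0 t (by omega) (by omega)
    · intro k hk c hc b a _ _ hp hP s hs hst
      refine hclosed k (by omega) (c + 1) (by omega) s hs (Or.inr (Or.inl ⟨by omega, ?_, ?_⟩))
      · rwa [Nat.add_sub_cancel, h.a10 c hc]
      · rw [Nat.add_sub_cancel]; exact hP s hs hst
    · intro k hk c hc b a b₁ a₁ b₂ a₂ _ _ hb₁ ha₁ hb₂ ha₂ hp hP₁ hP₂ hr1 hr2 hbe hae s hs hst
      obtain ⟨s₁, hs₁, hst₁⟩ := hrep b₁ a₁ hb₁ ha₁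
      obtain ⟨s₂, hs₂, hst₂⟩ := hrep b₂ a₂ hb₂ ha₂
      refine hclosed k (by omega) (c + 1) (by omega) s hs (Or.inr (Or.inr (Or.inl
        ⟨by omega, ?_, s₁, hs₁, ?_, s₂, hs₂, ?_, ?_⟩)))
      · rwa [Nat.add_sub_cancel, h.a10 c hc]
      · rw [Nat.add_sub_cancel]; exact hP₁ s₁ hs₁ hst₁
      · rw [Nat.add_sub_cancel]; exact hP₂ s₂ hs₂ hst₂
      · rw [Nat.add_sub_cancel, h.a11 c hc]
        intro t _ ht
        have htR : t ≤ R := by omega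
        rw [hV s hs _ (by omega), hV s hs _ (by omega), hV s₁ hs₁ _ (by omega),
            hV s₁ hs₁ _ (by omega), hV s₂ hs₂ _ (by omega), hV s₂ hs₂ _ (by omega),
            hV s₂ hs₂ _ (by omega), hV s₂ hs₂ _ (by omega), (hst t htR).1, (hst t htR).2,
            (hst₁ t htR).1, (hst₁ t htR).2, (hst₂ t htR).1, (hst₂ t htR).2,
            (hst₂ (t - F.w c) (by omega)).1, (hst₂ (t - F.w c) (by omega)).2]
        simp only [Nat.lt_succ_iff]
        exact ⟨hr1 t htR, hr2 t htR, hbe t htR, hae t htR⟩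
    · intro k hk b a b₁ a₁ i j _ _ hb₁ ha₁ hP hij hbe hae s hs hst
      obtain ⟨s₁, hs₁, hst₁⟩ := hrep b₁ a₁ hb₁ ha₁
      refine hclosed k (by omega) F.S (by omega) s hs (Or.inr (Or.inr (Or.inr
        ⟨s₁, hs₁, hP s₁ hs₁ hst₁, i, by omega, j, by omega, by omega, ?_⟩)))
      intro t _ ht
      have htR : t ≤ R := by omega
      rw [hV s hs _ (by omega), hV s hs _ (by omega), hV s₁ hs₁ _ (by omega),
        hV s₁ hs₁ _ (by omega), (hst t htR).1, (hst t htR).2, (hst₁ t htR).1, (hst₁ t htR).2]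
      exact ⟨hbe t htR, hae t htR⟩

end RAM

namespace RAM

/-! ### Tables -/

/-- Fill the array `a` with the multiples of the variable `c`. -/
def multStmt (a c : ℕ) : Stmt :=
  .seq (.nstore a (.const 0) (.const 0))
    (.loop 20 (.nstore a (.add (.var 20) (.const 1)) (.add (.arr a (.var 20)) (.var c))))

theorem run_mult {a c : ℕ} (hc : c ≠ 20) (σ : State) :
    ∀ x ≤ σ.nv limVar, ((multStmt a c).run σ).na a x = x * σ.nv c := by
  refine run_loop (σ := (Stmt.nstore a (.const 0) (.const 0)).run σ)
    (fun v τ => ∀ x ≤ v, τ.na a x = x * σ.nv c) ?_ fun v hv τ hτ hI x hx => ?_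
  · intro x hx
    obtain rfl : x = 0 := by omega
    simp [Stmt.run]
  · have h1 : τ.nv c = σ.nv c := hτ.nv c (by simp [Stmt.wn, hc])
    simp only [Stmt.run, storeN_na, true_and, Tm.eval_add, Tm.eval_var, Tm.eval_arr, Tm.eval_const,
      setN_nv, setN_na, if_true, if_neg hc, h1]
    split_ifs with h
    · rw [hI v le_rfl, h, Nat.succ_mul]
    · exact hI x (by omega)

/-- The quotients by the variable `10`, whose multiples are in the array `16`. -/
def quotStmt : Stmt :=
  .loop 20 (.nstore 17 (.var 20)
    (.sum 25 (.ite (.lt (.arr 16 (.add (.var 25) (.const 1))) (.add (.var 20) (.const 1)))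
      (.const 1) (.const 0))))

/-- The quotient is the number of positive multiples of `W` that do not exceed `s`, so counting
replaces division. -/
theorem run_quot {σ : State} {W : ℕ} (hW : 0 < W) (h16 : ∀ x ≤ σ.nv limVar, σ.na 16 x = x * W) :
    ∀ s < σ.nv limVar, (quotStmt.run σ).na 17 s = s / W := by
  classical
  refine run_tab _ fun s hs τ hτ _ => ?_
  have hlim : τ.nv limVar = σ.nv limVar := hτ.nv _ (by simp [Stmt.wn])
  have h16' : τ.na 16 = σ.na 16 := hτ.na _ (by simp [Stmt.wna])
  simp only [Tm.eval_sum, Tm.eval_ite, Tm.tt_lt, Tm.eval_arr, Tm.eval_add, Tm.eval_var,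
    Tm.eval_const, setN_nv, setN_na, hlim, h16', limVar, Nat.reduceEqDiff, if_true, if_false]
  rw [Finset.sum_boole, Nat.cast_id]
  have : (Finset.range (σ.nv 5)).filter (fun x => σ.na 16 (x + 1) < s + 1) =
      Finset.range (s / W) := by
    ext x
    simp only [Finset.mem_filter, Finset.mem_range]
    have hd : x < s / W ↔ (x + 1) * W ≤ s := by
      rw [Nat.lt_iff_add_one_le, Nat.le_div_iff_mul_le hW]
    constructor
    · rintro ⟨h1, h2⟩
      rw [h16 (x + 1) h1] at h2
      rw [hd]; omega
    · intro h
      have h1 : x < σ.nv 5 := h.trans_le ((Nat.div_le_self _ _).trans (le_of_lt hs))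
      rw [hd] at h
      refine ⟨h1, ?_⟩
      rw [h16 (x + 1) h1]; omega
  rw [this, Finset.card_range]

/-- The digits in base `nv 10`, from the quotients in the array `17`. -/
def digitStmt : Stmt :=
  .loop 20 (.loop 21 (.nstore 15 (.pair (.var 20) (.var 21))
    (.ite (.eq (.var 21) (.const 0)) (.sub (.var 20) (.arr 16 (.arr 17 (.var 20))))
      (.arr 15 (.pair (.arr 17 (.var 20)) (.sub (.var 21) (.const 1)))))))

/-- Digit `0` is the remainder, and digit `t + 1` of `s` is digit `t` of `s / W`. As `s / W ≤ s`,
that cell comes earlier in the order of the loops. -/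
theorem run_digit {σ : State} {W : ℕ} (h16 : ∀ x ≤ σ.nv limVar, σ.na 16 x = x * W)
    (h17 : ∀ s < σ.nv limVar, σ.na 17 s = s / W) :
    ∀ s < σ.nv limVar, ∀ t < σ.nv limVar,
      (digitStmt.run σ).na 15 (s * σ.nv limVar + t) = digit W s t := by
  have main := run_loop2 (x := 20) (y := 21) (σ := σ)
    (p := .nstore 15 (.pair (.var 20) (.var 21))
    (.ite (.eq (.var 21) (.const 0)) (.sub (.var 20) (.arr 16 (.arr 17 (.var 20))))
      (.arr 15 (.pair (.arr 17 (.var 20)) (.sub (.var 21) (.const 1))))))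
    (by simp [Stmt.wn]) (by simp [Stmt.wn])
    (fun j τ => ∀ s < σ.nv limVar, ∀ t < σ.nv limVar, s * σ.nv limVar + t < j →
      τ.na 15 (s * σ.nv limVar + t) = digit W s t)
    (fun j τ v h => ⟨h, h⟩) (by simp) fun a ha b hb τ hτ h20 h21 hI s hs t ht hst => by
      have hlim : τ.nv limVar = σ.nv limVar := hτ.nv _ (by simp [Stmt.wn])
      have h16' : τ.na 16 = σ.na 16 := hτ.na _ (by simp [Stmt.wna])
      have h17' : τ.na 17 = σ.na 17 := hτ.na _ (by simp [Stmt.wna])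
      simp only [Stmt.run, storeN_na, true_and, Tm.eval_pair, Tm.eval_var, h20, h21, hlim,
        Tm.eval_ite, Tm.tt_eq, Tm.eval_const, Tm.eval_sub, Tm.eval_arr, h16', h17']
      split_ifs with h1 h2
      · rw [pair_inj ht hb] at h1
        obtain ⟨rfl, rfl⟩ := h1
        subst h2
        have hle : s / W ≤ s := Nat.div_le_self _ _
        rw [h17 s hs, h16 _ (by omega), digit, pow_zero, Nat.div_one]
        have := Nat.div_add_mod s W
        rw [Nat.mul_comm] at this
        omega
      · rw [pair_inj ht hb] at h1
        obtain ⟨rfl, rfl⟩ := h1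
        have hle : s / W ≤ s := Nat.div_le_self _ _
        obtain ⟨t', rfl⟩ : ∃ t', t = t' + 1 := ⟨t - 1, by omega⟩
        rw [h17 s hs, Nat.add_sub_cancel, hI _ (by omega) _ (by omega) (by
          have := Nat.mul_le_mul_right (σ.nv limVar) hle
          omega)]
        rw [digit, digit, Nat.div_div_eq_div_mul, pow_succ, Nat.mul_comm W]
      · exact hI s hs t ht (by omega)
  intro s hs t ht
  exact main s hs t ht (pair_lt hs ht)

/-! Exploring the tree from the root. -/

/-- The lookup of `(u, v)` in the adjacency matrix. -/
def adjTm (u v : Tm) : Tm := .arr 0 (.add (.arr 18 u) v)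

theorem adjArray_eq {T : WeightedTree} (u v : Fin T.N) :
    T.adjArray (u * T.N + v) ≠ 0 ↔ T.graph.Adj u v := by
  have h : (u : ℕ) * T.N + v < T.N * T.N := pair_lt u.2 v.2
  have e : finProdFinEquiv.symm ⟨u * T.N + v, h⟩ = (u, v) := by
    rw [Equiv.symm_apply_eq]
    ext; simp [finProdFinEquiv, Nat.mul_comm, Nat.add_comm]
  unfold WeightedTree.adjArray
  rw [dif_pos h, e]
  simp

theorem lenArray_eq {T : WeightedTree} (u v : Fin T.N) :
    T.lenArray (u * T.N + v) = T.edgeLen s(u, v) := by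
  have h : (u : ℕ) * T.N + v < T.N * T.N := pair_lt u.2 v.2
  have e : finProdFinEquiv.symm ⟨u * T.N + v, h⟩ = (u, v) := by
    rw [Equiv.symm_apply_eq]
    ext; simp [finProdFinEquiv, Nat.mul_comm, Nat.add_comm]
  unfold WeightedTree.lenArray
  rw [dif_pos h, e]

/-- The input tree, and a table of the multiples of its size in the array `18`. -/
structure TreeEnv (T : WeightedTree) (σ : State) : Prop where
  N_lt : T.N < σ.nv limVar
  v0 : σ.nv 0 = T.N
  a0 : σ.na 0 = T.adjArray
  r0 : σ.ra 0 = T.lenArray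
  a18 : ∀ x ≤ σ.nv limVar, σ.na 18 x = x * T.N

theorem TreeEnv.congr {T : WeightedTree} {σ τ : State} (h : TreeEnv T σ)
    (h5 : τ.nv limVar = σ.nv limVar) (h0 : τ.nv 0 = σ.nv 0) (ha : τ.na 0 = σ.na 0)
    (hr : τ.ra 0 = σ.ra 0) (ha' : τ.na 18 = σ.na 18) : TreeEnv T τ :=
  ⟨h5 ▸ h.N_lt, h0.trans h.v0, ha.trans h.a0, hr.trans h.r0, by rw [h5, ha']; exact h.a18⟩

/-- The levels of the vertices, plus `1`, in the array `20`. -/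
def levelStmt : Stmt :=
  .seq (.loop 20 (.nstore 20 (.var 20) (.const 0)))
    (.seq (.nstore 20 (.const 0) (.const 1))
      (.loop 28 (.loop 20 (.nstore 20 (.var 20)
        (.ite (.and (.lt (.var 20) (.var 0)) (.and (.eq (.arr 20 (.var 20)) (.const 0))
          (.ex 25 (.and (.lt (.var 25) (.var 0))
            (.and (.eq (.arr 20 (.var 25)) (.add (.var 28) (.const 1)))
              (adjTm (.var 25) (.var 20)))))))
          (.add (.var 28) (.const 2)) (.arr 20 (.var 20)))))))

/-- All levels up to that of `v` occur on the way to the root, and vertices on different levels are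
different. -/
theorem hop_lt {T : WeightedTree} (v : Fin T.N) : T.hop v < T.N := by
  have h : ∀ d, ∀ v : Fin T.N, T.hop v = d → ∀ i ≤ d, ∃ u, T.hop u = i := by
    intro d
    induction d with
    | zero => intro v hv i hi; exact ⟨v, by omega⟩
    | succ d ih =>
      intro v hv i hi
      by_cases hid : i = d + 1
      · exact ⟨v, by omega⟩
      · have hvr : v ≠ T.root := by rintro rfl; rw [T.hop_root] at hv; omega
        have := WeightedTree.par_hop hvr
        exact ih (T.par v) (by omega) i (by omega)
  by_contra hcon
  have : Nonempty (Fin T.N) := ⟨v⟩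
  choose! f hf using h _ v rfl
  have := Finset.card_le_card_of_injOn (s := Finset.range (T.hop v + 1))
    (t := (Finset.univ : Finset (Fin T.N))) f (fun _ _ => Finset.mem_coe.2 (Finset.mem_univ _))
    (fun i hi j hj hij => by
      simp only [Finset.coe_range, Set.mem_Iio] at hi hj
      rw [← hf i (by omega), ← hf j (by omega), hij])
  rw [Finset.card_range, Finset.card_univ, Fintype.card_fin] at this
  omega

/-- Breadth-first search: round `t` reaches level `t + 1`. Levels are stored plus `1` because `0`
marks a vertex not reached yet; vertices labelled during the round do not interfere, since only
neighbours on level exactly `t` count. -/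
theorem run_level {T : WeightedTree} {σ : State} (h : TreeEnv T σ) :
    ∀ v : Fin T.N, (levelStmt.run σ).na 20 v = T.hop v + 1 := by
  classical
  set σ₁ := (Stmt.loop 20 (.nstore 20 (.var 20) (.const 0))).run σ with hσ₁
  have o₁ : Off _ σ σ₁ := Off.run _ _
  have z₁ : ∀ i < σ.nv limVar, σ₁.na 20 i = 0 := run_tab (fun _ => 0) fun _ _ _ _ _ => rfl
  set σ₂ := (Stmt.nstore 20 (.const 0) (.const 1)).run σ₁ with hσ₂
  have o₂ : Off _ σ₁ σ₂ := Off.run _ _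
  have l₂ : σ₂.nv limVar = σ.nv limVar :=
    (o₂.nv _ (by simp [Stmt.wn])).trans (o₁.nv _ (by simp [Stmt.wn]))
  have e₂ : TreeEnv T σ₂ := h.congr l₂
    ((o₂.nv _ (by simp [Stmt.wn])).trans (o₁.nv _ (by simp [Stmt.wn])))
    ((o₂.na _ (by simp [Stmt.wna])).trans (o₁.na _ (by simp [Stmt.wna])))
    ((o₂.ra _ (by simp [Stmt.wra])).trans (o₁.ra _ (by simp [Stmt.wra])))
    ((o₂.na _ (by simp [Stmt.wna])).trans (o₁.na _ (by simp [Stmt.wna])))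
  have main := run_loop (x := 28) (p := (.loop 20 (.nstore 20 (.var 20)
        (.ite (.and (.lt (.var 20) (.var 0)) (.and (.eq (.arr 20 (.var 20)) (.const 0))
          (.ex 25 (.and (.lt (.var 25) (.var 0))
            (.and (.eq (.arr 20 (.var 25)) (.add (.var 28) (.const 1)))
              (adjTm (.var 25) (.var 20)))))))
          (.add (.var 28) (.const 2)) (.arr 20 (.var 20)))))) (σ := σ₂)
    (fun t τ => ∀ v : Fin T.N, τ.na 20 v = if T.hop v ≤ t then T.hop v + 1 else 0) ?_ ?_
  · intro v
    have := main v
    rw [if_pos] at this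
    · exact this
    · have := hop_lt v
      have := h.N_lt
      omega
  · intro v
    simp only [hσ₂, Stmt.run, storeN_na, true_and, Tm.eval_const]
    by_cases hv : v = T.root
    · subst hv; simp [WeightedTree.root_val, T.hop_root]
    · have h0 : (v : ℕ) ≠ 0 := mt WeightedTree.eq_root_iff.1 hv
      have h1 : ¬ T.hop v ≤ 0 := by rw [Nat.le_zero, T.hop_eq_zero]; exact hv
      rw [if_neg h0, if_neg h1]
      exact z₁ v (v.2.trans h.N_lt)
  · intro t ht τ hτ hI
    have hlim : τ.nv limVar = σ₂.nv limVar := hτ.nv _ (by simp [Stmt.wn])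
    have hτ28 : (τ.setN 28 t).nv limVar = σ₂.nv limVar := by simp [limVar]; exact hlim
    have inner := run_loop (x := 20) (p := (.nstore 20 (.var 20)
        (.ite (.and (.lt (.var 20) (.var 0)) (.and (.eq (.arr 20 (.var 20)) (.const 0))
          (.ex 25 (.and (.lt (.var 25) (.var 0))
            (.and (.eq (.arr 20 (.var 25)) (.add (.var 28) (.const 1)))
              (adjTm (.var 25) (.var 20)))))))
          (.add (.var 28) (.const 2)) (.arr 20 (.var 20))))) (σ := τ.setN 28 t)
      (fun w υ => ∀ v : Fin T.N, υ.na 20 v =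
        if T.hop v ≤ t ∨ (T.hop v ≤ t + 1 ∧ (v : ℕ) < w) then T.hop v + 1 else 0) ?_ ?_
    · intro v
      rw [inner v, hτ28]
      have hv : (v : ℕ) < σ₂.nv limVar := v.2.trans e₂.N_lt
      congr 1
      simp only [hv, and_true, eq_iff_iff]
      omega
    · intro v
      rw [setN_na, hI v]
      simp
    · intro w hw υ hυ hJ v
      have l : υ.nv limVar = σ₂.nv limVar := (hυ.nv _ (by simp [Stmt.wn])).trans hτ28
      have e28 : υ.nv 28 = t := by rw [hυ.nv _ (by simp [Stmt.wn])]; simp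
      have e0 : υ.nv 0 = T.N := by
        rw [hυ.nv _ (by simp [Stmt.wn])]; simp [hτ.nv 0 (by simp [Stmt.wn]), e₂.v0]
      have a0 : υ.na 0 = T.adjArray := by
        rw [hυ.na _ (by simp [Stmt.wna]), setN_na, hτ.na 0 (by simp [Stmt.wna]), e₂.a0]
      have a18 : υ.na 18 = σ₂.na 18 := by
        rw [hυ.na _ (by simp [Stmt.wna]), setN_na, hτ.na 18 (by simp [Stmt.wna])]
      simp only [Stmt.run, storeN_na, true_and, Tm.eval_var, setN_nv, if_true, setN_na]
      by_cases hvw : (v : ℕ) = w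
      · rw [if_pos hvw]
        subst hvw
        simp only [Tm.eval_ite, Tm.tt_and, Tm.tt_lt, Tm.tt_eq, Tm.tt_ex, Tm.eval_var, Tm.eval_const,
          Tm.eval_arr, Tm.eval_add, adjTm, Tm.tt_arr, setN_nv, setN_na, e28, e0, a0, a18,
          limVar, Nat.reduceEqDiff, if_true, if_false, OfNat.zero_ne_ofNat]
        have hold := hJ v
        simp only [lt_irrefl, and_false, or_false] at hold
        have hex : (∃ u < υ.nv 5, u < T.N ∧ υ.na 20 u = t + 1 ∧
            T.adjArray (σ₂.na 18 u + v) ≠ 0) ↔ ∃ u : Fin T.N, T.hop u = t ∧ T.graph.Adj u v := by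
          constructor
          · rintro ⟨u, hu, huN, hu1, hu2⟩
            rw [e₂.a18 u (le_of_lt (l ▸ hu)), adjArray_eq ⟨u, huN⟩ v] at hu2
            rw [hJ ⟨u, huN⟩] at hu1
            refine ⟨⟨u, huN⟩, ?_, hu2⟩
            split_ifs at hu1
            omega
          · rintro ⟨u, hu1, hu2⟩
            have huL : (u : ℕ) < σ₂.nv limVar := u.2.trans e₂.N_lt
            refine ⟨u, l ▸ huL, u.2, ?_, ?_⟩
            · rw [hJ u, if_pos (Or.inl hu1.le), hu1]
            · rw [e₂.a18 u (le_of_lt huL), adjArray_eq u v]; exact hu2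
        simp only [hold, hex]
        by_cases h1 : T.hop v ≤ t
        · rw [if_pos (Or.inl h1), if_neg]
          · rw [if_pos h1]
          · rw [if_pos h1]; rintro ⟨-, h2, -⟩; omega
        · rw [if_neg h1]
          by_cases h2 : T.hop v = t + 1
          · have hvr : v ≠ T.root := by rintro rfl; rw [T.hop_root] at h2; omega
            have h3 := WeightedTree.par_hop hvr
            rw [if_pos ⟨v.2, rfl, T.par v, by omega, WeightedTree.par_adj hvr⟩,
              if_pos (Or.inr ⟨h2.le, by omega⟩), h2]
          · rw [if_neg, if_neg]
            · rintro (h3 | h3)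
              · exact h1 h3
              · omega
            · rintro ⟨-, -, u, hu1, hu2⟩
              have h4 := T.isTree.connected.dist_triangle (u := T.root) (v := u) (w := v)
              rw [SimpleGraph.dist_eq_one_iff_adj.2 hu2] at h4
              change T.hop v ≤ T.hop u + 1 at h4
              omega
      · rw [if_neg hvw, hJ v]
        congr 1
        simp only [eq_iff_iff]
        omega

end RAM

namespace RAM

/-! ### Frame conditions -/

/-- The variables below `20`, the natural arrays `as` and the real arrays `ras` have the same
contents in both memories. -/
structure Same (as ras : List ℕ) (σ τ : State) : Prop where
  nv : ∀ i < 20, τ.nv i = σ.nv i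
  na : ∀ a ∈ as, τ.na a = σ.na a
  ra : ∀ a ∈ ras, τ.ra a = σ.ra a

theorem Same.trans {as ras : List ℕ} {σ τ υ : State} (h : Same as ras σ τ)
    (h' : Same as ras τ υ) : Same as ras σ υ :=
  ⟨fun i hi => (h'.nv i hi).trans (h.nv i hi), fun i hi => (h'.na i hi).trans (h.na i hi),
    fun i hi => (h'.ra i hi).trans (h.ra i hi)⟩

theorem Same.refl (as ras : List ℕ) (σ : State) : Same as ras σ σ :=
  ⟨fun _ _ => rfl, fun _ _ => rfl, fun _ _ => rfl⟩

theorem Same.mono {as ras as' ras' : List ℕ} {σ τ : State} (h : Same as ras σ τ) (ha : as' ⊆ as)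
    (hr : ras' ⊆ ras) : Same as' ras' σ τ :=
  ⟨h.nv, fun a hh => h.na a (ha hh), fun a hh => h.ra a (hr hh)⟩

theorem Same.setN {as ras : List ℕ} {σ τ : State} (h : Same as ras σ τ) {i : ℕ} (hi : 20 ≤ i)
    (v : ℕ) : Same as ras σ (τ.setN i v) :=
  ⟨fun j hj => by rw [setN_nv, if_neg (by omega), h.nv j hj], h.na, h.ra⟩

theorem Same.lim {as ras : List ℕ} {σ τ : State} (h : Same as ras σ τ) :
    τ.nv limVar = σ.nv limVar := h.nv _ (by decide)

/-- The program does not write to the variables below `20` and the given arrays. -/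
def Stmt.keeps (s : Stmt) (as ras : List ℕ) : Bool :=
  s.wn.all (fun i => decide (20 ≤ i)) && (s.wna.all (fun i => decide (i ∉ as)) &&
    s.wra.all fun i => decide (i ∉ ras))

theorem Off.same {s : Stmt} {as ras : List ℕ} {σ τ : State} (h : Off s σ τ)
    (hs : s.keeps as ras = true) : Same as ras σ τ := by
  simp only [Stmt.keeps, Bool.and_eq_true, List.all_eq_true, decide_eq_true_eq] at hs
  exact ⟨fun i hi => h.nv i fun hh => by have := hs.1 i hh; omega,
    fun i hi => h.na i fun hh => hs.2.1 i hh hi, fun i hi => h.ra i fun hh => hs.2.2 i hh hi⟩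

theorem Stmt.same_run {s : Stmt} {as ras : List ℕ} (hs : s.keeps as ras = true) (σ : State) :
    Same as ras σ (s.run σ) := (Off.run s σ).same hs

/-- A loop that fills a real array. -/
theorem run_rtab {x a : ℕ} {e : RExp} {σ : State} (f : ℕ → ℝ)
    (h : ∀ v < σ.nv limVar, ∀ τ, Off (.loop x (.rstore a (.var x) e)) σ τ →
      (∀ i < v, τ.ra a i = f i) → e.eval (τ.setN x v) = f v) :
    ∀ i < σ.nv limVar, ((Stmt.loop x (.rstore a (.var x) e)).run σ).ra a i = f i := by
  refine run_loop (fun v τ => ∀ i < v, τ.ra a i = f i) (by simp) fun v hv τ hτ hI i hi => ?_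
  simp only [Stmt.run, Tm.eval, storeR_ra, setN_nv, true_and, if_true, setN_ra]
  split_ifs with hiv
  · rw [h v hv τ hτ hI, hiv]
  · exact hI i (by omega)

/-- Filling a real array along a tree, starting from the root. -/
theorem run_treeTab {T : WeightedTree} {a : ℕ} {p : Stmt} {σ : State} (val : Fin T.N → ℝ)
    (hN : T.N < σ.nv limVar) (h0 : σ.ra a 0 = val T.root)
    (hL : limVar ∉ (Stmt.loop 28 (.loop 20 p)).wn)
    (hp : ∀ τ, Off (.loop 28 (.loop 20 p)) σ τ → ∀ j, j ≠ τ.nv 20 → (p.run τ).ra a j = τ.ra a j)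
    (hv : ∀ τ, Off (.loop 28 (.loop 20 p)) σ τ → ∀ v : Fin T.N, τ.nv 20 = v →
      τ.ra a (T.par v) = val (T.par v) → (p.run τ).ra a v = val v) (v : Fin T.N) :
    ((Stmt.loop 28 (.loop 20 p)).run σ).ra a v = val v := by
  -- Each round recomputes every vertex. Values up to level `t` are correct after `t` rounds and are
  -- reproduced from then on; deeper ones are irrelevant until their parents are correct.
  have main := run_loop (x := 28) (p := .loop 20 p) (σ := σ)
    (fun t τ => ∀ v : Fin T.N, T.hop v ≤ t → τ.ra a v = val v) ?_ ?_
  · exact main v (by have := hop_lt v; omega)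
  · intro v hv
    rw [Nat.le_zero, T.hop_eq_zero] at hv
    subst hv; exact h0
  · intro t ht τ hτ hI
    have hlim : τ.nv limVar = σ.nv limVar := hτ.nv _ hL
    have h5 : limVar ≠ 28 := by decide
    have e : (τ.setN 28 t).nv limVar = σ.nv limVar := by rw [setN_nv, if_neg h5, hlim]
    have hτ' : Off (.loop 28 (.loop 20 p)) σ (τ.setN 28 t) := hτ.setN (by simp [Stmt.wn]) _
    have inner := run_loop (x := 20) (p := p) (σ := τ.setN 28 t)
      (fun w υ => ∀ v : Fin T.N, (T.hop v ≤ t ∨ (T.hop v ≤ t + 1 ∧ (v : ℕ) < w)) →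
        υ.ra a v = val v) ?_ ?_
    · intro v hv
      exact inner v (Or.inr ⟨hv, by rw [e]; exact v.2.trans hN⟩)
    · intro v hv
      exact hI v (by omega)
    · intro w hw υ hυ hJ v hv'
      have hυ' : Off (.loop 28 (.loop 20 p)) σ (υ.setN 20 w) :=
        (hτ'.trans (hυ.mono (by simp [Stmt.wn]) (by simp [Stmt.wr]) (by simp [Stmt.wna])
          (by simp [Stmt.wra]))).setN (by simp [Stmt.wn]) _
      by_cases hvw : (v : ℕ) = w
      · refine hv _ hυ' v (by simp [hvw]) (hJ _ (Or.inl ?_))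
        by_cases hr : v = T.root
        · rw [hr, T.par_root, T.hop_root]; exact Nat.zero_le _
        · have := WeightedTree.par_hop hr
          omega
      · rw [hp _ hυ' v (by simpa using hvw)]
        exact hJ v (by omega)

/-! ### The problem that the program solves -/

/-- Users are to be assigned to leaves of a subdivided tree. -/
structure Task where
  T : WeightedTree
  n : ℕ
  r : ℕ
  M : ℕ
  R : ℕ
  Fc : ℕ
  user : ℕ → Fin T.N
  fpar : ℕ → ℕ
  fpar_lt : ∀ f < Fc, fpar f < T.N * (M + 2 + 2)

namespace Task

variable (D : Task)

/-- The number of nodes. -/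
def S : ℕ := D.T.N * (D.M + 2 + 2) + D.Fc

/-- The node of a user. -/
def nd (u : ℕ) : ℕ := D.user u * (D.M + 2 + 2)

/-- The subdivided tree for the length scale `B`. -/
noncomputable def tree (B : ℝ) (hB : 0 ≤ B) : ParentTree :=
  D.T.chainTree D.M (D.M + 2) B D.Fc D.fpar hB D.fpar_lt

end Task

/-- What the preparations expect in the memory. -/
structure Setup (D : Task) (σ : State) : Prop where
  S_lt : D.S < σ.nv limVar
  n_lt : D.n < σ.nv limVar
  R_le : 2 * (D.R + 1) ≤ σ.nv limVar
  W_pow : (D.n + 1) ^ (2 * (D.R + 1)) ≤ σ.nv limVar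
  v0 : σ.nv 0 = D.T.N
  v1 : σ.nv 1 = D.n
  v3 : σ.nv 3 = D.r
  v8 : σ.nv 8 = D.M + 2 + 2
  v10 : σ.nv 10 = D.n + 1
  v11 : σ.nv 11 = D.Fc
  v12 : σ.nv 12 = D.T.N * (D.M + 2 + 2)
  v13 : σ.nv 13 = D.S
  v14 : σ.nv 14 = D.R + 1
  v15 : σ.nv 15 = D.M
  v16 : σ.nv 16 = D.M + 2 + 1
  a0 : σ.na 0 = D.T.adjArray
  a1 : ∀ u < D.n, σ.na 1 u = D.user u
  r0 : σ.ra 0 = D.T.lenArray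

theorem Setup.congr {D : Task} {σ τ : State} (h : Setup D σ) (hs : Same [0, 1] [0] σ τ) :
    Setup D τ := by
  have hn := hs.nv
  have ha := hs.na
  have hr := hs.ra
  constructor <;>
    first
    | (rw [hn _ (by decide)]; first
        | exact h.S_lt | exact h.n_lt | exact h.R_le | exact h.W_pow | exact h.v0 | exact h.v1
        | exact h.v3 | exact h.v8 | exact h.v10 | exact h.v11 | exact h.v12 | exact h.v13
        | exact h.v14 | exact h.v15 | exact h.v16)
    | (rw [ha _ (by decide)]; first | exact h.a0 | exact h.a1)
    | (rw [hr _ (by decide)]; exact h.r0)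

theorem Setup.N_lt {D : Task} {σ : State} (h : Setup D σ) : D.T.N < σ.nv limVar := by
  have h1 := h.S_lt
  unfold Task.S at h1
  nlinarith [D.T.N_pos]

theorem Setup.C_lt {D : Task} {σ : State} (h : Setup D σ) : D.M + 2 + 2 < σ.nv limVar := by
  have h1 := h.S_lt
  unfold Task.S at h1
  nlinarith [D.T.N_pos]

theorem Setup.Fc_lt {D : Task} {σ : State} (h : Setup D σ) : D.Fc < σ.nv limVar := by
  have h1 := h.S_lt
  unfold Task.S at h1
  omega

/-- The memory after the preparations. -/
structure Prepared (D : Task) (σ : State) : Prop extends Setup D σ where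
  a15 : ∀ s < σ.nv limVar, ∀ t < σ.nv limVar, σ.na 15 (s * σ.nv limVar + t) = digit (D.n + 1) s t
  a18 : ∀ x ≤ σ.nv limVar, σ.na 18 x = x * D.T.N
  a19 : ∀ x ≤ σ.nv limVar, σ.na 19 x = x * (D.M + 2 + 2)
  a21 : ∀ v : Fin D.T.N, σ.na 21 v = D.T.par v
  a22 : ∀ f < D.Fc, σ.na 22 f = D.fpar f
  a24 : ∀ u < D.n, σ.na 24 u = D.nd u
  r1 : ∀ v : Fin D.T.N, σ.ra 1 v = D.T.depth v
  r2 : ∀ v : Fin D.T.N, σ.ra 2 v = D.M * D.T.parLen v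

theorem Prepared.congr {D : Task} {σ τ : State} (h : Prepared D σ)
    (hs : Same [0, 1, 15, 18, 19, 21, 22, 24] [0, 1, 2] σ τ) : Prepared D τ := by
  have hn := hs.nv
  have ha := hs.na
  have hr := hs.ra
  refine ⟨h.toSetup.congr (hs.mono (by decide) (by decide)), ?_, ?_, ?_, ?_, ?_, ?_, ?_, ?_⟩ <;>
    first
    | (rw [ha _ (by decide)]; first
        | exact h.a21 | exact h.a22 | exact h.a24
        | (rw [hs.lim]; first | exact h.a15 | exact h.a18 | exact h.a19))
    | (rw [hr _ (by decide)]; first | exact h.r1 | exact h.r2)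

end RAM

/-! ### Parents, depths and scaled edge lengths -/

namespace RAM

theorem run_tab_on {x a : ℕ} {t : Tm} {σ : State} (P : ℕ → Prop) (f : ℕ → ℕ)
    (h : ∀ v < σ.nv limVar, P v → ∀ τ, Off (.loop x (.nstore a (.var x) t)) σ τ →
      t.eval (τ.setN x v) = f v) :
    ∀ i < σ.nv limVar, P i → ((Stmt.loop x (.nstore a (.var x) t)).run σ).na a i = f i := by
  refine run_loop (fun v τ => ∀ i < v, P i → τ.na a i = f i) (by simp)
    fun v hv τ hτ hI i hi hP => ?_
  simp only [Stmt.run, Tm.eval, storeN_na, setN_nv, true_and, if_true, setN_na]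
  split_ifs with hiv
  · subst hiv; exact h i hv hP τ hτ
  · exact hI i (by omega) hP

/-- The parents of the vertices, from the levels in the array `20`. -/
def parStmt : Stmt :=
  .loop 20 (.nstore 21 (.var 20) (.sum 25 (.ite (.and (.lt (.var 25) (.var 0))
    (.and (adjTm (.var 25) (.var 20))
      (.eq (.add (.arr 20 (.var 25)) (.const 1)) (.arr 20 (.var 20))))) (.var 25) (.const 0))))

/-- Exactly one neighbour lies one level higher, so the sum has a single term, the parent. At the
root the sum is empty, and its value `0` is the root. -/
theorem run_par {T : WeightedTree} {σ : State} (h : TreeEnv T σ)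
    (h20 : ∀ v : Fin T.N, σ.na 20 v = T.hop v + 1) (v : Fin T.N) :
    (parStmt.run σ).na 21 v = T.par v := by
  classical
  have := run_tab_on (x := 20) (a := 21) (σ := σ) (t := (.sum 25 (.ite (.and (.lt (.var 25) (.var 0))
    (.and (adjTm (.var 25) (.var 20))
      (.eq (.add (.arr 20 (.var 25)) (.const 1)) (.arr 20 (.var 20))))) (.var 25) (.const 0))))
    (fun i => i < T.N) (fun i => T.par (T.vert i)) ?_ v (v.2.trans h.N_lt) v.2
  · rw [WeightedTree.vert_val] at this; exact this
  · intro i hi hiN τ hτ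
    have hs := hτ.same (as := [0, 18, 20]) (ras := []) (by decide)
    obtain ⟨w, rfl⟩ : ∃ w : Fin T.N, i = w := ⟨⟨i, hiN⟩, rfl⟩
    simp only [Tm.eval_sum, Tm.eval_ite, Tm.tt_and, Tm.tt_lt, adjTm, Tm.tt_arr, Tm.tt_eq,
      Tm.eval_arr, Tm.eval_add, Tm.eval_var, Tm.eval_const, setN_nv, setN_na, limVar,
      Nat.reduceEqDiff, if_true, if_false, OfNat.zero_ne_ofNat, hs.nv 5 (by decide),
      hs.nv 0 (by decide), hs.na 0 (by decide), hs.na 18 (by decide), hs.na 20 (by decide),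
      h.v0, h.a0, WeightedTree.vert_val]
    have key : ∀ u < σ.nv 5, (u < T.N ∧ T.adjArray (σ.na 18 u + w) ≠ 0 ∧
        σ.na 20 u + 1 = σ.na 20 w) ↔ (w ≠ T.root ∧ u = T.par w) := by
      intro u hu
      rw [h.a18 u hu.le]
      constructor
      · rintro ⟨h1, h2, h3⟩
        rw [adjArray_eq ⟨u, h1⟩ w] at h2
        have h4 := h20 ⟨u, h1⟩
        simp only at h4
        rw [h4, h20 w] at h3
        have := WeightedTree.eq_par h2 (by omega)
        refine ⟨?_, by rw [← this]⟩
        rintro rfl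
        rw [T.hop_root] at h3
        omega
      · rintro ⟨h1, rfl⟩
        refine ⟨(T.par w).2, (adjArray_eq _ _).2 (WeightedTree.par_adj h1), ?_⟩
        rw [h20, h20, WeightedTree.par_hop h1]
    rw [Finset.sum_congr rfl fun u hu => if_congr (key u (Finset.mem_range.1 hu)) rfl rfl]
    by_cases hw : w = T.root
    · subst hw
      simp [T.par_root, WeightedTree.root_val]
    · rw [Finset.sum_eq_single (T.par w : ℕ)]
      · simp [hw]
      · intro b _ hb; simp [hb]
      · intro hb
        exact absurd (Finset.mem_range.2 ((T.par w).2.trans h.N_lt)) hb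

/-- The length of the edge to the parent. -/
def lenTm (v : NExp) : RExp := .arr 0 (.add (.arr 18 (.arr 21 v)) v)

theorem eval_lenTm {T : WeightedTree} {τ : State} {e : NExp} {v : Fin T.N} (hv : e.eval τ = v)
    (h0 : τ.ra 0 = T.lenArray) (h18 : ∀ v : Fin T.N, τ.na 18 v = v * T.N)
    (h21 : ∀ v : Fin T.N, τ.na 21 v = T.par v) : (lenTm e).eval τ = T.parLen v := by
  simp only [lenTm, RExp.eval, NExp.eval, hv, h21, h18, h0, lenArray_eq]
  rfl

def depthStmt : Stmt :=
  .seq (.rstore 1 (.const 0) .zero)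
    (.loop 28 (.loop 20 (.rstore 1 (.var 20) (.add (.arr 1 (.arr 21 (.var 20))) (lenTm (.var 20))))))

theorem run_depth {T : WeightedTree} {σ : State} (h : TreeEnv T σ)
    (h21 : ∀ v : Fin T.N, σ.na 21 v = T.par v) (v : Fin T.N) :
    (depthStmt.run σ).ra 1 v = T.depth v := by
  have hs₁ : Same [0, 18, 21] [0] σ ((Stmt.rstore 1 (.const 0) .zero).run σ) :=
    Stmt.same_run (by decide) _
  refine run_treeTab T.depth (by rw [hs₁.lim]; exact h.N_lt) ?_ (by decide) ?_ ?_ v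
  · rw [T.depth_root]; simp [Stmt.run]
  · intro τ _ j hj
    simp only [Stmt.run, storeR_ra, Tm.eval_var, true_and, if_neg hj]
  · intro τ hτ v hv hpar
    have hs := hs₁.trans (hτ.same (by decide))
    have h21' : ∀ v : Fin T.N, τ.na 21 v = T.par v := by rw [hs.na 21 (by decide)]; exact h21
    have h18 : ∀ v : Fin T.N, τ.na 18 v = v * T.N := fun v => by
      rw [hs.na 18 (by decide)]; exact h.a18 v (v.2.trans h.N_lt).le
    have e := eval_lenTm (e := .var 20) (T := T) (v := v) (by simp [hv])
      (by rw [hs.ra 0 (by decide), h.r0]) h18 h21'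
    simp only [Stmt.run, storeR_ra, Tm.eval_var, true_and, hv, if_true, RExp.eval, e, NExp.eval,
      h21', hpar]
    exact (T.depth_par v).symm

/-- The lengths of the edges to the parents, multiplied by the variable `15`. -/
def scaleStmt : Stmt :=
  .seq (.loop 20 (.rstore 2 (.var 20) .zero))
    (.loop 28 (.ite (.lt (.var 28) (.var 15))
      (.loop 20 (.rstore 2 (.var 20) (.add (.arr 2 (.var 20)) (lenTm (.var 20)))))
      (.nset 33 (.const 0))))

/-- Reals cannot be multiplied, so the length is added `M` times; the outer loop runs up to `limVar`
but idles after `M` rounds, whence `min t M`. -/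
theorem run_scale {T : WeightedTree} {σ : State} {M : ℕ} (h : TreeEnv T σ)
    (h21 : ∀ v : Fin T.N, σ.na 21 v = T.par v) (hM : M ≤ σ.nv limVar) (h15 : σ.nv 15 = M)
    (v : Fin T.N) : (scaleStmt.run σ).ra 2 v = M * T.parLen v := by
  have z₁ := run_rtab (x := 20) (a := 2) (e := .zero) (σ := σ) (fun _ => 0) fun _ _ _ _ _ => rfl
  have hs₁ : Same [0, 18, 21] [0] σ ((Stmt.loop 20 (.rstore 2 (.var 20) .zero)).run σ) :=
    Stmt.same_run (by decide) _
  set σ₁ := (Stmt.loop 20 (.rstore 2 (.var 20) .zero)).run σ with hσ₁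
  have main := run_loop (x := 28) (σ := σ₁) (p := .ite (.lt (.var 28) (.var 15))
      (.loop 20 (.rstore 2 (.var 20) (.add (.arr 2 (.var 20)) (lenTm (.var 20)))))
      (.nset 33 (.const 0)))
    (fun t τ => ∀ v : Fin T.N, τ.ra 2 v = (min t M : ℕ) * T.parLen v) ?_ ?_
  · have := main v
    rwa [hs₁.lim, min_eq_right hM] at this
  · intro v
    rw [z₁ v (v.2.trans h.N_lt)]; simp
  · intro t ht τ hτ hI
    have hs := hs₁.trans (hτ.same (by decide))
    have e15 : (τ.setN 28 t).nv 15 = M := by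
      rw [setN_nv, if_neg (by decide), hs.nv 15 (by decide), h15]
    rw [Stmt.run_ite, Tm.tt_lt, Tm.eval_var, Tm.eval_var, e15, setN_nv, if_pos rfl]
    split_ifs with htM
    · rw [Nat.min_eq_left htM.le] at hI
      rw [Nat.min_eq_left htM]
      have hs' : Same [0, 18, 21] [0] σ (τ.setN 28 t) := hs.setN (by decide) _
      have inner := run_loop (x := 20) (σ := τ.setN 28 t)
        (p := .rstore 2 (.var 20) (.add (.arr 2 (.var 20)) (lenTm (.var 20))))
        (fun w υ => ∀ v : Fin T.N, υ.ra 2 v = (if (v : ℕ) < w then (t + 1 : ℝ) else t) * T.parLen v)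
        ?_ ?_
      · intro v
        rw [inner v, if_pos (by rw [hs'.lim]; exact v.2.trans h.N_lt)]; push_cast; rfl
      · intro v
        rw [setN_ra, hI v]; simp
      · intro w hw υ hυ hJ v
        have hs2 := (hs'.trans (hυ.same (by decide))).setN (i := 20) (by decide) w
        have h21' : ∀ v : Fin T.N, (υ.setN 20 w).na 21 v = T.par v := by
          rw [hs2.na 21 (by decide)]; exact h21
        have h18 : ∀ v : Fin T.N, (υ.setN 20 w).na 18 v = v * T.N := fun v => by
          rw [hs2.na 18 (by decide)]; exact h.a18 v (v.2.trans h.N_lt).le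
        simp only [Stmt.run, storeR_ra, Tm.eval_var, true_and, RExp.eval, NExp.eval]
        rw [setN_nv, if_pos rfl]
        by_cases hvw : (v : ℕ) = w
        · have e := eval_lenTm (e := .var 20) (T := T) (v := v) (τ := υ.setN 20 w) (by simp [hvw])
            (by rw [hs2.ra 0 (by decide), h.r0]) h18 h21'
          rw [if_pos hvw, e, setN_ra, ← hvw, hJ v, if_neg (by omega), if_pos (by omega)]
          ring
        · rw [if_neg hvw, setN_ra, hJ v]
          congr 1
          exact if_congr (by omega) rfl rfl
    · have e : ((Stmt.nset 33 (.const 0)).run (τ.setN 28 t)).ra = τ.ra := rfl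
      rw [e, Nat.min_eq_right (by omega)]
      rwa [Nat.min_eq_right (by omega)] at hI

/-- All preparations; the term `fp` yields the parents of the leaves. -/
def prepStmt (fp : Tm) : Stmt :=
  .seq (multStmt 16 10) (.seq quotStmt (.seq digitStmt (.seq (multStmt 18 0)
    (.seq (multStmt 19 8) (.seq levelStmt (.seq parStmt (.seq depthStmt (.seq scaleStmt
      (.seq (.loop 20 (.nstore 22 (.var 20) fp))
        (.loop 20 (.nstore 24 (.var 20) (.arr 19 (.arr 1 (.var 20))))))))))))))

theorem run_prep {D : Task} {σ : State} (h : Setup D σ) {fp : Tm}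
    (hfp : ∀ τ, Same [0, 1, 2] [0] σ τ → (∀ x ≤ σ.nv limVar, τ.na 19 x = x * (D.M + 2 + 2)) →
      ∀ f < D.Fc, τ.nv 20 = f → fp.eval τ = D.fpar f) :
    Prepared D ((prepStmt fp).run σ) ∧ Same [0, 1, 2] [0] σ ((prepStmt fp).run σ) := by
  have s₁ : Same [0, 1, 2] [0] σ ((multStmt 16 10).run σ) := Stmt.same_run (by decide) _
  have t₁ := run_mult (a := 16) (c := 10) (by decide) σ
  rw [h.v10] at t₁
  rw [prepStmt, Stmt.run]
  generalize (multStmt 16 10).run σ = σ₁ at s₁ t₁ ⊢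
  have s₂ : Same [0, 1, 2, 16] [0] σ₁ (quotStmt.run σ₁) := Stmt.same_run (by decide) _
  have t₂ := run_quot (σ := σ₁) (W := D.n + 1) (by omega) (by rw [s₁.lim]; exact t₁)
  rw [Stmt.run]
  generalize quotStmt.run σ₁ = σ₂ at s₂ t₂ ⊢
  have s₃ : Same [0, 1, 2] [0] σ₂ (digitStmt.run σ₂) := Stmt.same_run (by decide) _
  have t₃ := run_digit (σ := σ₂) (W := D.n + 1)
    (by rw [s₂.lim, s₁.lim, s₂.na 16 (by decide)]; exact t₁) (by rw [s₂.lim]; exact t₂)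
  rw [Stmt.run]
  generalize digitStmt.run σ₂ = σ₃ at s₃ t₃ ⊢
  have q₃ := (s₁.trans (s₂.mono (by decide) (by decide))).trans s₃
  rw [s₂.lim, s₁.lim] at t₃
  have s₄ : Same [0, 1, 2, 15] [0] σ₃ ((multStmt 18 0).run σ₃) := Stmt.same_run (by decide) _
  have t₄ := run_mult (a := 18) (c := 0) (by decide) σ₃
  rw [q₃.nv 0 (by decide), h.v0, q₃.lim] at t₄
  rw [Stmt.run]
  generalize (multStmt 18 0).run σ₃ = σ₄ at s₄ t₄ ⊢
  have q₄ := q₃.trans (s₄.mono (by decide) (by decide))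
  have s₅ : Same [0, 1, 2, 15, 18] [0] σ₄ ((multStmt 19 8).run σ₄) := Stmt.same_run (by decide) _
  have t₅ := run_mult (a := 19) (c := 8) (by decide) σ₄
  rw [q₄.nv 8 (by decide), h.v8, q₄.lim] at t₅
  rw [Stmt.run]
  generalize (multStmt 19 8).run σ₄ = σ₅ at s₅ t₅ ⊢
  have q₅ := q₄.trans (s₅.mono (by decide) (by decide))
  have env : ∀ {τ : State}, Same [0, 1, 2, 18] [0] σ₅ τ → TreeEnv D.T τ := fun {τ} hs => by
    have q := q₅.trans (hs.mono (by decide) (by decide))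
    refine ⟨by rw [q.lim]; exact h.N_lt, by rw [q.nv 0 (by decide), h.v0],
      by rw [q.na 0 (by decide), h.a0], by rw [q.ra 0 (by decide), h.r0], ?_⟩
    rw [q.lim, hs.na 18 (by decide), s₅.na 18 (by decide)]; exact t₄
  have s₆ : Same [0, 1, 2, 15, 18, 19] [0] σ₅ (levelStmt.run σ₅) := Stmt.same_run (by decide) _
  have t₆ := run_level (env (Same.refl _ _ σ₅))
  rw [Stmt.run]
  generalize levelStmt.run σ₅ = σ₆ at s₆ t₆ ⊢
  have s₇ : Same [0, 1, 2, 15, 18, 19] [0] σ₆ (parStmt.run σ₆) := Stmt.same_run (by decide) _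
  have t₇ := run_par (env (s₆.mono (by decide) (by decide))) t₆
  rw [Stmt.run]
  generalize parStmt.run σ₆ = σ₇ at s₇ t₇ ⊢
  have q₇ := s₆.trans s₇
  have s₈ : Same [0, 1, 2, 15, 18, 19, 21] [0] σ₇ (depthStmt.run σ₇) :=
    Stmt.same_run (by decide) _
  have t₈ := run_depth (env (q₇.mono (by decide) (by decide))) t₇
  rw [Stmt.run]
  generalize depthStmt.run σ₇ = σ₈ at s₈ t₈ ⊢
  have q₈ := q₇.trans (s₈.mono (by decide) (by decide))
  rw [← s₈.na 21 (by decide)] at t₇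
  have s₉ : Same [0, 1, 2, 15, 18, 19, 21] [0, 1] σ₈ (scaleStmt.run σ₈) :=
    Stmt.same_run (by decide) _
  have t₉ := run_scale (env (q₈.mono (by decide) (by decide))) t₇ (M := D.M)
    (by rw [q₈.lim, q₅.lim]; have := h.C_lt; omega)
    (by rw [q₈.nv 15 (by decide), q₅.nv 15 (by decide), h.v15])
  rw [Stmt.run]
  generalize scaleStmt.run σ₈ = σ₉ at s₉ t₉ ⊢
  have q₉ := q₈.trans (s₉.mono (by decide) (by decide))
  rw [← s₉.na 21 (by decide)] at t₇
  rw [← s₉.ra 1 (by decide)] at t₈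
  have p₉ := q₅.trans (q₉.mono (by decide) (by decide))
  have s₁₀ : Same [0, 1, 2, 15, 18, 19, 21] [0, 1, 2] σ₉
      ((Stmt.loop 20 (.nstore 22 (.var 20) fp)).run σ₉) := Stmt.same_run rfl _
  have t₁₀ := run_tab_on (x := 20) (a := 22) (t := fp) (σ := σ₉) (fun f => f < D.Fc) D.fpar
    (fun f _ hf τ hτ => by
      have hs := (hτ.same (as := [0, 1, 2, 15, 18, 19, 21]) (ras := [0, 1, 2])
        rfl).setN (i := 20) (by decide) f
      refine hfp _ (p₉.trans (hs.mono (by decide) (by decide))) ?_ f hf (by simp)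
      rw [hs.na 19 (by decide), q₉.na 19 (by decide)]; exact t₅)
  rw [Stmt.run]
  generalize (Stmt.loop 20 (.nstore 22 (.var 20) fp)).run σ₉ = σ₁₀ at s₁₀ t₁₀ ⊢
  have s₁₁ : Same [0, 1, 2, 15, 18, 19, 21, 22] [0, 1, 2] σ₁₀
      ((Stmt.loop 20 (.nstore 24 (.var 20) (.arr 19 (.arr 1 (.var 20))))).run σ₁₀) :=
    Stmt.same_run (by decide) _
  have t₁₁ := run_tab_on (x := 20) (a := 24) (t := .arr 19 (.arr 1 (.var 20))) (σ := σ₁₀)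
    (fun f => f < D.n) D.nd
    (fun u _ hu τ hτ => by
      have hs := s₁₀.trans (hτ.same (as := [0, 1, 2, 15, 18, 19, 21]) (ras := [0, 1, 2])
        (by decide))
      simp only [Tm.eval_arr, Tm.eval_var, setN_na, setN_nv, if_true]
      rw [hs.na 1 (by decide), p₉.na 1 (by decide), h.a1 u hu, hs.na 19 (by decide),
        q₉.na 19 (by decide), t₅ _ ((D.user u).2.trans h.N_lt).le]
      rfl)
  generalize (Stmt.loop 20 (.nstore 24 (.var 20) (.arr 19 (.arr 1 (.var 20))))).run σ₁₀ = σ₁₁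
    at s₁₁ t₁₁ ⊢
  have q₁₁ := s₁₀.trans (s₁₁.mono (by decide) (by decide))
  have p₁₁ := p₉.trans (q₁₁.mono (by decide) (by decide))
  refine ⟨⟨h.congr (p₁₁.mono (by decide) (by decide)), ?_, ?_, ?_, ?_, ?_, ?_, ?_, ?_⟩, p₁₁⟩
  · rw [p₁₁.lim, q₁₁.na 15 (by decide), q₉.na 15 (by decide), s₅.na 15 (by decide),
      s₄.na 15 (by decide)]
    exact t₃
  · rw [p₁₁.lim, q₁₁.na 18 (by decide), q₉.na 18 (by decide), s₅.na 18 (by decide)]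
    exact t₄
  · rw [p₁₁.lim, q₁₁.na 19 (by decide), q₉.na 19 (by decide)]
    exact t₅
  · rw [q₁₁.na 21 (by decide)]; exact t₇
  · intro f hf
    rw [s₁₁.na 22 (by decide)]
    exact t₁₀ f (by rw [p₉.lim]; exact hf.trans h.Fc_lt) hf
  · intro u hu
    exact t₁₁ u (by rw [s₁₀.lim, p₉.lim]; exact hu.trans h.n_lt) hu
  · rw [q₁₁.ra 1 (by decide)]; exact t₈
  · rw [q₁₁.ra 2 (by decide)]; exact t₉

end RAM

namespace RAM

/-! ### The subdivided tree for a given length scale -/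

theorem Stmt.run_seq (p q : Stmt) (σ : State) : (Stmt.seq p q).run σ = q.run (p.run σ) := rfl

/-- The multiples of the real variable `1`. -/
def scaleTabStmt : Stmt :=
  .seq (.rstore 4 (.const 0) .zero)
    (.loop 20 (.rstore 4 (.add (.var 20) (.const 1)) (.add (.arr 4 (.var 20)) (.var 1))))

theorem run_scaleTab (σ : State) :
    ∀ x ≤ σ.nv limVar, (scaleTabStmt.run σ).ra 4 x = x * σ.rv 1 := by
  refine run_loop (σ := (Stmt.rstore 4 (.const 0) .zero).run σ)
    (fun v τ => ∀ x ≤ v, τ.ra 4 x = x * σ.rv 1) ?_ fun v hv τ hτ hI x hx => ?_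
  · intro x hx
    obtain rfl : x = 0 := by omega
    simp [Stmt.run]
  · have h1 : τ.rv 1 = σ.rv 1 := hτ.rv 1 (by simp [Stmt.wr])
    simp only [Stmt.run, storeR_ra, true_and, Tm.eval_add, Tm.eval_var, Tm.eval_const, RExp.eval,
      NExp.eval, setN_nv, setN_ra, setN_rv, if_true, h1]
    split_ifs with h
    · rw [hI v le_rfl, h]; push_cast; ring
    · exact hI x (by omega)

/-- The number of units of the edge from the vertex in the variable `20` to its parent. -/
def unitTm : Tm :=
  .sum 25 (.ite (.and (.lt (.var 25) (.var 16))
    (.rlt (.add (.arr 3 (.arr 21 (.var 20))) (.arr 4 (.var 25))) (.arr 2 (.var 20))))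
    (.const 1) (.const 0))

theorem eval_unitTm {D : Task} {τ : State} {B : ℝ} (h : Prepared D τ)
    (h4 : ∀ x ≤ τ.nv limVar, τ.ra 4 x = x * B) {v : Fin D.T.N} (hv : τ.nv 20 = v)
    (h3 : τ.ra 3 (D.T.par v) = D.T.slack D.M (D.M + 2) B (D.T.par v)) :
    unitTm.eval τ = D.T.units D.M (D.M + 2) B v := by
  classical
  simp only [unitTm, Tm.eval_sum, Tm.eval_ite, Tm.tt_and, Tm.tt_lt, Tm.tt_rlt, Tm.eval_var,
    Tm.eval_const, RExp.eval, NExp.eval, setN_nv, setN_na, setN_ra, Nat.reduceEqDiff, if_true,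
    if_false, hv, h.v16, h.a21, h3, h.r2]
  rw [WeightedTree.units, WeightedTree.unitsOf, Finset.sum_boole, Nat.cast_id]
  congr 1
  ext i
  have hC := h.C_lt
  simp only [Finset.mem_filter, Finset.mem_range]
  constructor
  · rintro ⟨h1, h2, h3⟩
    rw [h4 i h1.le] at h3
    exact ⟨h2, h3⟩
  · rintro ⟨h1, h2⟩
    refine ⟨by omega, h1, ?_⟩
    rwa [h4 i (by omega)]

def slackBody : Stmt :=
  .seq (.nset 32 unitTm)
    (.seq (.rset 3 (.sub (.add (.arr 3 (.arr 21 (.var 20))) (.arr 4 (.var 32))) (.arr 2 (.var 20))))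
      (.ite (.rlt (.var 3) .zero) (.rstore 3 (.var 20) .zero) (.rstore 3 (.var 20) (.var 3))))

/-- The rounding errors of the vertices. -/
def slackStmt : Stmt := .seq (.rstore 3 (.const 0) .zero) (.loop 28 (.loop 20 slackBody))

theorem run_slack {D : Task} {σ : State} {B : ℝ} (hB : 0 ≤ B) (h : Prepared D σ)
    (h4 : ∀ x ≤ σ.nv limVar, σ.ra 4 x = x * B) (v : Fin D.T.N) :
    (slackStmt.run σ).ra 3 v = D.T.slack D.M (D.M + 2) B v := by
  have hs₁ : Same [0, 1, 15, 18, 19, 21, 22, 24] [0, 1, 2, 4] σ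
    ((Stmt.rstore 3 (.const 0) .zero).run σ) := Stmt.same_run (by decide) _
  have key : ∀ τ : State, (slackBody.run τ).ra 3 = Function.update (τ.ra 3) (τ.nv 20)
      (max 0 (τ.ra 3 (τ.na 21 (τ.nv 20)) + τ.ra 4 (unitTm.eval τ) - τ.ra 2 (τ.nv 20))) := by
    intro τ
    rw [slackBody, Stmt.run_seq, Stmt.run_seq, Stmt.run_ite]
    simp only [Stmt.run, Tm.tt_rlt, RExp.eval, NExp.eval, setR_rv,
      setN_nv, setN_na, setN_ra, Nat.reduceEqDiff, if_true, if_false]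
    split_ifs with hlt
    · funext j
      simp only [storeR_ra, true_and, Tm.eval_var, setR_nv, setR_ra, setN_nv, setN_ra,
        Nat.reduceEqDiff, if_false, Function.update_apply]
      rw [max_eq_left hlt.le]
    · funext j
      simp only [storeR_ra, true_and, Tm.eval_var, setR_nv, setR_ra, setN_nv, setN_ra,
        Nat.reduceEqDiff, if_false, Function.update_apply]
      rw [max_eq_right (not_lt.1 hlt)]
  refine run_treeTab (D.T.slack D.M (D.M + 2) B) (by rw [hs₁.lim]; exact h.N_lt) ?_ (by decide)
    ?_ ?_ v
  · rw [D.T.slack_root]; simp [Stmt.run]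
  · intro τ _ j hj
    rw [key, Function.update_apply, if_neg hj]
  · intro τ hτ v hv hpar
    have hs := hs₁.trans (hτ.same (by decide))
    have hP := h.congr (hs.mono (by decide) (by decide))
    have h4' : ∀ x ≤ τ.nv limVar, τ.ra 4 x = x * B := by
      rw [hs.lim, hs.ra 4 (by decide)]; exact h4
    have hu := eval_unitTm hP h4' hv hpar
    have hle : D.T.units D.M (D.M + 2) B v ≤ D.M + 2 + 1 := WeightedTree.unitsOf_le _ _
    have hC := hP.C_lt
    rw [key, hv, Function.update_self, hP.a21, hpar, hu, h4' _ (by omega), hP.r2]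
    -- The loop does not spare the root, where the recursion formula happens to give back `0`.
    by_cases hvr : v = D.T.root
    · subst hvr
      rw [D.T.par_root, D.T.slack_root, WeightedTree.units_root hB, D.T.parLen_root]
      simp
    · exact (WeightedTree.slack_par hvr).symm

/-- The parents of the nodes and the lengths of the edges to them. -/
def nodeStmt : Stmt :=
  .loop 20 (.loop 21 (.ite (.and (.lt (.var 20) (.var 0)) (.lt (.var 21) (.var 8)))
    (.seq (.nstore 10 (.add (.arr 19 (.var 20)) (.var 21))
        (.ite (.lt (.var 21) (.var 16)) (.add (.add (.arr 19 (.var 20)) (.var 21)) (.const 1))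
          (.ite (.eq (.var 20) (.const 0)) (.var 13) (.arr 19 (.arr 21 (.var 20))))))
      (.nstore 11 (.add (.arr 19 (.var 20)) (.var 21))
        (.ite (.lt (.var 21) (.arr 23 (.var 20))) (.const 1) (.const 0))))
    (.nset 33 (.const 0))))

theorem run_node {D : Task} {σ : State} {B : ℝ} (h : Prepared D σ)
    (h23 : ∀ v : Fin D.T.N, σ.na 23 v = D.T.units D.M (D.M + 2) B v) (v : Fin D.T.N) {i : ℕ}
    (hi : i < D.M + 2 + 2) :
    (nodeStmt.run σ).na 10 (v * (D.M + 2 + 2) + i) =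
      D.T.chainPar (D.M + 2) D.Fc D.fpar (v * (D.M + 2 + 2) + i) ∧
    (nodeStmt.run σ).na 11 (v * (D.M + 2 + 2) + i) =
      D.T.chainW D.M (D.M + 2) B (v * (D.M + 2 + 2) + i) := by
  have main := run_loop2 (x := 20) (y := 21) (σ := σ)
    (p := (.ite (.and (.lt (.var 20) (.var 0)) (.lt (.var 21) (.var 8)))
    (.seq (.nstore 10 (.add (.arr 19 (.var 20)) (.var 21))
        (.ite (.lt (.var 21) (.var 16)) (.add (.add (.arr 19 (.var 20)) (.var 21)) (.const 1))
          (.ite (.eq (.var 20) (.const 0)) (.var 13) (.arr 19 (.arr 21 (.var 20))))))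
      (.nstore 11 (.add (.arr 19 (.var 20)) (.var 21))
        (.ite (.lt (.var 21) (.arr 23 (.var 20))) (.const 1) (.const 0))))
    (.nset 33 (.const 0)))) (by decide) (by decide)
    (fun j τ => ∀ v : Fin D.T.N, ∀ i < D.M + 2 + 2, v * σ.nv limVar + i < j →
      τ.na 10 (v * (D.M + 2 + 2) + i) =
        D.T.chainPar (D.M + 2) D.Fc D.fpar (v * (D.M + 2 + 2) + i) ∧
      τ.na 11 (v * (D.M + 2 + 2) + i) = D.T.chainW D.M (D.M + 2) B (v * (D.M + 2 + 2) + i))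
    (fun j τ v h => ⟨h, h⟩) (by simp) ?_
  · exact main v i hi (pair_lt (v.2.trans h.N_lt) (hi.trans h.C_lt))
  · intro a ha b hb τ hτ h20 h21 hI v i hi hj
    have hs := hτ.same (as := [0, 1, 15, 18, 19, 21, 22, 24, 23]) (ras := [0, 1, 2]) (by decide)
    have hP := h.congr (hs.mono (by decide) (by decide))
    have hiL := hi.trans h.C_lt
    have hold : ¬ (v * σ.nv limVar + i = a * σ.nv limVar + b) →
        v * σ.nv limVar + i < a * σ.nv limVar + b := by omega
    rw [pair_inj hiL hb] at hold
    simp only [Stmt.run_ite, Tm.tt_and, Tm.tt_lt, Tm.eval_var, hP.v0, hP.v8, h20, h21]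
    split_ifs with hab
    · have e19 : τ.na 19 a = a * (D.M + 2 + 2) := by
        rw [hs.na 19 (by decide), h.a19 a (hab.1.trans h.N_lt).le]
      obtain ⟨w, rfl⟩ : ∃ w : Fin D.T.N, a = w := ⟨⟨a, hab.1⟩, rfl⟩
      simp only [Stmt.run, storeN_na, true_and, Nat.reduceEqDiff, false_and, if_false,
        Tm.eval_add, Tm.eval_arr, Tm.eval_var, storeN_nv, h20, h21, e19, pair_inj hi hab.2]
      by_cases hvi : (v : ℕ) = w ∧ i = b
      · obtain ⟨hvw, rfl⟩ := hvi
        obtain rfl : v = w := Fin.ext hvw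
        simp only [true_and, if_true, Tm.eval_ite, Tm.tt_lt, Tm.tt_eq, Tm.eval_add, Tm.eval_arr,
          Tm.eval_var, Tm.eval_const, storeN_nv, storeN_na, Nat.reduceEqDiff, false_and, if_false,
          h20, h21, hP.v16, hP.v13, hP.a21, e19, hs.na 23 (by decide), h23]
        refine ⟨?_, ?_⟩
        · split_ifs with h1 h2
          · rw [WeightedTree.chainPar_step v h1]; ring
          · obtain rfl : i = D.M + 2 + 1 := by omega
            rw [h2, zero_mul, zero_add, WeightedTree.chainPar_root]
            rfl
          · obtain rfl : i = D.M + 2 + 1 := by omega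
            rw [WeightedTree.chainPar_last (mt WeightedTree.eq_root_iff.2 h2), hs.na 19 (by decide),
              h.a19 _ ((D.T.par v).2.trans h.N_lt).le, add_zero]
        · rw [WeightedTree.chainW_node v hi]
      · rw [if_neg hvi, if_neg hvi]
        exact hI v i hi (hold hvi)
    · have hvi : ¬ ((v : ℕ) = a ∧ i = b) := by
        rintro ⟨rfl, rfl⟩; exact hab ⟨v.2, hi⟩
      exact hI v i hi (hold hvi)

/-- The parents of the leaves. -/
def leafStmt : Stmt :=
  .loop 20 (.ite (.lt (.var 20) (.var 11))
    (.seq (.nstore 10 (.add (.var 12) (.var 20)) (.arr 22 (.var 20)))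
      (.nstore 11 (.add (.var 12) (.var 20)) (.const 0)))
    (.nset 33 (.const 0)))

theorem run_leaf {D : Task} {σ : State} (h : Prepared D σ) :
    (∀ f < D.Fc, (leafStmt.run σ).na 10 (D.T.N * (D.M + 2 + 2) + f) = D.fpar f ∧
      (leafStmt.run σ).na 11 (D.T.N * (D.M + 2 + 2) + f) = 0) ∧
    ∀ k < D.T.N * (D.M + 2 + 2), (leafStmt.run σ).na 10 k = σ.na 10 k ∧
      (leafStmt.run σ).na 11 k = σ.na 11 k := by
  have main := run_loop (x := 20) (σ := σ) (p := (.ite (.lt (.var 20) (.var 11))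
    (.seq (.nstore 10 (.add (.var 12) (.var 20)) (.arr 22 (.var 20)))
      (.nstore 11 (.add (.var 12) (.var 20)) (.const 0)))
    (.nset 33 (.const 0))))
    (fun j τ => (∀ f < D.Fc, f < j → τ.na 10 (D.T.N * (D.M + 2 + 2) + f) = D.fpar f ∧
      τ.na 11 (D.T.N * (D.M + 2 + 2) + f) = 0) ∧
    ∀ k < D.T.N * (D.M + 2 + 2), τ.na 10 k = σ.na 10 k ∧ τ.na 11 k = σ.na 11 k)
    ⟨by simp, fun _ _ => ⟨rfl, rfl⟩⟩ ?_
  · exact ⟨fun f hf => main.1 f hf (hf.trans h.Fc_lt), main.2⟩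
  · intro a ha τ hτ hI
    have hs := (hτ.same (as := [0, 1, 15, 18, 19, 21, 22, 24]) (ras := [0, 1, 2])
      (by decide)).setN (i := 20) (by decide) a
    have hP := h.congr (hs.mono (by decide) (by decide))
    have h20 : (τ.setN 20 a).nv 20 = a := by simp
    have hI' : (∀ f < D.Fc, f < a → (τ.setN 20 a).na 10 (D.T.N * (D.M + 2 + 2) + f) = D.fpar f ∧
      (τ.setN 20 a).na 11 (D.T.N * (D.M + 2 + 2) + f) = 0) ∧
      ∀ k < D.T.N * (D.M + 2 + 2), (τ.setN 20 a).na 10 k = σ.na 10 k ∧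
        (τ.setN 20 a).na 11 k = σ.na 11 k := hI
    generalize τ.setN 20 a = υ at hs hP h20 hI' ⊢
    simp only [Stmt.run_ite, Tm.tt_lt, Tm.eval_var, hP.v11, h20]
    split_ifs with haF
    · simp only [Stmt.run, storeN_na, true_and, Nat.reduceEqDiff, false_and, if_false,
        Tm.eval_add, Tm.eval_arr, Tm.eval_var, Tm.eval_const, storeN_nv, h20, hP.v12,
        hP.a22 a haF, Nat.add_left_cancel_iff]
      refine ⟨fun f hf hfa => ?_, fun k hk => ?_⟩
      · by_cases hfe : f = a
        · rw [if_pos hfe, if_pos hfe, hfe]; exact ⟨rfl, rfl⟩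
        · rw [if_neg hfe, if_neg hfe]; exact hI'.1 f hf (by omega)
      · rw [if_neg (by omega), if_neg (by omega)]; exact hI'.2 k hk
    · exact ⟨fun f hf hfa => hI'.1 f hf (by omega), hI'.2⟩

/-- The memory after the subdivided tree has been built. -/
structure Built (D : Task) (B : ℝ) (hB : 0 ≤ B) (σ : State) : Prop extends Prepared D σ where
  a10 : ∀ k < D.S, σ.na 10 k = (D.tree B hB).par k
  a11 : ∀ k < D.S, σ.na 11 k = (D.tree B hB).w k

theorem Built.congr {D : Task} {B : ℝ} {hB : 0 ≤ B} {σ τ : State} (h : Built D B hB σ)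
    (hs : Same [0, 1, 15, 18, 19, 21, 22, 24, 10, 11] [0, 1, 2] σ τ) : Built D B hB τ :=
  ⟨h.toPrepared.congr (hs.mono (by decide) (by decide)),
    by rw [hs.na 10 (by decide)]; exact h.a10, by rw [hs.na 11 (by decide)]; exact h.a11⟩

/-- Build the subdivided tree for the length scale in the real variable `1`. -/
def buildStmt : Stmt :=
  .seq scaleTabStmt (.seq slackStmt (.seq (.loop 20 (.nstore 23 (.var 20) unitTm))
    (.seq nodeStmt leafStmt)))

theorem run_build {D : Task} {B : ℝ} (hB : 0 ≤ B) {σ : State} (h : Prepared D σ)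
    (h1 : σ.rv 1 = B) : Built D B hB (buildStmt.run σ) := by
  have s₁ : Same [0, 1, 15, 18, 19, 21, 22, 24] [0, 1, 2] σ (scaleTabStmt.run σ) :=
    Stmt.same_run (by decide) _
  have t₁ := run_scaleTab σ
  rw [h1] at t₁
  rw [buildStmt, Stmt.run]
  generalize scaleTabStmt.run σ = σ₁ at s₁ t₁ ⊢
  have h₁ := h.congr s₁
  rw [← s₁.lim] at t₁
  have s₂ : Same [0, 1, 15, 18, 19, 21, 22, 24] [0, 1, 2, 4] σ₁ (slackStmt.run σ₁) :=
    Stmt.same_run (by decide) _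
  have t₂ := run_slack hB h₁ t₁
  rw [Stmt.run]
  generalize slackStmt.run σ₁ = σ₂ at s₂ t₂ ⊢
  have h₂ := h₁.congr (s₂.mono (by decide) (by decide))
  rw [← s₂.lim, ← s₂.ra 4 (by decide)] at t₁
  have s₃ : Same [0, 1, 15, 18, 19, 21, 22, 24] [0, 1, 2, 3, 4] σ₂
    ((Stmt.loop 20 (.nstore 23 (.var 20) unitTm)).run σ₂) := Stmt.same_run (by decide) _
  have t₃ : ∀ v : Fin D.T.N, ((Stmt.loop 20 (.nstore 23 (.var 20) unitTm)).run σ₂).na 23 v =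
      D.T.units D.M (D.M + 2) B v := fun v => by
    have := run_tab_on (x := 20) (a := 23) (t := unitTm) (σ := σ₂) (fun i => i < D.T.N)
      (fun i => D.T.units D.M (D.M + 2) B (D.T.vert i)) ?_ v (v.2.trans h₂.N_lt) v.2
    · rw [WeightedTree.vert_val] at this; exact this
    · intro i hi hiN τ hτ
      have hs := (hτ.same (as := [0, 1, 15, 18, 19, 21, 22, 24]) (ras := [0, 1, 2, 3, 4])
        (by decide)).setN (i := 20) (by decide) i
      refine eval_unitTm (h₂.congr (hs.mono (by decide) (by decide))) ?_ ?_ ?_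
      · rw [hs.lim, hs.ra 4 (by decide)]; exact t₁
      · rw [setN_nv, if_pos rfl, WeightedTree.val_vert hiN]
      · rw [hs.ra 3 (by decide)]; exact t₂ _
  rw [Stmt.run]
  generalize (Stmt.loop 20 (.nstore 23 (.var 20) unitTm)).run σ₂ = σ₃ at s₃ t₃ ⊢
  have h₃ := h₂.congr (s₃.mono (by decide) (by decide))
  have s₄ : Same [0, 1, 15, 18, 19, 21, 22, 24] [0, 1, 2] σ₃ (nodeStmt.run σ₃) :=
    Stmt.same_run (by decide) _
  have t₄ := fun v : Fin D.T.N => fun {i : ℕ} => run_node (B := B) h₃ t₃ v (i := i)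
  rw [Stmt.run]
  generalize nodeStmt.run σ₃ = σ₄ at s₄ t₄ ⊢
  have h₄ := h₃.congr s₄
  have s₅ : Same [0, 1, 15, 18, 19, 21, 22, 24] [0, 1, 2] σ₄ (leafStmt.run σ₄) :=
    Stmt.same_run (by decide) _
  have t₅ := run_leaf h₄
  generalize leafStmt.run σ₄ = σ₅ at s₅ t₅ ⊢
  refine ⟨h₄.congr s₅, fun k hk => ?_, fun k hk => ?_⟩
  · change _ = D.T.chainPar (D.M + 2) D.Fc D.fpar k
    by_cases hkN : k < D.T.N * (D.M + 2 + 2)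
    · obtain ⟨v, i, hi, rfl⟩ := WeightedTree.exists_chain hkN
      rw [(t₅.2 _ hkN).1, (t₄ v hi).1]
    · obtain ⟨f, rfl⟩ : ∃ f, k = D.T.N * (D.M + 2 + 2) + f := ⟨_, (Nat.add_sub_cancel' (not_lt.1 hkN)).symm⟩
      unfold Task.S at hk
      rw [(t₅.1 f (by omega)).1, WeightedTree.chainPar_leaf]
  · change _ = D.T.chainW D.M (D.M + 2) B k
    by_cases hkN : k < D.T.N * (D.M + 2 + 2)
    · obtain ⟨v, i, hi, rfl⟩ := WeightedTree.exists_chain hkN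
      rw [(t₅.2 _ hkN).2, (t₄ v hi).2]
    · obtain ⟨f, rfl⟩ : ∃ f, k = D.T.N * (D.M + 2 + 2) + f := ⟨_, (Nat.add_sub_cancel' (not_lt.1 hkN)).symm⟩
      unfold Task.S at hk
      rw [(t₅.1 f (by omega)).2, WeightedTree.chainW_leaf]

end RAM

namespace RAM

/-! ### Deciding solvability -/

namespace Task

variable (D : Task)

/-- The users in `U` are assigned to leaves at distance at most `R`, such that each leaf `f`,
which has `cnt f` users already, gets no users or at least `r` users in total. -/
def IsSol (B : ℝ) (hB : 0 ≤ B) (U : Finset ℕ) (cnt π : ℕ → ℕ) : Prop :=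
  (∀ u ∈ U, π u < D.Fc ∧
      (D.tree B hB).Near D.R (D.nd u) (D.T.N * (D.M + 2 + 2) + π u)) ∧
    ∀ f < D.Fc, cnt f + (U.filter fun u => π u = f).card = 0 ∨
      D.r ≤ cnt f + (U.filter fun u => π u = f).card

def Solv (B : ℝ) (hB : 0 ≤ B) (U : Finset ℕ) (cnt : ℕ → ℕ) : Prop := ∃ π, D.IsSol B hB U cnt π

/-- The permitted numbers of further users of the nodes. -/
def allowed (cnt : ℕ → ℕ) (k x : ℕ) : Prop :=
  if k < D.T.N * (D.M + 2 + 2) then x = 0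
  else x + cnt (k - D.T.N * (D.M + 2 + 2)) = 0 ∨ ¬ x + cnt (k - D.T.N * (D.M + 2 + 2)) < D.r

variable {D}

theorem nd_lt (u : ℕ) : D.nd u < D.S :=
  (WeightedTree.chain_lt (D.user u).2 (show 0 < D.M + 2 + 2 by omega)).trans_le
    (Nat.le_add_right _ _)

/-- Nodes that are not leaves are permitted no users, so every assignment goes to leaves; only the
numbering is shifted. -/
theorem solvable_iff {B : ℝ} {hB : 0 ≤ B} {U : Finset ℕ} {cnt : ℕ → ℕ} :
    (D.tree B hB).Solvable D.R D.nd U (D.allowed cnt) ↔ D.Solv B hB U cnt := by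
  have hS : (D.tree B hB).S = D.T.N * (D.M + 2 + 2) + D.Fc := rfl
  constructor
  · rintro ⟨g, h1, h2⟩
    have h3 : ∀ u ∈ U, D.T.N * (D.M + 2 + 2) ≤ g u := by
      intro u hu
      by_contra hlt
      have := h2 (g u) (h1 u hu).1
      rw [allowed, if_pos (by omega), Finset.card_eq_zero] at this
      exact Finset.notMem_empty u (this ▸ Finset.mem_filter.2 ⟨hu, rfl⟩)
    refine ⟨fun u => g u - D.T.N * (D.M + 2 + 2), fun u hu => ?_, fun f hf => ?_⟩
    · have := h3 u hu
      obtain ⟨h4, h5⟩ := h1 u hu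
      refine ⟨by beta_reduce; omega, ?_⟩
      beta_reduce
      rwa [Nat.add_sub_cancel' this]
    · have := h2 (D.T.N * (D.M + 2 + 2) + f) (by omega)
      rw [allowed, if_neg (by omega), Nat.add_sub_cancel_left] at this
      have e : (U.filter fun u => g u - D.T.N * (D.M + 2 + 2) = f) =
          U.filter fun u => g u = D.T.N * (D.M + 2 + 2) + f :=
        Finset.filter_congr fun u hu => by have := h3 u hu; omega
      rw [e]; omega
  · rintro ⟨π, h1, h2⟩
    refine ⟨fun u => D.T.N * (D.M + 2 + 2) + π u, fun u hu => ⟨?_, (h1 u hu).2⟩, fun k hk => ?_⟩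
    · have := (h1 u hu).1; beta_reduce; omega
    · beta_reduce
      rw [allowed]
      split_ifs with hkN
      · rw [Finset.card_eq_zero, Finset.filter_eq_empty_iff]
        intro u _; omega
      · have := h2 (k - D.T.N * (D.M + 2 + 2)) (by omega)
        have e : (U.filter fun u => π u = k - D.T.N * (D.M + 2 + 2)) =
            U.filter fun u => D.T.N * (D.M + 2 + 2) + π u = k :=
          Finset.filter_congr fun u _ => by omega
        rw [e] at this; omega

/-- The same decision program tests distances: with a single user, and exactly one user required at
the leaf, solvability means nearness. -/
theorem solvable_single_iff {B : ℝ} {hB : 0 ≤ B} {u f : ℕ} (hf : f < D.Fc) :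
    (D.tree B hB).Solvable D.R D.nd {u}
      (fun k x => x = if k = D.T.N * (D.M + 2 + 2) + f then 1 else 0) ↔
      (D.tree B hB).Near D.R (D.nd u) (D.T.N * (D.M + 2 + 2) + f) := by
  have hS : (D.tree B hB).S = D.T.N * (D.M + 2 + 2) + D.Fc := rfl
  constructor
  · rintro ⟨g, h1, h2⟩
    have h3 := h2 (D.T.N * (D.M + 2 + 2) + f) (by omega)
    beta_reduce at h3
    rw [if_pos rfl, Finset.card_eq_one] at h3
    obtain ⟨u', hu'⟩ := h3
    have := hu'.ge (Finset.mem_singleton_self u')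
    rw [Finset.mem_filter, Finset.mem_singleton] at this
    obtain ⟨rfl, hg⟩ := this
    rw [← hg]
    exact (h1 u' (Finset.mem_singleton_self _)).2
  · intro h
    refine ⟨fun _ => D.T.N * (D.M + 2 + 2) + f, fun u' hu' => ?_, fun k _ => ?_⟩
    · rw [Finset.mem_singleton] at hu'
      subst hu'
      exact ⟨by beta_reduce; omega, h⟩
    · by_cases hk : D.T.N * (D.M + 2 + 2) + f = k
      · simp [hk]
      · simp [hk, Ne.symm hk]

end Task

/-- The memories differ only in what the programs for solvability write to. -/
structure Quiet (σ τ : State) : Prop where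
  nv : ∀ i, i < 20 ∨ 32 ≤ i → τ.nv i = σ.nv i
  rv : τ.rv = σ.rv
  na : ∀ a, a ∉ [12, 13, 14] → τ.na a = σ.na a
  ra : τ.ra = σ.ra

theorem Quiet.setN {σ τ : State} (h : Quiet σ τ) {i : ℕ} (h1 : 20 ≤ i) (h2 : i < 32) (v : ℕ) :
    Quiet σ (τ.setN i v) :=
  ⟨fun j hj => by rw [setN_nv, if_neg (by omega), h.nv j hj], h.rv, h.na, h.ra⟩

theorem Quiet.trans {σ τ υ : State} (h : Quiet σ τ) (h' : Quiet τ υ) : Quiet σ υ :=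
  ⟨fun i hi => (h'.nv i hi).trans (h.nv i hi), h'.rv.trans h.rv,
    fun i hi => (h'.na i hi).trans (h.na i hi), h'.ra.trans h.ra⟩

def Stmt.quiet (s : Stmt) : Bool :=
  s.wn.all (fun i => decide (20 ≤ i) && decide (i < 32)) && (s.wr.isEmpty &&
    (s.wna.all (fun i => decide (i ∈ [12, 13, 14])) && s.wra.isEmpty))

theorem Off.quiet {s : Stmt} {σ τ : State} (h : Off s σ τ) (hs : s.quiet = true) : Quiet σ τ := by
  simp only [Stmt.quiet, Bool.and_eq_true, List.all_eq_true, decide_eq_true_eq,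
    List.isEmpty_iff] at hs
  obtain ⟨h1, h2, h3, h4⟩ := hs
  exact ⟨fun i hi => h.nv i fun hh => by have := h1 i hh; omega,
    funext fun i => h.rv i (by simp [h2]), fun a ha => h.na a fun hh => ha (h3 a hh),
    funext fun i => h.ra i (by simp [h4])⟩

theorem Quiet.same {σ τ : State} (h : Quiet σ τ) {as ras : List ℕ}
    (ha : as.all (fun a => decide (a ∉ [12, 13, 14])) = true) : Same as ras σ τ := by
  simp only [List.all_eq_true, decide_eq_true_eq] at ha
  exact ⟨fun i hi => h.nv i (Or.inl hi), fun a hh => h.na a (ha a hh), fun a _ => by rw [h.ra]⟩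

theorem Built.quiet {D : Task} {B : ℝ} {hB : 0 ≤ B} {σ τ : State} (h : Built D B hB σ)
    (hq : Quiet σ τ) : Built D B hB τ := h.congr (hq.same rfl)

/-- Decide solvability for the users `u` for which `g` holds, with `u` in the variable `25`; the
term `a` tells which numbers (the variable `21`) of users of a node (the variable `20`) are
permitted. -/
def decideStmt (g a : Tm) : Stmt :=
  .seq (.loop 20 (.nstore 13 (.var 20) (.sum 25 (.ite (.and (.lt (.var 25) (.var 1))
      (.and g (.eq (.arr 24 (.var 25)) (.var 20)))) (.const 1) (.const 0)))))
    (.seq (.loop 20 (.loop 21 (.nstore 14 (.pair (.var 20) (.var 21)) a))) oracleStmt)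

theorem quiet_decide (g a : Tm) (σ : State) : Quiet σ ((decideStmt g a).run σ) :=
  (Off.run _ _).quiet rfl

theorem run_decide {D : Task} {B : ℝ} {hB : 0 ≤ B} {σ : State} (h : Built D B hB σ)
    {U : Finset ℕ} {al : ℕ → ℕ → Prop} {g a : Tm} (hU : ∀ u ∈ U, u < D.n)
    (hg : ∀ τ, Quiet σ τ → ∀ u < D.n, τ.nv 25 = u → (g.tt τ ↔ u ∈ U))
    (ha : ∀ τ, Quiet σ τ → ∀ k < D.S, ∀ x < D.n + 1, τ.nv 20 = k → τ.nv 21 = x →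
      (a.tt τ ↔ al k x)) :
    ((decideStmt g a).run σ).nv 31 ≠ 0 ↔ (D.tree B hB).Solvable D.R D.nd U al := by
  classical
  rw [decideStmt, Stmt.run]
  have q₁ : Quiet σ ((Stmt.loop 20 (.nstore 13 (.var 20) (.sum 25 (.ite (.and
      (.lt (.var 25) (.var 1)) (.and g (.eq (.arr 24 (.var 25)) (.var 20)))) (.const 1)
      (.const 0))))).run σ) := (Off.run _ _).quiet rfl
  have t₁ := run_tab (x := 20) (a := 13) (σ := σ) (t := (.sum 25 (.ite (.and
      (.lt (.var 25) (.var 1)) (.and g (.eq (.arr 24 (.var 25)) (.var 20)))) (.const 1)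
      (.const 0)))) (fun k => (U.filter fun u => D.nd u = k).card) (fun k _ τ hτ _ => by
      have hq := (hτ.quiet rfl).setN (i := 20) (by decide) (by decide) k
      simp only [Tm.eval_sum, Tm.eval_ite, Tm.tt_and, Tm.tt_lt, Tm.tt_eq, Tm.eval_arr, Tm.eval_var,
        Tm.eval_const]
      have hlim : (τ.setN 20 k).nv limVar = σ.nv limVar := hq.nv _ (by decide)
      rw [Finset.sum_boole, Nat.cast_id, hlim]
      congr 1
      ext u
      have hq' := hq.setN (i := 25) (by decide) (by decide) u
      have hb := h.quiet hq'
      simp only [Finset.mem_filter, Finset.mem_range, setN_nv, if_true, Nat.reduceEqDiff, if_false]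
      have e1 : τ.nv 1 = D.n := by
        have := hb.v1
        simpa using this
      have e2 : ∀ u < D.n, τ.na 24 u = D.nd u := hb.a24
      rw [setN_na, setN_na, e1]
      constructor
      · rintro ⟨h1, h2, h3, h4⟩
        rw [hg _ hq' u h2 (by simp)] at h3
        rw [e2 u h2] at h4
        exact ⟨h3, h4⟩
      · rintro ⟨h1, h2⟩
        have h3 := hU u h1
        exact ⟨h3.trans h.n_lt, h3, (hg _ hq' u h3 (by simp)).2 h1, by rwa [e2 u h3]⟩)
  generalize (Stmt.loop 20 (.nstore 13 (.var 20) (.sum 25 (.ite (.and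
      (.lt (.var 25) (.var 1)) (.and g (.eq (.arr 24 (.var 25)) (.var 20)))) (.const 1)
      (.const 0))))).run σ = σ₁ at q₁ t₁ ⊢
  have hlim₁ : σ₁.nv limVar = σ.nv limVar := q₁.nv _ (by decide)
  rw [Stmt.run]
  have q₂ : Quiet σ₁ ((Stmt.loop 20 (.loop 21 (.nstore 14 (.pair (.var 20) (.var 21)) a))).run σ₁) :=
    (Off.run _ _).quiet rfl
  have e₂ : ((Stmt.loop 20 (.loop 21 (.nstore 14 (.pair (.var 20) (.var 21)) a))).run σ₁).na 13 =
    σ₁.na 13 := (Off.run _ _).na _ (by simp [Stmt.wna])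
  have t₂ := run_loop2 (x := 20) (y := 21) (σ := σ₁)
    (p := .nstore 14 (.pair (.var 20) (.var 21)) a) (by simp [Stmt.wn]) (by simp [Stmt.wn])
    (fun j τ => ∀ k < D.S, ∀ x < D.n + 1, k * σ.nv limVar + x < j →
      (τ.na 14 (k * σ.nv limVar + x) ≠ 0 ↔ al k x)) (fun j τ v h => ⟨h, h⟩) (by simp)
    (fun k hk x hx τ hτ h20 h21 hI k' hk' x' hx' hj => by
      have hq := q₁.trans (hτ.quiet rfl)
      have hlim : τ.nv limVar = σ.nv limVar := hq.nv _ (by decide)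
      rw [hlim₁] at hx hI hj
      have hx'L : x' < σ.nv limVar := by have := h.n_lt; omega
      simp only [Stmt.run, storeN_na, true_and, Tm.eval_pair, Tm.eval_var, h20, h21, hlim]
      split_ifs with he
      · rw [pair_inj hx'L hx] at he
        obtain ⟨rfl, rfl⟩ := he
        exact ha τ hq k' hk' x' hx' h20 h21
      · exact hI k' hk' x' hx' (by omega))
  generalize (Stmt.loop 20 (.loop 21 (.nstore 14 (.pair (.var 20) (.var 21)) a))).run σ₁ = σ₂
    at q₂ e₂ t₂ ⊢
  have hb := h.quiet (q₁.trans q₂)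
  have hlim₂ : σ₂.nv limVar = σ.nv limVar := (q₁.trans q₂).nv _ (by decide)
  have hS : (D.tree B hB).S = D.S := rfl
  refine oracle_spec (W := D.n + 1) ⟨by rw [hS]; exact hb.S_lt, hb.R_le, hb.W_pow, hb.v13, hb.v14,
    hb.v16, hb.a10, hb.a11, fun s hs t ht => hb.a15 s hs t (ht.trans_le hb.R_le), ?_,
    fun u _ => Task.nd_lt u, ?_, ?_⟩
  · have := Finset.card_le_card (show U ⊆ Finset.range D.n from
      fun u hu => Finset.mem_range.2 (hU u hu))
    rw [Finset.card_range] at this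
    omega
  · intro k hk
    rw [e₂]
    exact t₁ k (hk.trans (by rw [hS]; exact h.S_lt))
  · intro k hk x hx
    rw [hlim₂]
    refine t₂ k hk x hx ?_
    rw [hlim₁]
    exact pair_lt (hk.trans (by rw [hS]; exact h.S_lt)) (by have := h.n_lt; omega)

/-- Decide whether the users marked in the array `25` can be assigned, with the numbers of users
assigned before in the array `26`. -/
def solveStmt : Stmt :=
  decideStmt (.arr 25 (.var 25)) (.ite (.lt (.var 20) (.var 12)) (.eq (.var 21) (.const 0))
    (.or (.eq (.add (.var 21) (.arr 26 (.sub (.var 20) (.var 12)))) (.const 0))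
      (.not (.lt (.add (.var 21) (.arr 26 (.sub (.var 20) (.var 12)))) (.var 3)))))

/-- The users marked in the array `25` and the numbers in the array `26`. -/
structure Holds (D : Task) (U : Finset ℕ) (cnt : ℕ → ℕ) (σ : State) : Prop where
  lt : ∀ u ∈ U, u < D.n
  a25 : ∀ u < D.n, σ.na 25 u ≠ 0 ↔ u ∈ U
  a26 : ∀ f < D.Fc, σ.na 26 f = cnt f

theorem Holds.congr {D : Task} {U : Finset ℕ} {cnt : ℕ → ℕ} {σ τ : State} (h : Holds D U cnt σ)
    (h25 : τ.na 25 = σ.na 25) (h26 : τ.na 26 = σ.na 26) : Holds D U cnt τ :=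
  ⟨h.lt, by rw [h25]; exact h.a25, by rw [h26]; exact h.a26⟩

theorem run_solve {D : Task} {B : ℝ} {hB : 0 ≤ B} {σ : State} (h : Built D B hB σ)
    {U : Finset ℕ} {cnt : ℕ → ℕ} (hh : Holds D U cnt σ) :
    (solveStmt.run σ).nv 31 ≠ 0 ↔ D.Solv B hB U cnt := by
  rw [← Task.solvable_iff]
  refine run_decide h hh.lt (fun τ hq u hu h25 => ?_) fun τ hq k hk x hx h20 h21 => ?_
  · rw [Tm.tt_arr, Tm.eval_var, h25, hq.na 25 (by decide)]
    exact hh.a25 u hu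
  · have hb := h.quiet hq
    rw [Tm.tt_ite]
    simp only [Tm.tt_lt, Tm.tt_eq, Tm.tt_or, Tm.tt_not, Tm.eval_add, Tm.eval_sub, Tm.eval_arr,
      Tm.eval_var, Tm.eval_const, hb.v12, hb.v3, h20, h21, Task.allowed]
    split_ifs with hkN
    · simp [hkN]
    · unfold Task.S at hk
      rw [hq.na 26 (by decide), hh.a26 _ (by omega)]
      simp [hkN]

/-- Decide whether the user in the variable `34` is near the leaf in the variable `35`. -/
def nearStmt : Stmt :=
  decideStmt (.eq (.var 25) (.var 34))
    (.eq (.var 21) (.ite (.eq (.var 20) (.add (.var 12) (.var 35))) (.const 1) (.const 0)))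

theorem run_near {D : Task} {B : ℝ} {hB : 0 ≤ B} {σ : State} (h : Built D B hB σ)
    {u f : ℕ} (hu : u < D.n) (hf : f < D.Fc) (h34 : σ.nv 34 = u) (h35 : σ.nv 35 = f) :
    (nearStmt.run σ).nv 31 ≠ 0 ↔
      (D.tree B hB).Near D.R (D.nd u) (D.T.N * (D.M + 2 + 2) + f) := by
  rw [← Task.solvable_single_iff hf]
  refine run_decide h (by simpa using hu) (fun τ hq u' hu' h25 => ?_)
    fun τ hq k hk x hx h20 h21 => ?_
  · simp [h25, hq.nv 34 (by decide), h34]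
  · have hb := h.quiet hq
    simp only [Tm.tt_eq, Tm.eval_var, Tm.eval_ite, Tm.eval_add, Tm.eval_const, h20, h21, hb.v12,
      hq.nv 35 (by decide), h35]

end RAM

namespace RAM

/-! ### The search for the length scale -/

namespace Task

variable (D : Task)

/-- The problem is solvable for the length scale `B`. -/
def Feas (B : ℝ) : Prop := ∃ hB : 0 ≤ B, D.Solv B hB (Finset.range D.n) fun _ => 0

/-- The candidates for the length scale. -/
noncomputable def cand (v w x : Fin D.T.N) : ℝ :=
  -- For `x` the lowest common ancestor this is the distance of `v` and `w`. All triples are tried,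
  -- so that vertex need not be computed; other triples may give negative values.
  D.T.depth v + D.T.depth w - D.T.depth x - D.T.depth x

end Task

/-- Initially, no user has been assigned. -/
def initStmt : Stmt :=
  .seq (.loop 20 (.nstore 25 (.var 20) (.const 1)))
    (.seq (.loop 20 (.nstore 26 (.var 20) (.const 0))) (.nset 36 (.const 0)))

theorem run_init {D : Task} {σ : State} (h : Prepared D σ) :
    Prepared D (initStmt.run σ) ∧ Holds D (Finset.range D.n) (fun _ => 0) (initStmt.run σ) ∧
      (initStmt.run σ).nv 36 = 0 := by
  refine ⟨h.congr (Stmt.same_run (by decide) _), ⟨by simp, fun u hu => ?_, fun f hf => ?_⟩, ?_⟩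
  · have t₁ := run_tab (x := 20) (a := 25) (t := .const 1) (σ := σ) (fun _ => 1)
      (fun _ _ _ _ _ => rfl) u (hu.trans h.n_lt)
    have e : (initStmt.run σ).na 25 =
        ((Stmt.loop 20 (.nstore 25 (.var 20) (.const 1))).run σ).na 25 :=
      (Off.run (.seq (.loop 20 (.nstore 26 (.var 20) (.const 0))) (.nset 36 (.const 0))) _).na 25
        (by simp [Stmt.wna])
    rw [e, t₁]
    simpa using hu
  · have s₁ : Same [] [] σ ((Stmt.loop 20 (.nstore 25 (.var 20) (.const 1))).run σ) :=
      Stmt.same_run (by decide) _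
    exact run_tab (x := 20) (a := 26) (t := .const 0) (fun _ => 0)
      (fun _ _ _ _ _ => rfl) f (by rw [s₁.lim]; exact hf.trans h.Fc_lt)
  · simp [initStmt, Stmt.run]

def noop : Stmt := .nset 33 (.const 0)

/-- Try the candidate given by the variables `37`, `38` and `39`; the best candidate so far is in
the real variable `2` if the variable `36` is not zero. -/
def tryStmt : Stmt :=
  .seq (.rset 1 (.sub (.sub (.add (.arr 1 (.var 37)) (.arr 1 (.var 38))) (.arr 1 (.var 39)))
      (.arr 1 (.var 39))))
    (.ite (.rlt (.var 1) .zero) noop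
      (.seq buildStmt (.seq solveStmt
        (.ite (.and (.var 31) (.or (.eq (.var 36) (.const 0)) (.rlt (.var 1) (.var 2))))
          (.seq (.rset 2 (.var 1)) (.nset 36 (.const 1))) noop))))

theorem run_try {D : Task} {σ : State} (h : Prepared D σ)
    (hh : Holds D (Finset.range D.n) (fun _ => 0) σ) {v w x : Fin D.T.N} (hv : σ.nv 37 = v)
    (hw : σ.nv 38 = w) (hx : σ.nv 39 = x) :
    (D.Feas (D.cand v w x) ∧ (σ.nv 36 = 0 ∨ D.cand v w x < σ.rv 2) ∧
      (tryStmt.run σ).nv 36 = 1 ∧ (tryStmt.run σ).rv 2 = D.cand v w x) ∨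
    (¬ (D.Feas (D.cand v w x) ∧ (σ.nv 36 = 0 ∨ D.cand v w x < σ.rv 2)) ∧
      (tryStmt.run σ).nv 36 = σ.nv 36 ∧ (tryStmt.run σ).rv 2 = σ.rv 2) := by
  rw [tryStmt, Stmt.run_seq]
  set c := D.cand v w x with hc
  have e : (Stmt.rset 1 (.sub (.sub (.add (.arr 1 (.var 37)) (.arr 1 (.var 38)))
      (.arr 1 (.var 39))) (.arr 1 (.var 39)))).run σ = σ.setR 1 c := by
    simp only [Stmt.run, RExp.eval, NExp.eval, hv, hw, hx, h.r1]
    rfl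
  rw [e]
  have h₁ : Prepared D (σ.setR 1 c) := h.congr ⟨fun _ _ => rfl, fun _ _ => rfl, fun _ _ => rfl⟩
  have hh₁ : Holds D (Finset.range D.n) (fun _ => 0) (σ.setR 1 c) := hh.congr rfl rfl
  have r₁ : (σ.setR 1 c).rv 1 = c := by simp
  have r₂ : (σ.setR 1 c).rv 2 = σ.rv 2 := by simp
  have n₁ : (σ.setR 1 c).nv 36 = σ.nv 36 := rfl
  generalize σ.setR 1 c = σ₁ at h₁ hh₁ r₁ r₂ n₁ ⊢
  rw [← r₂, ← n₁, Stmt.run_ite, Tm.tt_rlt]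
  simp only [RExp.eval, r₁]
  split_ifs with hlt
  -- A negative candidate is rejected before the tree is built, in accordance with `Feas`.
  · refine Or.inr ⟨fun hf => ?_, by simp [noop, Stmt.run], rfl⟩
    obtain ⟨⟨hB, -⟩, -⟩ := hf
    exact absurd hlt (not_lt.2 hB)
  · have hB : 0 ≤ c := not_lt.1 hlt
    rw [Stmt.run_seq, Stmt.run_seq, Stmt.run_ite]
    have h₂ := run_build hB h₁ r₁
    have o₂ : Off buildStmt σ₁ (buildStmt.run σ₁) := Off.run _ _
    generalize buildStmt.run σ₁ = σ₂ at h₂ o₂ ⊢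
    have hh₂ : Holds D (Finset.range D.n) (fun _ => 0) σ₂ :=
      hh₁.congr (o₂.na _ (by decide)) (o₂.na _ (by decide))
    have t₃ := run_solve h₂ hh₂
    have q₃ : Quiet σ₂ (solveStmt.run σ₂) := quiet_decide _ _ _
    generalize solveStmt.run σ₂ = σ₃ at t₃ q₃ ⊢
    have n₃ : σ₃.nv 36 = σ₁.nv 36 := by rw [q₃.nv 36 (by decide), o₂.nv 36 (by decide)]
    have r₃ : σ₃.rv 2 = σ₁.rv 2 := by rw [q₃.rv, o₂.rv 2 (by decide)]
    have r₃' : σ₃.rv 1 = c := by rw [q₃.rv, o₂.rv 1 (by decide), r₁]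
    have hF : σ₃.nv 31 ≠ 0 ↔ D.Feas c := by
      rw [t₃]; exact ⟨fun hs => ⟨hB, hs⟩, fun ⟨_, hs⟩ => hs⟩
    have hcond : (Tm.and (.var 31) (.or (.eq (.var 36) (.const 0)) (.rlt (.var 1) (.var 2)))).tt σ₃ ↔
        D.Feas c ∧ (σ₁.nv 36 = 0 ∨ c < σ₁.rv 2) := by
      rw [Tm.tt_and, Tm.tt_or, Tm.tt_eq, Tm.tt_rlt, ← hF]
      simp only [Tm.eval_var, Tm.eval_const, RExp.eval, n₃, r₃, r₃']
      exact Iff.rfl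
    by_cases hcd : D.Feas c ∧ (σ₁.nv 36 = 0 ∨ c < σ₁.rv 2)
    · rw [if_pos (hcond.2 hcd)]
      exact Or.inl ⟨hcd.1, hcd.2, by simp [Stmt.run], by simp [Stmt.run, r₃']⟩
    · rw [if_neg (mt hcond.1 hcd)]
      exact Or.inr ⟨hcd, by simp [noop, Stmt.run, n₃], r₃⟩

/-- Find the best length scale. -/
def searchStmt : Stmt :=
  .loop 37 (.loop 38 (.loop 39 (.ite (.and (.lt (.var 37) (.var 0))
    (.and (.lt (.var 38) (.var 0)) (.lt (.var 39) (.var 0)))) tryStmt noop)))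

/-- The outcome of the search among the candidates satisfying `P`. -/
def Best (D : Task) (P : Fin D.T.N → Fin D.T.N → Fin D.T.N → Prop) (σ : State) : Prop :=
  (σ.nv 36 = 0 ∧ ∀ v w x, P v w x → ¬ D.Feas (D.cand v w x)) ∨
  (σ.nv 36 ≠ 0 ∧ D.Feas (σ.rv 2) ∧
    ∀ v w x, P v w x → D.Feas (D.cand v w x) → σ.rv 2 ≤ D.cand v w x)

/-- No monotonicity of `Feas` in the scale is used, so there is no bisection: all triples are tried
and the least feasible value is kept. -/
theorem run_search {D : Task} {σ : State} (h : Prepared D σ)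
    (hh : Holds D (Finset.range D.n) (fun _ => 0) σ) (h36 : σ.nv 36 = 0) :
    Prepared D (searchStmt.run σ) ∧
    Holds D (Finset.range D.n) (fun _ => 0) (searchStmt.run σ) ∧
    Best D (fun _ _ _ => True) (searchStmt.run σ) := by
  have o : Off searchStmt σ (searchStmt.run σ) := Off.run _ _
  refine ⟨h.congr (o.same (by decide)), hh.congr (o.na _ (by decide)) (o.na _ (by decide)), ?_⟩
  have main := run_loop3 (x := 37) (y := 38) (z := 39) (σ := σ)
    (p := .ite (.and (.lt (.var 37) (.var 0))
    (.and (.lt (.var 38) (.var 0)) (.lt (.var 39) (.var 0)))) tryStmt noop)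
    (by decide) (by decide) (by decide)
    (fun j τ => Best D (fun v w x => (v * σ.nv limVar + w) * σ.nv limVar + x < j) τ)
    (fun j τ v h => ⟨h, h, h⟩) (Or.inl ⟨h36, by simp⟩) ?_
  · rcases main with ⟨h1, h2⟩ | ⟨h1, h2, h3⟩
    · exact Or.inl ⟨h1, fun v w x _ => h2 v w x
        (idx_lt (v.2.trans h.N_lt) (w.2.trans h.N_lt) (x.2.trans h.N_lt))⟩
    · exact Or.inr ⟨h1, h2, fun v w x _ => h3 v w x
        (idx_lt (v.2.trans h.N_lt) (w.2.trans h.N_lt) (x.2.trans h.N_lt))⟩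
  · intro a ha b hb c hc τ hτ h37 h38 h39 hI
    have hP := h.congr (hτ.same (by decide))
    have hH := hh.congr (hτ.na 25 (by decide)) (hτ.na 26 (by decide))
    rw [Stmt.run_ite]
    simp only [Tm.tt_and, Tm.tt_lt, Tm.eval_var, hP.v0, h37, h38, h39]
    have hpos : ∀ v w x : Fin D.T.N,
        (v * σ.nv limVar + w) * σ.nv limVar + x < (a * σ.nv limVar + b) * σ.nv limVar + c + 1 →
        ((v : ℕ) = a ∧ (w : ℕ) = b ∧ (x : ℕ) = c) ∨
        (v * σ.nv limVar + w) * σ.nv limVar + x < (a * σ.nv limVar + b) * σ.nv limVar + c := by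
      intro v w x hlt
      rcases Nat.lt_succ_iff_lt_or_eq.1 hlt with hlt | heq
      · exact Or.inr hlt
      · rw [pair_inj (x.2.trans h.N_lt) hc, pair_inj (w.2.trans h.N_lt) hb, and_assoc] at heq
        exact Or.inl heq
    split_ifs with hlt
    · obtain ⟨h1, h2, h3⟩ := hlt
      have ht := run_try hP hH (v := ⟨a, h1⟩) (w := ⟨b, h2⟩) (x := ⟨c, h3⟩) h37 h38 h39
      have hpos' : ∀ v w x : Fin D.T.N,
          (v * σ.nv limVar + w) * σ.nv limVar + x < (a * σ.nv limVar + b) * σ.nv limVar + c + 1 →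
          D.cand v w x = D.cand ⟨a, h1⟩ ⟨b, h2⟩ ⟨c, h3⟩ ∨
          (v * σ.nv limVar + w) * σ.nv limVar + x < (a * σ.nv limVar + b) * σ.nv limVar + c := by
        intro v w x hlt
        refine (hpos v w x hlt).imp_left fun ⟨e1, e2, e3⟩ => ?_
        rw [show v = ⟨a, h1⟩ from Fin.ext e1, show w = ⟨b, h2⟩ from Fin.ext e2,
          show x = ⟨c, h3⟩ from Fin.ext e3]
      generalize D.cand ⟨a, h1⟩ ⟨b, h2⟩ ⟨c, h3⟩ = d at ht hpos'
      rcases ht with ⟨t1, t2, t3, t4⟩ | ⟨t1, t2, t3⟩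
      · refine Or.inr ⟨by omega, by rw [t4]; exact t1, fun v w x hlt hF => ?_⟩
        rw [t4]
        rcases hpos' v w x hlt with he | hlt'
        · exact he.ge
        · rcases hI with ⟨i1, i2⟩ | ⟨i1, i2, i3⟩
          · exact absurd hF (i2 v w x hlt')
          · have := i3 v w x hlt' hF
            rcases t2 with t2 | t2
            · exact absurd t2 i1
            · exact t2.le.trans this
      · rcases hI with ⟨i1, i2⟩ | ⟨i1, i2, i3⟩
        · refine Or.inl ⟨by omega, fun v w x hlt hF => ?_⟩
          rcases hpos' v w x hlt with he | hlt'
          · exact t1 ⟨he ▸ hF, Or.inl i1⟩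
          · exact i2 v w x hlt' hF
        · refine Or.inr ⟨by omega, by rw [t3]; exact i2, fun v w x hlt hF => ?_⟩
          rw [t3]
          rcases hpos' v w x hlt with he | hlt'
          · by_contra hcon
            rw [he] at hF hcon
            exact t1 ⟨hF, Or.inr (not_le.1 hcon)⟩
          · exact i3 v w x hlt' hF
    · have e1 : (noop.run τ).nv 36 = τ.nv 36 := by simp [noop, Stmt.run]
      have e2 : (noop.run τ).rv 2 = τ.rv 2 := rfl
      have hpos' : ∀ v w x : Fin D.T.N,
          (v * σ.nv limVar + w) * σ.nv limVar + x < (a * σ.nv limVar + b) * σ.nv limVar + c + 1 →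
          (v * σ.nv limVar + w) * σ.nv limVar + x < (a * σ.nv limVar + b) * σ.nv limVar + c := by
        intro v w x hlt'
        refine (hpos v w x hlt').resolve_left fun ⟨e1, e2, e3⟩ => hlt ?_
        rw [← e1, ← e2, ← e3]
        exact ⟨v.2, w.2, x.2⟩
      unfold Best
      rw [e1, e2]
      rcases hI with ⟨i1, i2⟩ | ⟨i1, i2, i3⟩
      · exact Or.inl ⟨i1, fun v w x hl => i2 v w x (hpos' v w x hl)⟩
      · exact Or.inr ⟨i1, i2, fun v w x hl => i3 v w x (hpos' v w x hl)⟩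

end RAM

namespace RAM

/-! ### The assignment of the users -/

namespace Task

variable {D : Task} {B : ℝ} {hB : 0 ≤ B}

/-- The leaf that a solution gives to `u` works: one user moves from those still to be assigned to
those counted in `cnt`, and the total at each leaf is unchanged. -/
theorem Solv.step {U : Finset ℕ} {cnt : ℕ → ℕ} (h : D.Solv B hB U cnt) {u : ℕ} (hu : u ∈ U) :
    ∃ f < D.Fc, (D.tree B hB).Near D.R (D.nd u) (D.T.N * (D.M + 2 + 2) + f) ∧
      D.Solv B hB (U.erase u) (Function.update cnt f (cnt f + 1)) := by
  obtain ⟨π, h1, h2⟩ := h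
  refine ⟨π u, (h1 u hu).1, (h1 u hu).2, π, fun u' hu' => h1 u' (Finset.mem_of_mem_erase hu'),
    fun f hf => ?_⟩
  have := h2 f hf
  rw [Finset.filter_erase]
  by_cases hfu : f = π u
  · subst hfu
    have hmem : u ∈ U.filter fun u' => π u' = π u := Finset.mem_filter.2 ⟨hu, rfl⟩
    have h3 := Finset.card_erase_of_mem hmem
    have h4 := Finset.card_pos.2 ⟨u, hmem⟩
    rw [Function.update_self]
    omega
  · rw [Function.update_of_ne hfu, Finset.erase_eq_of_notMem]
    · exact this
    · intro hh
      exact hfu (Finset.mem_filter.1 hh).2.symm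

/-- It is possible to assign the user `u` to the leaf `f`. -/
def Fits (D : Task) (B : ℝ) (hB : 0 ≤ B) (U : Finset ℕ) (cnt : ℕ → ℕ) (u f : ℕ) : Prop :=
  (D.tree B hB).Near D.R (D.nd u) (D.T.N * (D.M + 2 + 2) + f) ∧
    D.Solv B hB (U.erase u) (Function.update cnt f (cnt f + 1))

end Task

/-- Assign the user in the variable `34` to the leaf in the variable `35`, if possible. -/
def assignStep : Stmt :=
  .seq nearStmt (.seq (.nset 36 (.var 31)) (.seq (.nstore 25 (.var 34) (.const 0))
    (.seq (.nstore 26 (.var 35) (.add (.arr 26 (.var 35)) (.const 1))) (.seq solveStmt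
      (.ite (.and (.var 36) (.var 31)) (.nstore 3 (.var 34) (.var 35))
        (.seq (.nstore 25 (.var 34) (.const 1))
          (.nstore 26 (.var 35) (.sub (.arr 26 (.var 35)) (.const 1)))))))))

/-- The user is removed and the leaf credited tentatively; if one of the two tests fails, both
changes are undone. -/
theorem run_assignStep {D : Task} {B : ℝ} {hB : 0 ≤ B} {σ : State} (h : Built D B hB σ)
    {U : Finset ℕ} {cnt : ℕ → ℕ} (hh : Holds D U cnt σ) {u f : ℕ} (hu : u ∈ U) (hf : f < D.Fc)
    (h34 : σ.nv 34 = u) (h35 : σ.nv 35 = f) :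
    (D.Fits B hB U cnt u f ∧
      Holds D (U.erase u) (Function.update cnt f (cnt f + 1)) (assignStep.run σ) ∧
      (assignStep.run σ).na 3 = Function.update (σ.na 3) u f) ∨
    (¬ D.Fits B hB U cnt u f ∧ Holds D U cnt (assignStep.run σ) ∧
      (assignStep.run σ).na 3 = σ.na 3) := by
  have hn := hh.lt u hu
  rw [assignStep, Stmt.run_seq]
  have t₁ := run_near h hn hf h34 h35
  have q₁ : Quiet σ (nearStmt.run σ) := quiet_decide _ _ _
  generalize nearStmt.run σ = σ₁ at t₁ q₁ ⊢
  have h₁ := h.quiet q₁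
  have e : (Stmt.seq (.nset 36 (.var 31)) (.seq (.nstore 25 (.var 34) (.const 0))
    (.nstore 26 (.var 35) (.add (.arr 26 (.var 35)) (.const 1))))).run σ₁ =
    ((σ₁.setN 36 (σ₁.nv 31)).storeN 25 u 0).storeN 26 f (cnt f + 1) := by
    have : σ₁.na 26 f = cnt f := by rw [q₁.na 26 (by decide), hh.a26 f hf]
    simp only [Stmt.run, Tm.eval_var, Tm.eval_const, Tm.eval_add, Tm.eval_arr, storeN_nv,
      storeN_na, setN_nv, setN_na, Nat.reduceEqDiff, if_false, false_and,
      q₁.nv 34 (by decide), q₁.nv 35 (by decide), h34, h35, this]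
  -- Sequences are reassociated so that the three updates form one block, whose effect is `e`.
  change (_ ∧ Holds _ _ _ ((Stmt.seq solveStmt _).run ((Stmt.seq (.nset 36 (.var 31)) (.seq
    (.nstore 25 (.var 34) (.const 0))
    (.nstore 26 (.var 35) (.add (.arr 26 (.var 35)) (.const 1))))).run σ₁)) ∧
    ((Stmt.seq solveStmt _).run ((Stmt.seq (.nset 36 (.var 31)) (.seq
    (.nstore 25 (.var 34) (.const 0))
    (.nstore 26 (.var 35) (.add (.arr 26 (.var 35)) (.const 1))))).run σ₁)).na 3 = _) ∨
    (_ ∧ Holds _ _ _ ((Stmt.seq solveStmt _).run ((Stmt.seq (.nset 36 (.var 31)) (.seq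
    (.nstore 25 (.var 34) (.const 0))
    (.nstore 26 (.var 35) (.add (.arr 26 (.var 35)) (.const 1))))).run σ₁)) ∧
    ((Stmt.seq solveStmt _).run ((Stmt.seq (.nset 36 (.var 31)) (.seq
    (.nstore 25 (.var 34) (.const 0))
    (.nstore 26 (.var 35) (.add (.arr 26 (.var 35)) (.const 1))))).run σ₁)).na 3 = _)
  rw [e]
  set σ₂ := ((σ₁.setN 36 (σ₁.nv 31)).storeN 25 u 0).storeN 26 f (cnt f + 1) with hσ₂
  have n25 : ∀ j, σ₂.na 25 j = if j = u then 0 else σ.na 25 j := fun j => by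
    rw [← q₁.na 25 (by decide)]; simp [hσ₂]
  have n26 : ∀ j, σ₂.na 26 j = if j = f then cnt f + 1 else σ.na 26 j := fun j => by
    rw [← q₁.na 26 (by decide)]; simp [hσ₂]
  have n3 : σ₂.na 3 = σ.na 3 := by
    rw [← q₁.na 3 (by decide)]; funext j; simp [hσ₂]
  have n36 : σ₂.nv 36 = σ₁.nv 31 := by simp [hσ₂]
  have n34 : σ₂.nv 34 = u := by rw [← h34, ← q₁.nv 34 (by decide)]; simp [hσ₂]
  have n35 : σ₂.nv 35 = f := by rw [← h35, ← q₁.nv 35 (by decide)]; simp [hσ₂]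
  have h₂ : Built D B hB σ₂ := by
    refine h₁.congr ⟨fun i hi => ?_, fun a ha => ?_, fun _ _ => rfl⟩
    · simp [hσ₂]; omega
    · have e1 : a ≠ 25 := by rintro rfl; revert ha; decide
      have e2 : a ≠ 26 := by rintro rfl; revert ha; decide
      funext j; simp [hσ₂, e1, e2]
  have hh₂ : Holds D (U.erase u) (Function.update cnt f (cnt f + 1)) σ₂ := by
    refine ⟨fun u' hu' => hh.lt u' (Finset.mem_of_mem_erase hu'), fun u' hu' => ?_,
      fun f' hf' => ?_⟩
    · rw [n25, Finset.mem_erase]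
      split_ifs with hc
      · simp [hc]
      · simp [hc, hh.a25 u' hu']
    · rw [n26, Function.update_apply, hh.a26 f' hf']
  clear_value σ₂
  rw [Stmt.run_seq, Stmt.run_ite]
  have t₃ := run_solve h₂ hh₂
  have q₃ : Quiet σ₂ (solveStmt.run σ₂) := quiet_decide _ _ _
  generalize solveStmt.run σ₂ = σ₃ at t₃ q₃ ⊢
  have hcond : (Tm.and (.var 36) (.var 31)).tt σ₃ ↔ D.Fits B hB U cnt u f := by
    rw [Tm.tt_and]
    change σ₃.nv 36 ≠ 0 ∧ σ₃.nv 31 ≠ 0 ↔ _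
    rw [t₃, q₃.nv 36 (by decide), n36, t₁]
    rfl
  have m34 : σ₃.nv 34 = u := by rw [q₃.nv 34 (by decide), n34]
  have m35 : σ₃.nv 35 = f := by rw [q₃.nv 35 (by decide), n35]
  by_cases hF : D.Fits B hB U cnt u f
  · rw [if_pos (hcond.2 hF)]
    refine Or.inl ⟨hF, hh₂.congr ?_ ?_, ?_⟩
    · rw [← q₃.na 25 (by decide)]; funext j; simp [Stmt.run]
    · rw [← q₃.na 26 (by decide)]; funext j; simp [Stmt.run]
    · rw [← n3, ← q₃.na 3 (by decide)]
      funext j; simp [Stmt.run, m34, m35, Function.update_apply]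
  · rw [if_neg (mt hcond.1 hF)]
    refine Or.inr ⟨hF, ⟨hh.lt, fun u' hu' => ?_, fun f' hf' => ?_⟩, ?_⟩
    · simp only [Stmt.run, storeN_na, Nat.reduceEqDiff, false_and, if_false, true_and,
        Tm.eval_var, Tm.eval_const, m34]
      split_ifs with hc
      · simp [hc, hu]
      · rw [q₃.na 25 (by decide), n25, if_neg hc]; exact hh.a25 u' hu'
    · simp only [Stmt.run, storeN_na, storeN_nv, Nat.reduceEqDiff, false_and, if_false, true_and,
        Tm.eval_var, Tm.eval_const, Tm.eval_sub, Tm.eval_arr, m35]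
      rw [q₃.na 26 (by decide), n26, n26, if_pos rfl]
      split_ifs with hc
      · rw [hc]; rfl
      · exact hh.a26 f' hf'
    · rw [← n3, ← q₃.na 3 (by decide)]; funext j; simp [Stmt.run]

/-- Assign all users, with the length scale in the real variable `2`. -/
def assignStmt : Stmt :=
  .seq (.rset 1 (.var 2)) (.seq buildStmt (.loop 34 (.loop 35
    (.ite (.and (.lt (.var 34) (.var 1)) (.and (.lt (.var 35) (.var 11)) (.arr 25 (.var 34))))
      assignStep noop))))

/-- The users outside `U` have been assigned. -/
structure Partial (D : Task) (B : ℝ) (hB : 0 ≤ B) (U : Finset ℕ) (cnt : ℕ → ℕ) (σ : State) :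
    Prop where
  holds : Holds D U cnt σ
  solv : D.Solv B hB U cnt
  near : ∀ u < D.n, u ∉ U → σ.na 3 u < D.Fc ∧
    (D.tree B hB).Near D.R (D.nd u) (D.T.N * (D.M + 2 + 2) + σ.na 3 u)
  cnt_eq : ∀ f < D.Fc, cnt f = ((Finset.range D.n \ U).filter fun u => σ.na 3 u = f).card

theorem Partial.step {D : Task} {B : ℝ} {hB : 0 ≤ B} {U : Finset ℕ} {cnt : ℕ → ℕ} {σ τ : State}
    (h : Partial D B hB U cnt σ) {u f : ℕ} (hu : u ∈ U) (hf : f < D.Fc)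
    (hF : D.Fits B hB U cnt u f)
    (hτ : Holds D (U.erase u) (Function.update cnt f (cnt f + 1)) τ)
    (h3 : τ.na 3 = Function.update (σ.na 3) u f) :
    Partial D B hB (U.erase u) (Function.update cnt f (cnt f + 1)) τ := by
  refine ⟨hτ, hF.2, fun u' hu' hU' => ?_, fun f' hf' => ?_⟩
  · rw [h3]
    by_cases hc : u' = u
    · subst hc; rw [Function.update_self]; exact ⟨hf, hF.1⟩
    · rw [Function.update_of_ne hc]
      exact h.near u' hu' fun hh => hU' (Finset.mem_erase.2 ⟨hc, hh⟩)
  · have e : Finset.range D.n \ U.erase u = insert u (Finset.range D.n \ U) := by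
      have := h.holds.lt u hu
      ext i
      simp only [Finset.mem_sdiff, Finset.mem_range, Finset.mem_erase, Finset.mem_insert, not_and]
      by_cases hi : i = u
      · simp [hi, this]
      · simp [hi]
    have e2 : (Finset.range D.n \ U).filter (fun u' => τ.na 3 u' = f') =
        (Finset.range D.n \ U).filter fun u' => σ.na 3 u' = f' := by
      refine Finset.filter_congr fun i hi => ?_
      have : i ≠ u := by
        rintro rfl
        exact (Finset.mem_sdiff.1 hi).2 hu
      rw [h3, Function.update_of_ne this]
    rw [e, Finset.filter_insert, e2, h3, Function.update_self]
    by_cases hc : f' = f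
    · subst hc
      rw [if_pos rfl, Function.update_self, Finset.card_insert_of_notMem, ← h.cnt_eq f' hf']
      intro hh
      exact (Finset.mem_sdiff.1 (Finset.mem_filter.1 hh).1).2 hu
    · rw [if_neg (Ne.symm hc), Function.update_of_ne hc, h.cnt_eq f' hf']

/-- The greedy assignment never gets stuck: what has been fixed always extends to a solution, so by
`Solv.step` every remaining user fits some leaf. -/
theorem run_assign {D : Task} {σ : State} (h : Prepared D σ)
    (hh : Holds D (Finset.range D.n) (fun _ => 0) σ) (hF : D.Feas (σ.rv 2)) :
    ∃ hB : 0 ≤ σ.rv 2, D.IsSol (σ.rv 2) hB (Finset.range D.n) (fun _ => 0)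
      ((assignStmt.run σ).na 3) := by
  obtain ⟨hB, hS⟩ := hF
  refine ⟨hB, ?_⟩
  generalize hBr : σ.rv 2 = B at hB hS ⊢
  have h₁ : Prepared D (σ.setR 1 B) := h.congr ⟨fun _ _ => rfl, fun _ _ => rfl, fun _ _ => rfl⟩
  have e₁ : (Stmt.rset 1 (.var 2)).run σ = σ.setR 1 B := by simp [Stmt.run, hBr]
  rw [assignStmt, Stmt.run_seq, Stmt.run_seq, e₁]
  have hh₁ : Holds D (Finset.range D.n) (fun _ => 0) (σ.setR 1 B) := hh.congr rfl rfl
  have h₂ := run_build hB h₁ (by simp)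
  have o₂ : Off buildStmt (σ.setR 1 B) (buildStmt.run (σ.setR 1 B)) := Off.run _ _
  generalize buildStmt.run (σ.setR 1 B) = σ₂ at h₂ o₂ ⊢
  have hh₂ : Holds D (Finset.range D.n) (fun _ => 0) σ₂ :=
    hh₁.congr (o₂.na _ (by decide)) (o₂.na _ (by decide))
  have main := run_loop2 (x := 34) (y := 35) (σ := σ₂)
    (p := .ite (.and (.lt (.var 34) (.var 1)) (.and (.lt (.var 35) (.var 11))
      (.arr 25 (.var 34)))) assignStep noop) (by decide) (by decide)
    -- Pairs tried before and concerning a user still unassigned do not fit, with respect to the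
    -- present counts.
    (fun j τ => ∃ U cnt, Partial D B hB U cnt τ ∧ ∀ u ∈ U, ∀ f < D.Fc,
      u * σ₂.nv limVar + f < j → ¬ D.Fits B hB U cnt u f)
    (fun j τ v ⟨U, cnt, hP, h⟩ => ⟨⟨U, cnt, ⟨hP.1.congr rfl rfl, hP.2, hP.3, hP.4⟩, h⟩,
      ⟨U, cnt, ⟨hP.1.congr rfl rfl, hP.2, hP.3, hP.4⟩, h⟩⟩)
    ⟨Finset.range D.n, fun _ => 0, ⟨hh₂, hS, fun u hu hU => absurd (Finset.mem_range.2 hu) hU,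
      by simp⟩, by simp⟩ ?_
  · obtain ⟨U, cnt, hP, hU⟩ := main
    have hemp : U = ∅ := by
      rw [Finset.eq_empty_iff_forall_notMem]
      intro u hu
      obtain ⟨f, hf, hfit⟩ := hP.solv.step hu
      exact hU u hu f hf (pair_lt ((hP.holds.lt u hu).trans h₂.n_lt) (hf.trans h₂.Fc_lt)) hfit
    subst hemp
    obtain ⟨π, -, h2⟩ := hP.solv
    refine ⟨fun u hu => hP.near u (Finset.mem_range.1 hu) (Finset.notMem_empty u), fun f hf => ?_⟩
    have h3 := h2 f hf
    have h4 := hP.cnt_eq f hf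
    rw [Finset.sdiff_empty] at h4
    rw [Finset.filter_empty, Finset.card_empty, add_zero, h4] at h3
    rwa [zero_add]
  · rintro a ha b hb τ hτ h34 h35 ⟨U, cnt, hP, hU⟩
    have hb' := h₂.congr (hτ.same (by decide))
    have hcond : (Tm.and (.lt (.var 34) (.var 1)) (.and (.lt (.var 35) (.var 11))
        (.arr 25 (.var 34)))).tt τ ↔ b < D.Fc ∧ a ∈ U := by
      simp only [Tm.tt_and, Tm.tt_lt, Tm.tt_arr, Tm.eval_var, hb'.v1, hb'.v11, h34, h35]
      constructor
      · rintro ⟨h1, h2, h3⟩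
        exact ⟨h2, (hP.holds.a25 a h1).1 h3⟩
      · rintro ⟨h1, h2⟩
        have := hP.holds.lt a h2
        exact ⟨this, h1, (hP.holds.a25 a this).2 h2⟩
    have hpos : ∀ u ∈ U, ∀ f < D.Fc, u * σ₂.nv limVar + f < a * σ₂.nv limVar + b + 1 →
        ¬ (u = a ∧ f = b) → ¬ D.Fits B hB U cnt u f := by
      intro u hu f hf hlt hne
      refine hU u hu f hf ?_
      have : u * σ₂.nv limVar + f ≠ a * σ₂.nv limVar + b := by
        rw [Ne, pair_inj (hf.trans h₂.Fc_lt) hb]; exact hne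
      omega
    rw [Stmt.run_ite]
    by_cases hc : b < D.Fc ∧ a ∈ U
    · rw [if_pos (hcond.2 hc)]
      rcases run_assignStep hb' hP.holds hc.2 hc.1 h34 h35 with ⟨t1, t2, t3⟩ | ⟨t1, t2, t3⟩
      -- Refusals need not carry over to the new counts, but there are none to carry over: a
      -- remaining user among the pairs tried would precede `a`, hence would have been refused by
      -- all leaves, contrary to `Solv.step`.
      · refine ⟨_, _, hP.step hc.2 hc.1 t1 t2 t3, fun u hu f hf hlt => ?_⟩
        obtain ⟨hua, huU⟩ := Finset.mem_erase.1 hu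
        exfalso
        obtain ⟨g, hg, hfit⟩ := hP.solv.step huU
        refine hU u huU g hg ?_ hfit
        have hgL := hg.trans h₂.Fc_lt
        have hua' : u < a := by
          rcases Nat.lt_or_ge u a with h | h
          · exact h
          · have h5 : a + 1 ≤ u := by omega
            have := Nat.mul_le_mul_right (σ₂.nv limVar) h5
            rw [Nat.succ_mul] at this
            omega
        have := Nat.mul_le_mul_right (σ₂.nv limVar) hua'
        rw [Nat.succ_mul] at this
        omega
      · refine ⟨U, cnt, ⟨t2, hP.solv, by rw [t3]; exact hP.near, by rw [t3]; exact hP.cnt_eq⟩,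
          fun u hu f hf hlt => ?_⟩
        by_cases hne : u = a ∧ f = b
        · rw [hne.1, hne.2]; exact t1
        · exact hpos u hu f hf hlt hne
    · rw [if_neg (mt hcond.1 hc)]
      refine ⟨U, cnt, ⟨hP.1.congr rfl rfl, hP.2, hP.3, hP.4⟩, fun u hu f hf hlt => ?_⟩
      exact hpos u hu f hf hlt fun hne => hc ⟨hne.2 ▸ hf, hne.1 ▸ hu⟩

/-- The whole algorithm after the choice of the parameters. -/
def coreStmt (fp : Tm) : Stmt :=
  .seq (prepStmt fp) (.seq initStmt (.seq searchStmt
    (.ite (.var 36) (.seq assignStmt (.nset 4 (.const 1))) (.nset 4 (.const 0)))))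

theorem run_core {D : Task} {σ : State} (h : Setup D σ) {fp : Tm}
    (hfp : ∀ τ, Same [0, 1, 2] [0] σ τ → (∀ x ≤ σ.nv limVar, τ.na 19 x = x * (D.M + 2 + 2)) →
      ∀ f < D.Fc, τ.nv 20 = f → fp.eval τ = D.fpar f) :
    (((coreStmt fp).run σ).nv 4 = 0 ∧ ∀ v w x, ¬ D.Feas (D.cand v w x)) ∨
    (((coreStmt fp).run σ).nv 4 = 1 ∧ ∃ (B : ℝ) (hB : 0 ≤ B),
      D.IsSol B hB (Finset.range D.n) (fun _ => 0) (((coreStmt fp).run σ).na 3) ∧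
      ∀ v w x, D.Feas (D.cand v w x) → B ≤ D.cand v w x) := by
  have h₁ := (run_prep h hfp).1
  rw [coreStmt, Stmt.run_seq, Stmt.run_seq, Stmt.run_seq, Stmt.run_ite]
  generalize (prepStmt fp).run σ = σ₁ at h₁ ⊢
  obtain ⟨h₂, hh₂, n₂⟩ := run_init h₁
  generalize initStmt.run σ₁ = σ₂ at h₂ hh₂ n₂ ⊢
  obtain ⟨h₃, hh₃, hb⟩ := run_search h₂ hh₂ n₂
  generalize searchStmt.run σ₂ = σ₃ at h₃ hh₃ hb ⊢
  have htt : (Tm.var 36).tt σ₃ ↔ σ₃.nv 36 ≠ 0 := Iff.rfl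
  rcases hb with ⟨h1, h2⟩ | ⟨h1, h2, h3⟩
  · refine Or.inl ⟨?_, fun v w x => h2 v w x trivial⟩
    rw [if_neg (by rw [htt, h1]; decide)]
    simp [Stmt.run]
  · refine Or.inr ?_
    obtain ⟨hB, hS⟩ := run_assign h₃ hh₃ h2
    rw [if_pos (htt.2 h1)]
    exact ⟨by simp [Stmt.run], _, hB, hS, fun v w x => h3 v w x trivial⟩

end RAM

namespace RAM

/-! ### The choice of the parameters -/

/-- Compute, in the variable `40`, the least `m` such that `m` times the real variable `0` is at
least `2`. -/
def precisionProg : Prog :=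
  .seq (.nset 40 (.const 0)) (.seq (.rset 3 .zero) (.while (.rlt (.var 3) (.add .one .one))
    (.seq (.rset 3 (.add (.var 3) (.var 0))) (.nset 40 (.add (.var 40) (.const 1))))))

/-- The memories agree on the natural variables below `40` except for `limVar`, and on the natural
arrays and the real arrays. -/
structure Kept (σ τ : State) : Prop where
  nv : ∀ i < 40, i ≠ limVar → τ.nv i = σ.nv i
  na : τ.na = σ.na
  ra : τ.ra = σ.ra

/-- Adding `ε` until `2` is reached turns the real `ε` into a natural number without division or
rounding. The number of rounds depends on `ε` only. -/
theorem exec_precision {ε : ℝ} (hε : 0 < ε) : ∃ m : ℕ, 2 ≤ m * ε ∧ ∃ b : ℕ, ∀ σ : State,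
    σ.rv 0 = ε → ∃ T τ, Exec precisionProg σ T τ ∧ T ≤ b ∧ τ.nv 40 = m ∧ Kept σ τ := by
  classical
  have hex : ∃ m : ℕ, 2 ≤ m * ε := by
    obtain ⟨m, hm⟩ := exists_nat_ge (2 / ε)
    exact ⟨m, (div_le_iff₀ hε).1 hm⟩
  -- A round costs 5 for the test and 4 for each assignment; the last test costs 5 and the initial
  -- assignments 2 each.
  refine ⟨Nat.find hex, Nat.find_spec hex, Nat.find hex * 13 + 9, fun σ hσ => ?_⟩
  have key : ∀ k m (τ : State), m + k = Nat.find hex → τ.nv 40 = m → τ.rv 3 = m * ε →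
      τ.rv 0 = ε → Kept σ τ → ∃ T τ', Exec (.while (.rlt (.var 3) (.add .one .one))
        (.seq (.rset 3 (.add (.var 3) (.var 0))) (.nset 40 (.add (.var 40) (.const 1))))) τ T τ' ∧
        T ≤ k * 13 + 5 ∧ τ'.nv 40 = Nat.find hex ∧ Kept σ τ' := by
    intro k
    induction k with
    | zero =>
      intro m τ hm h40 h3 h0 hK
      obtain rfl : m = Nat.find hex := by omega
      refine ⟨_, τ, Exec.while_false ?_, by simp [Test.cost, RExp.cost], h40, hK⟩
      simp only [Test.Holds, RExp.eval, h3, not_lt]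
      have := Nat.find_spec hex
      linarith
    | succ k ih =>
      intro m τ hm h40 h3 h0 hK
      have hlt := Nat.find_min hex (show m < Nat.find hex by omega)
      obtain ⟨T, τ', h1, h2, h3', h4⟩ := ih (m + 1)
        ((τ.setR 3 (τ.rv 3 + τ.rv 0)).setN 40 (τ.nv 40 + 1)) (by omega)
        (by simp [h40]) (by simp [h3, h0]; ring) (by simp [h0])
        ⟨fun i hi hi5 => by simp [show i ≠ 40 by omega, hK.nv i hi hi5], hK.na, hK.ra⟩
      refine ⟨_, τ', Exec.while_true ?_ (Exec.seq (Exec.rset _ _ _) (Exec.nset _ _ _)) h1, ?_,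
        h3', h4⟩
      · simp only [Test.Holds, RExp.eval, h3]
        linarith [not_le.1 hlt]
      · simp only [Test.cost, RExp.cost, NExp.cost]
        rw [Nat.succ_mul]; omega
  obtain ⟨T, τ, h1, h2, h3, h4⟩ := key (Nat.find hex) 0 ((σ.setN 40 0).setR 3 0) (by omega)
    (by simp) (by simp) (by simp [hσ])
    ⟨fun i hi _ => by simp [show i ≠ 40 by omega], rfl, rfl⟩
  exact ⟨_, τ, .seq (Exec.nset _ _ _) (.seq (Exec.rset _ _ _) h1),
    by simp only [NExp.cost, RExp.cost]; omega, h3, h4⟩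

/-- Compute the power of the variable `42` with exponent `41` in `limVar`. -/
def powProg : Prog :=
  .seq (.nset limVar (.const 1)) (.seq (.nset 43 (.const 0)) (.seq (.nset 44 (.var 41))
    (Prog.count 43 (.seq (.nset 45 (.const 0)) (.seq (.nset 46 (.const 0))
      (.seq (.nset 47 (.var 42)) (.seq (Prog.count 46 (.nset 45 (.add (.var 45) (.var limVar))))
        (.nset limVar (.var 45)))))))))

/-- Powers by repeated addition. This is a program of the bare machine because bounded loops are
available only after `limVar` has been set. -/
theorem exec_pow (σ : State) : ∃ T τ, Exec powProg σ T τ ∧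
    T ≤ σ.nv 41 * (σ.nv 42 * 11 + 18) + 9 ∧ τ.nv limVar = σ.nv 42 ^ σ.nv 41 ∧
    τ.nv 40 = σ.nv 40 ∧ Kept σ τ := by
  obtain ⟨T, τ, h1, h2, h3⟩ := exec_count (c := 43) (n := σ.nv 41) (B := σ.nv 42 * 11 + 11)
    (body := (.seq (.nset 45 (.const 0)) (.seq (.nset 46 (.const 0))
      (.seq (.nset 47 (.var 42)) (.seq (Prog.count 46 (.nset 45 (.add (.var 45) (.var limVar))))
        (.nset limVar (.var 45)))))))
    (fun v τ => τ.nv 43 = v ∧ τ.nv 44 = σ.nv 41 ∧ τ.nv 42 = σ.nv 42 ∧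
      τ.nv limVar = σ.nv 42 ^ v ∧ τ.nv 40 = σ.nv 40 ∧ Kept σ τ) (fun v τ h => ⟨h.1, h.2.1⟩)
    (fun v _ τ ⟨i1, i2, i3, i4, i5, i6⟩ => by
      obtain ⟨T', τ', j1, j2, j3⟩ := exec_count (c := 46) (n := σ.nv 42) (B := 4)
        (body := .nset 45 (.add (.var 45) (.var limVar)))
        (fun w υ => υ.nv 46 = w ∧ υ.nv 47 = σ.nv 42 ∧ υ.nv 45 = w * σ.nv 42 ^ v ∧
          υ.nv limVar = σ.nv 42 ^ v ∧ υ.nv 43 = v ∧ υ.nv 44 = σ.nv 41 ∧ υ.nv 42 = σ.nv 42 ∧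
          υ.nv 40 = σ.nv 40 ∧ Kept σ υ) (fun w υ h => ⟨h.1, h.2.1⟩)
        (fun w _ υ ⟨k1, k2, k3, k4, k5, k6, k7, k8, k9⟩ =>
          ⟨_, _, Exec.nset _ _ _, by simp [NExp.cost], by simp [k1], by simp, by simp [k2],
            by simp [NExp.eval, k3, k4, Nat.succ_mul], by simp [limVar] at k4 ⊢; exact k4,
            by simp [k5], by simp [k6], by simp [k7], by simp [k8],
            ⟨fun i hi hi5 => by
              simp [show i ≠ 46 by omega, show i ≠ 45 by omega, k9.nv i hi hi5], k9.na, k9.ra⟩⟩)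
        (σ := ((τ.setN 45 0).setN 46 0).setN 47 (σ.nv 42))
        ⟨by simp, by simp, by simp, by simpa [limVar] using i4, by simp [i1], by simp [i2],
          by simp [i3], by simp [i5], ⟨fun i hi hi5 => by
              simp [show i ≠ 46 by omega, show i ≠ 45 by omega, show i ≠ 47 by omega,
                i6.nv i hi hi5], i6.na, i6.ra⟩⟩
      obtain ⟨k1, k2, k3, k4, k5, k6, k7, k8, k9⟩ := j3
      have e : ((τ.setN 45 0).setN 46 0).nv 42 = σ.nv 42 := by simp [i3]
      refine ⟨_, _, .seq (Exec.nset _ _ _) (.seq (Exec.nset _ _ _) (.seq (Exec.nset _ _ _)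
        (.seq (by simpa only [NExp.eval, e] using j1) (Exec.nset _ _ _)))), ?_, ?_, ?_⟩
      · simp only [NExp.cost]; omega
      · simp [limVar, k5]
      · refine ⟨by simp, by simp [limVar, k6], by simp [limVar, k7],
          by simp [limVar, k3, pow_succ, Nat.mul_comm], by simp [limVar, k8],
          ⟨fun i hi hi5 => ?_, k9.na, k9.ra⟩⟩
        rw [setN_nv, if_neg (by omega), setN_nv, if_neg hi5, k9.nv i hi hi5])
    (σ := ((σ.setN limVar 1).setN 43 0).setN 44 (σ.nv 41))
    ⟨by simp, by simp, by simp [limVar], by simp [limVar], by simp [limVar],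
      ⟨fun i hi hi5 => by
        simp [show i ≠ 43 by omega, show i ≠ 44 by omega, hi5], rfl, rfl⟩⟩
  obtain ⟨i1, i2, i3, i4, i5, i6⟩ := h3
  have e : ((σ.setN limVar 1).setN 43 0).nv 41 = σ.nv 41 := by simp [limVar]
  refine ⟨_, τ, .seq (Exec.nset _ _ _) (.seq (Exec.nset _ _ _) (.seq (Exec.nset _ _ _)
    (by simpa only [NExp.eval, e] using h1))), ?_, i4, i5, i6⟩
  simp only [NExp.cost]
  have : σ.nv 42 * 11 + 11 + 7 = σ.nv 42 * 11 + 18 := rfl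
  rw [this] at h2
  omega

/-- The choice of the precision and of the bound for all loops. -/
def prelude : Prog :=
  .seq precisionProg (.seq
    (.nset 41 (.add (.add (.add (.var 40) (.var 40)) (.add (.var 40) (.var 40))) (.const 11)))
    (.seq (.nset 42 (.add (.add (.var 0) (.var 1)) (.add (.var 2) (.const 2)))) powProg))

/-- The exponent `4 * m + 11` is `2 * C + 3` for `C = 2 * m + 4`, the number of nodes in each chain;
compare `limit_le`. -/
theorem exec_prelude {ε : ℝ} (hε : 0 < ε) : ∃ m : ℕ, 2 ≤ m * ε ∧ ∃ b : ℕ, ∀ σ : State,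
    σ.rv 0 = ε → ∃ T τ, Exec prelude σ T τ ∧
      T ≤ b + (4 * m + 11) * ((σ.nv 0 + σ.nv 1 + σ.nv 2 + 2) * 11 + 18) ∧ τ.nv 40 = m ∧
      τ.nv limVar = (σ.nv 0 + σ.nv 1 + σ.nv 2 + 2) ^ (4 * m + 11) ∧ Kept σ τ := by
  obtain ⟨m, hm, b, hb⟩ := exec_precision hε
  refine ⟨m, hm, b + 100, fun σ hσ => ?_⟩
  obtain ⟨T₁, τ₁, h1, h2, h3, h4⟩ := hb σ hσ
  obtain ⟨T₂, τ₂, k1, k2, k3, k4, k5⟩ := exec_pow ((τ₁.setN 41 (4 * m + 11)).setN 42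
    (σ.nv 0 + σ.nv 1 + σ.nv 2 + 2))
  have e0 := h4.nv 0 (by decide) (by decide)
  have e1 := h4.nv 1 (by decide) (by decide)
  have e2 := h4.nv 2 (by decide) (by decide)
  have e41 : ((τ₁.setN 41 (4 * m + 11)).setN 42 (σ.nv 0 + σ.nv 1 + σ.nv 2 + 2)).nv 41 =
    4 * m + 11 := by simp
  have e42 : ((τ₁.setN 41 (4 * m + 11)).setN 42 (σ.nv 0 + σ.nv 1 + σ.nv 2 + 2)).nv 42 =
    σ.nv 0 + σ.nv 1 + σ.nv 2 + 2 := by simp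
  rw [e41, e42] at k2 k3
  have s1 := Exec.nset τ₁ 41
    (.add (.add (.add (.var 40) (.var 40)) (.add (.var 40) (.var 40))) (.const 11))
  have s2 := Exec.nset (τ₁.setN 41 (4 * m + 11)) 42
    (.add (.add (.var 0) (.var 1)) (.add (.var 2) (.const 2)))
  simp only [NExp.eval, h3, show m + m + (m + m) + 11 = 4 * m + 11 by ring] at s1
  simp only [NExp.eval, setN_nv, Nat.reduceEqDiff, OfNat.zero_ne_ofNat, OfNat.one_ne_ofNat,
    if_false, e0, e1, e2, ← add_assoc] at s2
  refine ⟨_, τ₂, .seq h1 (.seq s1 (.seq s2 k1)), ?_, ?_, k3, ?_⟩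
  · simp only [NExp.cost]; omega
  · rw [k4]; simp [h3]
  · refine ⟨fun i hi hi5 => ?_, k5.na.trans h4.na, k5.ra.trans h4.ra⟩
    rw [k5.nv i hi hi5, setN_nv, if_neg (by omega), setN_nv, if_neg (by omega), h4.nv i hi hi5]

/-- The parameters; the terms `Rt` and `Ft` yield the radius plus `1` and the number of leaves. -/
def paramStmt (Rt Ft : Tm) : Stmt :=
  .seq (.nset 8 (.add (.add (.var 40) (.var 40)) (.const 4)))
    (.seq (.nset 10 (.add (.var 1) (.const 1)))
      (.seq (.nset 12 (.sum 20 (.ite (.lt (.var 20) (.var 0)) (.var 8) (.const 0))))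
        (.seq (.nset 11 Ft) (.seq (.nset 13 (.add (.var 12) (.var 11)))
          (.seq (.nset 14 Rt) (.seq (.nset 15 (.add (.var 40) (.var 40)))
            (.nset 16 (.add (.add (.var 40) (.var 40)) (.const 3)))))))))

/-- `limVar` has to exceed the number of nodes, which is at most `N * C` for the chains and `N * C +
m` for the leaves, and to bound the number of codes, which have at most `2 * C` digits below `n +
1`. The first holds because `C < X ^ C` for `X ≥ 2`. -/
theorem limit_le {N n m C : ℕ} (hN : 0 < N) :
    N * C + N * C + m < (N + n + m + 2) ^ (2 * C + 3) ∧ n < (N + n + m + 2) ^ (2 * C + 3) ∧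
    2 * C ≤ (N + n + m + 2) ^ (2 * C + 3) ∧
    (n + 1) ^ (2 * C) ≤ (N + n + m + 2) ^ (2 * C + 3) := by
  set X := N + n + m + 2 with hX
  have h2 : 2 ≤ X := by omega
  have hC : C < X ^ C := (Nat.lt_two_pow_self).trans_le (Nat.pow_le_pow_left h2 C)
  have hP : 1 ≤ X ^ C := Nat.one_le_pow _ _ (by omega)
  have e3 : X ^ (C + 3) ≤ X ^ (2 * C + 3) := Nat.pow_le_pow_right (by omega) (by omega)
  have e : X ^ (C + 3) = X ^ C * (X * X * X) := by ring
  have h4 : X * X ≤ X ^ C * (X * X) := Nat.le_mul_of_pos_left _ hP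
  have h5 : N * C ≤ X * X ^ C := Nat.mul_le_mul (by omega) hC.le
  have h6 : X ^ C * X * 2 ≤ X ^ C * X * X := Nat.mul_le_mul_left _ h2
  have h7 : X ^ C * X * X * 2 ≤ X ^ C * X * X * X := Nat.mul_le_mul_left _ h2
  have h8 : 2 * X ≤ X ^ C * X * X := by
    calc 2 * X ≤ X * X := Nat.mul_le_mul_right _ h2
      _ ≤ X ^ C * (X * X) := h4
      _ = X ^ C * X * X := by ring
  have e' : X ^ (C + 3) = X ^ C * X * X * X := by ring
  have h5' : N * C ≤ X ^ C * X := by rw [mul_comm (X ^ C)]; exact h5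
  have h9 : X ^ C ≤ X ^ C * X := Nat.le_mul_of_pos_right _ (by omega)
  refine ⟨by omega, by omega, by omega, ?_⟩
  calc (n + 1) ^ (2 * C) ≤ X ^ (2 * C) := Nat.pow_le_pow_left (by omega) _
    _ ≤ X ^ (2 * C + 3) := Nat.pow_le_pow_right (by omega) (by omega)

/-- The whole algorithm. -/
def fullStmt (Rt Ft fp : Tm) : Stmt := .seq (paramStmt Rt Ft) (coreStmt fp)

/-- The input in the memory, for tasks with `m` additional numbers. -/
structure Input (D : Task) (m : ℕ) (σ : State) : Prop where
  v0 : σ.nv 0 = D.T.N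
  v1 : σ.nv 1 = D.n
  v2 : σ.nv 2 = m
  v3 : σ.nv 3 = D.r
  a0 : σ.na 0 = D.T.adjArray
  a1 : ∀ u < D.n, σ.na 1 u = D.user u
  r0 : σ.ra 0 = D.T.lenArray

theorem run_param {D : Task} {m M : ℕ} {σ : State} (h : Input D m σ) (hM : D.M = M + M)
    (hR : D.R + 1 ≤ D.M + 2 + 2) (hF : D.Fc ≤ D.T.N * (D.M + 2 + 2) + m) (h40 : σ.nv 40 = M)
    (h5 : σ.nv limVar = (D.T.N + D.n + m + 2) ^ (2 * (D.M + 2 + 2) + 3)) {Rt Ft : Tm}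
    (hRt : ∀ τ : State, τ.nv 40 = M → Rt.eval τ = D.R + 1)
    (hFt : ∀ τ : State, τ.nv 2 = m → τ.nv 12 = D.T.N * (D.M + 2 + 2) → Ft.eval τ = D.Fc) :
    Setup D ((paramStmt Rt Ft).run σ) ∧ ((paramStmt Rt Ft).run σ).na = σ.na := by
  have o : Off (paramStmt Rt Ft) σ ((paramStmt Rt Ft).run σ) := Off.run _ _
  have hna : ((paramStmt Rt Ft).run σ).na = σ.na := funext fun a => o.na a (by simp [paramStmt, Stmt.wna])
  have hra : ((paramStmt Rt Ft).run σ).ra = σ.ra := funext fun a => o.ra a (by simp [paramStmt, Stmt.wra])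
  have hlow : ∀ i, i ∉ (paramStmt Rt Ft).wn → ((paramStmt Rt Ft).run σ).nv i = σ.nv i := o.nv
  obtain ⟨l1, l2, l3, l4⟩ := limit_le (n := D.n) (m := m) (C := D.M + 2 + 2) D.T.N_pos
  rw [← h5] at l1 l2 l3 l4
  have hN : D.T.N ≤ σ.nv limVar := by
    have := Nat.le_mul_of_pos_right D.T.N (show 0 < D.M + 2 + 2 by omega)
    omega
  have hlim : ((paramStmt Rt Ft).run σ).nv limVar = σ.nv limVar := hlow _ (by simp [paramStmt, Stmt.wn])
  have hsum : ∀ τ : State, τ.nv limVar = σ.nv limVar → τ.nv 0 = D.T.N → τ.nv 8 = D.M + 2 + 2 →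
      (Tm.sum 20 (.ite (.lt (.var 20) (.var 0)) (.var 8) (.const 0))).eval τ =
        D.T.N * (D.M + 2 + 2) := by
    intro τ t5 t0 t8
    classical
    simp only [Tm.eval_sum, Tm.eval_ite, Tm.tt_lt, Tm.eval_var, Tm.eval_const, setN_nv, if_true,
      Nat.reduceEqDiff, OfNat.zero_ne_ofNat, if_false, t0, t8, t5]
    rw [Finset.sum_ite, Finset.sum_const_zero, add_zero, Finset.sum_const, smul_eq_mul]
    have : (Finset.range (σ.nv limVar)).filter (fun x => x < D.T.N) = Finset.range D.T.N := by
      ext i; simp only [Finset.mem_filter, Finset.mem_range]; omega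
    rw [this, Finset.card_range]
  let σ₂ : State := (σ.setN 8 (D.M + 2 + 2)).setN 10 (D.n + 1)
  let σ₃ : State := σ₂.setN 12 (D.T.N * (D.M + 2 + 2))
  have e : (paramStmt Rt Ft).run σ = ((((σ₃.setN 11 D.Fc).setN 13 D.S).setN 14 (D.R + 1)).setN 15
      D.M).setN 16 (D.M + 2 + 1) := by
    have e1 : (Stmt.nset 8 (.add (.add (.var 40) (.var 40)) (.const 4))).run σ =
        σ.setN 8 (D.M + 2 + 2) := by simp [Stmt.run, h40, hM, add_assoc]
    have e2 : (Stmt.nset 10 (.add (.var 1) (.const 1))).run (σ.setN 8 (D.M + 2 + 2)) = σ₂ := by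
      simp [Stmt.run, σ₂, h.v1]
    have e3 : (Stmt.nset 12 (.sum 20 (.ite (.lt (.var 20) (.var 0)) (.var 8) (.const 0)))).run σ₂ =
        σ₃ := by
      rw [Stmt.run, hsum σ₂ (by simp [σ₂, limVar]) (by simp [σ₂, h.v0]) (by simp [σ₂])]
    have e4 : (Stmt.nset 11 Ft).run σ₃ = σ₃.setN 11 D.Fc := by
      rw [Stmt.run, hFt σ₃ (by simp [σ₃, σ₂, h.v2]) (by simp [σ₃])]
    have e5 : (Stmt.nset 13 (.add (.var 12) (.var 11))).run (σ₃.setN 11 D.Fc) =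
        (σ₃.setN 11 D.Fc).setN 13 D.S := by simp [Stmt.run, σ₃, Task.S]
    have e6 : (Stmt.nset 14 Rt).run ((σ₃.setN 11 D.Fc).setN 13 D.S) =
        ((σ₃.setN 11 D.Fc).setN 13 D.S).setN 14 (D.R + 1) := by
      rw [Stmt.run, hRt _ (by simp [σ₃, σ₂, h40])]
    rw [paramStmt, Stmt.run_seq, e1, Stmt.run_seq, e2, Stmt.run_seq, e3, Stmt.run_seq, e4,
      Stmt.run_seq, e5, Stmt.run_seq, e6, Stmt.run_seq]
    simp [Stmt.run, σ₃, σ₂, h40, hM, add_assoc]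
  refine ⟨⟨?_, ?_, ?_, ?_, ?_, ?_, ?_, ?_, ?_, ?_, ?_, ?_, ?_, ?_, ?_, ?_, ?_, ?_⟩, hna⟩
  · rw [hlim, Task.S]; omega
  · rw [hlim]; exact l2
  · rw [hlim]; omega
  · rw [hlim]; exact (Nat.pow_le_pow_right (by omega) (by omega)).trans l4
  · rw [hlow _ (by simp [paramStmt, Stmt.wn]), h.v0]
  · rw [hlow _ (by simp [paramStmt, Stmt.wn]), h.v1]
  · rw [hlow _ (by simp [paramStmt, Stmt.wn]), h.v3]
  · rw [e]; simp [σ₃, σ₂]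
  · rw [e]; simp [σ₃, σ₂]
  · rw [e]; simp
  · rw [e]; simp [σ₃]
  · rw [e]; simp
  · rw [e]; simp
  · rw [e]; simp
  · rw [e]; simp
  · rw [hna, h.a0]
  · rw [hna]; exact h.a1
  · rw [hra, h.r0]

/-- The compiled part takes a polynomial number of steps in `limVar`. For fixed `ε` the exponent `4
* M + 11` is constant, so `limVar` is a polynomial in the size, and polynomials compose. -/
theorem exec_full {Rt Ft fp : Tm} (hlow : (fullStmt Rt Ft fp).low = true) {ε : ℝ} (hε : 0 < ε) :
    ∃ M : ℕ, 2 ≤ M * ε ∧ ∃ p : Polynomial ℕ, ∀ (D : Task) (m : ℕ) (σ : State), Input D m σ →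
      σ.rv 0 = ε → D.M = M + M → D.R + 1 ≤ D.M + 2 + 2 → D.Fc ≤ D.T.N * (D.M + 2 + 2) + m →
      (∀ τ : State, τ.nv 40 = M → Rt.eval τ = D.R + 1) →
      (∀ τ : State, τ.nv 2 = m → τ.nv 12 = D.T.N * (D.M + 2 + 2) → Ft.eval τ = D.Fc) →
      (∀ τ : State, τ.na 2 = σ.na 2 → (∀ x < D.T.N, τ.na 19 x = x * (D.M + 2 + 2)) →
        ∀ f < D.Fc, τ.nv 20 = f → fp.eval τ = D.fpar f) →
      ∃ T υ, Exec (.seq prelude ((fullStmt Rt Ft fp).comp 100)) σ T υ ∧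
        T ≤ p.eval (D.T.N + D.n + m) ∧
        ((υ.nv 4 = 0 ∧ ∀ v w x, ¬ D.Feas (D.cand v w x)) ∨
        (υ.nv 4 = 1 ∧ ∃ (B : ℝ) (hB : 0 ≤ B),
          D.IsSol B hB (Finset.range D.n) (fun _ => 0) (υ.na 3) ∧
          ∀ v w x, D.Feas (D.cand v w x) → B ≤ D.cand v w x)) := by
  obtain ⟨M, hM, b, hb⟩ := exec_prelude hε
  obtain ⟨p, hp⟩ := Stmt.comp_spec _ hlow
  refine ⟨M, hM, Polynomial.C b + Polynomial.C (4 * M + 11) *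
    ((Polynomial.X + Polynomial.C 2) * Polynomial.C 11 + Polynomial.C 18) +
    p.comp ((Polynomial.X + Polynomial.C 2) ^ (4 * M + 11)),
    fun D m σ hI h0 hDM hR hF hRt hFt hfp => ?_⟩
  obtain ⟨T₁, τ, h1, h2, h3, h4, h5⟩ := hb σ h0
  rw [hI.v0, hI.v1, hI.v2] at h2 h4
  have hI' : Input D m τ :=
    ⟨by rw [h5.nv 0 (by decide) (by decide), hI.v0], by rw [h5.nv 1 (by decide) (by decide), hI.v1],
      by rw [h5.nv 2 (by decide) (by decide), hI.v2], by rw [h5.nv 3 (by decide) (by decide), hI.v3],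
      by rw [h5.na, hI.a0], by rw [h5.na]; exact hI.a1, by rw [h5.ra, hI.r0]⟩
  have hexp : 4 * M + 11 = 2 * (D.M + 2 + 2) + 3 := by omega
  obtain ⟨hset, hna⟩ := run_param hI' hDM hR hF h3 (by rw [h4, hexp]) hRt hFt
  have hcore := run_core hset (fp := fp) (fun τ' hs h19 f hf h20 => by
    refine hfp τ' ?_ (fun x hx => h19 x (hx.trans hset.N_lt).le) f hf h20
    rw [hs.na 2 (by decide), hna, h5.na])
  obtain ⟨T₂, υ, k1, k2, -, k4⟩ := hp 100 τ τ le_rfl (Agree.refl τ)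
  refine ⟨_, υ, .seq h1 k1, ?_, ?_⟩
  · rw [h4] at k4
    simp only [Polynomial.eval_add, Polynomial.eval_mul, Polynomial.eval_C, Polynomial.eval_comp,
      Polynomial.eval_pow, Polynomial.eval_X]
    omega
  · rw [fullStmt, Stmt.run_seq] at k2
    rw [k2.nv 4 (by decide), k2.na]
    exact hcore

end RAM

/-! ### From tasks to the two problems -/

/-- Ensures that every cost is a candidate scale: a supremum over a nonempty set is attained, hence
ultimately a distance, and over the empty set it is `0`. -/
theorem Finset.sup_eq_zero_or {α : Type*} (s : Finset α) (f : α → ℝ≥0) :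
    s.sup f = 0 ∨ ∃ i ∈ s, s.sup f = f i := by
  rcases s.eq_empty_or_nonempty with rfl | h
  · exact Or.inl (by simp)
  · obtain ⟨i, hi, e⟩ := s.exists_mem_eq_sup h f
    exact Or.inr ⟨i, hi, e⟩

theorem card_filter_range {n : ℕ} (p : ℕ → Prop) [DecidablePred p] :
    ((Finset.range n).filter p).card =
      ((Finset.univ : Finset (Fin n)).filter fun u : Fin n => p u).card := by
  rw [← Finset.card_map Fin.valEmbedding]
  congr 1
  ext i
  simp only [Finset.mem_filter, Finset.mem_range, Finset.mem_map, Finset.mem_univ, true_and,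
    Fin.valEmbedding_apply]
  constructor
  · rintro ⟨h1, h2⟩; exact ⟨⟨i, h1⟩, h2, rfl⟩
  · rintro ⟨u, h1, rfl⟩; exact ⟨u.2, h1⟩

theorem vertexArray_eq {N k : ℕ} (g : Fin k → Fin N) (i : Fin k) : vertexArray g i = (g i : ℕ) := by
  simp [vertexArray]

namespace RAM.Task

variable {D : Task} {B : ℝ} {hB : 0 ≤ B}

theorem exists_cand_eq_dist (a b : Fin D.T.N) : ∃ v w x, D.cand v w x = D.T.dist a b := by
  obtain ⟨x, -, -, h⟩ := WeightedTree.exists_dist_eq a b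
  exact ⟨a, b, x, by rw [h, cand]; ring⟩

theorem exists_cand_eq_zero : ∃ v w x, D.cand v w x = 0 :=
  ⟨D.T.root, D.T.root, D.T.root, by simp [cand]⟩

theorem near_vertex_iff {R u : ℕ} {a : Fin D.T.N} :
    (D.tree B hB).Near R (D.nd u) (a * (D.M + 2 + 2)) ↔
      D.T.UnitNear D.M (D.M + 2) B R (D.user u) a := WeightedTree.chainTree_near_iff

theorem near_leaf_iff {R u f : ℕ} (hf : f < D.Fc) :
    (D.tree B hB).Near R (D.nd u) (D.T.N * (D.M + 2 + 2) + f) ↔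
      (D.tree B hB).Near R (D.nd u) (D.fpar f) := WeightedTree.chainTree_near_leaf hf

/-- `UnitNear.dist_le` with `K = M + 2` gives `M * dist ≤ (M + 4) * B`, and `4 ≤ M * ε`. -/
theorem dist_le (hB : 0 ≤ B) {ε : ℝ} (hε : 4 ≤ D.M * ε) {a b : Fin D.T.N}
    (h : D.T.UnitNear D.M (D.M + 2) B (D.M + 2) a b) : (D.T.dist a b : ℝ) ≤ (1 + ε) * B := by
  have h1 := WeightedTree.UnitNear.dist_le hB h
  push_cast at h1
  have hM : (0 : ℝ) < D.M := by
    rcases Nat.eq_zero_or_pos D.M with h0 | h0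
    · rw [h0] at hε; norm_num at hε
    · exact_mod_cast h0
  have h2 : 4 * B ≤ D.M * ε * B := mul_le_mul_of_nonneg_right hε hB
  refine le_of_mul_le_mul_left ?_ hM
  nlinarith

theorem unitNear (hB : 0 ≤ B) {a b : Fin D.T.N} (h : (D.T.dist a b : ℝ) ≤ B) :
    D.T.UnitNear D.M (D.M + 2) B (D.M + 2) a b :=
  WeightedTree.unitNear_of_dist_le hB (by omega) h

end RAM.Task

/-! ### Gathering -/

namespace GatheringInstance

variable (I : GatheringInstance)

/-- The users are to be assigned to leaves at the vertices of the facilities. -/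
noncomputable def task (M : ℕ) : RAM.Task where
  T := I.tree
  n := I.n
  r := I.r
  M := M
  R := M + 2
  Fc := I.m
  user u := if h : u < I.n then I.user ⟨u, h⟩ else I.tree.root
  fpar f := if h : f < I.m then I.fac ⟨f, h⟩ * (M + 2 + 2) else 0
  fpar_lt f hf := by
    rw [dif_pos hf]
    exact WeightedTree.chain_lt (K := M + 2) (I.fac ⟨f, hf⟩).2 (i := 0) (by omega)

variable {I} {M : ℕ} {B : ℝ} {hB : 0 ≤ B}

theorem task_user (u : Fin I.n) : (I.task M).user u = I.user u := by simp [task]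

theorem near_iff (u : Fin I.n) (f : Fin I.m) :
    ((I.task M).tree B hB).Near (M + 2) ((I.task M).nd u) (I.tree.N * (M + 2 + 2) + f) ↔
      I.tree.UnitNear M (M + 2) B (M + 2) (I.user u) (I.fac f) := by
  have h1 := RAM.Task.near_leaf_iff (D := I.task M) (B := B) (hB := hB) (R := M + 2) (u := u)
    (f := f) f.2
  have h2 := RAM.Task.near_vertex_iff (D := I.task M) (B := B) (hB := hB) (R := M + 2) (u := u)
    (a := I.fac f)
  rw [task_user] at h2
  have e : (I.task M).fpar f = I.fac f * (M + 2 + 2) := by simp [task]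
  rw [e] at h1
  exact h1.trans h2

/-- At the scale of its own cost a solution survives the rounding, since each user is within `B` of
its facility. -/
theorem feas {s : rGathering.Sol I} (hs : rGathering.Feasible I s) :
    (I.task M).Feas (rGathering.cost I s : ℝ) := by
  refine ⟨NNReal.coe_nonneg _, fun u => if h : u < I.n then s ⟨u, h⟩ else 0,
    fun u hu => ?_, fun f hf => ?_⟩
  · have hu' : u < I.n := Finset.mem_range.1 hu
    beta_reduce
    rw [dif_pos hu']
    refine ⟨(s ⟨u, hu'⟩).2, (near_iff ⟨u, hu'⟩ (s ⟨u, hu'⟩)).2 ?_⟩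
    refine RAM.Task.unitNear (D := I.task M) (NNReal.coe_nonneg _) (NNReal.coe_le_coe.2 ?_)
    exact Finset.le_sup (f := fun u => I.tree.dist (I.user u) (I.fac (s u)))
      (Finset.mem_univ (⟨u, hu'⟩ : Fin I.n))
  · have := hs ⟨f, hf⟩
    rw [zero_add]
    change (Finset.filter _ (Finset.range I.n)).card = 0 ∨
      I.r ≤ (Finset.filter _ (Finset.range I.n)).card
    rw [card_filter_range]
    simpa [Fin.ext_iff] using this

theorem exists_cand (s : rGathering.Sol I) :
    ∃ v w x, (I.task M).cand v w x = (rGathering.cost I s : ℝ) := by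
  rcases Finset.sup_eq_zero_or Finset.univ fun u => I.tree.dist (I.user u) (I.fac (s u)) with
    h | ⟨u, -, h⟩
  · have : rGathering.cost I s = 0 := h
    rw [this]
    exact RAM.Task.exists_cand_eq_zero
  · have : rGathering.cost I s = I.tree.dist (I.user u) (I.fac (s u)) := h
    rw [this]
    exact RAM.Task.exists_cand_eq_dist (D := I.task M) _ _

theorem exists_sol {ε : ℝ} (hε : 4 ≤ M * ε) (hε0 : 0 < ε) {π : ℕ → ℕ}
    (h : (I.task M).IsSol B hB (Finset.range I.n) (fun _ => 0) π) :
    ∃ s : rGathering.Sol I, (∀ u : Fin I.n, π u = (s u : ℕ)) ∧ rGathering.Feasible I s ∧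
      (rGathering.cost I s : ℝ) ≤ (1 + ε) * B := by
  have h1 : ∀ u : Fin I.n, π u < I.m := fun u => (h.1 u (Finset.mem_range.2 u.2)).1
  refine ⟨fun u => ⟨π u, h1 u⟩, fun u => rfl, fun f => ?_, ?_⟩
  · have := h.2 f f.2
    rw [zero_add] at this
    change (Finset.filter _ (Finset.range I.n)).card = 0 ∨
      I.r ≤ (Finset.filter _ (Finset.range I.n)).card at this
    rw [card_filter_range] at this
    simpa [Fin.ext_iff] using this
  · have hb : 0 ≤ (1 + ε) * B := by positivity
    have : (Finset.univ.sup fun u : Fin I.n => I.tree.dist (I.user u) (I.fac ⟨π u, h1 u⟩)) ≤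
        Real.toNNReal ((1 + ε) * B) := by
      refine Finset.sup_le fun u _ => ?_
      rw [← NNReal.coe_le_coe, Real.coe_toNNReal _ hb]
      refine RAM.Task.dist_le (D := I.task M) hB hε ?_
      exact (near_iff u ⟨π u, h1 u⟩).1 (h.1 u (Finset.mem_range.2 u.2)).2
    rwa [← NNReal.coe_le_coe, Real.coe_toNNReal _ hb] at this

end GatheringInstance

theorem MinProblem.le_opt {P : MinProblem} {I : P.Inst} {B : ℝ} (hs : ∃ s, P.Feasible I s)
    (hB : 0 ≤ B) (h : ∀ s, P.Feasible I s → B ≤ P.cost I s) : B ≤ P.opt I := by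
  obtain ⟨s, hs⟩ := hs
  have : Real.toNNReal B ≤ P.opt I := by
    refine le_csInf ⟨_, s, hs, rfl⟩ ?_
    rintro c ⟨s', hs', rfl⟩
    rw [← NNReal.coe_le_coe, Real.coe_toNNReal _ hB]
    exact h s' hs'
  rwa [← NNReal.coe_le_coe, Real.coe_toNNReal _ hB] at this

theorem rGathering_hasPTAS : rGathering.HasPTAS := by
  -- With `m` from the prelude the precision is `2 * m` and the radius `2 * m + 2`, so the first
  -- term is the radius plus one. The other two give the number of facilities and the node at the
  -- vertex of a facility.
  refine ⟨.seq RAM.prelude ((RAM.fullStmt (.add (.add (.var 40) (.var 40)) (.const 3)) (.var 2)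
    (.arr 19 (.arr 2 (.var 20)))).comp 100), fun ε hε => ?_⟩
  obtain ⟨M, hM, p, hp⟩ := RAM.exec_full (Rt := .add (.add (.var 40) (.var 40)) (.const 3))
    (Ft := .var 2) (fp := .arr 19 (.arr 2 (.var 20))) (by decide) hε
  refine ⟨p, fun I => ?_⟩
  change GatheringInstance at I
  have hMε : 4 ≤ ((M + M : ℕ) : ℝ) * ε := by push_cast; linarith
  obtain ⟨T, υ, h1, h2, h3⟩ := hp (I.task (M + M)) I.m ((rGathering.input I).setR 0 ε)
    ⟨rfl, rfl, rfl, rfl, rfl, fun u hu => by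
      rw [show u = ((⟨u, hu⟩ : Fin I.n) : ℕ) from rfl, GatheringInstance.task_user]
      exact vertexArray_eq I.user ⟨u, hu⟩, rfl⟩ (by simp) rfl
    (by change M + M + 2 + 1 ≤ M + M + 2 + 2; omega)
    (by change I.m ≤ _ + I.m; omega)
    (fun τ h => by simp [h, GatheringInstance.task]) (fun τ h _ => by simp [h]; rfl)
    (fun τ h h19 f hf h20 => by
      have e : τ.na 2 f = I.fac ⟨f, hf⟩ := by rw [h]; exact vertexArray_eq I.fac ⟨f, hf⟩
      rw [RAM.Tm.eval_arr, RAM.Tm.eval_arr, RAM.Tm.eval_var, h20, e, h19 _ (I.fac ⟨f, hf⟩).2]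
      have hf' : f < I.m := hf
      simp [GatheringInstance.task, hf'])
  refine ⟨T, υ, h1, h2, fun hs => ?_, fun hs => ?_⟩
  · rcases h3 with ⟨-, h4⟩ | ⟨h3, B, hB, h4, h5⟩
    · obtain ⟨s, hs⟩ := hs
      obtain ⟨v, w, x, e⟩ := GatheringInstance.exists_cand (M := M + M) s
      exact absurd (GatheringInstance.feas hs) (e ▸ h4 v w x)
    · obtain ⟨s, k1, k2, k3⟩ := GatheringInstance.exists_sol hMε hε h4
      have hopt : B ≤ rGathering.opt I := MinProblem.le_opt hs hB fun s hs => by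
        obtain ⟨v, w, x, e⟩ := GatheringInstance.exists_cand (M := M + M) s
        have := h5 v w x (e ▸ GatheringInstance.feas hs)
        rwa [e] at this
      exact ⟨h3, s, k1, k2, k3.trans (mul_le_mul_of_nonneg_left hopt (by linarith))⟩
  · rcases h3 with ⟨h3, -⟩ | ⟨-, B, hB, h4, -⟩
    · exact h3
    · obtain ⟨s, -, k2, -⟩ := GatheringInstance.exists_sol hMε hε h4
      exact absurd ⟨s, k2⟩ hs

/-! ### Clustering -/

namespace ClusteringInstance

variable (I : ClusteringInstance)

/-- The users are to be assigned to leaves at all nodes of the subdivided tree, which are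
candidates for the centers of the clusters. -/
noncomputable def task (M : ℕ) : RAM.Task where
  T := I.tree
  n := I.n
  r := I.r
  M := M + M
  R := M + 1
  Fc := I.tree.N * (M + M + 2 + 2)
  user u := if h : u < I.n then I.user ⟨u, h⟩ else I.tree.root
  fpar f := f
  fpar_lt _ hf := hf

variable {I} {M : ℕ} {B : ℝ} {hB : 0 ≤ B}

theorem task_user (u : Fin I.n) : (I.task M).user u = I.user u := by simp [task]

/-- The precision is taken even, so that the bound `M + M + 2` on rounded distances is twice the
radius `M + 1`. -/
theorem near_of_dist_le {u v : Fin I.n} (h : (I.tree.dist (I.user u) (I.user v) : ℝ) ≤ B) :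
    ((I.task M).tree B hB).Near (2 * (M + 1)) ((I.task M).nd u) ((I.task M).nd v) := by
  have h1 := RAM.Task.near_vertex_iff (D := I.task M) (B := B) (hB := hB) (R := M + M + 2) (u := u)
    (a := I.user v)
  rw [task_user] at h1
  have h2 := h1.2 (RAM.Task.unitNear (D := I.task M) hB h)
  rw [show 2 * (M + 1) = M + M + 2 by ring]
  have e : (I.task M).nd v = I.user v * (M + M + 2 + 2) := by
    rw [RAM.Task.nd, task_user]; rfl
  rw [e]; exact h2

theorem exists_center {B : ℝ} {hB : 0 ≤ B} {C : Finset (Fin I.n)} (hC : C.Nonempty)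
    (h : (I.diam C : ℝ) ≤ B) : ∃ c < I.tree.N * (M + M + 2 + 2), ∀ u ∈ C,
      ((I.task M).tree B hB).Near (M + 1) ((I.task M).nd u) c := by
  classical
  have hd : ∀ u ∈ C, ∀ v ∈ C, (I.tree.dist (I.user u) (I.user v) : ℝ) ≤ B := fun u hu v hv => by
    refine le_trans (NNReal.coe_le_coe.2 ?_) h
    exact (Finset.le_sup (f := fun j => I.tree.dist (I.user u) (I.user j)) hv).trans
      (Finset.le_sup (f := fun i => C.sup fun j => I.tree.dist (I.user i) (I.user j)) hu)
  obtain ⟨c, ⟨a, ha, hac⟩, hc⟩ := ParentTree.exists_center (F := (I.task M).tree B hB) (h := M + 1)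
    (A := C.image fun u : Fin I.n => (I.task M).nd u) (fun k _ => WeightedTree.chainTree_w_le k)
    (hC.image _) (fun a ha => by
      obtain ⟨u, -, rfl⟩ := Finset.mem_image.1 ha
      exact RAM.Task.nd_lt _)
    (fun a ha b hb => by
      obtain ⟨u, hu, rfl⟩ := Finset.mem_image.1 ha
      obtain ⟨v, hv, rfl⟩ := Finset.mem_image.1 hb
      exact near_of_dist_le (hd u hu v hv))
  -- The center is an ancestor of the node of a user, hence lies on a chain and carries one of the
  -- additional leaves.
  refine ⟨c, ?_, fun u hu => hc _ (Finset.mem_image_of_mem _ hu)⟩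
  obtain ⟨u, -, rfl⟩ := Finset.mem_image.1 ha
  obtain ⟨x, i, hi, rfl, -⟩ := WeightedTree.anc_of_chainTree_up (T := I.tree) hac
  exact WeightedTree.chain_lt x.2 hi

/-- Each user goes to the center of its part. Parts with the same center are united, which only adds
users. -/
theorem feas {P : rGatherClustering.Sol I} (hP : rGatherClustering.Feasible I P) :
    (I.task M).Feas (rGatherClustering.cost I P : ℝ) := by
  classical
  have hcost : ∀ C ∈ P.parts, (I.diam C : ℝ) ≤ (rGatherClustering.cost I P : ℝ) := fun C hC =>
    NNReal.coe_le_coe.2 (Finset.le_sup (f := I.diam) hC)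
  have hB : 0 ≤ (rGatherClustering.cost I P : ℝ) := NNReal.coe_nonneg _
  choose! c hc using fun (C : Finset (Fin I.n)) (hC : C ∈ P.parts) =>
    exists_center (M := M) (hB := hB) (P.nonempty_of_mem_parts hC) (hcost C hC)
  have hpart : ∀ u : Fin I.n, P.part u ∈ P.parts := fun u => P.part_mem.2 (Finset.mem_univ u)
  have hmem : ∀ u : Fin I.n, u ∈ P.part u := fun u => P.mem_part (Finset.mem_univ u)
  refine ⟨hB, fun u => if h : u < I.n then c (P.part ⟨u, h⟩) else 0, fun u hu => ?_,
    fun f hf => ?_⟩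
  · have hu' : u < I.n := Finset.mem_range.1 hu
    beta_reduce
    rw [dif_pos hu']
    have h1 := (hc _ (hpart ⟨u, hu'⟩)).1
    exact ⟨h1, (RAM.Task.near_leaf_iff (D := I.task M) h1).2
      ((hc _ (hpart ⟨u, hu'⟩)).2 _ (hmem ⟨u, hu'⟩))⟩
  · rw [zero_add]
    change (Finset.filter _ (Finset.range I.n)).card = 0 ∨
      I.r ≤ (Finset.filter _ (Finset.range I.n)).card
    rw [card_filter_range]
    simp only [Fin.is_lt, dif_pos, Fin.eta]
    rcases Finset.eq_empty_or_nonempty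
      (Finset.univ.filter fun u : Fin I.n => c (P.part u) = f) with h0 | ⟨u, hu⟩
    · exact Or.inl (Finset.card_eq_zero.2 h0)
    · refine Or.inr ((hP _ (hpart u)).trans (Finset.card_le_card fun v hv => ?_))
      rw [Finset.mem_filter] at hu ⊢
      rw [P.part_eq_of_mem (hpart u) hv]
      exact ⟨Finset.mem_univ _, hu.2⟩

theorem exists_cand (P : rGatherClustering.Sol I) :
    ∃ v w x, (I.task M).cand v w x = (rGatherClustering.cost I P : ℝ) := by
  have key : rGatherClustering.cost I P = 0 ∨
      ∃ i j, rGatherClustering.cost I P = I.tree.dist (I.user i) (I.user j) := by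
    rcases Finset.sup_eq_zero_or P.parts I.diam with h | ⟨C, -, h⟩
    · exact Or.inl h
    · rcases Finset.sup_eq_zero_or C fun i => C.sup fun j => I.tree.dist (I.user i) (I.user j) with
        h' | ⟨i, -, h'⟩
      · exact Or.inl (h.trans h')
      · rcases Finset.sup_eq_zero_or C fun j => I.tree.dist (I.user i) (I.user j) with
          h'' | ⟨j, -, h''⟩
        · exact Or.inl ((h.trans h').trans h'')
        · exact Or.inr ⟨i, j, (h.trans h').trans h''⟩
  rcases key with h | ⟨i, j, h⟩
  · rw [h]; exact RAM.Task.exists_cand_eq_zero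
  · rw [h]; exact RAM.Task.exists_cand_eq_dist (D := I.task M) _ _

/-- The clusters are the sets of users with a common center. By `Near.trans`, two of them are within
`2 * (M + 1)` units of each other, which is the rounded bound for the distance `B`. -/
theorem exists_sol {ε : ℝ} (hε : 4 ≤ ((M + M : ℕ) : ℝ) * ε) (hε0 : 0 < ε) {π : ℕ → ℕ}
    (h : (I.task M).IsSol B hB (Finset.range I.n) (fun _ => 0) π) :
    ∃ P : rGatherClustering.Sol I,
      (∀ i j : Fin I.n, π i = π j ↔ ∃ C ∈ P.parts, i ∈ C ∧ j ∈ C) ∧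
      rGatherClustering.Feasible I P ∧ (rGatherClustering.cost I P : ℝ) ≤ (1 + ε) * B := by
  classical
  let s : Setoid (Fin I.n) := Setoid.ker fun i : Fin I.n => π i
  have hrel : ∀ i j : Fin I.n, s i j ↔ π i = π j := fun i j => Setoid.ker_def
  have hb : 0 ≤ (1 + ε) * B := by positivity
  have hparts : ∀ C ∈ (Finpartition.ofSetoid s).parts, ∃ i : Fin I.n,
      C = Finset.univ.filter fun j : Fin I.n => π j = π i := by
    intro C hC
    obtain ⟨i, hi⟩ := (Finpartition.ofSetoid s).nonempty_of_mem_parts hC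
    refine ⟨i, ?_⟩
    ext j
    rw [← (Finpartition.ofSetoid s).part_eq_of_mem hC hi, Finpartition.mem_part_ofSetoid_iff_rel,
      hrel, Finset.mem_filter]
    simp [eq_comm]
  refine ⟨Finpartition.ofSetoid s, fun i j => ?_, fun C hC => ?_, ?_⟩
  · constructor
    · intro hij
      refine ⟨(Finpartition.ofSetoid s).part i,
        (Finpartition.ofSetoid s).part_mem.2 (Finset.mem_univ i),
        (Finpartition.ofSetoid s).mem_part (Finset.mem_univ i), ?_⟩
      rw [Finpartition.mem_part_ofSetoid_iff_rel, hrel]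
      exact hij
    · rintro ⟨C, hC, hi, hj⟩
      obtain ⟨k, rfl⟩ := hparts C hC
      rw [Finset.mem_filter] at hi hj
      rw [hi.2, hj.2]
  · obtain ⟨i, rfl⟩ := hparts C hC
    have h1 := h.2 (π i) (h.1 i (Finset.mem_range.2 i.2)).1
    rw [zero_add] at h1
    change (Finset.filter _ (Finset.range I.n)).card = 0 ∨
      I.r ≤ (Finset.filter _ (Finset.range I.n)).card at h1
    rw [card_filter_range] at h1
    refine h1.resolve_left (Finset.card_pos.2 ⟨i, ?_⟩).ne'
    simp
  · have : rGatherClustering.cost I (Finpartition.ofSetoid s) ≤ Real.toNNReal ((1 + ε) * B) := by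
      unfold rGatherClustering
      dsimp only
      refine Finset.sup_le fun C hC => ?_
      refine Finset.sup_le fun u hu => ?_
      refine Finset.sup_le fun v hv => ?_
      obtain ⟨k, rfl⟩ := hparts C hC
      rw [Finset.mem_filter] at hu hv
      rw [← NNReal.coe_le_coe, Real.coe_toNNReal _ hb]
      obtain ⟨hu1, hu2⟩ := h.1 u (Finset.mem_range.2 u.2)
      have hv2 := (h.1 v (Finset.mem_range.2 v.2)).2
      rw [RAM.Task.near_leaf_iff hu1] at hu2
      rw [hv.2, ← hu.2, RAM.Task.near_leaf_iff hu1] at hv2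
      have h3 := hu2.trans hv2.symm
      have e : (I.task M).nd v = I.user v * (M + M + 2 + 2) := by
        rw [RAM.Task.nd, task_user]; rfl
      rw [e] at h3
      have h4 := RAM.Task.near_vertex_iff (D := I.task M) (a := I.user v).1 h3
      rw [task_user] at h4
      refine RAM.Task.dist_le (D := I.task M) hB hε ?_
      have e' : M + 1 + (M + 1) = M + M + 2 := by ring
      exact e' ▸ h4
    rwa [← NNReal.coe_le_coe, Real.coe_toNNReal _ hb] at this

end ClusteringInstance

theorem rGatherClustering_hasPTAS : rGatherClustering.HasPTAS := by
  -- With `m` from the prelude the radius is `m + 1`, half of `2 * m + 2`, and the first term is the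
  -- radius plus one. There is one leaf for each node of the chains, attached to that node.
  refine ⟨.seq RAM.prelude ((RAM.fullStmt (.add (.var 40) (.const 2)) (.var 12)
    (.var 20)).comp 100), fun ε hε => ?_⟩
  obtain ⟨M, hM, p, hp⟩ := RAM.exec_full (Rt := .add (.var 40) (.const 2))
    (Ft := .var 12) (fp := .var 20) (by decide) hε
  refine ⟨p, fun I => ?_⟩
  change ClusteringInstance at I
  have hMε : 4 ≤ ((M + M : ℕ) : ℝ) * ε := by push_cast; linarith
  obtain ⟨T, υ, h1, h2, h3⟩ := hp (I.task M) 0 ((rGatherClustering.input I).setR 0 ε)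
    ⟨rfl, rfl, rfl, rfl, rfl, fun u hu => by
      rw [show u = ((⟨u, hu⟩ : Fin I.n) : ℕ) from rfl, ClusteringInstance.task_user]
      exact vertexArray_eq I.user ⟨u, hu⟩, rfl⟩ (by simp) rfl
    (by change M + 1 + 1 ≤ M + M + 2 + 2; omega)
    le_rfl
    (fun τ h => by simp [h, ClusteringInstance.task]) (fun τ _ h => by simp [h]; rfl)
    (fun τ _ _ f _ h20 => h20)
  refine ⟨T, υ, h1, h2, fun hs => ?_, fun hs => ?_⟩
  · rcases h3 with ⟨-, h4⟩ | ⟨h3, B, hB, h4, h5⟩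
    · obtain ⟨s, hs⟩ := hs
      obtain ⟨v, w, x, e⟩ := ClusteringInstance.exists_cand (M := M) s
      exact absurd (ClusteringInstance.feas hs) (e ▸ h4 v w x)
    · obtain ⟨s, k1, k2, k3⟩ := ClusteringInstance.exists_sol hMε hε h4
      have hopt : B ≤ rGatherClustering.opt I := MinProblem.le_opt hs hB fun s hs => by
        obtain ⟨v, w, x, e⟩ := ClusteringInstance.exists_cand (M := M) s
        have := h5 v w x (e ▸ ClusteringInstance.feas hs)
        rwa [e] at this
      exact ⟨h3, s, k1, k2, k3.trans (mul_le_mul_of_nonneg_left hopt (by linarith))⟩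
  · rcases h3 with ⟨h3, -⟩ | ⟨-, B, hB, h4, -⟩
    · exact h3
    · obtain ⟨s, -, k2, -⟩ := ClusteringInstance.exists_sol hMε hε h4
      exact absurd ⟨s, k2⟩ hs

theorem mainTheorem7 : rGatherClustering.HasPTAS ∧ rGathering.HasPTAS :=
  ⟨rGatherClustering_hasPTAS, rGathering_hasPTAS⟩
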